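/- **Definitions.** A pushdown system (of level 1) is a tuple $\mathcal N=(Q,\Sigma,\Delta,q_0)$ with a finite set $Q$ of states, a finite stack alphabet $\Sigma$ with a distinguished bottom symbol $\bot$, an initial state $q_0\in Q$, and $\Delta\subseteq Q\times\Sigma\times Q\times\mathrm{Op}$, where $\mathrm{Op}$ consists of the operations $\mathrm{push}_\sigma$ ($\sigma\in\Sigma\setminus\{\bot\}$), which append $\sigma$ to the stack, and $\mathrm{pop}$, which removes the topmost symbol of a stack with at least two symbols (and is undefined otherwise). Stacks are nonempty words over $\Sigma$, configurations are pairs of a state and a stack, and $(q,s)\to_\delta(q',s')$ for $\delta=(q,\sigma,q',op)\in\Delta$ if $\sigma$ is the topmost symbol of $s$ and $s'=op(s)$. Put $|\mathcal N|=|Q|+|\Sigma|+|\Delta|$. The *level-1 nested pushdown tree* (1-NPT) $\mathrm{NPT}(\mathcal N)$ is the structure whose elements are the finite runs of $\mathcal N$ from the configuration $(q_0,\bot)$, with a binary relation $\to_\delta$ for each $\delta\in\Delta$ (extension of a run by one $\delta$-step) and the jump relation $\hookrightarrow$: $\rho_1\hookrightarrow\rho_2$ iff $\rho_2$ extends $\rho_1$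 by a run of length at least $2$ that starts and ends in the same stack $s$, starts with a push, ends with a pop, and does not visit $s$ in between. The first-order model checking problem on 1-NPT asks, given $\mathcal N$ and a first-order sentence $\varphi$ in the vocabulary of $\mathrm{NPT}(\mathcal N)$, whether $\mathrm{NPT}(\mathcal N)\models\varphi$; inputs are coded as words over a fixed finite alphabet in a standard way. **Statement.** 1. There are an alternating (multi-tape) Turing machine $M$, a polynomial $p$ and a constant $c$ such that $M$ accepts exactly the codes of pairs $(\mathcal N,\varphi)$ with $\mathrm{NPT}(\mathcal N)\models\varphi$; on every input word of length $n$, every computation path of $M$ has at most $2^{2^{p(n)}}$ steps; and on the code of any pair $(\mathcal N,\varphi)$, every computation path of $M$ has at most $c\cdot|\varphi|$ alternations between existential and universal states, where $|\varphi|$ is the number of atoms, connectives and quantifiers of $\varphi$. In short, first-order model checking on 1-NPT can be solved by an alternating Turing machine in doubly exponential time with linearly many alternations in the size of the formula. 2. There are polynomials $p$ and $q$ such that, for every pushdown system $\mathcal N$ of level 1 and every $r\in\mathbb N$, there is a nondecreasing $f\colon\mathbb N\to\mathbb N$ with $f(r)\le r\cdot 2^{2^{q(r)}}\cdot 2^{p(|\mathcal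 N|)}$ such that Duplicator has a winning strategy in the $r$-round Ehrenfeucht–Fraïssé game on two copies of $\mathrm{NPT}(\mathcal N)$ with the following property: whenever $m<r$ rounds have been played, all elements chosen so far in the second copy are runs of length at most $f(m)$, and Spoiler plays in the first copy, Duplicator answers so that all elements chosen in the second copy are runs of length at most $f(m+1)$. -/

import Mathlib

/-! ## Pushdown systems of level 1 and their nested pushdown trees -/

/-- Stack operations of level 1. -/
inductive StackOp (Γ : Type) : Type where
  | push : Γ → StackOp Γ
  | pop : StackOp Γ

/-- The effect of an operation on a 1-stack, i.e. a nonempty word whose topmost symbol is the head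
of the list. Removing the last remaining symbol is undefined. -/
def StackOp.apply {Γ : Type} : StackOp Γ → List Γ → Option (List Γ)
  | .push b, s => some (b :: s)
  | .pop, _ :: b :: s => some (b :: s)
  | .pop, _ => none

/-- An element of `Q × Γ × Q × Op`. -/
structure PDTransition (Q Γ : Type) : Type where
  src : Q
  top : Γ
  dst : Q
  op : StackOp Γ

/-- A pushdown system of level 1 with states `Q` and stack alphabet `Γ`; the bottom-of-stack symbol
is never pushed. -/
structure PushdownSystem (Q Γ : Type) : Type where
  bot : Γ
  init : Q
  Δ : Finset (PDTransition Q Γ)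
  push_ne_bot : ∀ δ ∈ Δ, ∀ b : Γ, δ.op = .push b → b ≠ bot

namespace PushdownSystem

variable {Q Γ : Type}

/-- The size of a pushdown system: number of states, stack symbols and transitions. -/
def size [Fintype Q] [Fintype Γ] (N : PushdownSystem Q Γ) : ℕ :=
  Fintype.card Q + Fintype.card Γ + N.Δ.card

/-- The relation `c →δ d` on configurations (state, stack). -/
def StepBy (N : PushdownSystem Q Γ) (δ : PDTransition Q Γ) (c d : Q × List Γ) : Prop :=
  δ ∈ N.Δ ∧ c.1 = δ.src ∧ c.2.head? = some δ.top ∧ d.1 = δ.dst ∧ δ.op.apply c.2 = some d.2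

/-- The transition relation on configurations. -/
def Step (N : PushdownSystem Q Γ) (c d : Q × List Γ) : Prop :=
  ∃ δ, N.StepBy δ c d

/-- The initial configuration. -/
def initCfg (N : PushdownSystem Q Γ) : Q × List Γ := (N.init, [N.bot])

end PushdownSystem

/-- The set of nodes of the nested pushdown tree of `N`: the runs of `N` from the initial
configuration. A run `c₀ → c₁ → ⋯ → cₙ` with `c₀` initial is represented by `[c₁, …, cₙ]` (on level
1, the transitions of a run are determined by its configurations). -/
def NPT {Q Γ : Type} (N : PushdownSystem Q Γ) : Type :=
  { l : List (Q × List Γ) // List.IsChain N.Step (N.initCfg :: l) }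

namespace NPT

variable {Q Γ : Type} {N : PushdownSystem Q Γ}

/-- The length of a run (number of transitions). -/
def length (ρ : NPT N) : ℕ := ρ.1.length

/-- The final configuration of a run. -/
def final (ρ : NPT N) : Q × List Γ := (N.initCfg :: ρ.1).getLast (List.cons_ne_nil _ _)

/-- The edge relation labelled by `δ`. -/
def Edge (δ : PDTransition Q Γ) (ρ₁ ρ₂ : NPT N) : Prop :=
  ∃ c, ρ₂.1 = ρ₁.1 ++ [c] ∧ N.StepBy δ ρ₁.final c

/-- The jump relation: `ρ₂` extends `ρ₁` by a run `ρ₁.final → c₁ → ⋯ → c` of length at least 2,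
starting and ending in the same stack, whose first operation is a push and whose last operation is
a pop, and which does not visit this stack in between; `c₁ :: u` lists the configurations strictly
in between. -/
def Jump (ρ₁ ρ₂ : NPT N) : Prop :=
  ∃ (c₁ : Q × List Γ) (u : List (Q × List Γ)) (c : Q × List Γ),
    ρ₂.1 = ρ₁.1 ++ (c₁ :: u) ++ [c] ∧
    c.2 = ρ₁.final.2 ∧
    (∃ δ b, δ.op = .push b ∧ N.StepBy δ ρ₁.final c₁) ∧
    (∃ δ, δ.op = .pop ∧ N.StepBy δ ((c₁ :: u).getLast (List.cons_ne_nil _ _)) c) ∧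
    ∀ d ∈ c₁ :: u, d.2 ≠ ρ₁.final.2

end NPT

/-- The relation symbols of the nested pushdown tree of `N`: one binary symbol for each transition
of `N`, and a binary symbol for the jump relation. -/
inductive NPTRel {Q Γ : Type} (N : PushdownSystem Q Γ) : ℕ → Type where
  | edge (δ : PDTransition Q Γ) (h : δ ∈ N.Δ) : NPTRel N 2
  | jump : NPTRel N 2

/-- The vocabulary of the nested pushdown tree of `N`. -/
def nptLang {Q Γ : Type} (N : PushdownSystem Q Γ) : FirstOrder.Language.{0, 0} :=
  ⟨fun _ => Empty, NPTRel N⟩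

/-- The nested pushdown tree of `N` as a relational structure. -/
instance NPT.instStructure {Q Γ : Type} (N : PushdownSystem Q Γ) :
    (nptLang N).Structure (NPT N) where
  funMap := fun f => Empty.elim f
  RelMap := fun {_} R => match R with
    | .edge δ _ => fun x => NPT.Edge δ (x 0) (x 1)
    | .jump => fun x => NPT.Jump (x 0) (x 1)

/-- The size of a formula: the number of its atoms, connectives and quantifiers. -/
def formulaSize {L : FirstOrder.Language.{0, 0}} {α : Type} :
    {n : ℕ} → L.BoundedFormula α n → ℕ
  | _, .falsum => 1
  | _, .equal _ _ => 1
  | _, .rel _ _ => 1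
  | _, .imp φ ψ => formulaSize φ + formulaSize ψ + 1
  | _, .all φ => formulaSize φ + 1

/-! ## Input words of the model checking problem -/

/-- The finite input alphabet. -/
inductive Tok : Type where
  | one | endNum | item | sep | push | pop | falsum | equal | edge | jump | imp | all

/-- Self-delimiting unary code of a number. The numbers that occur below are indices of states,
symbols and variables, so unary notation costs only a polynomial factor. -/
def codeNat (n : ℕ) : List Tok := List.replicate n .one ++ [.endNum]

def codeTransition {n m : ℕ} (δ : PDTransition (Fin n) (Fin m)) : List Tok :=
  codeNat δ.src ++ codeNat δ.top ++ codeNat δ.dst ++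
    match δ.op with
    | .push b => .push :: codeNat b
    | .pop => [.pop]

/-- The code of a pushdown system with `n` states and `m` stack symbols whose transitions are listed
in `l`. -/
def codeSystem {n m : ℕ} (N : PushdownSystem (Fin n) (Fin m))
    (l : List (PDTransition (Fin n) (Fin m))) : List Tok :=
  codeNat n ++ codeNat m ++ codeNat N.bot ++ codeNat N.init ++
    l.flatMap (fun δ => .item :: codeTransition δ) ++ [.sep]

/-- Terms over `nptLang N` are variables; in a subformula of a sentence, all variables are bound,
and `Fin k` numbers the quantifiers in whose scope one is. -/
def varIndex {n m : ℕ} {N : PushdownSystem (Fin n) (Fin m)} {k : ℕ} :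
    (nptLang N).Term (Empty ⊕ Fin k) → ℕ
  | .var (.inl e) => e.elim
  | .var (.inr i) => i
  | .func f _ => Empty.elim f

def codeAtom {n m : ℕ} {N : PushdownSystem (Fin n) (Fin m)} :
    {a : ℕ} → NPTRel N a → (Fin a → ℕ) → List Tok
  | _, .edge δ _, x => .edge :: codeTransition δ ++ codeNat (x 0) ++ codeNat (x 1)
  | _, .jump, x => .jump :: codeNat (x 0) ++ codeNat (x 1)

/-- The code of a formula, in prefix notation. -/
def codeFormula {n m : ℕ} {N : PushdownSystem (Fin n) (Fin m)} :
    {k : ℕ} → (nptLang N).BoundedFormula Empty k → List Tok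
  | _, .falsum => [.falsum]
  | _, .equal s t => .equal :: codeNat (varIndex s) ++ codeNat (varIndex t)
  | _, .rel R ts => codeAtom R (fun i => varIndex (ts i))
  | _, .imp φ ψ => .imp :: codeFormula φ ++ codeFormula ψ
  | _, .all φ => .all :: codeFormula φ

/-- The word `w` represents the pair of the pushdown system `N` and the sentence `φ`: it lists the
transitions of `N` in some order, followed by `φ`. -/
def Encodes (w : List Tok) {n m : ℕ} (N : PushdownSystem (Fin n) (Fin m))
    (φ : (nptLang N).Sentence) : Prop :=
  ∃ l : List (PDTransition (Fin n) (Fin m)),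
    (∀ δ, δ ∈ l ↔ δ ∈ N.Δ) ∧ w = codeSystem N l ++ codeFormula φ

/-- The first-order model checking problem on nested pushdown trees of level 1, as a set of words.
Without loss of generality, states and stack symbols are numbered. -/
def ModelCheckingNPT : Set (List Tok) :=
  { w | ∃ (n m : ℕ) (N : PushdownSystem (Fin n) (Fin m)) (φ : (nptLang N).Sentence),
    Encodes w N φ ∧ FirstOrder.Language.Sentence.Realize (NPT N) φ }

/-! ## Alternating Turing machines -/

/-- The kinds of states of an alternating Turing machine. -/
inductive StateKind : Type where
  | existential | universal | accepting | rejecting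

/-- An alternating Turing machine with input alphabet `A` and `k + 1` two-way infinite tapes.
A cell holds a symbol from the finite alphabet `Γ` or is blank (`none`). A move rewrites the
scanned cells, moves every head by at most one cell and changes the state. -/
structure ATM (A : Type) : Type 1 where
  k : ℕ
  Γ : Type
  finΓ : Finite Γ
  inputSymbol : A ↪ Γ
  Q : Type
  finQ : Finite Q
  start : Q
  kind : Q → StateKind
  moves : Q → (Fin (k + 1) → Option Γ) →
    Set (Q × (Fin (k + 1) → Option Γ × Option Turing.Dir))

namespace ATM

variable {A : Type}

/-- A configuration: state and tapes, the latter with head positions. -/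
structure Cfg (M : ATM A) : Type where
  state : M.Q
  tapes : Fin (M.k + 1) → Turing.Tape (Option M.Γ)

/-- The initial configuration: the input on tape `0`, the head on its first symbol, and all other
cells blank. -/
def initCfg (M : ATM A) (w : List A) : M.Cfg where
  state := M.start
  tapes := fun i => if i = 0 then Turing.Tape.mk₁ (w.map fun a => some (M.inputSymbol a))
    else Turing.Tape.mk₁ []

/-- Write a symbol, then move the head (or leave it where it is). -/
def update {Γ : Type} (t : Turing.Tape (Option Γ)) (x : Option Γ × Option Turing.Dir) :
    Turing.Tape (Option Γ) :=
  match x.2 with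
  | none => t.write x.1
  | some d => (t.write x.1).move d

/-- One move of the machine; accepting and rejecting states are halting. -/
def Step (M : ATM A) (c d : M.Cfg) : Prop :=
  (M.kind c.state = .existential ∨ M.kind c.state = .universal) ∧
  ∃ x ∈ M.moves c.state (fun i => (c.tapes i).head),
    d = ⟨x.1, fun i => update (c.tapes i) (x.2 i)⟩

/-- The accepting configurations. -/
inductive AcceptingCfg (M : ATM A) : M.Cfg → Prop where
  | accepting (c : M.Cfg) : M.kind c.state = .accepting → AcceptingCfg M c
  | existential (c d : M.Cfg) : M.kind c.state = .existential → M.Step c d →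
      AcceptingCfg M d → AcceptingCfg M c
  | universal (c : M.Cfg) : M.kind c.state = .universal →
      (∀ d, M.Step c d → AcceptingCfg M d) → AcceptingCfg M c

/-- The machine accepts the input word. -/
def Accepts (M : ATM A) (w : List A) : Prop := M.AcceptingCfg (M.initCfg w)

/-- `1` if the mode switches between existential and universal, otherwise `0`. -/
def switch : StateKind → StateKind → ℕ
  | .existential, .universal => 1
  | .universal, .existential => 1
  | _, _ => 0

/-- The number of alternations along a computation path. -/
def alternations {M : ATM A} : List M.Cfg → ℕ
  | c :: d :: l => switch (M.kind c.state) (M.kind d.state) + alternations (d :: l)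
  | _ => 0

/-- On input `w`, every computation path has at most `T` steps. -/
def TimeBound (M : ATM A) (w : List A) (T : ℕ) : Prop :=
  ∀ l : List M.Cfg, List.IsChain M.Step (M.initCfg w :: l) → l.length ≤ T

/-- On input `w`, every computation path has at most `a` alternations. -/
def AlternationBound (M : ATM A) (w : List A) (a : ℕ) : Prop :=
  ∀ l : List M.Cfg, List.IsChain M.Step (M.initCfg w :: l) →
    alternations (M.initCfg w :: l) ≤ a

end ATM

/-! ## Ehrenfeucht-Fraïssé games on two copies of a structure -/

/-- A strategy of Duplicator. A position is the list of pairs of elements chosen so far in the two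
copies. Given the position, the copy in which Spoiler plays (`true` for the first copy) and the
element that he chooses, the strategy yields Duplicator's answer in the other copy. -/
abbrev DuplicatorStrategy (A : Type) : Type := List (A × A) → Bool → A → A

/-- The position after the next round, when Spoiler chooses `a` in the copy `b`. -/
def DuplicatorStrategy.next {A : Type} (τ : DuplicatorStrategy A) (p : List (A × A))
    (b : Bool) (a : A) : List (A × A) :=
  p ++ [if b then (a, τ p b a) else (τ p b a, a)]

/-- The positions that can be reached, from the empty position, if Duplicator uses `τ`. -/
inductive DuplicatorStrategy.Reachable {A : Type} (τ : DuplicatorStrategy A) :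
    List (A × A) → Prop where
  | nil : Reachable τ []
  | next (p : List (A × A)) (b : Bool) (a : A) : Reachable τ p → Reachable τ (τ.next p b a)

/-- The pairs in the list form a partial isomorphism. -/
def IsPartialIso (L : FirstOrder.Language.{0, 0}) {A : Type} [L.Structure A]
    (p : List (A × A)) : Prop :=
  (∀ x ∈ p, ∀ y ∈ p, x.1 = y.1 ↔ x.2 = y.2) ∧
  ∀ (k : ℕ) (R : L.Relations k) (x : Fin k → A × A), (∀ i, x i ∈ p) →
    (FirstOrder.Language.Structure.RelMap R (fun i => (x i).1) ↔
      FirstOrder.Language.Structure.RelMap R (fun i => (x i).2))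

/-- `τ` is winning for Duplicator in the `r`-round game on two copies of `A`. -/
def DuplicatorStrategy.IsWinning (L : FirstOrder.Language.{0, 0}) {A : Type} [L.Structure A]
    (τ : DuplicatorStrategy A) (r : ℕ) : Prop :=
  ∀ p, τ.Reachable p → p.length = r → IsPartialIso L p

/-- `τ` preserves the constraint `S` (a set of tuples) in the `r`-round game: whenever the tuple
chosen in the second copy is in `S` and Spoiler plays in the first copy, the tuple extended by
Duplicator's answer is in `S`. -/
def DuplicatorStrategy.Preserves {A : Type} (τ : DuplicatorStrategy A) (r : ℕ)
    (S : Set (List A)) : Prop :=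
  ∀ p, τ.Reachable p → p.length < r → p.map Prod.snd ∈ S →
    ∀ a, (τ.next p true a).map Prod.snd ∈ S

/-- The constraint given by length bounds `f 0, f 1, …`: all entries of an `m`-tuple are runs of
length at most `f m`. -/
def lengthConstraint {Q Γ : Type} (N : PushdownSystem Q Γ) (f : ℕ → ℕ) : Set (List (NPT N)) :=
  { t | ∀ ρ ∈ t, NPT.length ρ ≤ f t.length }

/-! Both parts rest on one fact: Duplicator can always answer with a short run.

A run is recorded as a trace: for each symbol on its final stack, the push that created it and the
tree of excursions completed above it since. Two backward maps on traces, the parent `par` and the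
last visit to the next lower level `tail`, determine the structure: an edge is a parent together
with the last transition, and a jump is a final pop followed back by `par` and `tail`
(`NPT.edge_iff`, `NPT.jump_iff`). Pumping replaces an excursion or a run by one with the same states
and symbols at its ends whose size lies in any prescribed window below the original size. The width
of the window is singly exponential in the size of the system. Using several disjoint windows, the
new object can be kept out of a given finite set (`typ_avoid`, `typX_avoid`).

Two runs are similar (`XS`) if their traces agree up to a depth `n`, and the parts further down have
the same end labels and are equal or both of size at least `t`. Going back in the same way preserves
similarity at the cost of depth, and comparisons between backward words have the same outcome on
similar runs (`XS.linear`). The invariant `Inv` of the game says that corresponding runs are similar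
and that their closures under `l` backward steps have the same equality pattern. In `Inv.extend`
Spoiler chooses `x`. Let `y` be the largest element of the closure of `x` that meets the closures of
earlier runs, and `e` the next larger element of the closure of `x`. The partner of `y` is known. An
answer to `e` is built on it, away from all old closures, and then extended to an answer to `x`. If
there is no `y`, then `e` is taken far below `x` and answered by a short run. The radius shrinks by
the factor 8 in each round and is still 2 at the end, which suffices for edges and jumps. The size
threshold changes in each round by a factor that is exponential in the radius. With radii up to `2 *
8 ^ r`, the answers become longer by an amount that is doubly exponential in `r` and exponential in
a polynomial of the size of the system.

For model checking, this allows quantifiers to be restricted to runs of doubly exponential length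
(`sat_rawFormula_iff`), and an alternating machine can guess these. The machine is obtained from a
small programming language in which each program decides a property in two modes: in universal mode
it accepts if the property holds, in existential mode if it fails. Negation is then a change of
mode. An implication is `¬(φ ∧ ¬ψ)`, and a universal quantifier ranges over guessed words `X` with
the claim `¬(X is a run ∧ ¬φ)`. The test that `X` is a run is a separate branch with a bounded
number of alternations, so each connective or quantifier costs at most four alternations along a
path (`Decides.eval`). -/

/-! ## Traces: runs as stacks of trees -/

/-- A completed excursion above a stack: a sequence of blocks, each of which consists of a push, an
inner excursion and a pop. -/
inductive Loop (D : Type) : Type where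
  | nil : Loop D
  | cons : Loop D → D → Loop D → D → Loop D

/-- A run from the initial configuration, as the list (topmost first) of its stack levels: the push
that opened the level (`none` for the bottom level) and the excursions completed since. -/
abbrev Trace (D : Type) : Type := List (Option D × Loop D)

namespace Loop

variable {D : Type}

/-- This is the number of transitions: each block contributes its push and its pop. -/
def size : Loop D → ℕ
  | nil => 0
  | cons l _ i _ => size l + size i + 2

variable {Q Γ : Type}

/-- The state after the excursion, when `q` is the state before. -/
def fin (q : Q) : Loop (PDTransition Q Γ) → Q
  | nil => q
  | cons _ _ _ δ => δ.dst

end Loop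

namespace Trace

variable {D : Type}

/-- For a run this is its length plus one: each level counts its opening push, and the bottom level
counts one although no push opens it. -/
def size : Trace D → ℕ
  | [] => 0
  | (_, T) :: s => size s + T.size + 1

end Trace

namespace PushdownSystem

variable {Q Γ : Type} (N : PushdownSystem Q Γ)

/-- The state in which a level is opened. -/
def st : Option (PDTransition Q Γ) → Q
  | none => N.init
  | some δ => δ.dst

/-- The symbol of a level. -/
def sym : Option (PDTransition Q Γ) → Γ
  | none => N.bot
  | some δ => match δ.op with
    | .push b => b
    | .pop => N.bot

/-- The excursion is possible from state `q` above the stack symbol `a`. -/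
def OkL : Q → Γ → Loop (PDTransition Q Γ) → Prop
  | _, _, .nil => True
  | q, a, .cons l δ₁ i δ₂ => OkL q a l ∧ δ₁ ∈ N.Δ ∧ δ₁.src = l.fin q ∧ δ₁.top = a ∧ δ₁.op ≠ .pop ∧
      OkL δ₁.dst (N.sym (some δ₁)) i ∧ δ₂ ∈ N.Δ ∧ δ₂.src = i.fin δ₁.dst ∧
      δ₂.top = N.sym (some δ₁) ∧ δ₂.op = .pop

/-- State and topmost stack symbol at the end of a run. -/
def lab : Trace (PDTransition Q Γ) → Option (Q × Γ)
  | [] => none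
  | (d, T) :: _ => some (T.fin (N.st d), N.sym d)

/-- The level `d` may be opened after the run `s`. -/
def Opens (d : Option (PDTransition Q Γ)) (s : Trace (PDTransition Q Γ)) : Prop :=
  match d with
  | none => s = []
  | some δ => δ ∈ N.Δ ∧ N.lab s = some (δ.src, δ.top) ∧ δ.op ≠ .pop

/-- The trace represents a run (or is empty). -/
def Ok : Trace (PDTransition Q Γ) → Prop
  | [] => True
  | (d, T) :: s => Ok s ∧ N.OkL (N.st d) (N.sym d) T ∧ N.Opens d s

theorem lab_eq_none {x : Trace (PDTransition Q Γ)} : N.lab x = none ↔ x = [] := by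
  cases x <;> simp [lab]

/-- Opening a level depends only on the state and topmost symbol below it. This is what allows the
lower part of a run to be exchanged for another one with the same label. -/
theorem Opens.congr {N : PushdownSystem Q Γ} {d : Option (PDTransition Q Γ)}
    {s s' : Trace (PDTransition Q Γ)} (h : N.Opens d s) (hl : N.lab s = N.lab s') :
    N.Opens d s' := by
  cases d with
  | none =>
    have h : s = [] := h
    subst h
    exact N.lab_eq_none.1 hl.symm
  | some δ => exact ⟨h.1, hl ▸ h.2.1, h.2.2⟩

end PushdownSystem

/-! ## Shrinking -/

/-- Equal, or both of size at least `t`. -/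
def EqUpTo {A : Type} (size : A → ℕ) (t : ℕ) (a b : A) : Prop :=
  a = b ∨ (t ≤ size a ∧ t ≤ size b)

theorem EqUpTo.symm {A : Type} {size : A → ℕ} {t : ℕ} {a b : A} (h : EqUpTo size t a b) :
    EqUpTo size t b a :=
  h.elim (fun h => Or.inl h.symm) fun h => Or.inr ⟨h.2, h.1⟩

/-- If elements can be shrunk to any size window of width `w`, then a small equivalent element can
be chosen outside of a given small set, unless the element itself is small. -/
theorem exists_small_avoiding {A : Type} (size : A → ℕ) (R : A → Prop) (w : ℕ) (T : A) (hT : R T)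
    (h : ∀ s, s ≤ size T → ∃ T', R T' ∧ s ≤ size T' ∧ size T' ≤ s + w)
    (t K : ℕ) (B : Finset A) (hB : B.card ≤ K) :
    ∃ T', R T' ∧ EqUpTo size t T T' ∧ size T' ≤ t + (K + 1) * (w + 1) ∧ (T' = T ∨ T' ∉ B) := by
  classical
  by_cases hs : size T ≤ t + (K + 1) * (w + 1)
  · exact ⟨T, hT, Or.inl rfl, hs, Or.inl rfl⟩
  have hle : ∀ j : ℕ, j < K + 1 → t + j * (w + 1) + w + 1 ≤ t + (K + 1) * (w + 1) := by
    intro j hj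
    have : (j + 1) * (w + 1) ≤ (K + 1) * (w + 1) := Nat.mul_le_mul_right _ hj
    nlinarith
  -- The windows for `j = 0, …, K` are disjoint, so the chosen elements are `K + 1` different ones,
  -- and `B` misses at least one of them. All of them have size at least `t`.
  have h' : ∀ j : Fin (K + 1), ∃ T', R T' ∧ t + j * (w + 1) ≤ size T' ∧
      size T' ≤ t + j * (w + 1) + w := fun j => h _ (by have := hle j j.2; omega)
  choose g hR h1 h2 using h'
  have hinj : Function.Injective g := by
    intro i j hij
    by_contra hne
    have key : ∀ i j : Fin (K + 1), i < j → size (g i) < size (g j) := by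
      intro i j hij
      have : (i.1 + 1) * (w + 1) ≤ j.1 * (w + 1) := Nat.mul_le_mul_right _ hij
      have := h2 i
      have := h1 j
      nlinarith
    rcases lt_or_gt_of_ne hne with hlt | hlt
    · exact absurd (key _ _ hlt) (by rw [hij]; exact lt_irrefl _)
    · exact absurd (key _ _ hlt) (by rw [hij]; exact lt_irrefl _)
  obtain ⟨T', hT', hn⟩ := Finset.exists_mem_notMem_of_card_lt_card
    (s := B) (t := Finset.univ.image g) (by
      rw [Finset.card_image_of_injective _ hinj, Finset.card_univ, Fintype.card_fin]; omega)
  obtain ⟨j, -, rfl⟩ := Finset.mem_image.1 hT'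
  have := h1 j
  have := h2 j
  have := hle j j.2
  exact ⟨g j, hR j, Or.inr ⟨by omega, by omega⟩, by omega, Or.inr hn⟩

/-- A shrinking lemma in windows from a one-step shrinking lemma. -/
theorem exists_window {A : Type} (size : A → ℕ) (R : A → Prop) (w : ℕ)
    (h : ∀ T, R T → w ≤ size T → ∃ T', R T' ∧ size T' < size T ∧ size T ≤ size T' + w)
    (T : A) (hT : R T) (s : ℕ) (hs : s ≤ size T) :
    ∃ T', R T' ∧ s ≤ size T' ∧ size T' ≤ s + w := by
  induction hn : size T using Nat.strong_induction_on generalizing T with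
  | _ n ih =>
    by_cases hw : size T ≤ s + w
    · exact ⟨T, hT, hs, hw⟩
    · obtain ⟨T', h1, h2, h3⟩ := h T hT (by omega)
      exact ih _ (by omega) T' h1 (by omega) rfl

/-! ### Pumping for excursions and runs. -/

namespace PushdownSystem

variable {Q Γ : Type} (N : PushdownSystem Q Γ)

/-- The excursion leads from state `σ.1` to state `σ.2.2` above the symbol `σ.2.1`. -/
def Typ (σ : Q × Γ × Q) (T : Loop (PDTransition Q Γ)) : Prop :=
  N.OkL σ.1 σ.2.1 T ∧ T.fin σ.1 = σ.2.2

open Classical in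
/-- The least size of an element with property `p`. -/
noncomputable def leastSize {A : Type} (size : A → ℕ) (p : A → Prop) : ℕ :=
  sInf {n | ∃ T, p T ∧ size T = n}

theorem leastSize_le {A : Type} {size : A → ℕ} {p : A → Prop} {T : A} (h : p T) :
    leastSize size p ≤ size T := Nat.sInf_le ⟨T, h, rfl⟩

theorem exists_leastSize {A : Type} {size : A → ℕ} {p : A → Prop} (h : ∃ T, p T) :
    ∃ T, p T ∧ size T = leastSize size p :=
  Nat.sInf_mem (s := {n | ∃ T, p T ∧ size T = n}) (h.elim fun T hT => ⟨_, T, hT, rfl⟩)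

variable [Fintype Q] [Fintype Γ]

/-- As in the pumping lemma for context-free grammars: in a smallest excursion of its type, the two
parts are smallest of their types, and these types have smaller least sizes. Thus the rank drops
along every branch, and the size at most doubles with each rank. The summand 2 makes this exact,
since `(l + 2) + (i + 2)` is the size of the whole plus 2. -/
theorem leastSize_typ_le (σ : Q × Γ × Q) (hσ : ∃ T, N.Typ σ T) :
    leastSize Loop.size (N.Typ σ) + 2 ≤ 2 ^ (Fintype.card (Q × Γ × Q) + 1) := by
  classical
  -- The rank of `σ` is the number of nonempty types with a smaller least size.
  let S : Q × Γ × Q → Finset (Q × Γ × Q) := fun σ => Finset.univ.filter fun τ =>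
    (∃ T, N.Typ τ T) ∧ leastSize Loop.size (N.Typ τ) < leastSize Loop.size (N.Typ σ)
  have main : ∀ n σ, (S σ).card = n → (∃ T, N.Typ σ T) →
      leastSize Loop.size (N.Typ σ) + 2 ≤ 2 ^ (n + 1) := by
    intro n
    induction n using Nat.strong_induction_on with
    | _ n ih =>
      intro σ hn hσ
      obtain ⟨T, hT, hsz⟩ := exists_leastSize (size := Loop.size) hσ
      have child : ∀ τ C, N.Typ τ C → C.size < T.size →
          C.size ≤ leastSize Loop.size (N.Typ τ) → C.size + 2 ≤ 2 ^ n := by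
        intro τ C hC hlt hmin
        have hsub : (S τ).card < (S σ).card := by
          apply Finset.card_lt_card
          rw [Finset.ssubset_iff_of_subset]
          · refine ⟨τ, ?_, ?_⟩
            · have := leastSize_le (size := Loop.size) hC
              simp only [S, Finset.mem_filter, Finset.mem_univ, true_and]
              exact ⟨⟨C, hC⟩, by omega⟩
            · simp [S]
          · intro υ
            have := leastSize_le (size := Loop.size) hC
            simp only [S, Finset.mem_filter, Finset.mem_univ, true_and]
            exact fun h => ⟨h.1, by omega⟩
        have := ih _ (hn ▸ hsub) τ rfl ⟨C, hC⟩
        have h2 : 2 ^ ((S τ).card + 1) ≤ 2 ^ n := Nat.pow_le_pow_right (by norm_num) (by omega)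
        omega
      rw [← hsz]
      cases T with
      | nil =>
        have : 2 ^ 1 ≤ 2 ^ (n + 1) := Nat.pow_le_pow_right (by norm_num) (by omega)
        simp only [Loop.size]; omega
      | cons l δ₁ i δ₂ =>
        obtain ⟨hok, hfin⟩ := hT
        obtain ⟨h1, h2, h3, h4, h5, h6, h7, h8, h9, h10⟩ := hok
        have hl : N.Typ (σ.1, σ.2.1, l.fin σ.1) l := ⟨h1, rfl⟩
        have hi : N.Typ (δ₁.dst, N.sym (some δ₁), i.fin δ₁.dst) i := ⟨h6, rfl⟩
        -- A smaller excursion of the type of `l` could be substituted for `l`, against the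
        -- minimality of the whole.
        have c1 := child _ l hl (by simp only [Loop.size]; omega) (by
          obtain ⟨l', hl', hs'⟩ := exists_leastSize (size := Loop.size) ⟨l, hl⟩
          have : N.Typ σ (.cons l' δ₁ i δ₂) :=
            ⟨⟨hl'.1, h2, h3.trans hl'.2.symm, h4, h5, h6, h7, h8, h9, h10⟩, hfin⟩
          have := leastSize_le (size := Loop.size) this
          rw [← hsz] at this
          simp only [Loop.size] at this
          omega)
        have c2 := child _ i hi (by simp only [Loop.size]; omega) (by
          obtain ⟨i', hi', hs'⟩ := exists_leastSize (size := Loop.size) ⟨i, hi⟩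
          have : N.Typ σ (.cons l δ₁ i' δ₂) :=
            ⟨⟨h1, h2, h3, h4, h5, hi'.1, h7, h8.trans hi'.2.symm, h9, h10⟩, hfin⟩
          have := leastSize_le (size := Loop.size) this
          rw [← hsz] at this
          simp only [Loop.size] at this
          omega)
        simp only [Loop.size, pow_succ]
        omega
  refine (main _ σ rfl hσ).trans (Nat.pow_le_pow_right (by norm_num) ?_)
  have := Finset.card_le_univ (S σ)
  omega

/-- Every nonempty type of excursions contains one of size less than this. -/
def loopBound (_ : PushdownSystem Q Γ) : ℕ := 2 ^ (Fintype.card (Q × Γ × Q) + 1)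

theorem exists_typ_lt {σ : Q × Γ × Q} {T : Loop (PDTransition Q Γ)} (hT : N.Typ σ T) :
    ∃ T', N.Typ σ T' ∧ T'.size < N.loopBound := by
  obtain ⟨T', h1, h2⟩ := exists_leastSize (size := Loop.size) ⟨T, hT⟩
  have := N.leastSize_typ_le σ ⟨T, hT⟩
  exact ⟨T', h1, by unfold loopBound; omega⟩

/-- Descending into a large part as long as there is one, one arrives at a large excursion both of
whose parts are smaller than `loopBound`. Its size is at most twice this bound, so that replacing it
by a short excursion of the same type loses little. -/
theorem typ_shrink (T : Loop (PDTransition Q Γ)) : ∀ σ, N.Typ σ T → N.loopBound ≤ T.size →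
    ∃ T', N.Typ σ T' ∧ T'.size < T.size ∧ T.size ≤ T'.size + 2 * N.loopBound := by
  induction T with
  | nil =>
    intro σ hT h
    obtain ⟨T', h1, h2⟩ := N.exists_typ_lt hT
    exact ⟨T', h1, by omega, by simp [Loop.size]⟩
  | cons l δ₁ i δ₂ ihl ihi =>
    intro σ hT h
    obtain ⟨⟨h1, h2, h3, h4, h5, h6, h7, h8, h9, h10⟩, hfin⟩ := hT
    by_cases hl : N.loopBound ≤ l.size
    · obtain ⟨l', ⟨ho, hf⟩, hs, hs'⟩ := ihl (σ.1, σ.2.1, l.fin σ.1) ⟨h1, rfl⟩ hl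
      exact ⟨.cons l' δ₁ i δ₂, ⟨⟨ho, h2, h3.trans hf.symm, h4, h5, h6, h7, h8, h9, h10⟩, hfin⟩,
        by simp only [Loop.size]; omega, by simp only [Loop.size]; omega⟩
    by_cases hi : N.loopBound ≤ i.size
    · obtain ⟨i', ⟨ho, hf⟩, hs, hs'⟩ := ihi (δ₁.dst, N.sym (some δ₁), i.fin δ₁.dst) ⟨h6, rfl⟩ hi
      exact ⟨.cons l δ₁ i' δ₂, ⟨⟨h1, h2, h3, h4, h5, ho, h7, h8.trans hf.symm, h9, h10⟩, hfin⟩,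
        by simp only [Loop.size]; omega, by simp only [Loop.size]; omega⟩
    obtain ⟨T', h1', h2'⟩ := N.exists_typ_lt
      (⟨⟨h1, h2, h3, h4, h5, h6, h7, h8, h9, h10⟩, hfin⟩ : N.Typ σ (.cons l δ₁ i δ₂))
    exact ⟨T', h1', by omega, by simp only [Loop.size]; omega⟩

/-- The run ends in state and topmost symbol `σ`. -/
def TypX (σ : Option (Q × Γ)) (x : Trace (PDTransition Q Γ)) : Prop := N.Ok x ∧ N.lab x = σ

/-- In a shortest run with a given label, the label of each lower part has a strictly smaller least
size, so labels do not repeat along the stack, and each level carries an excursion smaller than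
`loopBound`. In contrast to excursions, the bound is linear in the number of labels, because a stack
does not branch. -/
theorem leastSize_typX_le (σ : Option (Q × Γ)) (hσ : ∃ T, N.TypX σ T) :
    leastSize Trace.size (N.TypX σ) ≤
      N.loopBound * (Fintype.card (Option (Q × Γ)) + 1) := by
  classical
  let S : Option (Q × Γ) → Finset (Option (Q × Γ)) := fun σ => Finset.univ.filter fun τ =>
    (∃ T, N.TypX τ T) ∧ leastSize Trace.size (N.TypX τ) < leastSize Trace.size (N.TypX σ)
  have main : ∀ n σ, (S σ).card = n → (∃ T, N.TypX σ T) →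
      leastSize Trace.size (N.TypX σ) ≤ N.loopBound * (n + 1) := by
    intro n
    induction n using Nat.strong_induction_on with
    | _ n ih =>
      intro σ hn hσ
      obtain ⟨x, hx, hsz⟩ := exists_leastSize (size := Trace.size) hσ
      rw [← hsz]
      match x, hx, hsz with
      | [], _, _ => exact Nat.zero_le _
      | (d, T) :: s, hx, hsz =>
        obtain ⟨⟨h1, h2, h3⟩, hl⟩ := hx
        have hT : T.size < N.loopBound := by
          obtain ⟨T', hT', hlt⟩ := N.exists_typ_lt
            (⟨h2, rfl⟩ : N.Typ (N.st d, N.sym d, T.fin (N.st d)) T)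
          have : N.TypX σ ((d, T') :: s) := by
            refine ⟨⟨h1, hT'.1, h3⟩, ?_⟩
            rw [← hl]
            simp only [lab]
            rw [hT'.2]
          have := leastSize_le (size := Trace.size) this
          rw [← hsz] at this
          simp only [Trace.size] at this
          omega
        have hs : Trace.size s ≤ leastSize Trace.size (N.TypX (N.lab s)) := by
          obtain ⟨s', hs', he⟩ := exists_leastSize (size := Trace.size)
            (⟨s, h1, rfl⟩ : ∃ s', N.TypX (N.lab s) s')
          have : N.TypX σ ((d, T) :: s') := ⟨⟨hs'.1, h2, h3.congr hs'.2.symm⟩, hl⟩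
          have := leastSize_le (size := Trace.size) this
          rw [← hsz] at this
          simp only [Trace.size] at this
          omega
        have hty : N.TypX (N.lab s) s := ⟨h1, rfl⟩
        have hle := leastSize_le (size := Trace.size) hty
        have hsub : (S (N.lab s)).card < (S σ).card := by
          apply Finset.card_lt_card
          simp only [Trace.size] at hsz
          rw [Finset.ssubset_iff_of_subset]
          · refine ⟨N.lab s, ?_, ?_⟩
            · simp only [S, Finset.mem_filter, Finset.mem_univ, true_and]
              exact ⟨⟨s, hty⟩, by omega⟩
            · simp [S]
          · intro υ
            simp only [S, Finset.mem_filter, Finset.mem_univ, true_and]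
            exact fun h => ⟨h.1, by omega⟩
        have := ih _ (hn ▸ hsub) _ rfl ⟨s, hty⟩
        have h2 : N.loopBound * ((S (N.lab s)).card + 1) ≤ N.loopBound * n :=
          Nat.mul_le_mul_left _ (by omega)
        simp only [Trace.size, mul_add, mul_one]
        omega
  refine (main _ σ rfl hσ).trans (Nat.mul_le_mul_left _ ?_)
  have := Finset.card_le_univ (S σ)
  omega

/-- A window of sizes into which every run can be shrunk. -/
def window (N : PushdownSystem Q Γ) : ℕ :=
  2 * (N.loopBound * (Fintype.card (Option (Q × Γ)) + 2))

theorem two_mul_loopBound_le : 2 * N.loopBound ≤ N.window := by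
  unfold window
  nlinarith [Nat.zero_le (N.loopBound * (Fintype.card (Option (Q × Γ)) + 1))]

/-- The change is made as low as possible: in the run below the top level if that is large,
otherwise in the top excursion if that is large, otherwise in the run as a whole. -/
theorem typX_shrink (x : Trace (PDTransition Q Γ)) : ∀ σ, N.TypX σ x →
    N.window ≤ 2 * x.size → ∃ x', N.TypX σ x' ∧ x'.size < x.size ∧ x.size ≤ x'.size + N.window := by
  have hb : 0 < N.loopBound := by unfold loopBound; positivity
  have hw : N.window = 2 * (N.loopBound * (Fintype.card (Option (Q × Γ)) + 1)) + 2 * N.loopBound := by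
    unfold window; ring
  induction x with
  | nil =>
    intro σ hx h
    simp only [Trace.size] at h
    omega
  | cons F s ih =>
    obtain ⟨d, T⟩ := F
    intro σ hx h
    obtain ⟨⟨h1, h2, h3⟩, hl⟩ := id hx
    by_cases hs : N.window ≤ 2 * Trace.size s
    · obtain ⟨s', ⟨ho, hf⟩, hs, hs'⟩ := ih _ ⟨h1, rfl⟩ hs
      exact ⟨(d, T) :: s', ⟨⟨ho, h2, h3.congr hf.symm⟩, hl⟩, by simp only [Trace.size]; omega,
        by simp only [Trace.size]; omega⟩
    by_cases hT : N.loopBound ≤ T.size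
    · obtain ⟨T', ⟨ho, hf⟩, hs, hs'⟩ := N.typ_shrink T (N.st d, N.sym d, T.fin (N.st d)) ⟨h2, rfl⟩ hT
      have := N.two_mul_loopBound_le
      refine ⟨(d, T') :: s, ⟨⟨h1, ho, h3⟩, ?_⟩, by simp only [Trace.size]; omega,
        by simp only [Trace.size]; omega⟩
      rw [← hl]
      simp only [lab]
      rw [hf]
    -- Now the run below has size less than half of `window` and the top excursion less than
    -- `loopBound`, so a shortest run with the same label is smaller by at most `window`.
    obtain ⟨x', hx', hsz⟩ := exists_leastSize (size := Trace.size) ⟨_, hx⟩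
    have := N.leastSize_typX_le σ ⟨_, hx⟩
    exact ⟨x', hx', by omega, by simp only [Trace.size]; omega⟩

/-- In the game, `B` comes from the closures of earlier runs, from which the answer has to be kept
apart. -/
theorem typ_avoid {σ : Q × Γ × Q} {T : Loop (PDTransition Q Γ)} (hT : N.Typ σ T) (t K : ℕ)
    (B : Finset (Loop (PDTransition Q Γ))) (hB : B.card ≤ K) :
    ∃ T', N.Typ σ T' ∧ EqUpTo Loop.size t T T' ∧ T'.size ≤ t + (K + 1) * (N.window + 1) ∧
      (T' = T ∨ T' ∉ B) := by
  refine exists_small_avoiding Loop.size (N.Typ σ) N.window T hT ?_ t K B hB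
  refine exists_window Loop.size (N.Typ σ) N.window ?_ T hT
  intro T hT hw
  have := N.two_mul_loopBound_le
  obtain ⟨T', h1, h2, h3⟩ := N.typ_shrink T σ hT (by omega)
  exact ⟨T', h1, h2, by omega⟩

theorem typX_avoid {σ : Option (Q × Γ)} {x : Trace (PDTransition Q Γ)} (hx : N.TypX σ x) (t K : ℕ)
    (B : Finset (Trace (PDTransition Q Γ))) (hB : B.card ≤ K) :
    ∃ x', N.TypX σ x' ∧ EqUpTo Trace.size t x x' ∧
      Trace.size x' ≤ t + (K + 1) * (N.window + 1) ∧ (x' = x ∨ x' ∉ B) := by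
  refine exists_small_avoiding Trace.size (N.TypX σ) N.window x hx ?_ t K B hB
  exact exists_window Trace.size (N.TypX σ) N.window
    (fun T hT hw => N.typX_shrink T σ hT (by omega)) x hx

end PushdownSystem

/-! ## Similarity of traces -/

namespace Trace

variable {D : Type}

/-- The run without its last step. -/
def par : Trace D → Trace D
  | [] => []
  | (_, .nil) :: s => s
  | (d, .cons l δ₁ i _) :: s => (some δ₁, i) :: (d, l) :: s

/-- The parent (for `true`) or the last visit to the next lower level (for `false`). -/
def back (b : Bool) (x : Trace D) : Trace D := if b then x.par else List.tail x

/-- Iterated application of `back`. -/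
def app : List Bool → Trace D → Trace D
  | [], x => x
  | b :: w, x => app w (back b x)

@[simp] theorem app_nil (x : Trace D) : app [] x = x := rfl
theorem app_cons (b : Bool) (w : List Bool) (x : Trace D) : app (b :: w) x = app w (back b x) := rfl
@[simp] theorem back_true (x : Trace D) : back true x = x.par := rfl
@[simp] theorem back_false (x : Trace D) : back false x = List.tail x := rfl

theorem app_append (v w : List Bool) (x : Trace D) : app (v ++ w) x = app w (app v x) := by
  induction v generalizing x with
  | nil => rfl
  | cons b v ih => exact ih _

theorem app_empty (w : List Bool) : app w ([] : Trace D) = [] := by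
  induction w with
  | nil => rfl
  | cons b w ih => cases b <;> exact ih

theorem app_replicate_false (n : ℕ) (x : Trace D) :
    app (List.replicate n false) x = List.drop n x := by
  induction n generalizing x with
  | zero => rfl
  | succ n ih =>
    rw [List.replicate_succ, app_cons, ih, back_false, List.drop_tail]

@[simp] theorem size_cons (F : Option D × Loop D) (s : Trace D) :
    Trace.size (F :: s) = Trace.size s + F.2.size + 1 := rfl

@[simp] theorem size_nil : Trace.size ([] : Trace D) = 0 := rfl

theorem size_append (g s : Trace D) : Trace.size (g ++ s) = Trace.size g + Trace.size s := by
  induction g with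
  | nil => simp
  | cons F g ih => simp only [List.cons_append, size_cons, ih]; omega

theorem size_par_add_one {x : Trace D} (hx : x ≠ []) : x.par.size + 1 = x.size := by
  match x with
  | [] => exact absurd rfl hx
  | (d, .nil) :: s => simp [par, Loop.size]
  | (d, .cons l δ₁ i δ₂) :: s => simp only [par, size_cons, Loop.size]; omega

theorem size_back_lt (b : Bool) {x : Trace D} (hx : x ≠ []) : (back b x).size < x.size := by
  cases b with
  | true => have := size_par_add_one hx; simp only [back_true]; omega
  | false =>
    obtain ⟨F, s, rfl⟩ := List.exists_cons_of_ne_nil hx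
    simp only [back_false, List.tail_cons, size_cons]; omega

theorem size_back_le (b : Bool) (x : Trace D) : (back b x).size ≤ x.size := by
  by_cases hx : x = []
  · subst hx; cases b <;> exact le_rfl
  · exact (size_back_lt b hx).le

theorem size_app_le (w : List Bool) (x : Trace D) : (app w x).size ≤ x.size := by
  induction w generalizing x with
  | nil => exact le_rfl
  | cons b w ih => exact (ih _).trans (size_back_le b x)

/-- Each backward step strictly decreases the size of a nonempty trace. -/
theorem eq_nil_or_eq_of_size_le {w : List Bool} {x : Trace D} (h : x.size ≤ (app w x).size) :
    x = [] ∨ w = [] := by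
  cases w with
  | nil => exact Or.inr rfl
  | cons b w =>
    by_contra hc
    have := size_back_lt b (x := x) (by tauto)
    have := size_app_le w (back b x)
    rw [app_cons] at h
    omega

theorem app_eq_of_size_le {w : List Bool} {x : Trace D} (h : x.size ≤ (app w x).size) :
    app w x = x := by
  rcases eq_nil_or_eq_of_size_le h with rfl | rfl
  · exact app_empty w
  · rfl

/-- A parent step replaces the top level by at most two levels and so adds at most one. Once the
levels of `g` are used up, every further step starts from `y` and can only decrease the size. -/
theorem app_append_right (w : List Bool) (g y : Trace D) :
    (∃ g' : Trace D, g'.length ≤ g.length + w.length ∧ app w (g ++ y) = g' ++ y) ∨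
      (app w (g ++ y)).size ≤ Trace.size y := by
  induction w generalizing g with
  | nil => exact Or.inl ⟨g, by simp, rfl⟩
  | cons b w ih =>
    match b, g with
    | b, [] =>
      exact Or.inr ((size_app_le w _).trans (size_back_le b y))
    | false, F :: g =>
      rcases ih g with ⟨g', h1, h2⟩ | h
      · exact Or.inl ⟨g', by simp only [List.length_cons]; omega, h2⟩
      · exact Or.inr h
    | true, (d, .nil) :: g =>
      rcases ih g with ⟨g', h1, h2⟩ | h
      · exact Or.inl ⟨g', by simp only [List.length_cons]; omega, h2⟩
      · exact Or.inr h
    | true, (d, .cons l δ₁ i δ₂) :: g =>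
      rcases ih ((some δ₁, i) :: (d, l) :: g) with ⟨g', h1, h2⟩ | h
      · exact Or.inl ⟨g', by simp only [List.length_cons] at *; omega, h2⟩
      · exact Or.inr h

/-- A backward step changes or removes only the top level and leaves the lower ones intact, so `n`
steps cannot reach below the topmost `n` levels. -/
theorem drop_suffix_app (w : List Bool) (x : Trace D) (n : ℕ) (h : w.length ≤ n) :
    List.drop n x <:+ app w x := by
  induction w generalizing x n with
  | nil => exact List.drop_suffix n x
  | cons b w ih =>
    obtain ⟨n, rfl⟩ : ∃ m, n = m + 1 := ⟨n - 1, by simp only [List.length_cons] at h; omega⟩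
    have hn : w.length ≤ n := by simpa using h
    match b, x with
    | b, [] => simp
    | false, F :: s => exact ih s n hn
    | true, (d, .nil) :: s => exact ih s n hn
    | true, (d, .cons l δ₁ i δ₂) :: s =>
      refine List.IsSuffix.trans ?_ (ih ((some δ₁, i) :: (d, l) :: s) n hn)
      match n with
      | 0 => exact ⟨[(some δ₁, i), (d, l)], rfl⟩
      | 1 => exact (List.drop_suffix 1 s).trans (List.suffix_cons _ _)
      | n + 2 => exact List.drop_suffix_drop_left s (by omega)

theorem size_le_of_suffix {x y : Trace D} (h : x <:+ y) : x.size ≤ y.size := by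
  obtain ⟨g, rfl⟩ := h
  rw [size_append]
  omega

end Trace

/-! ### Similarity up to a depth and a size threshold. -/

namespace PushdownSystem

variable {Q Γ : Type} (N : PushdownSystem Q Γ)

/-- Excursions from state `q` that agree up to depth `n`; deeper parts are equal or of size at
least `t`, and lead to the same state. -/
def TS (t : ℕ) : ℕ → Q → Loop (PDTransition Q Γ) → Loop (PDTransition Q Γ) → Prop
  | 0, q, T, T' => T.fin q = T'.fin q ∧ EqUpTo Loop.size t T T'
  | _ + 1, _, .nil, T' => T' = .nil
  | n + 1, q, .cons l δ₁ i δ₂, T' => ∃ l' i', T' = .cons l' δ₁ i' δ₂ ∧ TS t n q l l' ∧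
      TS t n δ₁.dst i i'

/-- Runs whose topmost `n` levels agree up to depth `n`. -/
def XS (t : ℕ) : ℕ → Trace (PDTransition Q Γ) → Trace (PDTransition Q Γ) → Prop
  | 0, x, x' => N.lab x = N.lab x' ∧ EqUpTo Trace.size t x x'
  | _ + 1, [], x' => x' = []
  | n + 1, (d, T) :: s, x' => ∃ T' s', x' = (d, T') :: s' ∧ TS t (n + 1) (N.st d) T T' ∧
      XS t n s s'

variable {N} {t n : ℕ} {q : Q} {T T' : Loop (PDTransition Q Γ)} {x x' : Trace (PDTransition Q Γ)}

/-- If all deep parts are equal, so are the excursions. If some deep part differs, both versions of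
it are large, and so are the excursions that contain them. -/
theorem TS.eqUpTo (h : TS t n q T T') : EqUpTo Loop.size t T T' := by
  induction n generalizing q T T' with
  | zero => exact h.2
  | succ n ih =>
    cases T with
    | nil => exact Or.inl (Eq.symm h)
    | cons l δ₁ i δ₂ =>
      obtain ⟨l', i', rfl, h1, h2⟩ := h
      have h1 := ih h1
      have h2 := ih h2
      simp only [EqUpTo, Loop.size] at *
      rcases h1 with rfl | h1 <;> rcases h2 with rfl | h2
      · exact Or.inl rfl
      all_goals right; omega

theorem TS.fin_eq (h : TS t n q T T') : T.fin q = T'.fin q := by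
  cases n with
  | zero => exact h.1
  | succ n =>
    cases T with
    | nil => rw [show T' = .nil from h]
    | cons l δ₁ i δ₂ =>
      obtain ⟨l', i', rfl, h1, h2⟩ := h
      rfl

theorem TS.refl (t n : ℕ) (q : Q) (T : Loop (PDTransition Q Γ)) : TS t n q T T := by
  induction n generalizing q T with
  | zero => exact ⟨rfl, Or.inl rfl⟩
  | succ n ih =>
    cases T with
    | nil => rfl
    | cons l δ₁ i δ₂ => exact ⟨l, i, rfl, ih _ _, ih _ _⟩

theorem TS.symm (h : TS t n q T T') : TS t n q T' T := by
  induction n generalizing q T T' with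
  | zero => exact ⟨h.1.symm, h.2.symm⟩
  | succ n ih =>
    cases T with
    | nil => rw [show T' = .nil from h]; rfl
    | cons l δ₁ i δ₂ =>
      obtain ⟨l', i', rfl, h1, h2⟩ := h
      exact ⟨l, i, rfl, ih h1, ih h2⟩

theorem TS.mono {m : ℕ} (h : TS t n q T T') (hm : m ≤ n) : TS t m q T T' := by
  induction m generalizing n q T T' with
  | zero => exact ⟨h.fin_eq, h.eqUpTo⟩
  | succ m ih =>
    obtain ⟨n, rfl⟩ : ∃ k, n = k + 1 := ⟨n - 1, by omega⟩
    cases T with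
    | nil => exact h
    | cons l δ₁ i δ₂ =>
      obtain ⟨l', i', rfl, h1, h2⟩ := h
      exact ⟨l', i', rfl, ih h1 (by omega), ih h2 (by omega)⟩

theorem EqUpTo.mono {A : Type} {size : A → ℕ} {t t' : ℕ} {a b : A} (h : EqUpTo size t a b)
    (ht : t' ≤ t) : EqUpTo size t' a b :=
  h.imp_right fun h => ⟨ht.trans h.1, ht.trans h.2⟩

theorem TS.mono_left {t' : ℕ} (h : TS t n q T T') (ht : t' ≤ t) : TS t' n q T T' := by
  induction n generalizing q T T' with
  | zero => exact ⟨h.1, EqUpTo.mono h.2 ht⟩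
  | succ n ih =>
    cases T with
    | nil => exact h
    | cons l δ₁ i δ₂ =>
      obtain ⟨l', i', rfl, h1, h2⟩ := h
      exact ⟨l', i', rfl, ih h1, ih h2⟩

theorem XS.eqUpTo (h : N.XS t n x x') : EqUpTo Trace.size t x x' := by
  induction n generalizing x x' with
  | zero => exact h.2
  | succ n ih =>
    match x with
    | [] => exact Or.inl (Eq.symm h)
    | (d, T) :: s =>
      obtain ⟨T', s', rfl, h1, h2⟩ := h
      have h1 := h1.eqUpTo
      have h2 := ih h2
      simp only [EqUpTo, Trace.size_cons] at *
      rcases h1 with rfl | h1 <;> rcases h2 with rfl | h2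
      · exact Or.inl rfl
      all_goals right; omega

theorem XS.lab_eq (h : N.XS t n x x') : N.lab x = N.lab x' := by
  cases n with
  | zero => exact h.1
  | succ n =>
    match x with
    | [] => rw [show x' = [] from h]
    | (d, T) :: s =>
      obtain ⟨T', s', rfl, h1, h2⟩ := h
      simp only [lab, h1.fin_eq]

theorem XS.nil_iff (h : N.XS t n x x') : x = [] ↔ x' = [] := by
  rw [← N.lab_eq_none, ← N.lab_eq_none, h.lab_eq]

variable (N) in
theorem XS.refl (t n : ℕ) (x : Trace (PDTransition Q Γ)) : N.XS t n x x := by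
  induction n generalizing x with
  | zero => exact ⟨rfl, Or.inl rfl⟩
  | succ n ih =>
    match x with
    | [] => rfl
    | (d, T) :: s => exact ⟨T, s, rfl, TS.refl _ _ _ _, ih s⟩

theorem XS.symm (h : N.XS t n x x') : N.XS t n x' x := by
  induction n generalizing x x' with
  | zero => exact ⟨h.1.symm, h.2.symm⟩
  | succ n ih =>
    match x with
    | [] => rw [show x' = [] from h]; rfl
    | (d, T) :: s =>
      obtain ⟨T', s', rfl, h1, h2⟩ := h
      exact ⟨T, s, rfl, h1.symm, ih h2⟩

theorem XS.mono {m : ℕ} (h : N.XS t n x x') (hm : m ≤ n) : N.XS t m x x' := by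
  induction m generalizing n x x' with
  | zero => exact ⟨h.lab_eq, h.eqUpTo⟩
  | succ m ih =>
    obtain ⟨n, rfl⟩ : ∃ k, n = k + 1 := ⟨n - 1, by omega⟩
    match x with
    | [] => exact h
    | (d, T) :: s =>
      obtain ⟨T', s', rfl, h1, h2⟩ := h
      exact ⟨T', s', rfl, h1.mono (by omega), ih h2 (by omega)⟩

theorem XS.mono_left {t' : ℕ} (h : N.XS t n x x') (ht : t' ≤ t) : N.XS t' n x x' := by
  induction n generalizing x x' with
  | zero => exact ⟨h.1, EqUpTo.mono h.2 ht⟩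
  | succ n ih =>
    match x with
    | [] => exact h
    | (d, T) :: s =>
      obtain ⟨T', s', rfl, h1, h2⟩ := h
      exact ⟨T', s', rfl, h1.mono_left ht, ih h2⟩

/-- The parent of a run that ends with a pop has two levels in place of the top one, carrying the
two parts of the top excursion. These lie one step deeper, which costs one unit of depth. -/
theorem XS.back (b : Bool) (h : N.XS t (n + 1) x x') :
    N.XS t n (Trace.back b x) (Trace.back b x') := by
  match x with
  | [] =>
    rw [show x' = [] from h]
    exact XS.refl N _ _ _
  | (d, T) :: s =>
    obtain ⟨T', s', rfl, h1, h2⟩ := h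
    match b, T with
    | false, _ => exact h2
    | true, .nil =>
      rw [show T' = .nil from h1]
      exact h2
    | true, .cons l δ₁ i δ₂ =>
      obtain ⟨l', i', rfl, h3, h4⟩ := h1
      simp only [Trace.back_true, Trace.par]
      -- For `n ≤ 1` the agreement ends within the two new levels, so below that point only labels
      -- and sizes are left to compare.
      match n with
      | 0 =>
        refine ⟨by simp only [lab]; rw [show N.st (some δ₁) = δ₁.dst from rfl, h4.fin_eq], ?_⟩
        have h3 := h3.eqUpTo
        have h4 := h4.eqUpTo
        have h2 := h2.eqUpTo
        simp only [EqUpTo, Trace.size_cons] at *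
        rcases h3 with rfl | h3 <;> rcases h2 with rfl | h2 <;> rcases h4 with rfl | h4
        · exact Or.inl rfl
        all_goals right; omega
      | 1 =>
        refine ⟨i', _, rfl, h4, by simp only [lab]; rw [h3.fin_eq], ?_⟩
        have h3 := h3.eqUpTo
        have h2 := h2.eqUpTo
        simp only [EqUpTo, Trace.size_cons] at *
        rcases h3 with rfl | h3 <;> rcases h2 with rfl | h2
        · exact Or.inl rfl
        all_goals right; omega
      | n + 2 =>
        exact ⟨i', _, rfl, h4, l', s', rfl, h3.mono (by omega), h2.mono (by omega)⟩

theorem XS.app (w : List Bool) (h : N.XS t (n + w.length) x x') :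
    N.XS t n (Trace.app w x) (Trace.app w x') := by
  induction w generalizing x x' with
  | nil => exact h
  | cons b w ih => exact ih (XS.back b h)

/-- Of two runs that are obtained by going back from the same run, one is obtained from the other,
and in the same way for similar runs. -/
theorem XS.linear (m : ℕ) (h : N.XS t m x x') (w v : List Bool)
    (hm : w.length + v.length + w.count true + v.count true ≤ m) :
    ∃ r : List Bool, r.length ≤ w.length + v.length ∧
      ((Trace.app w x = Trace.app r (Trace.app v x) ∧
          Trace.app w x' = Trace.app r (Trace.app v x')) ∨
        (Trace.app v x = Trace.app r (Trace.app w x) ∧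
          Trace.app v x' = Trace.app r (Trace.app w x'))) := by
  induction m generalizing x x' w v with
  | zero =>
    have hw : w = [] := List.length_eq_zero_iff.1 (by omega)
    have hv : v = [] := List.length_eq_zero_iff.1 (by omega)
    subst hw hv
    exact ⟨[], by simp, Or.inl ⟨rfl, rfl⟩⟩
  | succ m ih =>
    match w, v with
    | [], v => exact ⟨v, by simp, Or.inr ⟨rfl, rfl⟩⟩
    | w, [] => exact ⟨w, by simp, Or.inl ⟨rfl, rfl⟩⟩
    | true :: w, true :: v =>
      simp only [List.length_cons, List.count_cons_self] at hm
      obtain ⟨r, h1, h2⟩ := ih (h.back true) w v (by omega)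
      exact ⟨r, by simp only [List.length_cons]; omega, h2⟩
    | false :: w, false :: v =>
      simp only [List.length_cons, List.count_cons_of_ne (show false ≠ true by decide)] at hm
      obtain ⟨r, h1, h2⟩ := ih (h.back false) w v (by omega)
      exact ⟨r, by simp only [List.length_cons]; omega, h2⟩
    | true :: w, false :: v =>
      simp only [List.length_cons, List.count_cons_of_ne (show false ≠ true by decide),
        List.count_cons_self] at hm
      match x with
      | [] =>
        rw [show x' = [] from h]
        exact ⟨[], by simp, by simp [Trace.app_empty]⟩
      | (d, .nil) :: s =>
        obtain ⟨T', s', rfl, hT, hs⟩ := h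
        rw [show T' = .nil from hT]
        obtain ⟨r, h1, h2⟩ := ih hs w v (by omega)
        exact ⟨r, by simp only [List.length_cons]; omega, h2⟩
      -- After a final pop, the level below `x` is two levels below the parent of `x`, so `false ::
      -- v` from `x` is `false :: false :: v` from the parent. Counting each `true` twice in the
      -- measure pays for the longer word.
      | (d, .cons l δ₁ i δ₂) :: s =>
        have hb := h.back true
        obtain ⟨T', s', rfl, hT, hs⟩ := h
        obtain ⟨l', i', rfl, h3, h4⟩ := hT
        obtain ⟨r, h1, h2⟩ := ih hb w (false :: false :: v) (by
          simp only [List.length_cons, List.count_cons_of_ne (show false ≠ true by decide)]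
          omega)
        exact ⟨r, by simp only [List.length_cons] at *; omega, h2⟩
    | false :: w, true :: v =>
      simp only [List.length_cons, List.count_cons_of_ne (show false ≠ true by decide),
        List.count_cons_self] at hm
      match x with
      | [] =>
        rw [show x' = [] from h]
        exact ⟨[], by simp, by simp [Trace.app_empty]⟩
      | (d, .nil) :: s =>
        obtain ⟨T', s', rfl, hT, hs⟩ := h
        rw [show T' = .nil from hT]
        obtain ⟨r, h1, h2⟩ := ih hs w v (by omega)
        exact ⟨r, by simp only [List.length_cons]; omega, h2⟩
      | (d, .cons l δ₁ i δ₂) :: s =>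
        have hb := h.back true
        obtain ⟨T', s', rfl, hT, hs⟩ := h
        obtain ⟨l', i', rfl, h3, h4⟩ := hT
        obtain ⟨r, h1, h2⟩ := ih hb (false :: false :: w) v (by
          simp only [List.length_cons, List.count_cons_of_ne (show false ≠ true by decide)]
          omega)
        exact ⟨r, by simp only [List.length_cons] at *; omega, h2⟩

theorem XS.linear' {m : ℕ} (h : N.XS t m x x') (w v : List Bool)
    (hm : 2 * (w.length + v.length) ≤ m) :
    ∃ r : List Bool, r.length ≤ w.length + v.length ∧
      ((Trace.app w x = Trace.app r (Trace.app v x) ∧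
          Trace.app w x' = Trace.app r (Trace.app v x')) ∨
        (Trace.app v x = Trace.app r (Trace.app w x) ∧
          Trace.app v x' = Trace.app r (Trace.app w x'))) := by
  have h1 := List.count_le_length (a := true) (l := w)
  have h2 := List.count_le_length (a := true) (l := v)
  exact h.linear m w v (by omega)

/-- By `XS.linear'` one of the two runs arises from the other by a word `r`, on both sides. If they
are equal and nonempty, then `r` is empty because going back decreases the size, and the runs are
equal on the other side as well. -/
theorem XS.app_eq {m : ℕ} (h : N.XS t m x x') (w v : List Bool)
    (hm : 2 * (w.length + v.length) ≤ m) (he : Trace.app w x = Trace.app v x) :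
    Trace.app w x' = Trace.app v x' := by
  have hw : N.XS t 0 (Trace.app w x) (Trace.app w x') := XS.app w (h.mono (by omega))
  have hv : N.XS t 0 (Trace.app v x) (Trace.app v x') := XS.app v (h.mono (by omega))
  by_cases h0 : Trace.app w x = []
  · rw [hw.nil_iff.1 h0, hv.nil_iff.1 (he ▸ h0)]
  obtain ⟨r, -, ⟨h1, h2⟩ | ⟨h1, h2⟩⟩ := h.linear' w v hm
  · rw [← he] at h1
    rcases Trace.eq_nil_or_eq_of_size_le (congrArg Trace.size h1).le with h3 | rfl
    · exact absurd h3 h0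
    · exact h2
  · rw [← he] at h1
    rcases Trace.eq_nil_or_eq_of_size_le (congrArg Trace.size h1).le with h3 | rfl
    · exact absurd h3 h0
    · exact h2.symm

/-- The sizes decide which alternative of `XS.linear'` holds; in the opposite one the two runs
coincide. -/
theorem XS.app_of_size_le {m : ℕ} (h : N.XS t m x x') (w v : List Bool)
    (hm : 2 * (w.length + v.length) ≤ m)
    (hs : (Trace.app v x).size ≤ (Trace.app w x).size) :
    ∃ r : List Bool, r.length ≤ w.length + v.length ∧
      Trace.app v x = Trace.app r (Trace.app w x) ∧
      Trace.app v x' = Trace.app r (Trace.app w x') := by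
  obtain ⟨r, hr, ⟨h1, h2⟩ | h1⟩ := h.linear' w v hm
  · have he : Trace.app w x = Trace.app v x :=
      h1.trans (Trace.app_eq_of_size_le (by rw [← h1]; exact hs))
    exact ⟨[], by simp, he.symm, (h.app_eq w v hm he).symm⟩
  · exact ⟨r, hr, h1⟩

end PushdownSystem

/-! ## The back-and-forth step -/

namespace PushdownSystem

variable {Q Γ : Type} {N : PushdownSystem Q Γ} {t n : ℕ}
  {x x' : Trace (PDTransition Q Γ)}

theorem XS.cons {d : Option (PDTransition Q Γ)} {T T' : Loop (PDTransition Q Γ)}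
    {s s' : Trace (PDTransition Q Γ)} (h1 : TS t n (N.st d) T T') (h2 : N.XS t n s s') :
    N.XS t n ((d, T) :: s) ((d, T') :: s') := by
  cases n with
  | zero =>
    refine ⟨by simp only [lab, h1.fin_eq], ?_⟩
    have h1 := h1.eqUpTo
    have h2 := h2.eqUpTo
    simp only [EqUpTo, Trace.size_cons] at *
    rcases h1 with rfl | h1 <;> rcases h2 with rfl | h2
    · exact Or.inl rfl
    all_goals right; omega
  | succ n => exact ⟨T', s', rfl, h1, h2.mono (by omega)⟩

theorem Ok.back (b : Bool) (h : N.Ok x) : N.Ok (Trace.back b x) := by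
  match b, x with
  | b, [] => cases b <;> trivial
  | false, (d, T) :: s => exact h.1
  | true, (d, .nil) :: s => exact h.1
  | true, (d, .cons l δ₁ i δ₂) :: s =>
    obtain ⟨h1, ⟨h2, h3, h4, h5, h6, h7, -⟩, h8⟩ := h
    refine ⟨⟨h1, h2, h8⟩, h7, h3, ?_, h6⟩
    rw [h4, h5]; rfl

theorem Ok.app (w : List Bool) (h : N.Ok x) : N.Ok (Trace.app w x) := by
  induction w generalizing x with
  | nil => exact h
  | cons b w ih => exact ih (h.back b)

/-- Extending similar runs by the same step. -/
theorem XS.par_inv {z : Trace (PDTransition Q Γ)} (hx : x ≠ []) (h : N.XS t (n + 2) x.par z)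
    (ho : N.Ok x) (hz : N.Ok z) :
    ∃ x', x'.par = z ∧ N.Ok x' ∧ N.XS t (n + 1) x x' ∧ x'.size = z.size + 1 := by
  match x with
  | [] => exact absurd rfl hx
  | (d, .nil) :: s =>
    exact ⟨(d, .nil) :: z, rfl, ⟨hz, trivial, ho.2.2.congr (XS.lab_eq h)⟩,
      XS.cons rfl (h.mono (by omega)), rfl⟩
  | (d, .cons l δ₁ i δ₂) :: s =>
    -- The final pop merges the two topmost levels of the parent. Depth `n + 2` ensures that `z` has
    -- two such levels too, opened in the same way.
    obtain ⟨i', z', rfl, h1, l', s', rfl, h2, h3⟩ := h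
    obtain ⟨o1, ⟨o2, o3, o4, o5, o6, o7, o8, o9, o10⟩, o11⟩ := ho
    obtain ⟨⟨z1, z2, z3⟩, z4, -, z6, -⟩ := hz
    have hl : (l'.fin (N.st d), N.sym d) = (δ₁.src, δ₁.top) := Option.some.inj z6
    refine ⟨(d, .cons l' δ₁ i' δ₂) :: s', rfl, ⟨z1, ⟨z2, o3, (Prod.ext_iff.1 hl).1.symm, o5, o6, z4,
      o8, o9.trans h1.fin_eq, o10⟩, z3⟩, ⟨_, s', rfl, ⟨l', i', rfl, h2.mono (by omega),
        h1.mono (by omega)⟩, h3.mono (by omega)⟩, ?_⟩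
    simp only [Trace.size_cons, Loop.size]; omega

/-- Similarity of depth at least one to the same `z` forces the same last transition, and a run is
determined by its parent and its last transition. -/
theorem XS.eq_of_par_eq {v e z : Trace (PDTransition Q Γ)} (hv : N.XS t (n + 1) v z)
    (he : N.XS t (n + 1) e z) (h : v.par = e.par) : v = e := by
  match v with
  | [] =>
    rw [show z = [] from hv] at he
    exact (he.nil_iff.2 rfl).symm
  | (d, T) :: s =>
    obtain ⟨T', s', rfl, h1, h2⟩ := hv
    match e with
    | [] => exact absurd he (by simp [XS])
    | (d2, T2) :: s2 =>
      obtain ⟨T3, s3, h3, h4, h5⟩ := he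
      obtain ⟨⟨rfl, rfl⟩, rfl⟩ : (d = d2 ∧ T' = T3) ∧ s' = s3 := by simpa using h3
      match T, T2 with
      | .nil, .nil =>
        have h : s = s2 := h
        rw [h]
      | .nil, .cons .. =>
        rw [show T' = .nil from h1] at h4
        obtain ⟨_, _, h4, -⟩ := h4
        cases h4
      | .cons .., .nil =>
        rw [show T' = .nil from h4] at h1
        obtain ⟨_, _, h1, -⟩ := h1
        cases h1
      | .cons l δ₁ i δ₂, .cons l2 δ₁' i2 δ₂' =>
        obtain ⟨_, _, rfl, -⟩ := h1
        obtain ⟨_, _, h4, -⟩ := h4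
        cases h4
        simp only [Trace.par, List.cons.injEq, Prod.mk.injEq, true_and] at h
        obtain ⟨rfl, rfl, rfl⟩ := h
        rfl

/-- The levels of `g` are smaller than the threshold `t`, and below the threshold similarity is
equality. -/
theorem XS.eq_append {g y y' z : Trace (PDTransition Q Γ)}
    (h : N.XS t (n + g.length) z (g ++ y')) (hg : Trace.size g < t)
    (hz : List.drop g.length z = y) : z = g ++ y := by
  induction g generalizing z with
  | nil => exact hz
  | cons F g ih =>
    obtain ⟨d, T⟩ := F
    simp only [Trace.size_cons] at hg
    match z with
    | [] => exact absurd h (by simp [XS])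
    | (d2, T2) :: s2 =>
      obtain ⟨T3, s3, h3, h4, h5⟩ := h
      obtain ⟨⟨rfl, rfl⟩, rfl⟩ : (d = d2 ∧ T = T3) ∧ g ++ y' = s3 := by simpa using h3
      rw [ih h5 (by omega) hz]
      rcases h4.eqUpTo with h | h
      · rw [h]; rfl
      · omega

/-! ### Short similar runs. -/

variable [Fintype Q] [Fintype Γ]

variable (N) in
/-- A size that suffices for a representative at depth `0`. -/
def base (t K : ℕ) : ℕ := t + (K + 1) * (N.window + 1)

variable {K G : ℕ}

/-- Only the parts at depth `n` are pumped, and their number at most doubles with each unit of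
depth. To stay outside of `B`, it suffices that one part stays outside of the corresponding
projection of `B`. If no part does, then nothing has been changed. -/
theorem exists_TS {σ : Q × Γ × Q} {T : Loop (PDTransition Q Γ)} (hT : N.Typ σ T)
    (B : Finset (Loop (PDTransition Q Γ))) (hB : B.card ≤ K) (t n : ℕ) :
    ∃ T', N.Typ σ T' ∧ TS t n σ.1 T T' ∧ T'.size + 2 ≤ 2 ^ n * (N.base t K + 2) ∧
      (T' = T ∨ T' ∉ B) := by
  classical
  induction n generalizing T σ B with
  | zero =>
    obtain ⟨T', h1, h2, h3, h4⟩ := N.typ_avoid hT t K B hB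
    exact ⟨T', h1, ⟨hT.2.trans h1.2.symm, h2⟩, by simp only [base]; omega, h4⟩
  | succ n ih =>
    cases T with
    | nil =>
      refine ⟨.nil, hT, rfl, ?_, Or.inl rfl⟩
      have := Nat.one_le_two_pow (n := n + 1)
      simp only [Loop.size]
      nlinarith [Nat.zero_le (N.base t K)]
    | cons l δ₁ i δ₂ =>
      obtain ⟨⟨h1, h2, h3, h4, h5, h6, h7, h8, h9, h10⟩, hfin⟩ := hT
      obtain ⟨l', hl1, hl2, hl3, hl4⟩ := ih (σ := (σ.1, σ.2.1, l.fin σ.1)) (T := l) ⟨h1, rfl⟩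
        (B.image fun T => match T with | .nil => .nil | .cons l _ _ _ => l)
        (Finset.card_image_le.trans hB)
      obtain ⟨i', hi1, hi2, hi3, hi4⟩ := ih
        (σ := (δ₁.dst, N.sym (some δ₁), i.fin δ₁.dst)) (T := i) ⟨h6, rfl⟩
        (B.image fun T => match T with | .nil => .nil | .cons _ _ i _ => i)
        (Finset.card_image_le.trans hB)
      refine ⟨.cons l' δ₁ i' δ₂, ⟨⟨hl1.1, h2, h3.trans hl1.2.symm, h4, h5, hi1.1, h7,
        h8.trans hi1.2.symm, h9, h10⟩, hfin⟩, ⟨l', i', rfl, hl2, hi2⟩, ?_, ?_⟩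
      · simp only [Loop.size, pow_succ]
        rw [show 2 ^ n * 2 * (N.base t K + 2) = 2 * (2 ^ n * (N.base t K + 2)) by ring]
        omega
      · rcases hl4 with rfl | hl4
        · rcases hi4 with rfl | hi4
          · exact Or.inl rfl
          · exact Or.inr fun h => hi4 (Finset.mem_image.2 ⟨_, h, rfl⟩)
        · exact Or.inr fun h => hl4 (Finset.mem_image.2 ⟨_, h, rfl⟩)

/-- The topmost `n` levels are shortened one by one by `exists_TS`, each to size at most `G`, and
the run below them by `typX_avoid`. -/
theorem exists_XS (hx : N.Ok x) (B : Finset (Trace (PDTransition Q Γ))) (hB : B.card ≤ K)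
    (t n : ℕ) (hG : 2 ^ n * (N.base t K + 2) ≤ G) :
    ∃ x', N.Ok x' ∧ N.XS t n x x' ∧ Trace.size x' ≤ N.base t K + n * G ∧ (x' = x ∨ x' ∉ B) := by
  classical
  induction n generalizing x B with
  | zero =>
    obtain ⟨x', h1, h2, h3, h4⟩ := N.typX_avoid ⟨hx, rfl⟩ t K B hB
    exact ⟨x', h1.1, ⟨h1.2.symm, h2⟩, by simpa [base] using h3, h4⟩
  | succ n ih =>
    match x with
    | [] => exact ⟨[], trivial, rfl, Nat.zero_le _, Or.inl rfl⟩
    | (d, T) :: s =>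
      have hG' : 2 ^ n * (N.base t K + 2) ≤ G :=
        (Nat.mul_le_mul_right _ (Nat.pow_le_pow_right (by norm_num) (by omega))).trans hG
      obtain ⟨s', hs1, hs2, hs3, hs4⟩ := ih hx.1 (B.image List.tail)
        (Finset.card_image_le.trans hB) hG'
      obtain ⟨T', hT1, hT2, hT3, hT4⟩ := exists_TS (N := N)
        (σ := (N.st d, N.sym d, T.fin (N.st d))) (T := T) ⟨hx.2.1, rfl⟩
        (B.image fun x => match x with | [] => .nil | (_, T) :: _ => T)
        (Finset.card_image_le.trans hB) t (n + 1)
      refine ⟨(d, T') :: s', ⟨hs1, hT1.1, hx.2.2.congr hs2.lab_eq⟩, ⟨T', s', rfl, hT2, hs2⟩,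
        ?_, ?_⟩
      · simp only [Trace.size_cons, Nat.add_mul, Nat.one_mul]
        omega
      · rcases hs4 with rfl | hs4
        · rcases hT4 with rfl | hT4
          · exact Or.inl rfl
          · exact Or.inr fun h => hT4 (Finset.mem_image.2 ⟨_, h, rfl⟩)
        · exact Or.inr fun h => hs4 (Finset.mem_image.2 ⟨_, h, rfl⟩)

/-- This serves when the lower part `y` already has a partner `y'`: only the levels of `g` are
shortened, and the result is placed on `y'`. -/
theorem exists_XS_append {g y y' : Trace (PDTransition Q Γ)} (hx : N.Ok (g ++ y)) (hy' : N.Ok y')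
    (hy : N.XS t n y y') (B : Finset (Trace (PDTransition Q Γ))) (hB : B.card ≤ K)
    (hG : 2 ^ n * (N.base t K + 2) ≤ G) :
    ∃ g' : Trace (PDTransition Q Γ), g'.length = g.length ∧ N.Ok (g' ++ y') ∧
      N.XS t n (g ++ y) (g' ++ y') ∧ Trace.size g' ≤ g.length * G ∧
      (g' = g ∨ g' ++ y' ∉ B) := by
  classical
  induction g generalizing B with
  | nil => exact ⟨[], rfl, hy', hy, by simp, Or.inl rfl⟩
  | cons F g ih =>
    obtain ⟨d, T⟩ := F
    obtain ⟨g', hg0, hg1, hg2, hg3, hg4⟩ := ih hx.1 (B.image List.tail)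
        (Finset.card_image_le.trans hB)
    obtain ⟨T', hT1, hT2, hT3, hT4⟩ := exists_TS (N := N)
        (σ := (N.st d, N.sym d, T.fin (N.st d))) (T := T) ⟨hx.2.1, rfl⟩
        (B.image fun x => match x with | [] => .nil | (_, T) :: _ => T)
        (Finset.card_image_le.trans hB) t n
    refine ⟨(d, T') :: g', by simp [hg0], ⟨hg1, hT1.1, hx.2.2.congr hg2.lab_eq⟩,
      XS.cons hT2 hg2, ?_, ?_⟩
    · simp only [Trace.size_cons, List.length_cons, Nat.add_mul, Nat.one_mul]
      omega
    · rcases hg4 with rfl | hg4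
      · rcases hT4 with rfl | hT4
        · exact Or.inl rfl
        · exact Or.inr fun h => hT4 (Finset.mem_image.2 ⟨_, h, rfl⟩)
      · exact Or.inr fun h => hg4 (Finset.mem_image.2 ⟨_, h, rfl⟩)

/-- Extending similar runs along a path of the closure. -/
theorem exists_XS_app {e' : Trace (PDTransition Q Γ)} (w : List Bool) (hx : N.Ok x) (he' : N.Ok e')
    (h : N.XS t (n + 1 + w.length) (Trace.app w x) e')
    (hG : 2 ^ (n + 1 + w.length) * (N.base t K + 2) ≤ G) :
    ∃ x', N.Ok x' ∧ Trace.app w x' = e' ∧ N.XS t (n + 1) x x' ∧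
      Trace.size x' ≤ e'.size + w.length * G := by
  induction w generalizing x n with
  | nil => exact ⟨e', he', rfl, h, by simp⟩
  | cons b w ih =>
    have hlen : n + 1 + (b :: w).length = n + 1 + 1 + w.length := by
      simp only [List.length_cons]; omega
    rw [hlen] at h hG
    obtain ⟨x₁, h1, h2, h3, h4⟩ := ih (hx.back b) h hG
    have h1G : 1 ≤ G := by
      have := Nat.one_le_two_pow (n := n + 1 + 1 + w.length)
      nlinarith [Nat.zero_le (N.base t K)]
    match b, x with
    | b, [] =>
      have hb : Trace.back b ([] : Trace (PDTransition Q Γ)) = [] := by cases b <;> rfl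
      refine ⟨[], trivial, ?_, rfl, Nat.zero_le _⟩
      rw [hb] at h3
      rw [Trace.app_empty, ← h2, h3.nil_iff.1 rfl, Trace.app_empty]
    | true, F :: s =>
      obtain ⟨x', g1, g2, g3, g4⟩ := XS.par_inv (List.cons_ne_nil _ _) h3 hx h1
      refine ⟨x', g2, ?_, g3, ?_⟩
      · rw [Trace.app_cons, Trace.back_true, g1, h2]
      · simp only [List.length_cons, Nat.add_mul, Nat.one_mul]; omega
    | false, (d, T) :: s =>
      -- A step to the level below forgets the top excursion, so any short similar one will do.
      -- Nothing has to be avoided here, since distinctness is settled at `e'`.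
      obtain ⟨T', hT1, hT2, hT3, -⟩ := exists_TS (N := N) (K := K)
        (σ := (N.st d, N.sym d, T.fin (N.st d))) (T := T) ⟨hx.2.1, rfl⟩ ∅ (by simp) t (n + 1)
      have hG' : 2 ^ (n + 1) * (N.base t K + 2) ≤ G :=
        (Nat.mul_le_mul_right _ (Nat.pow_le_pow_right (by norm_num) (by omega))).trans hG
      refine ⟨(d, T') :: x₁, ⟨h1, hT1.1, hx.2.2.congr h3.lab_eq⟩, h2,
        ⟨T', x₁, rfl, hT2, h3.mono (by omega)⟩, ?_⟩
      simp only [Trace.size_cons, List.length_cons, Nat.add_mul, Nat.one_mul]; omega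

omit [Fintype Q] [Fintype Γ]
end PushdownSystem

/-- The words over `Bool` of length at most `n`. -/
def wordsUpTo : ℕ → Finset (List Bool)
  | 0 => {[]}
  | n + 1 => insert [] ((wordsUpTo n).image (List.cons true) ∪ (wordsUpTo n).image (List.cons false))

theorem mem_wordsUpTo {n : ℕ} {w : List Bool} (h : w.length ≤ n) : w ∈ wordsUpTo n := by
  induction n generalizing w with
  | zero => simp [wordsUpTo, List.length_eq_zero_iff.1 (Nat.le_zero.1 h)]
  | succ n ih =>
    match w with
    | [] => simp [wordsUpTo]
    | b :: w =>
      have := ih (w := w) (by simpa using h)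
      cases b <;> simp [wordsUpTo, this]

theorem card_wordsUpTo (n : ℕ) : (wordsUpTo n).card + 1 ≤ 2 ^ (n + 1) := by
  induction n with
  | zero => simp [wordsUpTo]
  | succ n ih =>
    have h1 := Finset.card_insert_le ([] : List Bool)
      ((wordsUpTo n).image (List.cons true) ∪ (wordsUpTo n).image (List.cons false))
    have h2 := Finset.card_union_le ((wordsUpTo n).image (List.cons true))
      ((wordsUpTo n).image (List.cons false))
    have h3 := Finset.card_image_le (s := wordsUpTo n) (f := List.cons true)
    have h4 := Finset.card_image_le (s := wordsUpTo n) (f := List.cons false)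
    simp only [wordsUpTo, pow_succ] at *
    omega

/-! ### The invariant of the game and Duplicator's answer. -/

namespace PushdownSystem

variable {Q Γ : Type} (N : PushdownSystem Q Γ)

/-- The invariant of the game: corresponding runs are similar, and their closures under at most `l`
steps back have the same equality pattern. -/
structure Inv (t l : ℕ) (p : List (Trace (PDTransition Q Γ) × Trace (PDTransition Q Γ))) : Prop where
  ok : ∀ z ∈ p, N.Ok z.1 ∧ N.Ok z.2
  sim : ∀ z ∈ p, N.XS t (9 * l) z.1 z.2
  eq : ∀ z ∈ p, ∀ z' ∈ p, ∀ w v : List Bool, w.length ≤ l → v.length ≤ l →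
    (Trace.app w z.1 = Trace.app v z'.1 ↔ Trace.app w z.2 = Trace.app v z'.2)

variable {N} {t t' l K G : ℕ} {p : List (Trace (PDTransition Q Γ) × Trace (PDTransition Q Γ))}
  {x : Trace (PDTransition Q Γ)}

/-- Comparisons within the new pair follow from similarity by `XS.app_eq`, and those within `p` from
the old invariant. Only comparisons of the new pair with old ones remain, and these are `hc`. -/
theorem Inv.cons {x' : Trace (PDTransition Q Γ)} (h : N.Inv t' (8 * l) p) (ht : t ≤ t')
    (hx : N.Ok x) (hx' : N.Ok x') (hs : N.XS t (9 * l) x x')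
    (hc : ∀ r : List Bool, r.length ≤ l → ∀ z ∈ p, ∀ v : List Bool, v.length ≤ l →
      (Trace.app r x = Trace.app v z.1 ↔ Trace.app r x' = Trace.app v z.2)) :
    N.Inv t l ((x, x') :: p) := by
  refine ⟨?_, ?_, ?_⟩
  · simpa using ⟨⟨hx, hx'⟩, fun a b hab => h.ok (a, b) hab⟩
  · intro z hz
    rcases List.mem_cons.1 hz with rfl | hz
    · exact hs
    · exact ((h.sim z hz).mono_left ht).mono (by omega)
  · intro z hz z' hz' w v hw hv
    rcases List.mem_cons.1 hz with rfl | hz <;> rcases List.mem_cons.1 hz' with rfl | hz'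
    · exact ⟨hs.app_eq w v (by omega), hs.symm.app_eq w v (by omega)⟩
    · exact hc w hw z' hz' v hv
    · have := hc v hv z hz w hw
      exact ⟨fun h => (this.1 h.symm).symm, fun h => (this.2 h.symm).symm⟩
    · exact h.eq z hz z' hz' w v (by omega) (by omega)

variable [Fintype Q] [Fintype Γ]

/-- The entry `e = app we x` separates the closure of `x` into elements at or above `e`, which are
new, and elements at or below some `y` in an old closure (`hY`). An upper element leads back to `e`,
so if it lay in an old closure, so would `e`, against `hA`, or its partner `e'`, against `hB`. A
lower element is reached from `y`, whose comparisons are known. -/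
theorem Inv.extend_of_entry (h : N.Inv t' (8 * l) p) (ht : t ≤ t') (hl : 2 ≤ l)
    (hG : 2 ^ (10 * l) * (N.base t K + 2) ≤ G) (hx : N.Ok x)
    {e' : Trace (PDTransition Q Γ)} {we : List Bool} (hwe : we.length ≤ l) (he' : N.Ok e')
    (hs : N.XS t (10 * l) (Trace.app we x) e')
    (hA : ∀ z ∈ p, ∀ v : List Bool, v.length ≤ 3 * l → Trace.app v z.1 ≠ Trace.app we x)
    (hB : ∀ z ∈ p, ∀ v : List Bool, v.length ≤ 3 * l → Trace.app v z.2 ≠ e')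
    (hY : ∀ r : List Bool, r.length ≤ l → (Trace.app we x).size ≤ (Trace.app r x).size ∨
      ∃ z ∈ p, ∃ v q wy : List Bool, v.length ≤ 3 * l ∧ q.length ≤ 2 * l + 1 ∧ wy.length ≤ l ∧
        Trace.app q (Trace.app we x) = Trace.app v z.1 ∧ Trace.app q e' = Trace.app v z.2 ∧
        Trace.app wy x = Trace.app v z.1 ∧ (Trace.app r x).size ≤ (Trace.app v z.1).size) :
    ∃ x', N.Ok x' ∧ N.Inv t l ((x, x') :: p) ∧ Trace.size x' ≤ e'.size + l * G := by
  obtain ⟨x', h1, h2, h3, h4⟩ := exists_XS_app (K := K) (G := G) (n := 9 * l - 1) we hx he'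
    (hs.mono (by omega)) (by
      refine le_trans (Nat.mul_le_mul_right _ (Nat.pow_le_pow_right (by norm_num) ?_)) hG
      omega)
  have h3 : N.XS t (9 * l) x x' := h3.mono (by omega)
  refine ⟨x', h1, h.cons ht hx h1 h3 ?_, h4.trans (by gcongr)⟩
  intro r hr z hz v hv
  rcases hY r hr with hle | ⟨z₀, hz₀, v₀, q, wy, hv₀, hq, hwy, e1, e2, e3, hle⟩
  -- The word `s` from `app r x` to the entry has length at most `2 * l`. Together with `v` this
  -- gives the radius `3 * l` in `hA` and `hB`.
  · obtain ⟨s, hs1, hs2, hs3⟩ := h3.app_of_size_le r we (by omega) hle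
    constructor
    · intro he
      refine absurd ?_ (hA z hz (v ++ s) (by simp only [List.length_append]; omega))
      rw [Trace.app_append, ← he, ← hs2]
    · intro he
      refine absurd ?_ (hB z hz (v ++ s) (by simp only [List.length_append]; omega))
      rw [Trace.app_append, ← he, ← hs3, h2]
  · have hy : Trace.app wy x' = Trace.app v₀ z₀.2 := by
      rw [← e2, ← h2, ← Trace.app_append]
      -- The words `we ++ q` and `wy` need depth `2 * (4 * l + 1)`, which is at most `9 * l` because
      -- `2 ≤ l`.
      refine h3.app_eq _ _ (by simp only [List.length_append]; omega) ?_
      rw [Trace.app_append, e1, e3]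
    obtain ⟨s, hs1, hs2, hs3⟩ := h3.app_of_size_le wy r (by omega) (e3 ▸ hle)
    rw [hs2, hs3, e3, hy, ← Trace.app_append, ← Trace.app_append]
    exact h.eq z₀ hz₀ z hz _ _ (by simp only [List.length_append]; omega) (by omega)

/-- Sizes decrease along the word, so there is a single step at which they fall below `e`. -/
theorem exists_crossing {D : Type} {e : ℕ} (w : List Bool) (x : Trace D) (hx : e ≤ x.size)
    (hw : (Trace.app w x).size < e) :
    ∃ w₁ b w₂, w = w₁ ++ b :: w₂ ∧ e ≤ (Trace.app w₁ x).size ∧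
      (Trace.back b (Trace.app w₁ x)).size < e := by
  induction w generalizing x with
  | nil => exact absurd hw (by simpa using hx)
  | cons b w ih =>
    by_cases hb : e ≤ (Trace.back b x).size
    · obtain ⟨w₁, c, w₂, h1, h2, h3⟩ := ih (Trace.back b x) hb hw
      exact ⟨b :: w₁, c, w₂, by rw [h1]; rfl, h2, h3⟩
    · exact ⟨[], b, w, rfl, hx, by simpa using hb⟩

theorem exists_max_nat {A : Type*} (P : A → Prop) (f : A → ℕ) (M : ℕ) (hM : ∀ a, P a → f a ≤ M)
    (h : ∃ a, P a) : ∃ a, P a ∧ ∀ b, P b → f b ≤ f a := by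
  obtain ⟨a, ha⟩ := h
  obtain ⟨b, hb, hmin⟩ := WellFounded.has_min (measure fun a => M - f a).wf {a | P a} ⟨a, ha⟩
  refine ⟨b, hb, fun c hc => ?_⟩
  have h1 : ¬ (M - f c < M - f b) := hmin c hc
  have := hM c hc
  have := hM b hb
  omega

theorem exists_min_nat {A : Type*} (P : A → Prop) (f : A → ℕ)
    (h : ∃ a, P a) : ∃ a, P a ∧ ∀ b, P b → f a ≤ f b := by
  obtain ⟨a, ha⟩ := h
  obtain ⟨b, hb, hmin⟩ := WellFounded.has_min (measure f).wf {a | P a} ⟨a, ha⟩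
  exact ⟨b, hb, fun c hc => not_lt.1 (hmin c hc)⟩

/-- Duplicator's answer. -/
theorem Inv.extend (h : N.Inv t' (8 * l) p) (hl : 2 ≤ l)
    (hG : 2 ^ (10 * l + 1) * (N.base t K + 2) ≤ G) (ht : 12 * (l * G) < t')
    (hK : p.length * 2 ^ (3 * l + 1) ≤ K) (hx : N.Ok x) :
    ∃ x', N.Ok x' ∧ N.Inv t l ((x, x') :: p) ∧
      ∀ B, (∀ z ∈ p, Trace.size z.2 ≤ B) → Trace.size x' ≤ B + 12 * (l * G) := by
  classical
  have hbG : N.base t K + 2 ≤ G := by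
    have := Nat.one_le_two_pow (n := 10 * l + 1)
    nlinarith [Nat.zero_le (N.base t K)]
  have htb : t ≤ N.base t K := Nat.le_add_right _ _
  have hlG : G ≤ l * G := Nat.le_mul_of_pos_left _ (by omega)
  have htt : t ≤ t' := by omega
  have hG' : 2 ^ (10 * l) * (N.base t K + 2) ≤ G :=
    (Nat.mul_le_mul_right _ (Nat.pow_le_pow_right (by norm_num) (by omega))).trans hG
  -- The closures of radius `3 * l` of the earlier runs in the second copy, which the answer at the
  -- entry has to avoid.
  let B : Finset (Trace (PDTransition Q Γ)) :=
    (p.toFinset ×ˢ wordsUpTo (3 * l)).image fun a => Trace.app a.2 a.1.2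
  have hBcard : B.card ≤ K := by
    refine (Finset.card_image_le.trans ?_).trans hK
    rw [Finset.card_product]
    have := card_wordsUpTo (3 * l)
    exact Nat.mul_le_mul (List.toFinset_card_le p) (by omega)
  have hBmem : ∀ z ∈ p, ∀ v : List Bool, v.length ≤ 3 * l → Trace.app v z.2 ∈ B := by
    intro z hz v hv
    exact Finset.mem_image.2 ⟨(z, v), Finset.mem_product.2 ⟨List.mem_toFinset.2 hz,
      mem_wordsUpTo hv⟩, rfl⟩
  by_cases hnear : ∃ w : List Bool, w.length ≤ l ∧ ∃ z ∈ p, ∃ v : List Bool, v.length ≤ 3 * l ∧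
      Trace.app w x = Trace.app v z.1
  -- Let `y = app wy x` be the largest element of the closure of `x` that meets the old closures.
  -- Its partner is `app vy z.2`.
  · obtain ⟨wy, ⟨hwy, z, hz, vy, hvy, hy⟩, hmax⟩ := exists_max_nat
      (fun w : List Bool => w.length ≤ l ∧ ∃ z ∈ p, ∃ v : List Bool, v.length ≤ 3 * l ∧
        Trace.app w x = Trace.app v z.1) (fun w => (Trace.app w x).size) x.size
      (fun w _ => Trace.size_app_le w x) hnear
    have hy' : N.Ok (Trace.app vy z.2) := (h.ok z hz).2.app vy
    have hyy : N.XS t' (69 * l) (Trace.app vy z.1) (Trace.app vy z.2) :=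
      XS.app vy ((h.sim z hz).mono (by omega))
    have hyB : ∀ B, (∀ z ∈ p, Trace.size z.2 ≤ B) → (Trace.app vy z.2).size ≤ B :=
      fun B hB => (Trace.size_app_le _ _).trans (hB z hz)
    -- In this case `y` is `x` itself, and the partner of `y` is the answer.
    by_cases hxy : x.size ≤ (Trace.app wy x).size
    · have hxe : x = Trace.app vy z.1 := (Trace.app_eq_of_size_le hxy).symm.trans hy
      refine ⟨Trace.app vy z.2, hy', h.cons htt hx hy' ?_ ?_, fun B hB => (hyB B hB).trans (by omega)⟩
      · rw [hxe]
        exact (hyy.mono_left htt).mono (by omega)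
      · intro r hr z' hz' v hv
        rw [hxe, ← Trace.app_append, ← Trace.app_append]
        exact h.eq z hz z' hz' _ _ (by simp only [List.length_append]; omega) (by omega)
    -- The entry `e = app we x` is the smallest element of the closure of `x` above `y`. By the
    -- choice of `y` it lies in no old closure.
    obtain ⟨we, ⟨hwe, hlt⟩, hmin⟩ := exists_min_nat
      (fun w : List Bool => w.length ≤ l ∧ (Trace.app wy x).size < (Trace.app w x).size)
      (fun w => (Trace.app w x).size) ⟨[], by simp, by simpa using hxy⟩
    have hA : ∀ z ∈ p, ∀ v : List Bool, v.length ≤ 3 * l → Trace.app v z.1 ≠ Trace.app we x := by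
      intro z' hz' v hv he
      have := hmax we ⟨hwe, z', hz', v, hv, he.symm⟩
      omega
    have hY : ∀ q : List Bool, q.length ≤ 2 * l + 1 → ∀ e',
        Trace.app q (Trace.app we x) = Trace.app vy z.1 → Trace.app q e' = Trace.app vy z.2 →
        ∀ r : List Bool, r.length ≤ l → (Trace.app we x).size ≤ (Trace.app r x).size ∨
      ∃ z ∈ p, ∃ v q wy : List Bool, v.length ≤ 3 * l ∧ q.length ≤ 2 * l + 1 ∧ wy.length ≤ l ∧
        Trace.app q (Trace.app we x) = Trace.app v z.1 ∧ Trace.app q e' = Trace.app v z.2 ∧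
        Trace.app wy x = Trace.app v z.1 ∧ (Trace.app r x).size ≤ (Trace.app v z.1).size := by
      intro q hq e' h1 h2 r hr
      by_cases hle : (Trace.app we x).size ≤ (Trace.app r x).size
      · exact Or.inl hle
      · refine Or.inr ⟨z, hz, vy, q, wy, hvy, hq, hwy, h1, h2, hy, ?_⟩
        rw [← hy]
        by_contra hc
        exact hle (hmin r ⟨hr, by omega⟩)
    -- On the way from `x` to `y`, consider the step that passes below `e`. As nothing in the
    -- closure lies strictly between `e` and `y`, this step ends in `y`.
    obtain ⟨w₁, b, w₂, hw, hc1, hc2⟩ := exists_crossing wy x (Trace.size_app_le we x) hlt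
    have hlen : w₁.length + w₂.length + 1 = wy.length := by
      rw [hw]; simp only [List.length_append, List.length_cons]; omega
    have hyw : Trace.app wy x = Trace.app w₂ (Trace.back b (Trace.app w₁ x)) := by
      rw [hw, Trace.app_append, Trace.app_cons]
    have hback : Trace.back b (Trace.app w₁ x) = Trace.app vy z.1 := by
      have hb : Trace.back b (Trace.app w₁ x) = Trace.app (w₁ ++ [b]) x := by
        rw [Trace.app_append]; rfl
      rw [← hy, hyw]
      refine (Trace.app_eq_of_size_le ?_).symm
      rw [← hyw]
      by_contra hcc
      have := hmin (w₁ ++ [b]) ⟨by simp only [List.length_append, List.length_singleton]; omega,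
        by rw [← hb]; omega⟩
      rw [← hb] at this
      omega
    obtain ⟨r, hr, hre, -⟩ := (XS.refl N t (4 * l) x).app_of_size_le w₁ we (by omega) hc1
    have hze : Trace.app w₁ x ≠ [] := by
      intro h0
      rw [h0] at hc1
      simp only [Trace.size_nil] at hc1
      omega
    rw [hy] at hlt
    -- If `e` extends `y` by one step, the partner of `y` is extended by the same step.
    have hcaseA : Trace.par (Trace.app we x) = Trace.app vy z.1 →
        ∃ x', N.Ok x' ∧ N.Inv t l ((x, x') :: p) ∧
          ∀ B, (∀ z ∈ p, Trace.size z.2 ≤ B) → Trace.size x' ≤ B + 12 * (l * G) := by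
      intro hp
      have hne : Trace.app we x ≠ [] := by
        intro h0
        rw [h0] at hlt
        exact absurd hlt (Nat.not_lt_zero _)
      obtain ⟨e', he1, he2, he3, he4⟩ := XS.par_inv (n := 10 * l - 1) hne
        (hp ▸ hyy.mono (by omega)) (hx.app we) hy'
      have he3 : N.XS t' (10 * l) (Trace.app we x) e' := he3.mono (by omega)
      -- If `e'` were in an old closure, the corresponding element of the first copy would also have
      -- parent `y` and be similar to `e'`, so it would be `e` by `XS.eq_of_par_eq`.
      have hB : ∀ z ∈ p, ∀ v : List Bool, v.length ≤ 3 * l → Trace.app v z.2 ≠ e' := by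
        intro z' hz' v hv he
        refine hA z' hz' v hv ?_
        have hzz : N.XS t' (0 + 1) (Trace.app v z'.1) (Trace.app v z'.2) :=
          XS.app v ((h.sim z' hz').mono (by omega))
        refine hzz.eq_of_par_eq (he ▸ he3.mono (by omega)) ?_
        rw [hp]
        have := (h.eq z' hz' z hz (v ++ [true]) vy (by
          simp only [List.length_append, List.length_singleton]; omega) (by omega)).2 (by
            rw [Trace.app_append, he]; exact he1)
        rw [Trace.app_append] at this
        exact this
      obtain ⟨x', h1, h2, h3⟩ := h.extend_of_entry htt hl hG' hx hwe he2 (he3.mono_left htt) hA hB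
        (hY [true] (by simp) e' hp he1)
      exact ⟨x', h1, h2, fun B hB => by have := hyB B hB; omega⟩
    cases b with
    -- A parent step decreases the size by exactly one, so a step that starts at size at least that
    -- of `e` and ends below `e` in `y` must start at `e`.
    | true =>
      refine hcaseA ?_
      rw [hre, Trace.app_eq_of_size_le (w := r)]
      · exact hback
      · rw [← hre]
        have := Trace.size_par_add_one hze
        rw [Trace.back_true] at hback
        rw [hback] at this
        omega
    -- The run that is left by this step consists of one level on `y`, so `e`, which is reached from
    -- it, consists of few levels `g` on `y`. They are shortened and placed on the partner of `y`.
    | false =>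
      obtain ⟨F, s, hFs⟩ := List.exists_cons_of_ne_nil hze
      have hs : s = Trace.app vy z.1 := by rw [← hback, hFs]; rfl
      obtain ⟨g, hg, heg⟩ : ∃ g : Trace (PDTransition Q Γ), g.length ≤ 2 * l + 1 ∧
          Trace.app we x = g ++ Trace.app vy z.1 := by
        rcases Trace.app_append_right r [F] s with ⟨g, hg1, hg2⟩ | hle
        · refine ⟨g, by simp only [List.length_singleton] at hg1; omega, ?_⟩
          rw [hre, hFs, ← hs]
          exact hg2
        · rw [List.singleton_append, ← hFs, ← hre, hs] at hle
          omega
      obtain ⟨g', hg1, hg2, hg3, hg4, hg5⟩ := exists_XS_append (K := K) (G := G) (n := 10 * l)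
        (heg ▸ hx.app we) hy' ((hyy.mono_left htt).mono (by omega)) B hBcard hG'
      have hgG : Trace.size g' ≤ 5 * (l * G) := by
        refine hg4.trans ((Nat.mul_le_mul_right G hg).trans ?_)
        rw [Nat.add_mul, Nat.mul_assoc]
        omega
      have hB : ∀ z' ∈ p, ∀ v : List Bool, v.length ≤ 3 * l →
          Trace.app v z'.2 ≠ g' ++ Trace.app vy z.2 := by
        intro z' hz' v hv he
        -- If the levels `g` have been kept, they are smaller than the old threshold `t'`. An
        -- element of an old closure that equals the answer would then have a partner in the first
        -- copy with the very same levels on `y`, which is `e` by `XS.eq_append`.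
        rcases hg5 with rfl | hg5
        · refine hA z' hz' v hv ?_
          have hzz : N.XS t' (0 + g'.length) (Trace.app v z'.1) (Trace.app v z'.2) :=
            XS.app v ((h.sim z' hz').mono (by omega))
          rw [heg]
          refine XS.eq_append (he ▸ hzz) (by omega) ?_
          have := (h.eq z' hz' z hz (v ++ List.replicate g'.length false) vy (by
            simp only [List.length_append, List.length_replicate]; omega) (by omega)).2 (by
              rw [Trace.app_append, he, Trace.app_replicate_false, List.drop_left])
          rwa [Trace.app_append, Trace.app_replicate_false] at this
        · exact hg5 (he ▸ hBmem z' hz' v hv)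
      obtain ⟨x', h1, h2, h3⟩ := h.extend_of_entry htt hl hG' hx hwe hg2 (heg ▸ hg3) hA hB
        (hY (List.replicate g.length false) (by simpa using hg) _ (by
          rw [Trace.app_replicate_false, heg, List.drop_left]) (by
          rw [Trace.app_replicate_false, ← hg1, List.drop_left]))
      refine ⟨x', h1, h2, fun B hB => ?_⟩
      have := hyB B hB
      rw [Trace.size_append] at h3
      omega
  -- No element of the closure of `x` meets the old closures. The entry is `x` without its topmost
  -- `l` levels, which is a suffix of every element of the closure. The bound `12 * (l * G)` arises
  -- here: the base counts for one `l * G`, the `10 * l` levels for ten, and the way from the entry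
  -- up to `x` for another one.
  · obtain ⟨e', he1, he2, he3, he4⟩ := exists_XS (K := K) (G := G)
      (hx.app (List.replicate l false)) B hBcard t (10 * l) hG'
    have hA : ∀ z ∈ p, ∀ v : List Bool, v.length ≤ 3 * l →
        Trace.app v z.1 ≠ Trace.app (List.replicate l false) x :=
      fun z hz v hv he => hnear ⟨_, by simp, z, hz, v, hv, he.symm⟩
    have hB : ∀ z ∈ p, ∀ v : List Bool, v.length ≤ 3 * l → Trace.app v z.2 ≠ e' := by
      intro z hz v hv he
      -- If `e'` is the entry itself, it is smaller than `t'`. An element of an old closure equal to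
      -- it would have the same run as its partner in the first copy.
      rcases he4 with rfl | he4
      · have hzz : N.XS t' 0 (Trace.app v z.1) (Trace.app v z.2) :=
          XS.app v ((h.sim z hz).mono (by omega))
        rcases hzz.eqUpTo with h0 | h0
        · exact hA z hz v hv (h0.trans he)
        · rw [he] at h0
          rw [Nat.mul_assoc] at he3
          omega
      · exact he4 (he ▸ hBmem z hz v hv)
    obtain ⟨x', h1, h2, h3⟩ := h.extend_of_entry htt hl hG' hx (by simp) he1 he2 hA hB (by
      intro r hr
      left
      rw [Trace.app_replicate_false]
      exact Trace.size_le_of_suffix (Trace.drop_suffix_app r x l hr))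
    refine ⟨x', h1, h2, fun B _ => ?_⟩
    rw [Nat.mul_assoc] at he3
    omega

end PushdownSystem

/-! ## Nodes of the nested pushdown tree as traces -/

namespace Trace

variable {Q Γ : Type}

/-- The last transition of a run. -/
def lastOp {D : Type} : Trace D → Option D
  | [] => none
  | (d, .nil) :: _ => d
  | (_, .cons _ _ _ δ) :: _ => some δ

/-- Extend a run by a transition. -/
def ext (δ : PDTransition Q Γ) (x : Trace (PDTransition Q Γ)) : Trace (PDTransition Q Γ) :=
  match δ.op, x with
  | .push _, x => (some δ, .nil) :: x
  | .pop, (some δ₁, i) :: (d, l) :: s => (d, .cons l δ₁ i δ) :: s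
  | .pop, x => x

end Trace

namespace PushdownSystem

variable {Q Γ : Type} (N : PushdownSystem Q Γ)

/-- The trace of the run of length `0`. -/
def rootTrace (_ : PushdownSystem Q Γ) : Trace (PDTransition Q Γ) := [(none, .nil)]

/-- The stack after a run. -/
def stk (x : Trace (PDTransition Q Γ)) : List Γ := x.map fun F => N.sym F.1

theorem StepBy.unique {N : PushdownSystem Q Γ} {δ : PDTransition Q Γ} {c d d' : Q × List Γ}
    (h : N.StepBy δ c d) (h' : N.StepBy δ c d') : d = d' := by
  obtain ⟨-, -, -, h1, h2⟩ := h
  obtain ⟨-, -, -, h3, h4⟩ := h'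
  exact Prod.ext (h1.trans h3.symm) (Option.some.inj (h2.symm.trans h4))

end PushdownSystem

namespace NPT

variable {Q Γ : Type} {N : PushdownSystem Q Γ}

/-- The run of length `0`. -/
def root (N : PushdownSystem Q Γ) : NPT N := ⟨[], List.IsChain.singleton _⟩

/-- `x` is the trace of the run `ρ`. -/
inductive Rel : NPT N → Trace (PDTransition Q Γ) → Prop
  | root : Rel (root N) N.rootTrace
  | step {ρ ρ' : NPT N} {δ : PDTransition Q Γ} {x : Trace (PDTransition Q Γ)} :
      Rel ρ x → Edge δ ρ ρ' → Rel ρ' (x.ext δ)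

theorem Edge.final {δ : PDTransition Q Γ} {ρ ρ' : NPT N} (h : Edge δ ρ ρ') :
    N.StepBy δ ρ.final ρ'.final := by
  obtain ⟨c, h1, h2⟩ := h
  have : ρ'.final = c := by
    unfold NPT.final
    simp only [h1]
    rw [List.getLast_cons (by simp), List.getLast_append_singleton]
  rwa [this]

theorem Edge.length {δ : PDTransition Q Γ} {ρ ρ' : NPT N} (h : Edge δ ρ ρ') :
    ρ'.length = ρ.length + 1 := by
  obtain ⟨c, h1, h2⟩ := h
  simp [NPT.length, h1]

theorem Edge.unique {δ : PDTransition Q Γ} {ρ ρ' ρ'' : NPT N} (h : Edge δ ρ ρ')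
    (h' : Edge δ ρ ρ'') : ρ' = ρ'' := by
  obtain ⟨c, h1, h2⟩ := h
  obtain ⟨c', h1', h2'⟩ := h'
  exact Subtype.ext (by rw [h1, h1', h2.unique h2'])

theorem exists_edge {δ : PDTransition Q Γ} {ρ : NPT N} {c : Q × List Γ}
    (h : N.StepBy δ ρ.final c) : ∃ ρ', Edge δ ρ ρ' := by
  refine ⟨⟨ρ.1 ++ [c], ?_⟩, c, rfl, h⟩
  have := ρ.2
  rw [← List.cons_append]
  refine List.isChain_append.2 ⟨this, List.IsChain.singleton _, ?_⟩
  intro a ha b hb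
  simp only [List.head?_cons, Option.mem_def, Option.some.injEq] at hb
  subst hb
  rw [List.getLast?_eq_getLast_of_ne_nil (List.cons_ne_nil _ _)] at ha
  obtain rfl := Option.some.inj ha
  exact ⟨δ, h⟩

/-- Pushes and pops change the height of the stack in opposite directions, and the pushed symbol is
seen on top, so the two configurations determine the transition. -/
theorem Edge.det {δ δ' : PDTransition Q Γ} {ρ₁ ρ₂ ρ : NPT N} (h : Edge δ ρ₁ ρ)
    (h' : Edge δ' ρ₂ ρ) : ρ₁ = ρ₂ ∧ δ = δ' := by
  obtain ⟨c, h1, h2⟩ := id h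
  obtain ⟨c', h1', h2'⟩ := id h'
  obtain ⟨e1, e2⟩ := List.append_inj' (h1.symm.trans h1') rfl
  obtain rfl : ρ₁ = ρ₂ := Subtype.ext e1
  refine ⟨rfl, ?_⟩
  obtain ⟨-, a1, a2, a3, a4⟩ := h.final
  obtain ⟨-, b1, b2, b3, b4⟩ := h'.final
  obtain ⟨src, top, dst, op⟩ := δ
  obtain ⟨src', top', dst', op'⟩ := δ'
  simp only at a1 a2 a3 a4 b1 b2 b3 b4
  obtain rfl := a1.symm.trans b1
  obtain rfl := Option.some.inj (a2.symm.trans b2)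
  obtain rfl := a3.symm.trans b3
  have key : op = op' := by
    generalize ρ.final.2 = s' at *
    match op, op', ρ₁.final.2, a2, a4, b4 with
    | .push b, .push b', s, _, a4, b4 =>
      have := (Option.some.inj a4).trans (Option.some.inj b4).symm
      rw [(List.cons.inj this).1]
    | .pop, .pop, s, _, a4, b4 => rfl
    | .push b, .pop, e :: f :: s, _, a4, b4 =>
      have := congrArg List.length ((Option.some.inj a4).trans (Option.some.inj b4).symm)
      simp only [List.length_cons] at this
      omega
    | .pop, .push b, e :: f :: s, _, a4, b4 =>
      have := congrArg List.length ((Option.some.inj a4).trans (Option.some.inj b4).symm)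
      simp only [List.length_cons] at this
      omega
    | .push b, .pop, [e], _, a4, b4 => simp [StackOp.apply] at b4
    | .pop, .push b, [e], _, a4, b4 => simp [StackOp.apply] at a4
  rw [key]

theorem eq_root_or_edge (ρ : NPT N) : ρ = root N ∨ ∃ δ ρ', Edge δ ρ' ρ := by
  obtain ⟨l, hl⟩ := ρ
  rcases List.eq_nil_or_concat l with rfl | ⟨l', c, rfl⟩
  · exact Or.inl rfl
  · right
    rw [List.concat_eq_append, ← List.cons_append] at hl
    have h := List.isChain_append.1 hl
    have hs := h.2.2 _ (List.getLast?_eq_getLast_of_ne_nil (List.cons_ne_nil N.initCfg l')) c rfl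
    obtain ⟨δ, hδ⟩ := hs
    exact ⟨δ, ⟨l', h.1⟩, c, by simp [List.concat_eq_append], hδ⟩

theorem Edge.not_root {δ : PDTransition Q Γ} {ρ : NPT N} (h : Edge δ ρ (root N)) : False := by
  obtain ⟨c, h1, -⟩ := h
  simp [root] at h1

theorem Rel.props {ρ : NPT N} {x : Trace (PDTransition Q Γ)} (h : Rel ρ x) :
    N.Ok x ∧ x ≠ [] ∧ ρ.final.2 = N.stk x ∧ (∃ a, N.lab x = some (ρ.final.1, a)) ∧
      x.size = ρ.length + 1 := by
  induction h with
  | root =>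
    exact ⟨⟨trivial, trivial, rfl⟩, List.cons_ne_nil _ _, rfl, ⟨N.bot, rfl⟩, rfl⟩
  | @step ρ ρ' δ x hr he ih =>
    obtain ⟨i1, i2, i3, ⟨a, i4⟩, i5⟩ := ih
    obtain ⟨s1, s2, s3, s4, s5⟩ := he.final
    have hlen := he.length
    have ha : a = δ.top := by
      match x with
      | (d, T) :: s =>
        rw [i3] at s3
        have h1 : N.sym d = δ.top := Option.some.inj s3
        have h2 := Option.some.inj i4
        rw [← h1]; exact (Prod.ext_iff.1 h2).2.symm
    rw [ha, s2] at i4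
    cases hop : δ.op with
    | push b =>
      have hx : x.ext δ = (some δ, .nil) :: x := by unfold Trace.ext; rw [hop]
      rw [hop] at s5
      rw [hx]
      have hb : N.sym (some δ) = b := by simp [PushdownSystem.sym, hop]
      refine ⟨⟨i1, trivial, s1, i4, by rw [hop]; simp⟩, List.cons_ne_nil _ _, ?_, ⟨N.sym (some δ), ?_⟩, ?_⟩
      · rw [← Option.some.inj s5, i3]
        simp [PushdownSystem.stk, hb]
      · rw [s4]; rfl
      · rw [hlen, ← i5]; rfl
    | pop =>
      rw [hop, i3] at s5
      match x with
      | [] => exact absurd rfl i2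
      | [F] => simp [PushdownSystem.stk, StackOp.apply] at s5
      | (none, T) :: F :: s => exact absurd i1.2.2 (List.cons_ne_nil _ _)
      | (some δ₁, i) :: (d, l) :: s =>
        have hx : Trace.ext δ ((some δ₁, i) :: (d, l) :: s) = (d, .cons l δ₁ i δ) :: s := by
          unfold Trace.ext; rw [hop]
        rw [hx]
        obtain ⟨⟨o1, o2, o3⟩, o4, o5, o6, o7⟩ := i1
        have h6 : (l.fin (N.st d), N.sym d) = (δ₁.src, δ₁.top) := Option.some.inj o6
        have h4 : (i.fin δ₁.dst, N.sym (some δ₁)) = (δ.src, δ.top) := Option.some.inj i4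
        refine ⟨⟨o1, ⟨o2, o5, (Prod.ext_iff.1 h6).1.symm, (Prod.ext_iff.1 h6).2.symm, o7, o4, s1,
          (Prod.ext_iff.1 h4).1.symm, (Prod.ext_iff.1 h4).2.symm, hop⟩, o3⟩,
          List.cons_ne_nil _ _, ?_, ⟨N.sym d, ?_⟩, ?_⟩
        · rw [← Option.some.inj s5]
          simp [PushdownSystem.stk]
        · rw [s4]; rfl
        · rw [hlen, ← i5]
          simp only [Trace.size_cons, Loop.size]
          omega

/-- Extending a trace loses no information: the previous trace and the last transition can be
recovered. In particular a pop is possible only if the trace has a level to return to. -/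
theorem Rel.ext_eq {ρ ρ' : NPT N} {δ : PDTransition Q Γ} {x : Trace (PDTransition Q Γ)}
    (h : Rel ρ x) (he : Edge δ ρ ρ') :
    (x.ext δ).par = x ∧ (x.ext δ).lastOp = some δ ∧
      ((∃ b, δ.op = .push b) ∧ x.ext δ = (some δ, .nil) :: x ∨
        δ.op = .pop ∧ ∃ δ₁ i d l s, x = (some δ₁, i) :: (d, l) :: s ∧
          x.ext δ = (d, .cons l δ₁ i δ) :: s) := by
  obtain ⟨i1, i2, i3, -, -⟩ := h.props
  obtain ⟨-, -, -, -, s5⟩ := he.final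
  cases hop : δ.op with
  | push b =>
    have hx : x.ext δ = (some δ, .nil) :: x := by unfold Trace.ext; rw [hop]
    rw [hx]
    exact ⟨rfl, rfl, Or.inl ⟨⟨b, rfl⟩, rfl⟩⟩
  | pop =>
    rw [hop, i3] at s5
    match x with
    | [] => exact absurd rfl i2
    | [F] => simp [PushdownSystem.stk, StackOp.apply] at s5
    | (none, T) :: F :: s => exact absurd i1.2.2 (List.cons_ne_nil _ _)
    | (some δ₁, i) :: (d, l) :: s =>
      have hx : Trace.ext δ ((some δ₁, i) :: (d, l) :: s) = (d, .cons l δ₁ i δ) :: s := by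
        unfold Trace.ext; rw [hop]
      rw [hx]
      exact ⟨rfl, rfl, Or.inr ⟨rfl, δ₁, i, d, l, s, rfl, rfl⟩⟩

theorem exists_rel (ρ : NPT N) : ∃ x, Rel ρ x := by
  induction hn : ρ.length using Nat.strong_induction_on generalizing ρ with
  | _ n ih =>
    rcases ρ.eq_root_or_edge with rfl | ⟨δ, ρ', he⟩
    · exact ⟨_, .root⟩
    · obtain ⟨x, hx⟩ := ih ρ'.length (by have := he.length; omega) ρ' rfl
      exact ⟨_, .step hx he⟩

theorem Rel.unique {ρ : NPT N} {x x' : Trace (PDTransition Q Γ)} (h : Rel ρ x) (h' : Rel ρ x') :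
    x = x' := by
  induction h generalizing x' with
  | root =>
    generalize hρ : NPT.root N = ρ at h'
    cases h' with
    | root => rfl
    | step _ he => subst hρ; exact he.not_root.elim
  | step hr he ih =>
    cases h' with
    | root => exact he.not_root.elim
    | step hr' he' =>
      obtain ⟨rfl, rfl⟩ := he.det he'
      rw [ih hr']

theorem Rel.inj {ρ ρ' : NPT N} {x : Trace (PDTransition Q Γ)} (h : Rel ρ x) (h' : Rel ρ' x) :
    ρ = ρ' := by
  induction h generalizing ρ' with
  | root =>
    generalize hx : N.rootTrace = x at h'
    cases h' with
    | root => rfl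
    | step hr he =>
      have := (hr.ext_eq he).2.1
      rw [← hx] at this
      simp [PushdownSystem.rootTrace, Trace.lastOp] at this
  | @step ρ ρ₁ δ x hr he ih =>
    have hE := hr.ext_eq he
    generalize hx : x.ext δ = y at h'
    cases h' with
    | root =>
      have := hE.2.1
      rw [hx] at this
      simp [PushdownSystem.rootTrace, Trace.lastOp] at this
    | step hr' he' =>
      have hE' := hr'.ext_eq he'
      have h1 := hE.1
      rw [hx, hE'.1] at h1
      subst h1
      have h2 := hE.2.1
      rw [hx, hE'.2.1] at h2
      obtain rfl := Option.some.inj h2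
      obtain rfl := ih hr'
      exact he.unique he'

/-- The run is built by induction along parents. The conditions in `Ok` are exactly what makes the
last transition applicable at the end of the parent. -/
theorem exists_rel_of_ok {x : Trace (PDTransition Q Γ)} (hx : N.Ok x) (hne : x ≠ []) :
    ∃ ρ : NPT N, Rel ρ x := by
  induction hn : x.size using Nat.strong_induction_on generalizing x with
  | _ n ih =>
    have hs := Trace.size_par_add_one hne
    have hp := hx.back true
    match x with
    | [] => exact absurd rfl hne
    | (none, .nil) :: s =>
      obtain rfl : s = [] := hx.2.2
      exact ⟨root N, .root⟩
    | (some δ, .nil) :: s =>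
      obtain ⟨o1, o2, o3, o4, o5⟩ := hx
      have hsne : s ≠ [] := by
        rintro rfl
        simp [PushdownSystem.lab] at o4
      obtain ⟨ρ, hρ⟩ := ih (Trace.size s) (by simp only [Trace.par] at hs; omega) o1 hsne rfl
      obtain ⟨-, -, h3, ⟨a, h4⟩, -⟩ := hρ.props
      cases hop : δ.op with
      | pop => exact absurd hop o5
      | push b =>
        have h4' := Option.some.inj (h4.symm.trans o4)
        have hstep : N.StepBy δ ρ.final (δ.dst, b :: ρ.final.2) := by
          refine ⟨o3, (Prod.ext_iff.1 h4').1, ?_, rfl, by rw [hop]; rfl⟩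
          rw [h3]
          match s with
          | F :: s => exact congrArg some (Prod.ext_iff.1 (Option.some.inj o4)).2
        obtain ⟨ρ', he⟩ := exists_edge hstep
        refine ⟨ρ', ?_⟩
        have := Rel.step hρ he
        unfold Trace.ext at this
        rwa [hop] at this
    | (d, .cons l δ₁ i δ₂) :: s =>
      obtain ⟨ρ, hρ⟩ := ih _ (by rw [← hn, ← hs]; exact Nat.lt_succ_self _) hp
        (by simp [Trace.par]) rfl
      obtain ⟨o1, ⟨o2, o3, o4, o5, o6, o7, o8, o9, o10, o11⟩, o12⟩ := hx
      obtain ⟨-, -, h3, ⟨a, h4⟩, -⟩ := hρ.props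
      have h4' := Option.some.inj h4
      have hstep : N.StepBy δ₂ ρ.final (δ₂.dst, N.sym d :: N.stk s) := by
        refine ⟨o8, ?_, ?_, rfl, ?_⟩
        · rw [o9]; exact (Prod.ext_iff.1 h4').1.symm
        · rw [h3, o10]; rfl
        · rw [h3, o11]; rfl
      obtain ⟨ρ', he⟩ := exists_edge hstep
      refine ⟨ρ', ?_⟩
      have := Rel.step hρ he
      unfold Trace.ext at this
      rwa [o11] at this

/-- The trace of a run. -/
noncomputable def trace (ρ : NPT N) : Trace (PDTransition Q Γ) := ρ.exists_rel.choose

theorem rel_trace (ρ : NPT N) : Rel ρ ρ.trace := ρ.exists_rel.choose_spec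

theorem trace_inj {ρ ρ' : NPT N} : ρ.trace = ρ'.trace ↔ ρ = ρ' :=
  ⟨fun h => ρ.rel_trace.inj (h ▸ ρ'.rel_trace), fun h => h ▸ rfl⟩

/-- Together with `jump_iff`, this expresses the relations by data on which similar traces agree. -/
theorem edge_iff {δ : PDTransition Q Γ} {ρ ρ' : NPT N} :
    Edge δ ρ ρ' ↔ ρ'.trace.lastOp = some δ ∧ ρ'.trace.par = ρ.trace := by
  constructor
  · intro h
    obtain ⟨h1, h2, -⟩ := ρ.rel_trace.ext_eq h
    rw [ρ'.rel_trace.unique (.step ρ.rel_trace h)]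
    exact ⟨h2, h1⟩
  · rintro ⟨h1, h2⟩
    rcases ρ'.eq_root_or_edge with rfl | ⟨δ', ρ'', he⟩
    · rw [(rel_trace (root N)).unique .root] at h1
      simp [PushdownSystem.rootTrace, Trace.lastOp] at h1
    · obtain ⟨h3, h4, -⟩ := ρ''.rel_trace.ext_eq he
      rw [ρ'.rel_trace.unique (.step ρ''.rel_trace he)] at h1 h2
      obtain rfl := Option.some.inj (h4.symm.trans h1)
      obtain rfl := trace_inj.1 (h3.symm.trans h2)
      exact he

/-- Excursions of the top level do not descend below that level. In a jump this shows that the stack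
at its start is not visited in between. -/
theorem exists_above {ρ : NPT N} {d : Option (PDTransition Q Γ)} {T : Loop (PDTransition Q Γ)}
    {x : Trace (PDTransition Q Γ)} (h : Rel ρ ((d, T) :: x)) :
    ∃ (ρ₀ : NPT N) (u : List (Q × List Γ)), Rel ρ₀ ((d, .nil) :: x) ∧ ρ.1 = ρ₀.1 ++ u ∧
      ∀ c ∈ u, x.length < c.2.length := by
  induction T generalizing d x ρ with
  | nil => exact ⟨ρ, [], h, by simp, by simp⟩
  | cons l δ₁ i δ₂ ihl ihi =>
    -- Taking back the last step of a run; it is applied to the final pop and to the push of the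
    -- last block.
    have inv : ∀ {ρ : NPT N} {y : Trace (PDTransition Q Γ)}, Rel ρ y → y.par ≠ [] →
        ∃ (ρ' : NPT N) (c : Q × List Γ), Rel ρ' y.par ∧ ρ.1 = ρ'.1 ++ [c] ∧ c.2.length = y.length := by
      intro ρ y hr hy
      have hp := hr.props
      cases hr with
      | root => exact absurd rfl hy
      | @step ρ' _ δ z hr' he =>
        obtain ⟨c, h1, h2⟩ := id he
        refine ⟨ρ', c, ?_, h1, ?_⟩
        · rw [(hr'.ext_eq he).1]; exact hr'
        · rw [h2.unique he.final, hp.2.2.1]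
          simp [PushdownSystem.stk]
    obtain ⟨ρ₁, c₁, h1, h2, h3⟩ := inv h (by simp [Trace.par])
    obtain ⟨ρ₂, u₂, h4, h5, h6⟩ := ihi h1
    obtain ⟨ρ₃, c₃, h7, h8, h9⟩ := inv h4 (by simp [Trace.par])
    obtain ⟨ρ₄, u₄, h10, h11, h12⟩ := ihl h7
    refine ⟨ρ₄, u₄ ++ [c₃] ++ u₂ ++ [c₁], h10, by rw [h2, h5, h8, h11]; simp, ?_⟩
    intro c hc
    simp only [List.mem_append, List.mem_singleton] at hc
    simp only [List.length_cons] at *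
    rcases hc with ((hc | rfl) | hc) | rfl
    · exact h12 c hc
    · omega
    · have := h6 c hc; omega
    · omega

/-- Before the final pop, the level opened by the push of the jump is the topmost one, and the level
below it, with the excursions completed before that push, is the run at which the jump starts. -/
theorem jump_iff {ρ ρ' : NPT N} :
    Jump ρ ρ' ↔ (∃ δ, ρ'.trace.lastOp = some δ ∧ δ.op = .pop) ∧ ρ'.trace.par.tail = ρ.trace := by
  constructor
  · rintro ⟨c₁, u, c, h1, h2, ⟨δ, b, hb, hδ⟩, ⟨δ', hp, hδ'⟩, hu⟩
    -- As long as the stack at the start is not revisited, the trace of the start remains a proper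
    -- suffix of the current trace.
    have key : ∀ v w : List (Q × List Γ), u = v ++ w →
        ∃ (ρ₁ : NPT N) (g : Trace (PDTransition Q Γ)), ρ₁.1 = ρ.1 ++ c₁ :: v ∧ g ≠ [] ∧
          Rel ρ₁ (g ++ ρ.trace) := by
      intro v
      induction v using List.reverseRecOn with
      | nil =>
        intro w _
        obtain ⟨ρ₁, he⟩ := exists_edge hδ
        obtain ⟨c', hc', hs⟩ := id he
        refine ⟨ρ₁, [(some δ, .nil)], ?_, by simp, ?_⟩
        · rw [hc', hs.unique hδ]
        · have := Rel.step ρ.rel_trace he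
          unfold Trace.ext at this
          rwa [hb] at this
      | append_singleton v e ih =>
        intro w hw
        obtain ⟨ρ₁, g, hρ₁, hg, hr⟩ := ih (e :: w) (by rw [hw]; simp)
        have hch := ρ'.2
        rw [h1, hw] at hch
        have hpre : List.IsChain N.Step (N.initCfg :: (ρ₁.1 ++ [e])) := by
          rw [hρ₁]
          refine hch.prefix ⟨w ++ [c], ?_⟩
          simp
        rcases NPT.eq_root_or_edge (N := N) ⟨ρ₁.1 ++ [e], hpre⟩ with h0 | ⟨δ₂, ρ₂, he⟩
        · simpa [root] using congrArg Subtype.val h0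
        obtain ⟨e', he1, he2⟩ := id he
        obtain ⟨e3, e4⟩ := List.append_inj' he1 rfl
        obtain rfl : ρ₁ = ρ₂ := Subtype.ext e3
        obtain ⟨-, -, hx⟩ := hr.ext_eq he
        have hr2 := Rel.step hr he
        have hfin := he2.unique he.final
        obtain rfl : e = e' := by simpa using e4
        have hne : e.2 ≠ ρ.final.2 := hu e (by rw [hw]; simp)
        refine ⟨⟨ρ₁.1 ++ [e], hpre⟩, ?_⟩
        rcases hx with ⟨-, hx⟩ | ⟨-, δ₁, i, d, l, s, hx1, hx2⟩
        · exact ⟨(some δ₂, .nil) :: g, (congrArg (· ++ [e]) hρ₁).trans (by simp), by simp, by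
            rw [hx] at hr2; exact hr2⟩
        · match g with
          | [] => exact absurd rfl hg
          -- A pop of the only additional level would restore the stack of `ρ`, which `hu` excludes.
          | [F] =>
            exfalso
            apply hne
            rw [hfin, hr2.props.2.2.1, hx2, ρ.rel_trace.props.2.2.1]
            have : ρ.trace = (d, l) :: s := (List.cons.inj hx1).2
            rw [this]
            simp [PushdownSystem.stk]
          | F :: F' :: g =>
            refine ⟨(d, .cons l δ₁ i δ₂) :: g, (congrArg (· ++ [e]) hρ₁).trans (by simp), by simp, ?_⟩
            rw [hx2] at hr2
            have : s = g ++ ρ.trace := by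
              have := (List.cons.inj (List.cons.inj hx1).2).2
              exact this.symm
            rw [this] at hr2
            exact hr2
    obtain ⟨ρ₁, g, hρ₁, hg, hr⟩ := key u [] (by simp)
    have he : Edge δ' ρ₁ ρ' := by
      refine ⟨c, by rw [h1, hρ₁], ?_⟩
      have : ρ₁.final = (c₁ :: u).getLast (List.cons_ne_nil _ _) := by
        unfold NPT.final
        simp only [hρ₁]
        rw [List.getLast_cons (by simp), List.getLast_append_of_right_ne_nil _ _ (by simp)]
      rwa [this]
    obtain ⟨x1, x2, x3⟩ := hr.ext_eq he
    have hr2 := Rel.step hr he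
    rw [ρ'.rel_trace.unique hr2]
    refine ⟨⟨δ', x2, hp⟩, ?_⟩
    rw [x1]
    rcases x3 with ⟨⟨b', x3⟩, -⟩ | ⟨-, δ₁, i, d, l, s, hx1, hx2⟩
    · rw [hp] at x3; cases x3
    · match g with
      | [] => exact absurd rfl hg
      | [F] => rfl
      -- With two additional levels before the final pop, the stack afterwards would be higher than
      -- that of `ρ`.
      | F :: F' :: g =>
        exfalso
        have hc : c = ρ'.final := by
          obtain ⟨c', hc1, hc2⟩ := id he
          rw [h1, hρ₁] at hc1
          obtain ⟨-, hc3⟩ := List.append_inj' hc1 rfl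
          rw [← hc2.unique he.final]
          simpa using hc3
        have := congrArg List.length h2
        rw [hc, hr2.props.2.2.1, hx2, ρ.rel_trace.props.2.2.1] at this
        have h5 := congrArg List.length (List.cons.inj (List.cons.inj hx1).2).2
        simp [PushdownSystem.stk] at this h5
        omega
  · rintro ⟨⟨δ, h1, h2⟩, h3⟩
    have hne : ρ.trace ≠ [] := ρ.rel_trace.props.2.1
    have hlen : ρ.final.2.length = ρ.trace.length := by
      rw [ρ.rel_trace.props.2.2.1]; simp [PushdownSystem.stk]
    rcases ρ'.eq_root_or_edge with rfl | ⟨δ', ρ₁, he⟩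
    · rw [(rel_trace (root N)).unique .root] at h1
      simp [PushdownSystem.rootTrace, Trace.lastOp] at h1
    obtain ⟨x1, x2, x3⟩ := ρ₁.rel_trace.ext_eq he
    have hr2 := Rel.step ρ₁.rel_trace he
    rw [ρ'.rel_trace.unique hr2] at h1 h3
    obtain rfl := Option.some.inj (x2.symm.trans h1)
    rw [x1] at h3
    rcases x3 with ⟨⟨b', x3⟩, -⟩ | ⟨-, δ₁, i, d, l, s, hx1, hx2⟩
    · rw [h2] at x3; cases x3
    have hr1 := ρ₁.rel_trace
    rw [hx1] at hr1 h3
    obtain ⟨ρ₂, u, h4, h5, h6⟩ := exists_above hr1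
    have hok := h4.props.1
    have hρ : Rel ρ ((d, l) :: s) := by rw [show (d, l) :: s = ρ.trace from h3]; exact ρ.rel_trace
    obtain ⟨δ₀, ρ₃, he3⟩ : ∃ δ ρ₃, Edge δ ρ₃ ρ₂ := by
      rcases ρ₂.eq_root_or_edge with rfl | h
      · have := h4.unique .root
        simp [PushdownSystem.rootTrace] at this
      · exact h
    obtain ⟨y1, y2, y3⟩ := ρ₃.rel_trace.ext_eq he3
    have hr3 := h4.unique (Rel.step ρ₃.rel_trace he3)
    rw [← hr3] at y1 y2
    obtain rfl : δ₁ = δ₀ := by simpa [Trace.lastOp] using y2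
    obtain rfl : ρ₃ = ρ := by
      refine trace_inj.1 (y1.symm.trans ?_)
      simp only [Trace.par]
      exact h3
    obtain ⟨c₁, hc1, hc2⟩ := id he3
    obtain ⟨c, hc3, hc4⟩ := id he
    have hlen' : ρ₃.trace.length = s.length + 1 := by rw [← h3]; simp
    refine ⟨c₁, u, c, by rw [hc3, h5, hc1]; simp, ?_, ⟨δ₁, ?_⟩, ⟨δ', h2, ?_⟩, ?_⟩
    · rw [hc4.unique he.final, hr2.props.2.2.1, hx2, ρ₃.rel_trace.props.2.2.1, ← h3]
      simp [PushdownSystem.stk]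
    · cases hop : δ₁.op with
      | pop => exact absurd hop hok.2.2.2.2
      | push b => exact ⟨b, rfl, hc2⟩
    · have : ρ₁.final = (c₁ :: u).getLast (List.cons_ne_nil _ _) := by
        unfold NPT.final
        simp only [h5, hc1, List.append_assoc, List.singleton_append]
        rw [List.getLast_cons (by simp), List.getLast_append_of_right_ne_nil _ _ (by simp)]
      rwa [← this]
    · intro e he0 heq
      have hcontra : ρ₃.trace.length < e.2.length := by
        rcases List.mem_cons.1 he0 with rfl | he0
        · rw [hc2.unique he3.final, h4.props.2.2.1]
          simp [PushdownSystem.stk, hlen']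
        · have := h6 e he0
          simp only [List.length_cons] at this
          omega
      rw [heq, hlen] at hcontra
      exact lt_irrefl _ hcontra

end NPT

/-! ## The game -/

namespace PushdownSystem

variable {Q Γ : Type} {N : PushdownSystem Q Γ} {t n l : ℕ}

theorem XS.lastOp_eq {x x' : Trace (PDTransition Q Γ)} (h : N.XS t (n + 1) x x') :
    x.lastOp = x'.lastOp := by
  match x with
  | [] => rw [show x' = [] from h]
  | (d, T) :: s =>
    obtain ⟨T', s', rfl, h1, h2⟩ := h
    cases T with
    | nil => rw [show T' = .nil from h1]; rfl
    | cons l δ₁ i δ₂ =>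
      obtain ⟨l', i', rfl, h1, h2⟩ := h1
      rfl

variable {p p' : List (Trace (PDTransition Q Γ) × Trace (PDTransition Q Γ))}

theorem Inv.of_subset (h : N.Inv t l p) (hp : ∀ z ∈ p', z ∈ p) : N.Inv t l p' :=
  ⟨fun z hz => h.ok z (hp z hz), fun z hz => h.sim z (hp z hz),
    fun z hz z' hz' => h.eq z (hp z hz) z' (hp z' hz')⟩

theorem Inv.swap (h : N.Inv t l p) : N.Inv t l (p.map Prod.swap) := by
  refine ⟨?_, ?_, ?_⟩
  · intro z hz
    obtain ⟨y, hy, rfl⟩ := List.mem_map.1 hz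
    exact (h.ok y hy).symm
  · intro z hz
    obtain ⟨y, hy, rfl⟩ := List.mem_map.1 hz
    exact (h.sim y hy).symm
  · intro z hz z' hz' w v hw hv
    obtain ⟨y, hy, rfl⟩ := List.mem_map.1 hz
    obtain ⟨y', hy', rfl⟩ := List.mem_map.1 hz'
    exact (h.eq y hy y' hy' w v hw hv).symm

end PushdownSystem

/-- The radius of the closures when `k` rounds remain. -/
def radius (k : ℕ) : ℕ := 2 * 8 ^ k

theorem two_le_radius (k : ℕ) : 2 ≤ radius k := by
  have := Nat.one_le_pow k 8 (by norm_num)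
  unfold radius; omega

theorem radius_succ (k : ℕ) : radius (k + 1) = 8 * radius k := by
  unfold radius; ring

theorem radius_mono {k r : ℕ} (h : k ≤ r) : radius k ≤ radius r :=
  Nat.mul_le_mul_left _ (Nat.pow_le_pow_right (by norm_num) h)

/-- The growth factor of the thresholds. -/
def growth (r : ℕ) : ℕ := 12 * (radius r * 2 ^ (10 * radius r + 1))

/-- A bound on the number of elements in the closures. -/
def closureBound (r : ℕ) : ℕ := r * 2 ^ (3 * radius r + 1)

/-! ### Thresholds and Duplicator's strategy. -/

namespace PushdownSystem

variable {Q Γ : Type} [Fintype Q] [Fintype Γ] (N : PushdownSystem Q Γ)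

/-- The threshold below which trees are preserved when `k` of `r` rounds remain. -/
def threshold (r k : ℕ) : ℕ :=
  ((closureBound r + 1) * (N.window + 1) + 2) * (3 * growth r) ^ k

/-- The invariant when `k` of `r` rounds remain. -/
def GameInv (r k : ℕ) (p : List (NPT N × NPT N)) : Prop :=
  N.Inv (N.threshold r k) (radius k) (p.map fun z => (z.1.trace, z.2.trace))

variable {N} {r k : ℕ} {p : List (NPT N × NPT N)}

theorem one_le_growth (r : ℕ) : 1 ≤ growth r := by
  have := two_le_radius r
  have := Nat.one_le_two_pow (n := 10 * radius r + 1)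
  unfold growth
  nlinarith

theorem threshold_pos (r k : ℕ) : 0 < N.threshold r k := by
  have := one_le_growth r
  unfold threshold
  positivity

/-- Runs introduced when `k` rounds remain must be small for the threshold of the round before, as
`Inv.extend` demands. Both summands of the base are at most the current threshold, which accounts
for a factor 2; the third unit in `3 * growth r` makes the inequality strict. -/
theorem growth_lt {k : ℕ} (hk : k < r) :
    12 * (radius k * (2 ^ (10 * radius k + 1) * (N.base (N.threshold r k) (closureBound r) + 2))) <
      N.threshold r (k + 1) := by
  have hg := one_le_growth r
  have hr := radius_mono hk.le
  have hA : 12 * (radius k * 2 ^ (10 * radius k + 1)) ≤ growth r :=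
    Nat.mul_le_mul_left _ (Nat.mul_le_mul hr (Nat.pow_le_pow_right (by norm_num) (by omega)))
  have hZ : (closureBound r + 1) * (N.window + 1) + 2 ≤ N.threshold r k :=
    Nat.le_mul_of_pos_right _ (by positivity)
  have hpos := N.threshold_pos r k
  have hT : N.threshold r (k + 1) = 3 * growth r * N.threshold r k := by
    unfold threshold; ring
  calc 12 * (radius k * (2 ^ (10 * radius k + 1) * (N.base (N.threshold r k) (closureBound r) + 2)))
      = 12 * (radius k * 2 ^ (10 * radius k + 1)) *
          (N.threshold r k + ((closureBound r + 1) * (N.window + 1) + 2)) := by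
        unfold base; ring
    _ ≤ growth r * (N.threshold r k + N.threshold r k) := Nat.mul_le_mul hA (by omega)
    _ < 3 * growth r * N.threshold r k := by nlinarith
    _ = _ := hT.symm

theorem threshold_mono {j k : ℕ} (h : j ≤ k) : N.threshold r j ≤ N.threshold r k := by
  have := one_le_growth r
  exact Nat.mul_le_mul_left _ (Nat.pow_le_pow_right (by omega) h)

/-- Duplicator can answer in the second copy, by a short run. -/
theorem GameInv.extend (h : N.GameInv r (k + 1) p) (hk : p.length + k < r) (ρ : NPT N) :
    ∃ ρ' : NPT N, N.GameInv r k (p ++ [(ρ, ρ')]) ∧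
      ∀ B, (∀ z ∈ p, z.2.length ≤ B) → ρ'.length ≤ B + N.threshold r r := by
  have h' : N.Inv (N.threshold r (k + 1)) (8 * radius k)
      (p.map fun z => (z.1.trace, z.2.trace)) := by rw [← radius_succ]; exact h
  obtain ⟨hok, hne, -⟩ := ρ.rel_trace.props
  have hgr := N.growth_lt (show k < r by omega)
  obtain ⟨x', h1, h2, h3⟩ := h'.extend (t := N.threshold r k) (K := closureBound r)
    (two_le_radius k) le_rfl hgr (by
      rw [List.length_map]
      refine Nat.mul_le_mul (by omega) (Nat.pow_le_pow_right (by norm_num) ?_)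
      have := radius_mono (show k ≤ r by omega)
      omega) hok
  have hne' : x' ≠ [] := fun h0 => hne ((h2.sim _ List.mem_cons_self).nil_iff.2 h0)
  obtain ⟨ρ', hρ'⟩ := NPT.exists_rel_of_ok h1 hne'
  obtain rfl : ρ'.trace = x' := ρ'.rel_trace.unique hρ'
  refine ⟨ρ', h2.of_subset ?_, ?_⟩
  · intro z hz
    simp only [List.map_append, List.map_cons, List.map_nil, List.mem_append,
      List.mem_singleton] at hz
    exact List.mem_cons.2 hz.symm
  · intro B hB
    -- The size of a trace is the length of the run plus one.
    have := h3 (B + 1) (by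
      intro z hz
      obtain ⟨y, hy, rfl⟩ := List.mem_map.1 hz
      have := hB y hy
      have := y.2.rel_trace.props.2.2.2.2
      simp only
      omega)
    have hs := ρ'.rel_trace.props.2.2.2.2
    have := N.threshold_mono (r := r) (show k + 1 ≤ r by omega)
    omega

omit [Fintype Q] [Fintype Γ] in
theorem map_swap_trace : (p.map Prod.swap).map (fun z => (z.1.trace, z.2.trace)) =
    (p.map fun z => (z.1.trace, z.2.trace)).map Prod.swap := by
  simp

theorem GameInv.swap (h : N.GameInv r k p) : N.GameInv r k (p.map Prod.swap) := by
  unfold GameInv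
  rw [map_swap_trace]
  exact Inv.swap h

/-- Duplicator can answer in the first copy. -/
theorem GameInv.extend_left (h : N.GameInv r (k + 1) p) (hk : p.length + k < r) (ρ : NPT N) :
    ∃ ρ' : NPT N, N.GameInv r k (p ++ [(ρ', ρ)]) := by
  obtain ⟨ρ', h1, -⟩ := h.swap.extend (by simpa using hk) ρ
  refine ⟨ρ', ?_⟩
  have := h1.swap
  simpa [Function.comp_def] using this

/-- Equality, edges and jumps are equations between closure elements for the words `[]`, `[true]`
and `[true, false]`, together with the last transition. Words of length at most 2 are covered since
every radius is at least 2. -/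
theorem GameInv.isPartialIso (h : N.GameInv r k p) : IsPartialIso (nptLang N) p := by
  have hl := two_le_radius k
  have hm : ∀ z ∈ p, (z.1.trace, z.2.trace) ∈ p.map fun z => (z.1.trace, z.2.trace) :=
    fun z hz => List.mem_map.2 ⟨z, hz, rfl⟩
  have hE : ∀ z ∈ p, ∀ z' ∈ p, ∀ w : List Bool, w.length ≤ 2 →
      (Trace.app w z.1.trace = z'.1.trace ↔ Trace.app w z.2.trace = z'.2.trace) :=
    fun z hz z' hz' w hw => h.eq _ (hm z hz) _ (hm z' hz') w [] (by omega) (Nat.zero_le _)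
  have hO : ∀ z ∈ p, z.1.trace.lastOp = z.2.trace.lastOp := by
    intro z hz
    exact ((h.sim _ (hm z hz)).mono (m := 0 + 1) (by omega)).lastOp_eq
  refine ⟨?_, ?_⟩
  · intro z hz z' hz'
    rw [← NPT.trace_inj, ← NPT.trace_inj]
    exact hE z hz z' hz' [] (by simp)
  · intro m R x hx
    cases R with
    | edge δ hδ =>
      change NPT.Edge δ (x 0).1 (x 1).1 ↔ NPT.Edge δ (x 0).2 (x 1).2
      rw [NPT.edge_iff, NPT.edge_iff, hO _ (hx 1)]
      exact and_congr_right fun _ => hE _ (hx 1) _ (hx 0) [true] (by simp)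
    | jump =>
      change NPT.Jump (x 0).1 (x 1).1 ↔ NPT.Jump (x 0).2 (x 1).2
      rw [NPT.jump_iff, NPT.jump_iff, hO _ (hx 1)]
      exact and_congr_right fun _ => hE _ (hx 1) _ (hx 0) [true, false] (by simp)

variable (N) in
open Classical in
/-- Duplicator's strategy in the `r`-round game. -/
noncomputable def strategy (r : ℕ) : DuplicatorStrategy (NPT N) := fun p b a =>
  if b then
    if h : ∃ a', N.GameInv r (r - (p.length + 1)) (p ++ [(a, a')]) ∧
        ∀ B, (∀ z ∈ p, z.2.length ≤ B) → a'.length ≤ B + N.threshold r r then h.choose else a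
  else if h : ∃ a', N.GameInv r (r - (p.length + 1)) (p ++ [(a', a)]) then h.choose else a

theorem strategy_next (h : N.GameInv r (r - p.length) p) (hp : p.length < r) (b : Bool)
    (a : NPT N) : N.GameInv r (r - (p.length + 1)) ((N.strategy r).next p b a) ∧
      (b = true → ∀ B, (∀ z ∈ p, z.2.length ≤ B) →
        (N.strategy r p b a).length ≤ B + N.threshold r r) := by
  have h' : N.GameInv r (r - (p.length + 1) + 1) p := by
    rwa [show r - (p.length + 1) + 1 = r - p.length by omega]
  cases b with
  | true =>
    have hex := h'.extend (by omega) a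
    have hs : N.strategy r p true a = hex.choose := by
      unfold strategy; rw [if_pos rfl, dif_pos hex]
    unfold DuplicatorStrategy.next
    rw [hs]
    exact ⟨hex.choose_spec.1, fun _ => hex.choose_spec.2⟩
  | false =>
    have hex := h'.extend_left (by omega) a
    have hs : N.strategy r p false a = hex.choose := by simp [strategy, hex]
    unfold DuplicatorStrategy.next
    rw [hs]
    exact ⟨hex.choose_spec, by simp⟩

theorem gameInv_nil : N.GameInv r k [] := ⟨by simp, by simp, by simp⟩

omit [Fintype Q] [Fintype Γ] in
theorem length_next (τ : DuplicatorStrategy (NPT N)) (b : Bool) (a : NPT N) :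
    (τ.next p b a).length = p.length + 1 := by simp [DuplicatorStrategy.next]

theorem gameInv_of_reachable (h : (N.strategy r).Reachable p) (hp : p.length ≤ r) :
    N.GameInv r (r - p.length) p := by
  induction h with
  | nil => exact gameInv_nil
  | next p b a hr ih =>
    rw [length_next] at hp ⊢
    exact (strategy_next (ih (by omega)) (by omega) b a).1

theorem strategy_isWinning (r : ℕ) : (N.strategy r).IsWinning (nptLang N) r :=
  fun _ hp hlen => (gameInv_of_reachable hp hlen.le).isPartialIso

/-- Each answer exceeds the longest earlier run of the second copy by at most `threshold r r`, hence
the linear bound in `m`. -/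
theorem strategy_preserves (r : ℕ) :
    (N.strategy r).Preserves r (lengthConstraint N fun m => m * N.threshold r r) := by
  intro p hp hlen hS a
  have hn := (strategy_next (gameInv_of_reachable hp hlen.le) hlen true a).2 rfl
    (p.length * N.threshold r r) (by
      intro z hz
      have := hS z.2 (List.mem_map.2 ⟨z, hz, rfl⟩)
      simpa using this)
  intro ρ hρ
  simp only [DuplicatorStrategy.next, if_true, List.map_append, List.map_cons, List.map_nil,
    List.mem_append, List.mem_singleton, List.length_append, List.length_map,
    List.length_singleton] at hρ ⊢
  rw [Nat.add_mul, Nat.one_mul]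
  rcases hρ with hρ | rfl
  · have := hS ρ hρ
    simp only [List.length_map] at this
    omega
  · exact hn

/-! ### Explicit bounds. -/

theorem window_le (N : PushdownSystem Q Γ) :
    N.window + 1 ≤ 2 ^ (N.size ^ 3 + N.size ^ 2 + 5) := by
  have h1 : Fintype.card (Q × Γ × Q) ≤ N.size ^ 3 := by
    rw [Fintype.card_prod, Fintype.card_prod]
    have hq : Fintype.card Q ≤ N.size := by unfold size; omega
    have hg : Fintype.card Γ ≤ N.size := by unfold size; omega
    calc _ ≤ N.size * (N.size * N.size) := Nat.mul_le_mul hq (Nat.mul_le_mul hg hq)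
      _ = _ := by ring
  have h2 : Fintype.card (Option (Q × Γ)) ≤ N.size ^ 2 + 1 := by
    rw [Fintype.card_option, Fintype.card_prod]
    have hq : Fintype.card Q ≤ N.size := by unfold size; omega
    have hg : Fintype.card Γ ≤ N.size := by unfold size; omega
    have := Nat.mul_le_mul hq hg
    nlinarith
  have h3 : N.size ^ 2 + 3 ≤ 2 ^ (N.size ^ 2 + 2) := by
    have := Nat.lt_two_pow_self (n := N.size ^ 2 + 2)
    omega
  have h4 : N.loopBound ≤ 2 ^ (N.size ^ 3 + 1) := Nat.pow_le_pow_right (by norm_num) (by omega)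
  have h5 := Nat.mul_le_mul h4 ((show Fintype.card (Option (Q × Γ)) + 2 ≤ N.size ^ 2 + 3 by
    omega).trans h3)
  rw [← pow_add] at h5
  have h6 : (2 : ℕ) ^ (N.size ^ 3 + N.size ^ 2 + 5) =
      4 * 2 ^ (N.size ^ 3 + 1 + (N.size ^ 2 + 2)) := by
    rw [show N.size ^ 3 + N.size ^ 2 + 5 = (N.size ^ 3 + 1 + (N.size ^ 2 + 2)) + 2 by ring, pow_add]
    ring
  have := Nat.one_le_two_pow (n := N.size ^ 3 + 1 + (N.size ^ 2 + 2))
  unfold window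
  omega

/-- Each of the `r` factors is a power of 2 whose exponent is linear in `radius r = 2 * 8 ^ r`. The
total exponent is of order `r * 8 ^ r`, which is at most a constant times `2 ^ (4 * r)`. -/
theorem growth_le (r : ℕ) : (closureBound r + 3) * (3 * growth r) ^ r ≤ 2 ^ 2 ^ (4 * r + 6) := by
  obtain ⟨L, hL⟩ : ∃ L, radius r = L := ⟨_, rfl⟩
  have hL2 : L = 2 * 8 ^ r := hL.symm
  have h1 : 3 * growth r ≤ 2 ^ (11 * L + 7) := by
    unfold growth
    rw [hL]
    calc 3 * (12 * (L * 2 ^ (10 * L + 1))) ≤ 64 * (2 ^ L * 2 ^ (10 * L + 1)) := by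
          have := Nat.mul_le_mul_right (2 ^ (10 * L + 1)) (Nat.lt_two_pow_self (n := L)).le
          omega
      _ = 2 ^ (11 * L + 7) := by
        rw [show 11 * L + 7 = L + (10 * L + 1) + 6 by ring, pow_add, pow_add]; ring
  have h2 : closureBound r + 3 ≤ 2 ^ (r + 3 * L + 3) := by
    unfold closureBound
    rw [hL]
    have := Nat.mul_le_mul_right (2 ^ (3 * L + 1)) (Nat.lt_two_pow_self (n := r)).le
    have h3 : 2 ^ (r + 3 * L + 3) = 4 * (2 ^ r * 2 ^ (3 * L + 1)) := by
      rw [show r + 3 * L + 3 = r + (3 * L + 1) + 2 by ring, pow_add, pow_add]; ring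
    have := Nat.one_le_two_pow (n := r)
    have := Nat.one_le_two_pow (n := 3 * L + 1)
    have : 1 ≤ 2 ^ r * 2 ^ (3 * L + 1) := Nat.one_le_iff_ne_zero.2 (by positivity)
    omega
  calc (closureBound r + 3) * (3 * growth r) ^ r
      ≤ 2 ^ (r + 3 * L + 3) * (2 ^ (11 * L + 7)) ^ r :=
        Nat.mul_le_mul h2 (Nat.pow_le_pow_left h1 r)
    _ = 2 ^ (r + 3 * L + 3 + (11 * L + 7) * r) := by rw [← pow_mul, ← pow_add]
    _ ≤ 2 ^ 2 ^ (4 * r + 6) := by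
      refine Nat.pow_le_pow_right (by norm_num) ?_
      have e1 : (2 : ℕ) ^ (4 * r + 6) = 64 * (2 ^ r * 8 ^ r) := by
        rw [pow_add, pow_mul, show (2 : ℕ) ^ 4 = 2 * 8 by norm_num, mul_pow]; ring
      rw [e1, hL2]
      have e2 : r ≤ 2 ^ r := (Nat.lt_two_pow_self (n := r)).le
      have e3 : 1 ≤ 8 ^ r := Nat.one_le_pow _ _ (by norm_num)
      have e4 : r * 8 ^ r ≤ 2 ^ r * 8 ^ r := Nat.mul_le_mul_right _ e2
      have e5 : 8 ^ r ≤ 2 ^ r * 8 ^ r := Nat.le_mul_of_pos_left _ (by positivity)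
      have e6 : r ≤ r * 8 ^ r := Nat.le_mul_of_pos_right _ (by positivity)
      have e7 : (11 * (2 * 8 ^ r) + 7) * r = 22 * (r * 8 ^ r) + 7 * r := by ring
      rw [e7]
      omega

theorem threshold_le (N : PushdownSystem Q Γ) (r : ℕ) :
    N.threshold r r ≤ 2 ^ 2 ^ (4 * r + 6) * 2 ^ (N.size ^ 3 + N.size ^ 2 + 5) := by
  have h1 := N.window_le
  have h2 := growth_le r
  calc N.threshold r r ≤ (closureBound r + 3) * (N.window + 1) * (3 * growth r) ^ r := by
        refine Nat.mul_le_mul_right _ ?_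
        nlinarith [Nat.zero_le N.window]
    _ = (closureBound r + 3) * (3 * growth r) ^ r * (N.window + 1) := by ring
    _ ≤ _ := Nat.mul_le_mul h2 h1

theorem exists_bounded_strategy : ∃ p q : Polynomial ℕ,
    ∀ (Q Γ : Type) [Fintype Q] [Fintype Γ] (N : PushdownSystem Q Γ) (r : ℕ),
      ∃ (f : ℕ → ℕ) (τ : DuplicatorStrategy (NPT N)),
        Monotone f ∧
        f r ≤ r * 2 ^ 2 ^ q.eval r * 2 ^ p.eval N.size ∧
        τ.IsWinning (nptLang N) r ∧
        τ.Preserves r (lengthConstraint N f) := by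
  refine ⟨.X ^ 3 + .X ^ 2 + 5, 4 * .X + 6, ?_⟩
  intro Q Γ _ _ N r
  refine ⟨fun m => m * N.threshold r r, N.strategy r, fun a b h => Nat.mul_le_mul_right _ h, ?_,
    strategy_isWinning r, strategy_preserves r⟩
  have := Nat.mul_le_mul_left r (N.threshold_le r)
  simpa [Nat.mul_assoc] using this

end PushdownSystem

/-! ## A programming language for alternating Turing machines

The tapes are used as stacks of tokens. A control state is a list of programs that remain to be
executed. -/

instance Tok.instDecidableEq : DecidableEq Tok := fun a b => by
  cases a <;> cases b <;> first | exact isTrue rfl | exact isFalse (by nofun)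

instance Tok.instFinite : Finite Tok :=
  Finite.of_injective (β := Fin 12)
    (fun t => match t with
      | .one => 0 | .endNum => 1 | .item => 2 | .sep => 3 | .push => 4 | .pop => 5
      | .falsum => 6 | .equal => 7 | .edge => 8 | .jump => 9 | .imp => 10 | .all => 11)
    (by intro a b; cases a <;> cases b <;> simp)

/-- Programs over stacks that are indexed by `ι`. -/
inductive Prog (ι : Type) : Type where
  | skip : Prog ι
  | pop (i : ι) : Prog ι
  | push (i : ι) (t : Tok) : Prog ι
  | write (i : ι) (t : Tok) : Prog ι
  | seq (p q : Prog ι) : Prog ι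
  | br (i : ι) (f : Option Tok → Prog ι) : Prog ι
  | wh (i : ι) (c : Option Tok → Bool) (p : Prog ι) : Prog ι
  | fork (p q : Prog ι) : Prog ι
  | flip : Prog ι
  | verdict (b : Bool) : Prog ι

set_option linter.unusedSectionVars false

namespace Prog

variable {ι : Type}

/-- The control states that occur when `p` is executed with continuation `k`. -/
def reach : Prog ι → List (Prog ι) → Set (List (Prog ι))
  | skip, k => {skip :: k}
  | pop i, k => {pop i :: k}
  | push i t, k => {push i t :: k, write i t :: k}
  | write i t, k => {write i t :: k}
  | seq p q, k => {seq p q :: k} ∪ (reach p (q :: k) ∪ reach q k)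
  | br i f, k => {br i f :: k} ∪ ⋃ o, reach (f o) k
  | wh i c p, k => {wh i c p :: k} ∪ reach p (wh i c p :: k)
  | fork p q, k => {fork p q :: k, skip :: q :: k} ∪ (reach p k ∪ reach q k)
  | flip, k => {flip :: k}
  | verdict b, k => {verdict b :: k}

/-- A loop is not unfolded: its body is executed with the loop itself as the continuation, so the
recursion is structural. -/
theorem finite_reach (p : Prog ι) (k : List (Prog ι)) : (reach p k).Finite := by
  induction p generalizing k with
  | seq p q hp hq => exact (Set.finite_singleton _).union ((hp _).union (hq _))
  | br i f h => exact (Set.finite_singleton _).union (Set.finite_iUnion fun o => h o k)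
  | wh i c p h => exact (Set.finite_singleton _).union (h _)
  | fork p q hp hq => exact (by simp : Set.Finite {_, _}).union ((hp _).union (hq _))
  | _ => simp [reach]

theorem self_mem_reach (p : Prog ι) (k : List (Prog ι)) : p :: k ∈ reach p k := by
  cases p <;> simp [reach]

/-- A move of the control: whether the mode changes, the next control state and the actions on the
tapes. -/
abbrev Move (ι : Type) : Type :=
  Bool × List (Prog ι) × (ι → Option Tok × Option Turing.Dir)

variable [DecidableEq ι]

/-- The possible moves in a control state when the symbols `h` are scanned. -/
def succ (h : ι → Option Tok) : List (Prog ι) → Set (Move ι)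
  | [] => ∅
  | skip :: k => {(false, k, fun j => (h j, none))}
  | pop i :: k => {(false, k, Function.update (fun j => (h j, none)) i (none, some .right))}
  | push i t :: k =>
    {(false, write i t :: k, Function.update (fun j => (h j, none)) i (h i, some .left))}
  | write i t :: k => {(false, k, Function.update (fun j => (h j, none)) i (some t, none))}
  | seq p q :: k => {(false, p :: q :: k, fun j => (h j, none))}
  | br i f :: k => {(false, f (h i) :: k, fun j => (h j, none))}
  | wh i c p :: k =>
    {(false, if c (h i) then p :: wh i c p :: k else k, fun j => (h j, none))}
  | fork p q :: k =>
    {(false, p :: k, fun j => (h j, none)), (false, skip :: q :: k, fun j => (h j, none))}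
  | flip :: k => {(true, k, fun j => (h j, none))}
  | verdict _ :: _ => ∅

theorem succ_mem_reach (p : Prog ι) (k : List (Prog ι)) (h : ι → Option Tok)
    {c : List (Prog ι)} (hc : c ∈ reach p k) {y : Move ι} (hy : y ∈ succ h c) :
    y.2.1 ∈ reach p k ∨ y.2.1 = k := by
  induction p generalizing k with
  | skip | pop | write | flip | verdict =>
    simp only [reach, Set.mem_singleton_iff] at hc
    subst hc
    simp only [succ, Set.mem_singleton_iff, Set.mem_empty_iff_false] at hy
    try simp [hy]
  | push i t =>
    simp only [reach, Set.mem_insert_iff, Set.mem_singleton_iff] at hc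
    rcases hc with rfl | rfl <;> simp only [succ, Set.mem_singleton_iff] at hy <;> subst hy <;>
      simp [reach]
  | seq p q hp hq =>
    rcases hc with hc | hc | hc
    · rw [Set.mem_singleton_iff] at hc
      subst hc
      simp only [succ, Set.mem_singleton_iff] at hy
      subst hy
      exact .inl (.inr (.inl (self_mem_reach _ _)))
    · rcases hp _ hc with h | h
      · exact .inl (.inr (.inl h))
      · exact .inl (.inr (.inr (h ▸ self_mem_reach _ _)))
    · rcases hq _ hc with h | h
      · exact .inl (.inr (.inr h))
      · exact .inr h
  | br i f hf =>
    rcases hc with hc | hc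
    · rw [Set.mem_singleton_iff] at hc
      subst hc
      simp only [succ, Set.mem_singleton_iff] at hy
      subst hy
      exact .inl (.inr (Set.mem_iUnion.2 ⟨_, self_mem_reach _ _⟩))
    · obtain ⟨o, ho⟩ := Set.mem_iUnion.1 hc
      rcases hf o _ ho with h | h
      · exact .inl (.inr (Set.mem_iUnion.2 ⟨o, h⟩))
      · exact .inr h
  | wh i c p hp =>
    rcases hc with hc | hc
    · rw [Set.mem_singleton_iff] at hc
      subst hc
      simp only [succ, Set.mem_singleton_iff] at hy
      subst hy
      dsimp only
      split
      · exact .inl (.inr (self_mem_reach _ _))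
      · exact .inr rfl
    · rcases hp _ hc with h | h
      · exact .inl (.inr h)
      · exact .inl (.inl h)
  | fork p q hp hq =>
    rcases hc with (hc | hc) | hc | hc
    · subst hc
      simp only [succ, Set.mem_insert_iff, Set.mem_singleton_iff] at hy
      rcases hy with rfl | rfl
      · exact .inl (.inr (.inl (self_mem_reach _ _)))
      · exact .inl (.inl (.inr rfl))
    · rw [Set.mem_singleton_iff] at hc
      subst hc
      simp only [succ, Set.mem_singleton_iff] at hy
      subst hy
      exact .inl (.inr (.inr (self_mem_reach _ _)))
    · rcases hp _ hc with h | h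
      · exact .inl (.inr (.inl h))
      · exact .inr h
    · rcases hq _ hc with h | h
      · exact .inl (.inr (.inr h))
      · exact .inr h

/-- The control states of the machine that executes `p`. -/
def states (p : Prog ι) : Set (List (Prog ι)) := insert [] (reach p [])

theorem succ_mem_states {p : Prog ι} {h : ι → Option Tok} {c : List (Prog ι)} (hc : c ∈ p.states)
    {y : Move ι} (hy : y ∈ succ h c) : y.2.1 ∈ p.states := by
  rcases hc with rfl | hc
  · simp [succ] at hy
  · exact (succ_mem_reach p [] h hc hy).symm

/-- The kind of a control state. A verdict states whether the input has the property that is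
tested, and is accepted in universal mode if it is affirmative and in existential mode if not. -/
def kind (mode : Bool) : List (Prog ι) → StateKind
  | [] => .rejecting
  | verdict b :: _ => if b = mode then .accepting else .rejecting
  | _ => if mode then .universal else .existential

/-- The alternating Turing machine that executes `p`; `e` assigns tapes to stacks. -/
def toATM (p : Prog ι) {n : ℕ} (e : ι ≃ Fin (n + 1)) : ATM Tok where
  k := n
  Γ := Tok
  finΓ := inferInstance
  inputSymbol := Function.Embedding.refl _
  Q := Bool × p.states
  finQ := by
    have : Finite p.states := ((finite_reach p []).insert []).to_subtype
    infer_instance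
  start := (true, ⟨[p], Or.inr (self_mem_reach p [])⟩)
  kind := fun q => kind q.1 q.2.1
  moves := fun q h => { x | ∃ y ∈ succ (fun j => h (e j)) q.2.1,
    x.1.1 = (q.1 ^^ y.1) ∧ x.1.2.1 = y.2.1 ∧ x.2 = fun i => y.2.2 (e.symm i) }

variable {n : ℕ} (p : Prog ι) (e : ι ≃ Fin (n + 1))

/-- The configuration with given mode, control state and tapes. -/
def cfg (mode : Bool) (k : p.states) (τ : ι → Turing.Tape (Option Tok)) : (p.toATM e).Cfg :=
  ⟨(mode, k), fun i => τ (e.symm i)⟩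

/-- In control state `k` with tapes `τ`, the machine decides the truth of `P` in at most `T` steps
with at most `a` alternations. -/
def DecidesTape (k : List (Prog ι)) (τ : ι → Turing.Tape (Option Tok)) (P : Prop) (T a : ℕ) :
    Prop :=
  ∀ (hk : k ∈ p.states) (mode : Bool),
    ((p.toATM e).AcceptingCfg (cfg p e mode ⟨k, hk⟩ τ) ↔ if mode then P else ¬ P) ∧
    ∀ l, List.IsChain (p.toATM e).Step (cfg p e mode ⟨k, hk⟩ τ :: l) →
      l.length ≤ T ∧ ATM.alternations (cfg p e mode ⟨k, hk⟩ τ :: l) ≤ a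

/-- Halting control states. -/
def Halting : List (Prog ι) → Prop
  | [] => True
  | verdict _ :: _ => True
  | _ => False

theorem kind_of_not_halting {k : List (Prog ι)} (hk : ¬ Halting k) (mode : Bool) :
    kind mode k = if mode then .universal else .existential := by
  unfold Halting at hk
  unfold kind
  split at hk <;> simp_all

theorem step_cfg_iff {k : List (Prog ι)} (hh : ¬ Halting k) (hk : k ∈ p.states) (mode : Bool)
    (τ : ι → Turing.Tape (Option Tok)) (d : (p.toATM e).Cfg) :
    (p.toATM e).Step (cfg p e mode ⟨k, hk⟩ τ) d ↔
      ∃ y, ∃ hy : y ∈ succ (fun j => (τ j).head) k,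
        d = cfg p e (mode ^^ y.1) ⟨y.2.1, succ_mem_states hk hy⟩
          (fun j => ATM.update (τ j) (y.2.2 j)) := by
  have hkind : (p.toATM e).kind (cfg p e mode ⟨k, hk⟩ τ).state = .existential ∨
      (p.toATM e).kind (cfg p e mode ⟨k, hk⟩ τ).state = .universal := by
    change kind mode k = _ ∨ kind mode k = _
    rw [kind_of_not_halting hh]
    cases mode <;> simp
  have hhead : (fun j => ((cfg p e mode ⟨k, hk⟩ τ).tapes (e j)).head) = fun j => (τ j).head := by
    funext j
    simp [cfg]
  constructor
  · rintro ⟨-, ⟨⟨m, k'⟩, acts⟩, ⟨y, hy, h1, h2, h3⟩, rfl⟩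
    have hy' : y ∈ succ (fun j => (τ j).head) k := by
      rw [← hhead]
      exact hy
    refine ⟨y, hy', ?_⟩
    dsimp only at h1 h2 h3
    subst h3
    unfold cfg
    congr 1
    exact Prod.ext h1 (Subtype.ext h2)
  · rintro ⟨y, hy, rfl⟩
    refine ⟨hkind, ⟨(mode ^^ y.1, ⟨y.2.1, succ_mem_states hk hy⟩), fun i => y.2.2 (e.symm i)⟩,
      ⟨y, ?_, rfl, rfl, rfl⟩, rfl⟩
    have h := hy
    rw [← hhead] at h
    exact h

theorem _root_.ATM.acceptingCfg_universal {A : Type} {M : ATM A} {c : M.Cfg}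
    (h : M.kind c.state = .universal) :
    M.AcceptingCfg c ↔ ∀ d, M.Step c d → M.AcceptingCfg d := by
  refine ⟨fun hc => ?_, ATM.AcceptingCfg.universal c h⟩
  cases hc with
  | accepting _ h' => rw [h] at h'; cases h'
  | existential _ _ h' => rw [h] at h'; cases h'
  | universal _ _ h' => exact h'

theorem _root_.ATM.acceptingCfg_existential {A : Type} {M : ATM A} {c : M.Cfg}
    (h : M.kind c.state = .existential) :
    M.AcceptingCfg c ↔ ∃ d, M.Step c d ∧ M.AcceptingCfg d := by
  refine ⟨fun hc => ?_, fun ⟨d, h1, h2⟩ => ATM.AcceptingCfg.existential c d h h1 h2⟩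
  cases hc with
  | accepting _ h' => rw [h] at h'; cases h'
  | existential _ d _ h1 h2 => exact ⟨d, h1, h2⟩
  | universal _ h' => rw [h] at h'; cases h'

theorem _root_.ATM.switch_le (x y : StateKind) : ATM.switch x y ≤ 1 := by
  cases x <;> cases y <;> simp [ATM.switch]

theorem switch_kind {k : List (Prog ι)} (hh : ¬ Halting k) (mode : Bool) (k' : List (Prog ι)) :
    ATM.switch (kind mode k) (kind mode k') = 0 := by
  rw [kind_of_not_halting hh]
  rcases k' with _ | ⟨x, k'⟩
  · cases mode <;> rfl
  · cases x with
    | verdict b => cases mode <;> cases b <;> rfl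
    | _ => cases mode <;> rfl

/-- In universal mode all moves must lead to acceptance, which is `P`. In existential mode some move
must, which is `¬ P`. A move that changes the mode arrives in the opposite mode, where acceptance
means the negation; this explains the condition on `y.1`. -/
theorem DecidesTape.step {p : Prog ι} {e : ι ≃ Fin (n + 1)} {k : List (Prog ι)}
    (hh : ¬ Halting k) {τ : ι → Turing.Tape (Option Tok)} {P : Prop} {T a : ℕ}
    (P' : Move ι → Prop)
    (hP : P ↔ ∀ y ∈ succ (fun j => (τ j).head) k, if y.1 then ¬ P' y else P' y)
    (h : ∀ y ∈ succ (fun j => (τ j).head) k, ∃ a', a' + y.1.toNat ≤ a ∧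
      DecidesTape p e y.2.1 (fun j => ATM.update (τ j) (y.2.2 j)) (P' y) T a') :
    DecidesTape p e k τ P (T + 1) a := by
  intro hk mode
  have hkind : (p.toATM e).kind (cfg p e mode ⟨k, hk⟩ τ).state =
      if mode then .universal else .existential := kind_of_not_halting hh mode
  refine ⟨?_, ?_⟩
  · cases mode with
    | true =>
      rw [ATM.acceptingCfg_universal hkind, if_pos rfl, hP]
      constructor
      · intro H y hy
        obtain ⟨a', -, h1⟩ := h y hy
        have h2 := H _ ((step_cfg_iff p e hh hk true τ _).2 ⟨y, hy, rfl⟩)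
        rw [(h1 _ _).1] at h2
        cases hb : y.1 <;> simpa [hb] using h2
      · intro H d hd
        obtain ⟨y, hy, rfl⟩ := (step_cfg_iff p e hh hk true τ _).1 hd
        obtain ⟨a', -, h1⟩ := h y hy
        rw [(h1 _ _).1]
        have := H y hy
        cases hb : y.1 <;> simpa [hb] using this
    | false =>
      rw [ATM.acceptingCfg_existential hkind, if_neg (by simp), hP]
      push Not
      constructor
      · rintro ⟨d, hd, H⟩
        obtain ⟨y, hy, rfl⟩ := (step_cfg_iff p e hh hk false τ _).1 hd
        obtain ⟨a', -, h1⟩ := h y hy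
        rw [(h1 _ _).1] at H
        refine ⟨y, hy, ?_⟩
        cases hb : y.1 <;> simpa [hb] using H
      · rintro ⟨y, hy, H⟩
        obtain ⟨a', -, h1⟩ := h y hy
        refine ⟨_, (step_cfg_iff p e hh hk false τ _).2 ⟨y, hy, rfl⟩, ?_⟩
        rw [(h1 _ _).1]
        cases hb : y.1 <;> simpa [hb] using H
  · intro l hl
    cases l with
    | nil => simp [ATM.alternations]
    | cons d l =>
      rw [List.isChain_cons_cons] at hl
      obtain ⟨y, hy, rfl⟩ := (step_cfg_iff p e hh hk mode τ _).1 hl.1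
      obtain ⟨a', ha', h1⟩ := h y hy
      obtain ⟨h2, h3⟩ := (h1 (succ_mem_states hk hy) (mode ^^ y.1)).2 l hl.2
      refine ⟨by simpa using h2, ?_⟩
      rw [ATM.alternations]
      have h4 : ATM.switch ((p.toATM e).kind (cfg p e mode ⟨k, hk⟩ τ).state)
          ((p.toATM e).kind (cfg p e (mode ^^ y.1) ⟨y.2.1, succ_mem_states hk hy⟩
            (fun j => ATM.update (τ j) (y.2.2 j))).state) ≤ y.1.toNat := by
        cases hb : y.1 with
        | false =>
          have := switch_kind hh mode y.2.1
          simp only [Bool.xor_false, Bool.toNat_false, Nat.le_zero]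
          exact this
        | true => exact ATM.switch_le _ _
      omega

theorem DecidesTape.verdict {p : Prog ι} {e : ι ≃ Fin (n + 1)} (b : Bool) (k : List (Prog ι))
    (τ : ι → Turing.Tape (Option Tok)) (T a : ℕ) :
    DecidesTape p e (verdict b :: k) τ (b = true) T a := by
  intro hk mode
  have hkind : (p.toATM e).kind (cfg p e mode ⟨_, hk⟩ τ).state =
      if b = mode then .accepting else .rejecting := rfl
  refine ⟨?_, ?_⟩
  · have h : (p.toATM e).AcceptingCfg (cfg p e mode ⟨_, hk⟩ τ) ↔ b = mode := by
      constructor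
      · intro h
        by_contra hb
        rw [if_neg hb] at hkind
        cases h with
        | accepting _ h' => rw [hkind] at h'; cases h'
        | existential _ _ h' => rw [hkind] at h'; cases h'
        | universal _ h' => rw [hkind] at h'; cases h'
      · intro hb
        rw [if_pos hb] at hkind
        exact .accepting _ hkind
    rw [h]
    cases b <;> cases mode <;> simp
  · intro l hl
    cases l with
    | nil => simp [ATM.alternations]
    | cons d l =>
      rw [List.isChain_cons_cons] at hl
      obtain ⟨h1, -⟩ := hl.1
      rw [hkind] at h1
      split at h1 <;> simp at h1

theorem DecidesTape.mono {p : Prog ι} {e : ι ≃ Fin (n + 1)} {k : List (Prog ι)}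
    {τ : ι → Turing.Tape (Option Tok)} {P P' : Prop} {T T' a a' : ℕ}
    (h : DecidesTape p e k τ P T a) (hP : P' ↔ P) (hT : T ≤ T') (ha : a ≤ a') :
    DecidesTape p e k τ P' T' a' := by
  intro hk mode
  obtain ⟨h1, h2⟩ := h hk mode
  refine ⟨by rw [h1, hP], fun l hl => ?_⟩
  obtain ⟨h3, h4⟩ := h2 l hl
  exact ⟨h3.trans hT, h4.trans ha⟩

/-- The tape that holds a stack, with the head on the topmost token. -/
def tape (l : List Tok) : Turing.Tape (Option Tok) := Turing.Tape.mk₁ (l.map some)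

theorem head_tape (l : List Tok) : (tape l).head = l.head? := by
  cases l <;> rfl

theorem update_idle (t : Turing.Tape (Option Tok)) : ATM.update t (t.head, none) = t :=
  Turing.Tape.write_self t

theorem update_pop (l : List Tok) : ATM.update (tape l) (none, some .right) = tape l.tail := by
  -- The cell left behind is erased, so the part to the left of the head is again entirely blank.
  have hblank : Turing.ListBlank.cons (none : Option Tok) (Turing.ListBlank.mk []) =
      Turing.ListBlank.mk [] := by
    rw [Turing.ListBlank.cons_mk]
    exact Quotient.sound' (Or.inr ⟨1, rfl⟩)
  cases l with
  | nil =>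
    change (Turing.Tape.mk _ (Turing.ListBlank.cons _ (Turing.ListBlank.mk [])) _ :
      Turing.Tape (Option Tok)) = Turing.Tape.mk _ (Turing.ListBlank.mk []) _
    rw [hblank]
    rfl
  | cons x l =>
    change (Turing.Tape.mk _ (Turing.ListBlank.cons _ (Turing.ListBlank.mk [])) _ :
      Turing.Tape (Option Tok)) = Turing.Tape.mk _ (Turing.ListBlank.mk []) _
    rw [hblank]
    cases l <;> rfl

theorem update_push (l : List Tok) (t : Tok) :
    ATM.update (ATM.update (tape l) ((tape l).head, some .left)) (some t, none) =
      tape (t :: l) := by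
  have h : ATM.update (tape l) ((tape l).head, some .left) = (tape l).move .left := by
    change ((tape l).write (tape l).head).move .left = _
    rw [Turing.Tape.write_self]
  rw [h]
  change (Turing.Tape.mk (some t) (Turing.ListBlank.tail (Turing.ListBlank.mk []))
    (Turing.ListBlank.cons (tape l).head (tape l).right)) = Turing.Tape.mk _ _ _
  congr 1
  cases l with
  | nil => exact Quotient.sound' (Or.inr ⟨1, rfl⟩)
  | cons x l => rfl

/-- In control state `k` with stacks `s`, the machine decides the truth of `P` in at most `T` steps
with at most `a` alternations. -/
def Decides (k : List (Prog ι)) (s : ι → List Tok) (P : Prop) (T a : ℕ) : Prop :=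
  DecidesTape p e k (fun i => tape (s i)) P T a

namespace Decides

variable {p : Prog ι} {e : ι ≃ Fin (n + 1)} {k : List (Prog ι)} {s : ι → List Tok}
  {P P' : Prop} {T T' a a' : ℕ}

theorem mono (h : Decides p e k s P T a) (hP : P' ↔ P) (hT : T ≤ T') (ha : a ≤ a') :
    Decides p e k s P' T' a' :=
  DecidesTape.mono h hP hT ha

theorem verdict (b : Bool) (k : List (Prog ι)) (s : ι → List Tok) (T a : ℕ) :
    Decides p e (.verdict b :: k) s (b = true) T a :=
  DecidesTape.verdict b k _ T a

theorem idle (s : ι → List Tok) :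
    (fun j => ATM.update (tape (s j)) ((fun j => ((tape (s j)).head, none)) j)) =
      fun j => tape (s j) := by
  funext j
  exact update_idle _

theorem of_succ_idle (k k' : List (Prog ι)) (hh : ¬ Halting k)
    (hs : succ (fun j => (tape (s j)).head) k =
      {(false, k', fun j => ((tape (s j)).head, none))})
    (h : Decides p e k' s P T a) : Decides p e k s P (T + 1) a := by
  refine DecidesTape.step hh (fun _ => P) (by rw [hs]; simp) fun y hy => ?_
  rw [hs, Set.mem_singleton_iff] at hy
  subst hy
  refine ⟨a, le_rfl, ?_⟩
  rw [idle]
  exact h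

theorem skip (h : Decides p e k s P T a) : Decides p e (.skip :: k) s P (T + 1) a :=
  of_succ_idle _ k id rfl h

theorem seq {q r : Prog ι} (h : Decides p e (q :: r :: k) s P T a) :
    Decides p e (.seq q r :: k) s P (T + 1) a :=
  of_succ_idle _ _ id rfl h

theorem br {i : ι} {f : Option Tok → Prog ι} (h : Decides p e (f (s i).head? :: k) s P T a) :
    Decides p e (.br i f :: k) s P (T + 1) a :=
  of_succ_idle _ _ id (by simp only [succ, head_tape]) h

theorem wh_true {i : ι} {c : Option Tok → Bool} {q : Prog ι} (hc : c (s i).head? = true)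
    (h : Decides p e (q :: .wh i c q :: k) s P T a) :
    Decides p e (.wh i c q :: k) s P (T + 1) a :=
  of_succ_idle _ _ id (by simp only [succ, head_tape]; rw [if_pos hc]) h

theorem wh_false {i : ι} {c : Option Tok → Bool} {q : Prog ι} (hc : c (s i).head? = false)
    (h : Decides p e k s P T a) : Decides p e (.wh i c q :: k) s P (T + 1) a :=
  of_succ_idle _ _ id (by simp only [succ, head_tape]; rw [if_neg (by simp [hc])]) h

theorem pop {i : ι} (h : Decides p e k (Function.update s i (s i).tail) P T a) :
    Decides p e (.pop i :: k) s P (T + 1) a := by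
  refine DecidesTape.step id (fun _ => P) (by simp [succ]) fun y hy => ?_
  simp only [succ, Set.mem_singleton_iff] at hy
  subst hy
  refine ⟨a, le_rfl, ?_⟩
  refine (congrArg (fun τ => DecidesTape p e k τ P T a) (funext fun j => ?_)).mp h
  by_cases hj : j = i
  · subst hj
    simp [update_pop]
  · simp [hj, update_idle]

theorem push {i : ι} {t : Tok} (h : Decides p e k (Function.update s i (t :: s i)) P T a) :
    Decides p e (.push i t :: k) s P (T + 2) a := by
  refine DecidesTape.step (T := T + 1) id (fun _ => P) (by simp [succ]) fun y hy => ?_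
  simp only [succ, Set.mem_singleton_iff] at hy
  subst hy
  refine ⟨a, le_rfl, ?_⟩
  refine DecidesTape.step (T := T) id (fun _ => P) (by simp [succ]) fun y hy => ?_
  simp only [succ, Set.mem_singleton_iff] at hy
  subst hy
  refine ⟨a, le_rfl, ?_⟩
  refine (congrArg (fun τ => DecidesTape p e k τ P T a) (funext fun j => ?_)).mp h
  by_cases hj : j = i
  · subst hj
    simp [update_push]
  · simp [hj, update_idle]

/-- This is a conjunction in both modes: in existential mode, the machine accepts if one of the
conjuncts fails. -/
theorem fork {q r : Prog ι} (h : Decides p e (q :: k) s P T a)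
    (h' : Decides p e (r :: k) s P' T a) :
    Decides p e (.fork q r :: k) s (P ∧ P') (T + 2) a := by
  -- The `skip` before the second branch gives the two control states different lengths, so that
  -- they can be told apart even if `q = r`.
  refine DecidesTape.step (T := T + 1) id
    (fun y => (y.2.1 = q :: k → P) ∧ (y.2.1 = .skip :: r :: k → P')) ?_ fun y hy => ?_
  · simp [succ]
  · simp only [succ, Set.mem_insert_iff, Set.mem_singleton_iff] at hy
    rcases hy with rfl | rfl
    · refine ⟨a, le_rfl, ?_⟩
      rw [idle]
      exact DecidesTape.mono h (by simp) (by omega) le_rfl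
    · refine ⟨a, le_rfl, ?_⟩
      rw [idle]
      exact DecidesTape.mono (Decides.skip h') (by simp) le_rfl le_rfl

/-- Apart from `flip`, no instruction changes the mode, so alternations are counted here only. -/
theorem flip (h : Decides p e k s P T a) : Decides p e (.flip :: k) s (¬ P) (T + 1) (a + 1) := by
  refine DecidesTape.step id (fun _ => P) (by simp [succ]) fun y hy => ?_
  simp only [succ, Set.mem_singleton_iff] at hy
  subst hy
  refine ⟨a, le_rfl, ?_⟩
  rw [idle]
  exact h

end Decides

end Prog

/-! ## Subroutines -/

namespace Prog

open Function

variable {ι : Type} [DecidableEq ι] {n : ℕ} {p : Prog ι} {e : ι ≃ Fin (n + 1)}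
  {k : List (Prog ι)} {s : ι → List Tok} {P P' : Prop} {T T' a a' : ℕ}

theorem correct_of_decides {i₀ : ι} (he : e i₀ = 0) {w : List Tok}
    (h : Decides p e [p] (fun i => if i = i₀ then w else []) P T a) :
    ((p.toATM e).Accepts w ↔ P) ∧ (p.toATM e).TimeBound w T ∧
      (p.toATM e).AlternationBound w a := by
  have hc : (p.toATM e).initCfg w = cfg p e true ⟨[p], Or.inr (self_mem_reach p [])⟩
      (fun i => tape (if i = i₀ then w else [])) := by
    unfold ATM.initCfg cfg
    congr 1
    funext i
    by_cases hi : i = 0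
    · subst hi
      have : e.symm 0 = i₀ := by rw [← he, Equiv.symm_apply_apply]
      rw [if_pos rfl]
      change Turing.Tape.mk₁ (w.map some) = tape (if e.symm 0 = i₀ then w else [])
      rw [if_pos this, tape]
    · have : e.symm i ≠ i₀ := by
        rintro h'
        apply hi
        rw [← h'] at he
        exact (Equiv.apply_symm_apply e i).symm.trans he
      rw [if_neg hi]
      change Turing.Tape.mk₁ [] = tape (if e.symm i = i₀ then w else [])
      rw [if_neg this, tape]
      rfl
  obtain ⟨h1, h2⟩ := h (Or.inr (self_mem_reach p [])) true
  refine ⟨?_, fun l hl => ?_, fun l hl => ?_⟩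
  · unfold ATM.Accepts
    rw [hc]
    simpa using h1
  · rw [hc] at hl
    exact (h2 l hl).1
  · rw [hc] at hl ⊢
    exact (h2 l hl).2

namespace Decides

theorem br_of {i : ι} {f : Option Tok → Prog ι} (o : Option Tok) (ho : (s i).head? = o)
    (h : Decides p e (f o :: k) s P T a) : Decides p e (.br i f :: k) s P (T + 1) a :=
  br (ho ▸ h)

theorem br_cons {i : ι} {f : Option Tok → Prog ι} (t : Tok) {l : List Tok} (ho : s i = t :: l)
    (h : Decides p e (f (some t) :: k) s P T a) : Decides p e (.br i f :: k) s P (T + 1) a :=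
  br_of (some t) (by simp [ho]) h

theorem congr (hP : P' ↔ P) (h : Decides p e k s P T a) : Decides p e k s P' T a :=
  h.mono hP le_rfl le_rfl

theorem le (h : Decides p e k s P T a) (hT : T ≤ T') : Decides p e k s P T' a :=
  h.mono Iff.rfl hT le_rfl

theorem reject (hP : ¬ P) : Decides p e (.verdict false :: k) s P T a :=
  (verdict false k s T a).congr (by simp [hP])

theorem accept (hP : P) : Decides p e (.verdict true :: k) s P T a :=
  (verdict true k s T a).congr (by simp [hP])

end Decides

open Decides

/-- Test for the given token. -/
def isTok (t : Tok) (o : Option Tok) : Bool := o == some t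

/-- Move the contents of stack `i` to stack `j`. -/
def pour (i j : ι) : Prog ι :=
  wh i Option.isSome <| br i fun
    | some t => seq (push j t) (pop i)
    | none => skip

theorem Decides.pour {i j : ι} (hij : i ≠ j)
    (h : Decides p e k (update (update s i []) j ((s i).reverse ++ s j)) P T a) :
    Decides p e (pour i j :: k) s P (T + 6 * (s i).length + 1) a := by
  generalize hl : s i = l
  rw [hl] at h
  induction l generalizing s with
  | nil =>
    rw [← hl, update_eq_self, hl] at h
    simp only [List.reverse_nil, List.nil_append, update_eq_self] at h
    exact wh_false (by simp [hl]) h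
  | cons t l ih =>
    have := ih (s := update (update s j (t :: s j)) i l)
      (by simpa [hij.symm, update_comm hij] using h) (by simp)
    refine (wh_true (by simp [hl]) (br_cons t hl (seq (push (Decides.pop (T := _) ?_))))).le
      (T := T + 6 * l.length + 1 + 6) (by simp; omega)
    rw [update_of_ne hij, hl]
    exact this

/-- Move the contents of stack `i` to stacks `j` and `l`. -/
def pourTwo (i j l : ι) : Prog ι :=
  wh i Option.isSome <| br i fun
    | some t => seq (push j t) (seq (push l t) (pop i))
    | none => skip

theorem Decides.pourTwo {i j l : ι} (hij : i ≠ j) (hil : i ≠ l) (hjl : j ≠ l)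
    (h : Decides p e k (update (update (update s i []) j ((s i).reverse ++ s j)) l
      ((s i).reverse ++ s l)) P T a) :
    Decides p e (pourTwo i j l :: k) s P (T + 9 * (s i).length + 1) a := by
  generalize hm : s i = m
  rw [hm] at h
  induction m generalizing s with
  | nil =>
    rw [← hm, update_eq_self, hm] at h
    simp only [List.reverse_nil, List.nil_append, update_eq_self] at h
    exact wh_false (by simp [hm]) h
  | cons t m ih =>
    have := ih (s := update (update (update s j (t :: s j)) l (t :: s l)) i m)
      (by simpa [hij.symm, hil.symm, hjl.symm, hjl, update_comm hij, update_comm hil,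
        update_comm hjl] using h) (by simp)
    refine (wh_true (by simp [hm]) (br_cons t hm (seq (push (seq (push (Decides.pop
      (T := _) ?_))))))).le (T := T + 9 * m.length + 1 + 9) (by simp; omega)
    rw [update_of_ne hil, update_of_ne hij, hm, update_of_ne hjl.symm]
    exact this

/-- Copy stack `i` to stack `j`, with auxiliary stack `l`. -/
def dup (i l j : ι) : Prog ι := seq (pour i l) (pourTwo l i j)

theorem Decides.dup {i j l : ι} (hij : i ≠ j) (hil : i ≠ l) (hjl : j ≠ l) (hl : s l = [])
    (h : Decides p e k (update s j (s i ++ s j)) P T a) :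
    Decides p e (dup i l j :: k) s P (T + 15 * (s i).length + 3) a := by
  refine (seq (Decides.pour hil (Decides.pourTwo hil.symm hjl.symm hij (T := T) ?_))).le ?_
  · convert h using 1
    funext x
    by_cases hxi : x = i
    · subst hxi; simp [hij, hil, hl]
    by_cases hxj : x = j
    · subst hxj; simp [hjl, hij.symm, hl]
    by_cases hxl : x = l
    · subst hxl; simp [hjl.symm, hil.symm, hl]
    simp [hxi, hxj, hxl]
  · simp [hl]; omega

/-- Write a token on the stack `o`, if any. -/
def emit (o : Option ι) (t : Tok) : Prog ι :=
  match o with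
  | some j => push j t
  | none => skip

/-- The effect of writing a list of tokens one after the other on the stack `o`, if any. -/
def emits (o : Option ι) (l : List Tok) (s : ι → List Tok) : ι → List Tok :=
  match o with
  | some j => update s j (l.reverse ++ s j)
  | none => s

@[simp] theorem emits_none (l : List Tok) (s : ι → List Tok) : emits none l s = s := rfl

@[simp] theorem emits_some (j : ι) (l : List Tok) (s : ι → List Tok) :
    emits (some j) l s = update s j (l.reverse ++ s j) := rfl

theorem emits_apply_of_ne {o : Option ι} {i : ι} (h : o ≠ some i) (l : List Tok) :
    emits o l s i = s i := by
  cases o with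
  | none => rfl
  | some j =>
    have : i ≠ j := fun h' => h (h' ▸ rfl)
    simp [this]

theorem update_emits {o : Option ι} {i : ι} (h : o ≠ some i) (l r : List Tok) :
    update (emits o l s) i r = emits o l (update s i r) := by
  cases o with
  | none => rfl
  | some j =>
    have : i ≠ j := fun h' => h (h' ▸ rfl)
    simp [this.symm, update_comm this]

theorem emits_emits (o : Option ι) (l l' : List Tok) :
    emits o l (emits o l' s) = emits o (l' ++ l) s := by
  cases o <;> simp

theorem emits_nil (o : Option ι) : emits o [] s = s := by
  cases o <;> simp

theorem Decides.emit {o : Option ι} {t : Tok} (h : Decides p e k (emits o [t] s) P T a) :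
    Decides p e (emit o t :: k) s P (T + 2) a := by
  cases o with
  | none => exact (Decides.skip h).le (by omega)
  | some j => exact push h

/-- Read the code of a number from stack `i`, and write it on the stack `o`. -/
def mvNat (i : ι) (o : Option ι) : Prog ι :=
  seq (wh i (isTok .one) (seq (pop i) (emit o .one))) <| br i fun
    | some .endNum => seq (pop i) (emit o .endNum)
    | _ => verdict false

theorem codeNat_zero : codeNat 0 = [.endNum] := rfl

theorem codeNat_succ (x : ℕ) : codeNat (x + 1) = .one :: codeNat x := by
  simp [codeNat, List.replicate_succ]

/-- The end marker makes the code prefix-free. Unique readability of all other codes builds on this.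
-/
theorem codeNat_append_inj {x y : ℕ} {r r' : List Tok} :
    codeNat x ++ r = codeNat y ++ r' ↔ x = y ∧ r = r' := by
  induction x generalizing y with
  | zero => cases y <;> simp [codeNat_zero, codeNat_succ]
  | succ x ih => cases y <;> simp [codeNat_zero, codeNat_succ, ih]

theorem length_codeNat (x : ℕ) : (codeNat x).length = x + 1 := by simp [codeNat]

/-- If the stack does not start with a code, the program rejects and the existential statement is
false. Otherwise `x` and `r` are unique, and deciding `P x r` decides the existential statement. -/
theorem Decides.mvNat {i : ι} {o : Option ι} (hi : o ≠ some i) {P : ℕ → List Tok → Prop}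
    (h : ∀ x r, s i = codeNat x ++ r →
      Decides p e k (emits o (codeNat x) (update s i r)) (P x r) T a) :
    Decides p e (mvNat i o :: k) s (∃ x r, s i = codeNat x ++ r ∧ P x r)
      (T + 5 * (s i).length + 7) a := by
  refine (seq (T := T + 5 * (s i).length + 6) ?_).le (by omega)
  generalize hl : s i = l
  induction l generalizing s P with
  | nil =>
    refine (wh_false (by simp [hl, isTok]) (br_of none (by simp [hl])
      (reject (T := 0) ?_))).le (by omega)
    rintro ⟨x, r, h1, -⟩
    cases x <;> simp [codeNat_zero, codeNat_succ] at h1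
  | cons t l ih =>
    by_cases ht : t = .one
    · subst ht
      have := ih (s := emits o [.one] (update s i l)) (P := fun x r => P (x + 1) r) ?_ ?_
      · refine ((wh_true (by simp [hl, isTok]) (seq (Decides.pop (Decides.emit (T := _) ?_)))).congr
          (P := ∃ x r, l = codeNat x ++ r ∧ P (x + 1) r) ?_).le (T := T + 5 * l.length + 6 + 5) ?_
        · rw [hl]
          exact this
        · constructor
          · rintro ⟨x, r, h1, h2⟩
            cases x with
            | zero => simp [codeNat_zero] at h1
            | succ x =>
              rw [codeNat_succ, List.cons_append, List.cons_inj_right] at h1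
              exact ⟨x, r, h1, h2⟩
          · rintro ⟨x, r, h1, h2⟩
            exact ⟨x + 1, r, by rw [codeNat_succ, h1]; rfl, h2⟩
        · simp; omega
      · intro x r hx
        rw [emits_apply_of_ne hi, update_self] at hx
        have := h (x + 1) r (by rw [hl, hx, codeNat_succ]; rfl)
        rw [update_emits hi, update_idem, emits_emits]
        rwa [codeNat_succ] at this
      · rw [emits_apply_of_ne hi, update_self]
    · refine (wh_false (T := T + 5) (by simp [hl, isTok, ht]) ?_).le (by omega)
      by_cases ht' : t = .endNum
      · subst ht'
        refine (br_cons _ hl (seq (Decides.pop (Decides.emit ((h 0 l (by simp [hl, codeNat_zero])) |>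
          fun h => ?_))))).congr (P := P 0 l) ?_
        · rw [hl]
          exact h
        · constructor
          · rintro ⟨x, r, h1, h2⟩
            have := (codeNat_append_inj (x := 0) (r := l)).1 h1
            rwa [this.1, this.2]
          · intro h
            exact ⟨0, l, rfl, h⟩
      · refine (br_cons t hl (k := k) (T := 0) ?_).le (by omega)
        have : ¬ ∃ x r, t :: l = codeNat x ++ r ∧ P x r := by
          rintro ⟨x, r, h1, -⟩
          cases x <;> simp_all [codeNat_zero, codeNat_succ]
        split
        · simp_all
        · exact reject this

theorem Decides.mvNat_of {i : ι} {o : Option ι} (hi : o ≠ some i) {x : ℕ} {r : List Tok}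
    (hs : s i = codeNat x ++ r)
    (h : Decides p e k (emits o (codeNat x) (update s i r)) P T a) :
    Decides p e (Prog.mvNat i o :: k) s P (T + 5 * (s i).length + 7) a := by
  refine (Decides.mvNat hi (P := fun _ _ => P) fun x' r' h' => ?_).congr ?_
  · rw [hs, codeNat_append_inj] at h'
    rw [← h'.1, ← h'.2]
    exact h
  · exact ⟨fun h => ⟨x, r, hs, h⟩, fun ⟨_, _, _, h⟩ => h⟩

/-- The code of a transition between numbered states. -/
def codeRaw (δ : PDTransition ℕ ℕ) : List Tok :=
  codeNat δ.src ++ codeNat δ.top ++ codeNat δ.dst ++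
    match δ.op with
    | .push b => .push :: codeNat b
    | .pop => [.pop]

theorem codeRaw_push (q x q' b : ℕ) (r : List Tok) : codeRaw ⟨q, x, q', .push b⟩ ++ r =
    codeNat q ++ (codeNat x ++ (codeNat q' ++ .push :: (codeNat b ++ r))) := by
  simp [codeRaw]

theorem codeRaw_pop (q x q' : ℕ) (r : List Tok) : codeRaw ⟨q, x, q', .pop⟩ ++ r =
    codeNat q ++ (codeNat x ++ (codeNat q' ++ .pop :: r)) := by
  simp [codeRaw]

theorem codeRaw_append_inj {δ δ' : PDTransition ℕ ℕ} {r r' : List Tok} :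
    codeRaw δ ++ r = codeRaw δ' ++ r' ↔ δ = δ' ∧ r = r' := by
  obtain ⟨q, x, q', o⟩ := δ
  obtain ⟨q₁, x₁, q₁', o₁⟩ := δ'
  cases o <;> cases o₁ <;>
    simp [codeRaw_push, codeRaw_pop, codeNat_append_inj, and_assoc]

/-- Read the code of a transition from stack `i`, and write it on the stack `o`. -/
def mvTr (i : ι) (o : Option ι) : Prog ι :=
  seq (mvNat i o) <| seq (mvNat i o) <| seq (mvNat i o) <| br i fun
    | some .push => seq (pop i) (seq (emit o .push) (mvNat i o))
    | some .pop => seq (pop i) (emit o .pop)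
    | _ => verdict false

theorem Decides.mvTr {i : ι} {o : Option ι} (hi : o ≠ some i)
    {P : PDTransition ℕ ℕ → List Tok → Prop}
    (h : ∀ δ r, s i = codeRaw δ ++ r →
      Decides p e k (emits o (codeRaw δ) (update s i r)) (P δ r) T a) :
    Decides p e (mvTr i o :: k) s (∃ δ r, s i = codeRaw δ ++ r ∧ P δ r)
      (T + 20 * (s i).length + 40) a := by
  -- The property is unfolded field by field, in the order in which the fields are read.
  have key : Decides p e (Prog.mvTr i o :: k) s
      (∃ q r₁, s i = codeNat q ++ r₁ ∧ ∃ x r₂, r₁ = codeNat x ++ r₂ ∧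
        ∃ q' r₃, r₂ = codeNat q' ++ r₃ ∧ ((∃ b r₄, r₃ = .push :: (codeNat b ++ r₄) ∧
          P ⟨q, x, q', .push b⟩ r₄) ∨ ∃ r₄, r₃ = .pop :: r₄ ∧ P ⟨q, x, q', .pop⟩ r₄))
      (T + 5 * (s i).length + 12 + 5 * (s i).length + 7 + 1 + 5 * (s i).length + 7 + 1 +
        5 * (s i).length + 7 + 1) a := by
    refine seq (Decides.mvNat hi fun q r₁ h₁ => seq ?_)
    refine Decides.le (T := _) (Decides.mvNat hi (s := emits o (codeNat q) (update s i r₁))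
      (P := fun x r₂ => ∃ q' r₃, r₂ = codeNat q' ++ r₃ ∧ ((∃ b r₄, r₃ = .push :: (codeNat b ++ r₄) ∧
          P ⟨q, x, q', .push b⟩ r₄) ∨ ∃ r₄, r₃ = .pop :: r₄ ∧ P ⟨q, x, q', .pop⟩ r₄))
      (T := T + 5 * (s i).length + 12 + 5 * (s i).length + 7 + 1)
      fun x r₂ h₂ => ?_) ?_ |>.congr ?_
    · refine Decides.le (seq (Decides.mvNat hi (P := fun q' r₃ =>
        ((∃ b r₄, r₃ = .push :: (codeNat b ++ r₄) ∧
          P ⟨q, x, q', .push b⟩ r₄) ∨ ∃ r₄, r₃ = .pop :: r₄ ∧ P ⟨q, x, q', .pop⟩ r₄))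
        (T := T + 5 * (s i).length + 12) fun q' r₃ h₃ => ?_)) ?_ |>.congr ?_
      · rw [emits_apply_of_ne hi, update_self] at h₂
        rw [emits_apply_of_ne hi, update_self] at h₃
        subst h₂ h₃
        simp only [update_emits hi, update_idem, emits_emits]
        set s' := emits o ((codeNat q ++ codeNat x) ++ codeNat q') (update s i r₃) with hs'
        have hs'i : s' i = r₃ := by rw [hs', emits_apply_of_ne hi, update_self]
        rcases r₃ with _ | ⟨t, r₃⟩
        · refine (br_of none (by simp [hs'i]) (reject (T := 0) (by simp))).le (by omega)
        · by_cases hp : t = .push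
          · subst hp
            refine (br_cons _ hs'i (seq (Decides.pop (seq (Decides.emit (Decides.mvNat hi
              (P := fun b r₄ => P ⟨q, x, q', .push b⟩ r₄) (T := T) fun b r₄ h₄ => ?_)))))).congr
              ?_ |>.le ?_
            · rw [emits_apply_of_ne hi, update_self, hs'i] at h₄
              simp only [List.tail_cons] at h₄
              subst h₄
              have := h ⟨q, x, q', .push b⟩ r₄ (by rw [h₁, codeRaw_push])
              simp only [hs', update_emits hi, update_idem, emits_emits]
              have hc : codeRaw ⟨q, x, q', .push b⟩ =
                codeNat q ++ codeNat x ++ codeNat q' ++ [.push] ++ codeNat b := by simp [codeRaw]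
              rw [hc] at this
              exact this
            · rw [emits_apply_of_ne hi, update_self, hs'i]
              simp
            · rw [emits_apply_of_ne hi, update_self, hs'i, h₁]
              simp
              omega
          · by_cases hp' : t = .pop
            · subst hp'
              refine ((br_cons _ hs'i (seq (Decides.pop (Decides.emit (T := T) ?_)))).congr
                (P := P ⟨q, x, q', .pop⟩ r₃) ?_).le (by omega)
              · rw [hs'i]
                have := h ⟨q, x, q', .pop⟩ r₃ (by rw [h₁, codeRaw_pop])
                simp only [hs', update_emits hi, update_idem, emits_emits]
                have hc : codeRaw ⟨q, x, q', .pop⟩ =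
                  codeNat q ++ codeNat x ++ codeNat q' ++ [.pop] := by simp [codeRaw]
                rw [hc] at this
                exact this
              · simp
            · refine (br_cons t hs'i (k := k) (T := 0) ?_).le (by omega)
              split
              · simp_all
              · simp_all
              · exact reject (by simp [hp, hp'])
      · rw [emits_apply_of_ne hi, update_self] at h₂
        simp only [emits_apply_of_ne hi, update_self]
        rw [h₁, h₂]
        simp
        omega
      · simp only [emits_apply_of_ne hi, update_self]
    · simp only [emits_apply_of_ne hi, update_self]
      rw [h₁]
      simp
    · simp only [emits_apply_of_ne hi, update_self]
  refine (key.congr ?_).le (by omega)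
  constructor
  · rintro ⟨⟨q, x, q', b | _⟩, r, h1, h2⟩
    · rw [codeRaw_push] at h1
      exact ⟨q, _, h1, x, _, rfl, q', _, rfl, .inl ⟨b, r, rfl, h2⟩⟩
    · rw [codeRaw_pop] at h1
      exact ⟨q, _, h1, x, _, rfl, q', _, rfl, .inr ⟨r, rfl, h2⟩⟩
  · rintro ⟨q, _, h1, x, _, rfl, q', _, rfl, ⟨b, r, rfl, h2⟩ | ⟨r, rfl, h2⟩⟩
    · exact ⟨⟨q, x, q', .push b⟩, r, by rw [h1, codeRaw_push], h2⟩
    · exact ⟨⟨q, x, q', .pop⟩, r, by rw [h1, codeRaw_pop], h2⟩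

theorem Decides.mvTr_of {i : ι} {o : Option ι} (hi : o ≠ some i) {δ : PDTransition ℕ ℕ}
    {r : List Tok} (hs : s i = codeRaw δ ++ r)
    (h : Decides p e k (emits o (codeRaw δ) (update s i r)) P T a) :
    Decides p e (Prog.mvTr i o :: k) s P (T + 20 * (s i).length + 40) a := by
  refine (Decides.mvTr hi (P := fun _ _ => P) fun δ' r' h' => ?_).congr ?_
  · rw [hs, codeRaw_append_inj] at h'
    rw [← h'.1, ← h'.2]
    exact h
  · exact ⟨fun h => ⟨δ, r, hs, h⟩, fun ⟨_, _, _, h⟩ => h⟩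

end Prog

/-! ### Codes of lists of transitions and of formulas. -/

namespace Prog

open Function Decides

variable {ι : Type} [DecidableEq ι] {n : ℕ} {p : Prog ι} {e : ι ≃ Fin (n + 1)}
  {k : List (Prog ι)} {s : ι → List Tok} {P P' : Prop} {T T' a a' : ℕ}

/-- The code of a list of transitions. -/
def codeRun (x : List (PDTransition ℕ ℕ)) : List Tok := x.flatMap fun δ => .item :: codeRaw δ

@[simp] theorem codeRun_nil : codeRun [] = [] := rfl

theorem codeRun_cons (δ : PDTransition ℕ ℕ) (x : List (PDTransition ℕ ℕ)) (r : List Tok) :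
    codeRun (δ :: x) ++ r = .item :: (codeRaw δ ++ (codeRun x ++ r)) := by
  simp [codeRun]

/-- The code of a list has no end marker; it ends where the next token is not `.item`. -/
theorem codeRun_append_inj {x y : List (PDTransition ℕ ℕ)} {r r' : List Tok}
    (hr : r.head? ≠ some .item) (hr' : r'.head? ≠ some .item) :
    codeRun x ++ r = codeRun y ++ r' ↔ x = y ∧ r = r' := by
  induction x generalizing y with
  | nil =>
    cases y with
    | nil => simp
    | cons δ y =>
      rw [codeRun_cons]
      simp only [codeRun_nil, List.nil_append, reduceCtorEq, false_and, iff_false]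
      rintro rfl
      simp at hr
  | cons δ x ih =>
    cases y with
    | nil =>
      rw [codeRun_cons]
      simp only [codeRun_nil, List.nil_append, reduceCtorEq, false_and, iff_false]
      rintro rfl
      simp at hr'
    | cons δ' y => rw [codeRun_cons, codeRun_cons, List.cons_inj_right, codeRaw_append_inj, ih]; simp [and_assoc]

theorem codeRun_inj {x y : List (PDTransition ℕ ℕ)} : codeRun x = codeRun y ↔ x = y := by
  have := codeRun_append_inj (x := x) (y := y) (r := []) (r' := []) (by simp) (by simp)
  simpa using this

/-- Read the code of a list of transitions from stack `i`, and write it on the stack `o`. -/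
def mvRun (i : ι) (o : Option ι) : Prog ι :=
  wh i (isTok .item) <| seq (pop i) (seq (emit o .item) (mvTr i o))

/-- The bound `L` is kept apart from the current length, so that in the induction every item costs
the same. -/
theorem Decides.mvRun {i : ι} {o : Option ι} (hi : o ≠ some i) {L : ℕ} (hL : (s i).length ≤ L)
    (h : ∀ x r, s i = codeRun x ++ r → r.head? ≠ some .item →
      Decides p e k (emits o (codeRun x) (update s i r)) P T a) :
    Decides p e (mvRun i o :: k) s ((∃ x r, s i = codeRun x ++ r ∧ r.head? ≠ some .item) ∧ P)
      (T + (s i).length * (20 * L + 50) + 1) a := by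
  induction hm : (s i).length using Nat.strong_induction_on generalizing s with
  | _ m ih =>
    by_cases hc : (s i).head? = some .item
    · obtain ⟨l, hl⟩ : ∃ l, s i = .item :: l := by
        cases h' : s i with
        | nil => simp [h'] at hc
        | cons t l => simp [h'] at hc; exact ⟨l, by rw [hc]⟩
      have hm' : m = l.length + 1 := by rw [← hm, hl]; rfl
      refine (wh_true (by simp [isTok, hc]) (seq (Decides.pop (seq (Decides.emit (Decides.mvTr hi
        (P := fun δ r => (∃ x r', r = codeRun x ++ r' ∧ r'.head? ≠ some .item) ∧ P)
        (T := T + (m - 1) * (20 * L + 50) + 1) fun δ r h' => ?_)))))).congr ?_ |>.le ?_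
      · rw [emits_apply_of_ne hi, update_self, hl] at h'
        simp only [List.tail_cons] at h'
        have hlen : (codeRaw δ).length + r.length = l.length := by rw [h']; simp
        rw [update_emits hi, update_idem, emits_emits]
        have hsi : emits o ([Tok.item] ++ codeRaw δ) (update s i r) i = r := by
          rw [emits_apply_of_ne hi, update_self]
        have := ih r.length (by omega) (s := emits o ([Tok.item] ++ codeRaw δ) (update s i r))
          (by rw [hsi]; omega) (fun x r' h1 h2 => ?_) (by rw [hsi])
        · rw [hsi] at this
          refine this.le ?_
          have : r.length * (20 * L + 50) ≤ (m - 1) * (20 * L + 50) :=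
            Nat.mul_le_mul_right _ (by omega)
          omega
        · rw [hsi] at h1
          have := h (δ :: x) r' (by rw [hl, h', h1, codeRun_cons]) h2
          rw [update_emits hi, update_idem, emits_emits]
          have hcr : codeRun (δ :: x) = [Tok.item] ++ codeRaw δ ++ codeRun x := by
            simp [codeRun]
          rwa [hcr] at this
      · rw [emits_apply_of_ne hi, update_self, hl]
        simp only [List.tail_cons]
        constructor
        · rintro ⟨⟨x, r, h1, h2⟩, hP⟩
          cases x with
          | nil =>
            simp only [codeRun_nil, List.nil_append] at h1
            simp [← h1] at h2
          | cons δ x =>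
            rw [codeRun_cons, List.cons_inj_right] at h1
            exact ⟨δ, _, h1, ⟨x, r, rfl, h2⟩, hP⟩
        · rintro ⟨δ, _, h1, ⟨x, r, rfl, h2⟩, hP⟩
          exact ⟨⟨δ :: x, r, by rw [codeRun_cons, h1], h2⟩, hP⟩
      · rw [emits_apply_of_ne hi, update_self, hl]
        simp only [List.tail_cons]
        have : m * (20 * L + 50) = (m - 1) * (20 * L + 50) + (20 * L + 50) := by
          rw [hm', Nat.add_sub_cancel]; ring
        omega
    · have h0 := h [] (s i) rfl hc
      rw [codeRun_nil, emits_nil, update_eq_self] at h0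
      refine ((wh_false (by simpa [isTok] using hc) h0).congr ?_).le (by omega)
      exact ⟨fun h => h.2, fun h => ⟨⟨[], _, rfl, hc⟩, h⟩⟩

/-- First-order formulas over a nested pushdown tree, without regard to the vocabulary and to the
number of free variables. -/
inductive RawFormula : Type where
  | falsum : RawFormula
  | equal (x y : ℕ) : RawFormula
  | edge (δ : PDTransition ℕ ℕ) (x y : ℕ) : RawFormula
  | jump (x y : ℕ) : RawFormula
  | imp (φ ψ : RawFormula) : RawFormula
  | all (φ : RawFormula) : RawFormula

/-- The code of a formula. -/
def RawFormula.code : RawFormula → List Tok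
  | falsum => [.falsum]
  | equal x y => .equal :: codeNat x ++ codeNat y
  | edge δ x y => .edge :: codeRaw δ ++ codeNat x ++ codeNat y
  | jump x y => .jump :: codeNat x ++ codeNat y
  | imp φ ψ => .imp :: φ.code ++ ψ.code
  | all φ => .all :: φ.code

theorem RawFormula.code_append_inj {φ ψ : RawFormula} {r r' : List Tok} :
    φ.code ++ r = ψ.code ++ r' ↔ φ = ψ ∧ r = r' := by
  induction φ generalizing ψ r r' with
  | falsum => cases ψ <;> simp [code]
  | equal x y => cases ψ <;> simp [code, codeNat_append_inj, and_assoc]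
  | edge δ x y => cases ψ <;> simp [code, codeNat_append_inj, codeRaw_append_inj, and_assoc]
  | jump x y => cases ψ <;> simp [code, codeNat_append_inj, and_assoc]
  | imp φ φ' ih ih' => cases ψ <;> simp [code, ih, ih', and_assoc]
  | all φ ih => cases ψ <;> simp [code, ih]

theorem none_ne (i : ι) : (none : Option ι) ≠ some i := nofun

/-- Read the codes of as many formulas from stack `i` as there are tokens in stack `c`. -/
def skipFormulas (i c : ι) : Prog ι :=
  wh c Option.isSome <| br i fun
    | some .falsum => seq (pop i) (pop c)
    | some .equal => seq (pop i) (seq (mvNat i none) (seq (mvNat i none) (pop c)))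
    | some .edge =>
      seq (pop i) (seq (mvTr i none) (seq (mvNat i none) (seq (mvNat i none) (pop c))))
    | some .jump => seq (pop i) (seq (mvNat i none) (seq (mvNat i none) (pop c)))
    | some .imp => seq (pop i) (push c .one)
    | some .all => pop i
    | _ => verdict false

theorem exists_formulas_succ {m : ℕ} {l : List Tok} :
    (∃ (φs : List RawFormula) (r : List Tok), φs.length = m + 1 ∧
      l = φs.flatMap RawFormula.code ++ r) ↔
    ∃ (φ : RawFormula) (φs : List RawFormula) (r : List Tok), φs.length = m ∧
      l = φ.code ++ (φs.flatMap RawFormula.code ++ r) := by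
  constructor
  · rintro ⟨_ | ⟨φ, φs⟩, r, h1, h2⟩
    · simp at h1
    · exact ⟨φ, φs, r, by simpa using h1, by simpa using h2⟩
  · rintro ⟨φ, φs, r, h1, h2⟩
    exact ⟨φ :: φs, r, by simpa using h1, by simpa using h2⟩

/-- Stack `c` counts the formulas still to be read. In prefix notation an atom completes one of
them, an implication turns one into two, and a quantifier turns one into one. -/
theorem Decides.skipFormulas {i c : ι} (hic : i ≠ c) {L : ℕ} (hL : (s i).length ≤ L)
    (h : ∀ (φs : List RawFormula) (r : List Tok), φs.length = (s c).length →
      s i = φs.flatMap RawFormula.code ++ r →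
      Decides p e k (update (update s i r) c []) P T a) :
    Decides p e (skipFormulas i c :: k) s
      ((∃ (φs : List RawFormula) (r : List Tok), φs.length = (s c).length ∧
        s i = φs.flatMap RawFormula.code ++ r) ∧ P)
      (T + (s i).length * (30 * L + 70) + 2) a := by
  induction hm : (s i).length using Nat.strong_induction_on generalizing s with
  | _ m ih =>
    rcases hc : s c with _ | ⟨u, cs⟩
    · have h0 := h [] (s i) (by simp [hc]) rfl
      rw [update_eq_self, ← hc, update_eq_self] at h0
      refine ((wh_false (by simp [hc]) h0).congr ?_).le (by omega)
      exact ⟨fun h => h.2, fun h => ⟨⟨[], _, rfl, rfl⟩, h⟩⟩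
    rw [List.length_cons, exists_formulas_succ]
    refine (wh_true (T := T + m * (30 * L + 70) + 1) (by simp [hc]) ?_).le (by omega)
    rcases hl : s i with _ | ⟨t, l⟩
    · refine (br_of (T := 0) none (by simp [hl]) (reject ?_)).le (by omega)
      rintro ⟨⟨φ, φs, r, -, h1⟩, -⟩
      cases φ <;> simp [RawFormula.code] at h1
    have hm' : m = l.length + 1 := by rw [← hm, hl]; rfl
    have hLm : m ≤ L := hm ▸ hL
    have hmul : ∀ {r : List Tok}, r.length ≤ l.length →
        r.length * (30 * L + 70) + (30 * L + 70) ≤ m * (30 * L + 70) := fun hr => by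
      rw [hm', Nat.add_mul, one_mul]
      exact Nat.add_le_add_right (Nat.mul_le_mul_right _ hr) _
    let Rest : List Tok → Prop := fun r =>
      (∃ (φs : List RawFormula) (r' : List Tok), φs.length = cs.length ∧
        r = φs.flatMap RawFormula.code ++ r') ∧ P
    have key : ∀ (φ : RawFormula) (r : List Tok), s i = φ.code ++ r → r.length ≤ l.length →
        Decides p e (Prog.skipFormulas i c :: k) (update (update s i r) c cs) (Rest r)
          (T + l.length * (30 * L + 70) + 2) a := by
      intro φ r hr hrl
      have hs1 : update (update s i r) c cs i = r := by simp [hic]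
      have hs2 : update (update s i r) c cs c = cs := by simp
      have := ih r.length (by omega) (s := update (update s i r) c cs) (by rw [hs1]; omega)
        (fun φs r' h1 h2 => ?_) (by rw [hs1])
      · rw [hs1, hs2] at this
        refine this.le ?_
        have := Nat.mul_le_mul_right (30 * L + 70) hrl
        omega
      · rw [hs1] at h2
        rw [hs2] at h1
        have := h (φ :: φs) r' (by simp [hc, h1]) (by rw [hr, h2]; simp)
        convert this using 1
        funext z
        simp only [update_apply]
        split_ifs <;> simp_all
    -- The common ending of the atoms `equal`, `jump` and `edge`: two variables, after which one
    -- formula is complete.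
    have two : ∀ (F : ℕ → ℕ → RawFormula) (l' : List Tok), l'.length ≤ l.length →
        (∀ x y r, l' = codeNat x ++ (codeNat y ++ r) → s i = (F x y).code ++ r) →
        Decides p e (Prog.seq (Prog.mvNat i none) (Prog.seq (Prog.mvNat i none) (Prog.pop c)) ::
          Prog.skipFormulas i c :: k) (update s i l')
          (∃ x y r, l' = codeNat x ++ (codeNat y ++ r) ∧ Rest r)
          (T + l.length * (30 * L + 70) + 2 + 10 * L + 20) a := by
      intro F l' hl' hF
      refine ((seq (Decides.mvNat (none_ne i) (s := update s i l')
        (P := fun x r => ∃ y r', r = codeNat y ++ r' ∧ Rest r')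
        (T := T + l.length * (30 * L + 70) + 2 + 5 * L + 10) fun x r h1 => ?_)).congr ?_).le ?_
      · rw [update_self] at h1
        have hr1 : (codeNat x).length + r.length = l'.length := by rw [h1]; simp
        rw [emits_none, update_idem]
        refine ((seq (Decides.mvNat (none_ne i) (s := update s i r)
          (P := fun y r' => Rest r')
          (T := T + l.length * (30 * L + 70) + 2 + 1) fun y r' h2 => ?_)).congr ?_).le ?_
        · rw [update_self] at h2
          rw [emits_none, update_idem]
          refine Decides.pop ?_
          rw [update_of_ne hic.symm, hc]
          refine key (F x y) r' (hF x y r' (by rw [h1, h2])) ?_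
          have hr2 : (codeNat y).length + r'.length = r.length := by rw [h2]; simp
          omega
        · rw [update_self]
        · rw [update_self]
          omega
      · rw [update_self]
        constructor
        · rintro ⟨x, y, r, h1, h2⟩
          exact ⟨x, _, h1, y, r, rfl, h2⟩
        · rintro ⟨x, _, h1, y, r, rfl, h2⟩
          exact ⟨x, y, r, h1, h2⟩
      · rw [update_self]
        omega
    have hmul' := hmul le_rfl
    cases t with
    | falsum =>
      refine ((br_cons _ hl (seq (Decides.pop (Decides.pop (T := _) ?_)))).congr
(P := Rest l) ?_).le
        (T := T + l.length * (30 * L + 70) + 2 + 4) (by omega)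
      · have := key .falsum l (by rw [hl]; rfl) le_rfl
        rw [update_of_ne hic.symm, hl, hc]
        exact this
      · refine and_congr_left fun _ => ⟨?_, ?_⟩
        · rintro ⟨φ, φs, r, h1, h2⟩
          cases φ <;> simp [RawFormula.code] at h2
          exact ⟨φs, r, h1, h2⟩
        · rintro ⟨φs, r, h1, h2⟩
          exact ⟨.falsum, φs, r, h1, by rw [h2]; rfl⟩
    | equal =>
      have := two .equal l le_rfl (fun x y r h' => by rw [hl, h']; simp [RawFormula.code])
      refine ((br_cons _ hl (seq (Decides.pop (T := _) (by rw [hl]; exact this)))).congr ?_).le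
        (T := T + l.length * (30 * L + 70) + 2 + 10 * L + 20 + 3) (by omega)
      constructor
      · rintro ⟨⟨φ, φs, r, h1, h2⟩, hP⟩
        cases φ <;> simp [RawFormula.code] at h2
        exact ⟨_, _, _, h2, ⟨φs, r, h1, rfl⟩, hP⟩
      · rintro ⟨x, y, r, h1, ⟨φs, r', h2, h3⟩, hP⟩
        exact ⟨⟨.equal x y, φs, r', h2, by simp [RawFormula.code, h1, h3]⟩, hP⟩
    | jump =>
      have := two .jump l le_rfl (fun x y r h' => by rw [hl, h']; simp [RawFormula.code])
      refine ((br_cons _ hl (seq (Decides.pop (T := _) (by rw [hl]; exact this)))).congr ?_).le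
        (T := T + l.length * (30 * L + 70) + 2 + 10 * L + 20 + 3) (by omega)
      constructor
      · rintro ⟨⟨φ, φs, r, h1, h2⟩, hP⟩
        cases φ <;> simp [RawFormula.code] at h2
        exact ⟨_, _, _, h2, ⟨φs, r, h1, rfl⟩, hP⟩
      · rintro ⟨x, y, r, h1, ⟨φs, r', h2, h3⟩, hP⟩
        exact ⟨⟨.jump x y, φs, r', h2, by simp [RawFormula.code, h1, h3]⟩, hP⟩
    | edge =>
      refine ((br_cons _ hl (seq (Decides.pop (seq (Decides.mvTr (none_ne i)
        (P := fun δ r => ∃ x y r', r = codeNat x ++ (codeNat y ++ r') ∧ Rest r')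
        (T := T + l.length * (30 * L + 70) + 2 + 10 * L + 20) fun δ r h1 => ?_))))).congr ?_).le ?_
      · rw [update_self, hl, List.tail_cons] at h1
        have hr1 : (codeRaw δ).length + r.length = l.length := by rw [h1]; simp
        rw [emits_none, update_idem]
        exact two (.edge δ) r (by omega) fun x y r' h2 => by
          rw [hl, h1, h2]; simp [RawFormula.code]
      · rw [update_self, hl, List.tail_cons]
        constructor
        · rintro ⟨⟨φ, φs, r, h1, h2⟩, hP⟩
          cases φ <;> simp [RawFormula.code] at h2
          exact ⟨_, _, h2, _, _, _, rfl, ⟨φs, r, h1, rfl⟩, hP⟩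
        · rintro ⟨δ, _, h1, x, y, r, rfl, ⟨φs, r', h2, h3⟩, hP⟩
          exact ⟨⟨.edge δ x y, φs, r', h2, by simp [RawFormula.code, h1, h3]⟩, hP⟩
      · rw [update_self, hl, List.tail_cons]
        omega
    | imp =>
      have hs2 : update (update s i l) c (.one :: s c) i = l := by simp [hic]
      have := ih l.length (by omega) (s := update (update s i l) c (.one :: s c))
        (by rw [hs2]; omega) (fun φs r h1 h2 => ?_) (by rw [hs2])
      · refine ((br_cons _ hl (seq (Decides.pop (Decides.push (T := _) ?_)))).congr
          (P := (∃ (φs : List RawFormula) (r : List Tok), φs.length = (s c).length + 1 ∧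
            l = φs.flatMap RawFormula.code ++ r) ∧ P) ?_).le
          (T := T + l.length * (30 * L + 70) + 2 + 5) (by omega)
        · rw [hs2] at this
          rw [hl, List.tail_cons, update_of_ne hic.symm]
          rwa [update_self] at this
        · rw [hc, List.length_cons, exists_formulas_succ]
          refine and_congr_left fun _ => ⟨?_, ?_⟩
          · rintro ⟨φ, φs, r, h1, h2⟩
            cases φ with
            | imp φ ψ =>
              simp [RawFormula.code] at h2
              exact ⟨φ, ψ :: φs, r, by simp [h1], by simp [h2]⟩
            | _ => simp [RawFormula.code] at h2
          · rintro ⟨φ, φs, r, h1, h2⟩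
            rcases φs with _ | ⟨ψ, φs⟩
            · simp at h1
            · exact ⟨.imp φ ψ, φs, r, by simpa using h1, by simp [RawFormula.code, h2]⟩
      · rw [hs2] at h2
        rw [update_self, hc] at h1
        rcases φs with _ | ⟨φ, _ | ⟨ψ, φs⟩⟩
        · simp at h1
        · simp at h1
        · have := h (.imp φ ψ :: φs) r (by simp_all) (by rw [hl, h2]; simp [RawFormula.code])
          convert this using 1
          funext z
          simp only [update_apply]
          split_ifs <;> simp_all
    | all =>
      have hs2 : update s i l i = l := by simp
      have hs3 : update s i l c = s c := by simp [hic.symm]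
      have := ih l.length (by omega) (s := update s i l)
        (by rw [hs2]; omega) (fun φs r h1 h2 => ?_) (by rw [hs2])
      · refine ((br_cons _ hl (Decides.pop (T := _) ?_)).congr
          (P := (∃ (φs : List RawFormula) (r : List Tok), φs.length = (s c).length ∧
            l = φs.flatMap RawFormula.code ++ r) ∧ P) ?_).le
          (T := T + l.length * (30 * L + 70) + 2 + 2) (by omega)
        · rw [hs2, hs3] at this
          rw [hl, List.tail_cons]
          exact this
        · rw [hc, List.length_cons, exists_formulas_succ]
          refine and_congr_left fun _ => ⟨?_, ?_⟩
          · rintro ⟨φ, φs, r, h1, h2⟩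
            cases φ with
            | all φ =>
              simp [RawFormula.code] at h2
              exact ⟨φ, φs, r, h1, by simp [h2]⟩
            | _ => simp [RawFormula.code] at h2
          · rintro ⟨φ, φs, r, h1, h2⟩
            exact ⟨.all φ, φs, r, h1, by simp [RawFormula.code, h2]⟩
      · rw [hs2] at h2
        rw [hs3, hc] at h1
        rcases φs with _ | ⟨φ, φs⟩
        · simp at h1
        · have := h (.all φ :: φs) r (by simp_all) (by rw [hl, h2]; simp [RawFormula.code])
          rwa [update_idem]
    | _ =>
      refine (br_cons _ hl (k := _) (T := 0) (reject ?_)).le (by omega)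
      rintro ⟨⟨φ, φs, r, -, h1⟩, -⟩
      cases φ <;> simp [RawFormula.code] at h1

/-- Read the code of a formula from stack `i`, with auxiliary stack `c`. -/
def skipFormula (i c : ι) : Prog ι := seq (push c .one) (skipFormulas i c)

theorem Decides.skipFormula {i c : ι} (hic : i ≠ c) (hc : s c = [])
    (h : ∀ (φ : RawFormula) (r : List Tok), s i = φ.code ++ r →
      Decides p e k (update s i r) P T a) :
    Decides p e (skipFormula i c :: k) s ((∃ (φ : RawFormula) (r : List Tok), s i = φ.code ++ r) ∧ P)
      (T + (s i).length * (30 * (s i).length + 70) + 5) a := by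
  have hsi : update s c (.one :: s c) i = s i := by simp [hic]
  refine (seq (Decides.push (Decides.skipFormulas hic (P := P) (T := T) (L := (s i).length)
    (by rw [hsi]) fun φs r h1 h2 => ?_))).congr ?_ |>.le (by rw [hsi])
  · rw [hsi] at h2
    rw [update_self, hc, List.length_singleton, List.length_eq_one_iff] at h1
    obtain ⟨φ, rfl⟩ := h1
    convert h φ r (by simpa using h2) using 1
    funext z
    simp only [update_apply]
    split_ifs <;> simp_all
  · rw [hsi, update_self, hc]
    refine and_congr_left fun _ => ⟨?_, ?_⟩
    · rintro ⟨φ, r, h⟩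
      exact ⟨[φ], r, rfl, by simpa using h⟩
    · rintro ⟨φs, r, h1, h2⟩
      rw [List.length_singleton, List.length_eq_one_iff] at h1
      obtain ⟨φ, rfl⟩ := h1
      exact ⟨φ, r, by simpa using h2⟩

theorem Decides.skipFormula_of {i c : ι} (hic : i ≠ c) (hc : s c = []) {φ : RawFormula}
    {r : List Tok} (hs : s i = φ.code ++ r) (h : Decides p e k (update s i r) P T a) :
    Decides p e (Prog.skipFormula i c :: k) s P
      (T + (s i).length * (30 * (s i).length + 70) + 5) a := by
  refine (Decides.skipFormula hic hc (P := P) fun φ' r' h' => ?_).congr ?_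
  · rw [hs, RawFormula.code_append_inj] at h'
    rw [← h'.2]
    exact h
  · exact ⟨fun h => ⟨⟨φ, r, hs⟩, h⟩, fun h => h.2⟩

end Prog

/-! ### Comparison, search, arithmetic in unary and guessing. -/

namespace Prog

open Function Decides

variable {ι : Type} [DecidableEq ι] {n : ℕ} {p : Prog ι} {e : ι ≃ Fin (n + 1)}
  {k : List (Prog ι)} {s : ι → List Tok} {P P' : Prop} {T T' a a' : ℕ}

/-- Test whether stack `i` is smaller than stack `j`. -/
def lt (i j : ι) : Prog ι :=
  seq (wh i Option.isSome (seq (pop i) (br j fun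
    | some _ => pop j
    | none => verdict false))) <| br j fun
    | some _ => verdict true
    | none => verdict false

theorem Decides.lt {i j : ι} (hij : i ≠ j) :
    Decides p e (lt i j :: k) s ((s i).length < (s j).length) (5 * (s i).length + 3) a := by
  refine (seq (T := 5 * (s i).length + 2) ?_).le (by omega)
  generalize hl : s i = l
  induction l generalizing s with
  | nil =>
    refine (wh_false (by simp [hl]) (br_of _ rfl (k := k) (T := 0) ?_)).le (by omega)
    rcases h : s j with _ | ⟨t, r⟩
    · exact reject (by simp)
    · exact accept (by simp)
  | cons t l ih =>
    refine (wh_true (T := 5 * l.length + 6) (by simp [hl]) (seq (Decides.pop ?_))).le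
      (by simp; omega)
    rcases h : s j with _ | ⟨u, r⟩
    · exact Decides.le (br_of (T := 0) none (by simp [hij.symm, h]) (reject (by simp)))
        (by omega)
    · refine Decides.le (br_cons u (l := r) (by simp [hij.symm, h])
        (Decides.pop (Decides.congr ?_ (ih ?_)))) (by omega)
      · simp [h, hij.symm]
      · simp [hij, hl]

/-- Compare stacks `i` and `j`. -/
def eqTest (i j : ι) : Prog ι :=
  seq (wh i Option.isSome (br i fun o => br j fun o' =>
    if o = o' then seq (pop i) (pop j) else verdict false)) <| br j fun
    | some _ => verdict false
    | none => verdict true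

theorem Decides.eqTest {i j : ι} (hij : i ≠ j) :
    Decides p e (eqTest i j :: k) s (s i = s j) (6 * (s i).length + 3) a := by
  refine (seq (T := 6 * (s i).length + 2) ?_).le (by omega)
  generalize hl : s i = l
  induction l generalizing s with
  | nil =>
    refine (wh_false (by simp [hl]) (br_of _ rfl (k := k) (T := 0) ?_)).le (by omega)
    rcases h : s j with _ | ⟨t, r⟩
    · exact accept (by simp)
    · exact reject (by simp)
  | cons t l ih =>
    refine (wh_true (T := 6 * l.length + 7) (by simp [hl]) (br_cons t hl (br_of _ rfl
      (T := 6 * l.length + 5) ?_))).le (by simp; omega)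
    by_cases hj : (s j).head? = some t
    · rw [if_pos hj.symm]
      obtain ⟨r, hr⟩ : ∃ r, s j = t :: r := by
        cases h' : s j with
        | nil => simp [h'] at hj
        | cons u r => simp [h'] at hj; exact ⟨r, by rw [hj]⟩
      refine (seq (Decides.pop (Decides.pop ((ih ?_).congr ?_)))).le (by omega)
      · simp [hij, hl]
      · simp [hr, hij.symm]
    · rw [if_neg (Ne.symm hj)]
      exact reject fun h => hj (by rw [← h]; rfl)

/-- Tokens that occur in the code of a transition. -/
def trTok : Option Tok → Bool
  | some .one => true
  | some .endNum => true
  | some .push => true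
  | some .pop => true
  | _ => false

theorem trTok_of_mem_codeRaw {δ : PDTransition ℕ ℕ} {t : Tok} (h : t ∈ codeRaw δ) :
    trTok (some t) = true := by
  obtain ⟨q, x, q', o⟩ := δ
  cases o <;> simp [codeRaw, codeNat, List.mem_replicate] at h <;> aesop

/-- Test whether the code of a transition on stack `i` is a prefix of stack `j`. -/
def prefixTest (i j : ι) : Prog ι :=
  seq (wh i trTok (br i fun o => br j fun o' =>
    if o = o' then seq (pop i) (pop j) else verdict false)) (verdict true)

theorem Decides.prefixTest {i j : ι} (hij : i ≠ j) {l r : List Tok} (hs : s i = l ++ r)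
    (hl : ∀ t ∈ l, trTok (some t) = true) (hr : trTok r.head? = false) :
    Decides p e (prefixTest i j :: k) s (l <+: s j) (6 * l.length + 3) a := by
  refine (seq (T := 6 * l.length + 2) ?_).le (by omega)
  induction l generalizing s with
  | nil => exact (wh_false (by simpa [hs] using hr) (accept (T := 0) (by simp))).le (by omega)
  | cons t l ih =>
    rw [List.forall_mem_cons] at hl
    refine (wh_true (T := 6 * l.length + 7) (by simpa [hs] using hl.1)
      (br_cons t hs (br_of _ rfl (T := 6 * l.length + 5) ?_))).le (by simp; omega)
    by_cases hj : (s j).head? = some t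
    · rw [if_pos hj.symm]
      obtain ⟨r', hr'⟩ : ∃ r, s j = t :: r := by
        cases h' : s j with
        | nil => simp [h'] at hj
        | cons u r => simp [h'] at hj; exact ⟨r, by rw [hj]⟩
      refine (seq (Decides.pop (Decides.pop ((ih ?_ hl.2).congr ?_)))).le (by omega)
      · simp [hij, hs]
      · simp [hr', hij.symm]
    · rw [if_neg (Ne.symm hj)]
      refine reject ?_
      rintro ⟨r', hr'⟩
      exact hj (by rw [← hr']; rfl)

/-- The property `R` holds for each element of a list and the list of its successors. -/
def AllSuffix {α : Type} (R : α → List α → Prop) : List α → Prop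
  | [] => True
  | u :: x => R u x ∧ AllSuffix R x

/-- Perform the test `q` for each element of the list of transitions on stack `i`. -/
def forTr (i : ι) (q : Prog ι) : Prog ι :=
  seq (wh i (isTok .item) (seq (pop i) (seq (fork q skip) (mvTr i none)))) (verdict true)

/-- At each item one branch performs the test and halts, while the other goes on to the next item. A
path performs `q` at most once, so its time and its alternations are counted once and not for every
item. -/
theorem Decides.forTr {i : ι} {q : Prog ι} {x : List (PDTransition ℕ ℕ)} {r : List Tok}
    (hi : s i = codeRun x ++ r) (hr : r.head? ≠ some .item)
    {R : PDTransition ℕ ℕ → List (PDTransition ℕ ℕ) → Prop} {L : ℕ} (hL : (s i).length ≤ L)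
    (hq : ∀ (K : List (Prog ι)) (δ : PDTransition ℕ ℕ) (y : List (PDTransition ℕ ℕ)),
      (codeRaw δ ++ (codeRun y ++ r)).length ≤ L →
      Decides p e (q :: K) (update s i (codeRaw δ ++ (codeRun y ++ r))) (R δ y) T a) :
    Decides p e (forTr i q :: k) s (AllSuffix R x) (L * (20 * L + 50) + T + 2) a := by
  suffices h : Decides p e (wh i (isTok .item) (Prog.seq (Prog.pop i)
      (Prog.seq (Prog.fork q Prog.skip) (Prog.mvTr i none))) :: Prog.verdict true :: k) s
      (AllSuffix R x) ((s i).length * (20 * L + 50) + T + 1) a by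
    refine Decides.le (seq h) ?_
    have := Nat.mul_le_mul_right (20 * L + 50) hL
    omega
  induction x generalizing s with
  | nil =>
    exact Decides.le (wh_false (by simpa [isTok, hi] using hr) (accept (T := 0) trivial))
      (by omega)
  | cons δ x ih =>
    rw [codeRun_cons] at hi
    have hlen : (s i).length = (codeRaw δ).length + (codeRun x ++ r).length + 1 := by
      rw [hi]; simp
    generalize hM : (codeRun x ++ r).length = M at hlen
    have hsi : update s i (s i).tail i = codeRaw δ ++ (codeRun x ++ r) := by simp [hi]
    refine Decides.le (T := M * (20 * L + 50) + T + 1 + 20 * L + 41 + 6)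
      (wh_true (by simp [isTok, hi]) (seq (Decides.pop (seq (Decides.fork
      (T := M * (20 * L + 50) + T + 1 + 20 * L + 41) ?_ (Decides.skip
      (T := M * (20 * L + 50) + T + 1 + 20 * L + 40) ?_)))))) ?_
    · refine Decides.le (T := T) ?_ (by omega)
      rw [hi, List.tail_cons]
      exact hq _ δ x (by rw [List.length_append, hM]; omega)
    · have := ih (s := update (update s i (s i).tail) i (codeRun x ++ r)) (by simp)
        (by rw [update_self]; omega) (fun K δ' y hy => by simpa using hq K δ' y hy)
      rw [update_self, hM] at this
      refine Decides.le (Decides.mvTr_of (none_ne i) hsi this) ?_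
      rw [hsi, List.length_append, hM]
      omega
    · rw [hlen, Nat.add_mul, Nat.add_mul]
      omega

/-- Test whether the transition on top of stack `j` is among those that are listed on stack `i`. -/
def memTest (i j : ι) : Prog ι := seq flip (forTr i (seq flip (prefixTest i j)))

theorem head?_codeRun_append_ne (x : List (PDTransition ℕ ℕ)) {r : List Tok}
    (hr : trTok r.head? = false) : trTok (codeRun x ++ r).head? = false := by
  cases x with
  | nil => exact hr
  | cons δ x => rw [codeRun_cons]; rfl

/-- Membership is the negation of "all items differ", and each difference is a negated comparison.
The two negations are the two alternations. -/
theorem Decides.memTest {i j : ι} (hij : i ≠ j) {x : List (PDTransition ℕ ℕ)} {r r' : List Tok}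
    {δ : PDTransition ℕ ℕ} (hi : s i = codeRun x ++ r) (hr : trTok r.head? = false)
    (hr' : r.head? ≠ some .item) (hj : s j = codeRaw δ ++ r') {L : ℕ} (hL : (s i).length ≤ L) :
    Decides p e (memTest i j :: k) s (δ ∈ x) (L * (20 * L + 50) + 6 * L + 9) (a + 2) := by
  have hx : δ ∈ x ↔ ¬ AllSuffix (fun δ' _ => ¬ δ = δ') x := by
    induction x generalizing s with
    | nil => simp [AllSuffix]
    | cons δ' x ih =>
      have := ih (s := update s i (codeRun x ++ r)) (by simp) (by simpa [hij.symm] using hj)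
        (by
          rw [update_self]
          rw [hi, codeRun_cons] at hL
          simp only [List.length_cons, List.length_append] at hL ⊢
          omega)
      rw [AllSuffix, List.mem_cons, this]
      tauto
  refine Decides.le (Decides.congr hx (seq (Decides.flip (a := a + 1) (Decides.forTr hi hr' hL
    (T := 6 * L + 5) fun K δ' y hy => seq (Decides.flip (Decides.le (Decides.congr ?_
      (Decides.prefixTest hij (l := codeRaw δ') (r := codeRun y ++ r) (by simp)
        (fun t ht => trTok_of_mem_codeRaw ht) (head?_codeRun_append_ne y hr))) ?_)))))) (by omega)
  · rw [update_of_ne hij.symm, hj]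
    constructor
    · rintro rfl
      exact List.prefix_append _ _
    · rintro ⟨l, hl⟩
      exact (codeRaw_append_inj.1 hl).1.symm
  · rw [List.length_append] at hy
    omega

/-- Write `m` ones on stack `j`. -/
def pushes (j : ι) : ℕ → Prog ι
  | 0 => skip
  | m + 1 => seq (push j .one) (pushes j m)

theorem Decides.pushes {j : ι} {m : ℕ}
    (h : Decides p e k (update s j (List.replicate m .one ++ s j)) P T a) :
    Decides p e (pushes j m :: k) s P (T + 3 * m + 1) a := by
  induction m generalizing s with
  | zero => exact Decides.skip (by simpa using h)
  | succ m ih =>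
    refine (seq (Decides.push (ih ?_))).le (by omega)
    rw [List.replicate_succ'] at h
    simpa using h

/-- Multiply the length of stack `i` by `m`, with auxiliary stack `t`. -/
def scale (i t : ι) (m : ℕ) : Prog ι :=
  seq (wh i Option.isSome (seq (pop i) (pushes t m))) (pour t i)

theorem Decides.scale {i t : ι} (hit : i ≠ t) (ht : s t = []) {m : ℕ}
    (h : Decides p e k (update s i (List.replicate (m * (s i).length) .one)) P T a) :
    Decides p e (scale i t m :: k) s P (T + (9 * m + 4) * (s i).length + 3) a := by
  suffices H : ∀ (l : ℕ), s t = List.replicate l .one →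
      Decides p e k (update (update s i (List.replicate (m * (s i).length + l) .one)) t []) P T a →
      Decides p e (wh i Option.isSome (Prog.seq (Prog.pop i) (Prog.pushes t m)) ::
        Prog.pour t i :: k) s P
        (T + (3 * m + 4) * (s i).length + 6 * (m * (s i).length + l) + 2) a by
    refine (seq (H 0 ht ?_)).le (Nat.le_of_eq (by ring))
    convert h using 1
    funext z
    simp only [update_apply]
    split_ifs <;> simp_all
  clear h ht
  intro l
  generalize hn : (s i).length = c
  induction c generalizing s l with
  | zero =>
    intro ht h
    rw [List.length_eq_zero_iff] at hn
    refine (wh_false (by simp [hn]) (Decides.pour hit.symm (T := T) ?_)).le (by simp [ht])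
    convert h using 1
    funext z
    simp only [update_apply]
    split_ifs <;> simp_all
  | succ c ih =>
    intro ht h
    obtain ⟨u, r, hr⟩ : ∃ u r, s i = u :: r := List.exists_cons_of_length_eq_add_one hn
    have hrl : r.length = c := by simpa [hr] using hn
    have hupd : update (update s i r) t (List.replicate m .one ++ update s i r t) =
        update (update s i r) t (List.replicate (m + l) .one) := by
      rw [update_of_ne hit.symm, ht, List.replicate_append_replicate]
    refine (wh_true (T := T + (3 * m + 4) * c + 6 * (m * c + (m + l)) + 2 + 3 * m + 1 + 2)
      (by simp [hr]) (seq (Decides.pop (Decides.pushes ?_)))).le (Nat.le_of_eq (by ring))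
    rw [hr, List.tail_cons, hupd]
    refine ih _ (by simp [hit, hrl]) (by simp) ?_
    convert h using 1
    funext z
    simp only [update_apply]
    split_ifs <;> simp_all
    try ring

/-- Multiply the length of stack `i` by `m` for each element of stack `w`; `w'` and `t` are
auxiliary stacks. -/
def scalePow (w w' i t : ι) (m : ℕ) : Prog ι :=
  seq (wh w Option.isSome (seq (br w fun
    | some u => seq (push w' u) (pop w)
    | none => skip) (scale i t m))) (pour w' w)

theorem Decides.scalePow {w w' i t : ι} (hww : w ≠ w') (hwi : w ≠ i) (hwt : w ≠ t) (hwi' : w' ≠ i)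
    (hwt' : w' ≠ t) (hit : i ≠ t) (hw' : s w' = []) (ht : s t = []) {m : ℕ} (hm : 1 ≤ m)
    {l : ℕ} (hl : s i = List.replicate l .one)
    (h : Decides p e k (update s i (List.replicate (m ^ (s w).length * l) .one)) P T a) :
    Decides p e (scalePow w w' i t m :: k) s P
      (T + (s w).length * ((9 * m + 4) * (m ^ (s w).length * l) + 20) + 3) a := by
  -- The final value bounds all intermediate values on stack `i`, so one cost serves for all
  -- iterations.
  suffices H : ∀ M, m ^ (s w).length * l ≤ M →
      Decides p e k (update (update (update s i (List.replicate (m ^ (s w).length * l) .one)) w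
        ((s w').reverse ++ s w)) w' []) P T a →
      Decides p e (wh w Option.isSome (Prog.seq (Prog.br w fun
        | some u => Prog.seq (Prog.push w' u) (Prog.pop w)
        | none => Prog.skip) (Prog.scale i t m)) :: Prog.pour w' w :: k) s P
        (T + (s w).length * ((9 * m + 4) * M + 20) + 6 * (s w').length + 2) a by
    refine (seq (H _ le_rfl ?_)).le (by simp [hw'])
    convert h using 1
    funext z
    simp only [update_apply]
    split_ifs <;> simp_all
  clear h hw'
  intro M hM h
  generalize hn : (s w).length = c at *
  induction c generalizing s l with
  | zero =>
    rw [List.length_eq_zero_iff] at hn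
    refine (wh_false (by simp [hn]) (Decides.pour hww.symm (T := T) ?_)).le (by omega)
    convert h using 1
    funext z
    simp only [update_apply]
    split_ifs <;> simp_all
  | succ c ih =>
    obtain ⟨u, r, hr⟩ : ∃ u r, s w = u :: r := List.exists_cons_of_length_eq_add_one hn
    have hrl : r.length = c := by simpa [hr] using hn
    have hlM : l ≤ M := le_trans (Nat.le_mul_of_pos_left _ (by positivity)) hM
    have hmul : (9 * m + 4) * l ≤ (9 * m + 4) * M := Nat.mul_le_mul_left _ hlM
    refine (wh_true (T := T + c * ((9 * m + 4) * M + 20) + 6 * ((s w').length + 1) + 2 +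
      (9 * m + 4) * l + 3 + 6) (by simp [hr]) (seq (br_cons u hr (seq (Decides.push (Decides.pop
      ((Decides.scale hit (T := T + c * ((9 * m + 4) * M + 20) + 6 * ((s w').length + 1) + 2)
        ?_ ?_).le ?_))))))).le ?_
    · simp [hwt.symm, hwt'.symm, ht]
    · have hsi : update (update s w' (u :: s w')) w r i = List.replicate l .one := by
        simp [hwi.symm, hwi'.symm, hl]
      rw [update_of_ne hww, hr, List.tail_cons, hsi, List.length_replicate]
      have := ih (s := update (update (update s w' (u :: s w')) w r) i
        (List.replicate (m * l) .one)) (l := m * l) (by simp [hwt.symm, hwt'.symm, hit.symm, ht])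
        (by simp) (by simp [hwi, hrl]) ?_ ?_
      · simpa [hwi', hww.symm] using this
      · calc m ^ c * (m * l) = m ^ (c + 1) * l := by ring
          _ ≤ M := hM
      · convert h using 1
        funext z
        simp only [update_apply]
        split_ifs <;> simp_all
        try ring
    · simp [hwi.symm, hwi'.symm, hl]
    · rw [Nat.add_mul c 1]
      omega

/-- The tokens that occur in the code of a list of transitions. -/
def runToks : List Tok := [.one, .endNum, .item, .push, .pop]

/-- Write one of the tokens that occur in runs on stack `j`. -/
def pickTok (j : ι) : Prog ι :=
  fork (push j .one) (fork (push j .endNum) (fork (push j .item) (fork (push j .push)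
    (push j .pop))))

theorem Decides.pickTok {j : ι} {P : Tok → Prop}
    (h : ∀ t ∈ runToks, Decides p e k (update s j (t :: s j)) (P t) T a) :
    Decides p e (pickTok j :: k) s (∀ t ∈ runToks, P t) (T + 10) a := by
  have h' : ∀ t ∈ runToks, Decides p e (Prog.push j t :: k) s (P t) (T + 2) a :=
    fun t ht => Decides.push (h t ht)
  simp only [runToks, List.forall_mem_cons] at h' ⊢
  obtain ⟨h1, h2, h3, h4, h5, -⟩ := h'
  exact Decides.fork (h1.le (by omega)) (Decides.fork (h2.le (by omega))
    (Decides.fork (h3.le (by omega)) (Decides.fork h4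
      (h5.congr (by simp)))))

/-- Write a list of tokens on stack `j` whose length is bounded by that of stack `i`, with auxiliary
stack `t`. -/
def guess (i t j : ι) : Prog ι :=
  seq (wh i Option.isSome (seq (pop i) (seq (push t .one) (fork (pour i t) (pickTok j)))))
    (pour t i)

/-- For each unit on stack `i` the machine either stops or chooses one more token. The units are
collected on stack `t` and restored at the end. -/
theorem Decides.guess {i t j : ι} (hit : i ≠ t) (hij : i ≠ j) (htj : t ≠ j) (ht : s t = [])
    {l : ℕ} (hl : s i = List.replicate l .one) {P : List Tok → Prop}
    (h : ∀ X : List Tok, (∀ t ∈ X, t ∈ runToks) → X.length ≤ l →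
      Decides p e k (update s j (X ++ s j)) (P X) T a) :
    Decides p e (guess i t j :: k) s
      (∀ X : List Tok, (∀ t ∈ X, t ∈ runToks) → X.length ≤ l → P X) (T + 40 * l + 3) a := by
  suffices H : ∀ m, s t = List.replicate m .one →
      (∀ X : List Tok, (∀ t ∈ X, t ∈ runToks) → X.length ≤ l → Decides p e k
        (update (update (update s i (List.replicate (m + l) .one)) t []) j (X ++ s j)) (P X) T a) →
      Decides p e (wh i Option.isSome (Prog.seq (Prog.pop i) (Prog.seq (Prog.push t .one)
        (Prog.fork (Prog.pour i t) (Prog.pickTok j)))) :: Prog.pour t i :: k) s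
        (∀ X : List Tok, (∀ t ∈ X, t ∈ runToks) → X.length ≤ l → P X)
        (T + 34 * l + 6 * (m + l) + 2) a by
    refine (seq (H 0 ht fun X hX hXl => ?_)).le (by omega)
    convert h X hX hXl using 1
    funext z
    simp only [update_apply]
    split_ifs <;> simp_all
  clear h ht
  intro m ht h
  induction l generalizing s m P with
  | zero =>
    have hP : (∀ X : List Tok, (∀ t ∈ X, t ∈ runToks) → X.length ≤ 0 → P X) ↔ P [] := by
      refine ⟨fun h => h [] (by simp) le_rfl, fun h X _ hX => ?_⟩
      rw [List.length_eq_zero_iff.1 (Nat.le_zero.1 hX)]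
      exact h
    refine ((wh_false (by simp [hl]) (Decides.pour hit.symm (T := T) ?_)).congr hP).le
      (by simp [ht])
    convert h [] (by simp) le_rfl using 1
    funext z
    simp only [update_apply]
    split_ifs <;> simp_all
  | succ l ih =>
    -- Words are split at their last token, because the token chosen first lies deepest on the
    -- stack.
    have hstep : ∀ R : List Tok → Prop, (∀ X : List Tok, (∀ t ∈ X, t ∈ runToks) → X.length ≤ l + 1 → R X) ↔
        R [] ∧ ∀ u ∈ runToks, ∀ X : List Tok, (∀ t ∈ X, t ∈ runToks) → X.length ≤ l →
          R (X ++ [u]) := by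
      intro R
      constructor
      · intro H
        refine ⟨H [] (by simp) (by simp), fun u hu X hX hXl => H _ ?_ (by simpa using hXl)⟩
        intro t ht
        rw [List.mem_append, List.mem_singleton] at ht
        rcases ht with ht | rfl
        exacts [hX t ht, hu]
      · rintro ⟨H1, H2⟩ X hX hXl
        rcases List.eq_nil_or_concat' X with rfl | ⟨Y, u, rfl⟩
        · exact H1
        · exact H2 u (hX u (by simp)) Y (fun t ht => hX t (by simp [ht])) (by simpa using hXl)
    have hs1 : update (update s i (List.replicate l .one)) t (.one :: s t) t =
      List.replicate (m + 1) .one := by simp [ht, List.replicate_succ]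
    have hs2 : update (update s i (List.replicate l .one)) t (.one :: s t) i =
      List.replicate l .one := by simp [hit]
    rw [hstep]
    refine (wh_true (T := T + 34 * l + 6 * (m + 1 + l) + 2 + 20) (by simp [hl, List.replicate_succ])
      (seq (Decides.pop (seq (Decides.push ?_))))).le (T :=
        T + 34 * l + 6 * (m + 1 + l) + 2 + 20 + 1) (by omega)
    rw [hl, List.replicate_succ, List.tail_cons, update_of_ne hit.symm]
    refine (Decides.fork (T := T + 34 * l + 6 * (m + 1 + l) + 2 + 10) ?_ ?_).le (by omega)
    · refine (Decides.pour hit (T := T + 6 * (m + 1 + l) + 2) ?_).le (by rw [hs2]; simp; try omega)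
      rw [hs1, hs2]
      refine (wh_false (T := T + 6 * (m + 1 + l) + 1) (by simp [hit])
        ((Decides.pour hit.symm (T := T) ?_).le ?_))
      · convert h [] (by simp) (by simp) using 1
        funext z
        simp only [update_apply]
        split_ifs <;> simp_all
        omega
      · simp
        omega
    · refine Decides.pickTok fun u hu => ?_
      have := ih (s := update (update (update s i (List.replicate l .one)) t (.one :: s t)) j
        (u :: s j)) (P := fun X => P (X ++ [u])) (by simp [hij, hit]) (m + 1)
        (by simp [htj, ht, List.replicate_succ]) (fun X hX hXl => ?_)
      · simpa [htj.symm, hij.symm] using this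
      · convert h (X ++ [u]) ?_ (by simpa using hXl) using 1
        · funext z
          simp only [update_apply]
          split_ifs <;> simp_all
          omega
        · intro t ht
          rw [List.mem_append, List.mem_singleton] at ht
          rcases ht with ht | rfl
          exacts [hX t ht, hu]

end Prog

/-! ## Numbered pushdown systems -/

/-- A pushdown system with numbered states and symbols, whose transitions are listed. -/
structure RawSystem : Type where
  states : ℕ
  symbols : ℕ
  bot : ℕ
  init : ℕ
  items : List (PDTransition ℕ ℕ)

open Prog

namespace RawSystem

variable (R : RawSystem)

/-- All states and symbols are in the specified range, and the bottom symbol is never pushed. -/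
def Ok : Prop :=
  (R.bot < R.symbols ∧ R.init < R.states) ∧ ∀ δ ∈ R.items, δ.src < R.states ∧ δ.top < R.symbols ∧
    δ.dst < R.states ∧ ∀ b, δ.op = .push b → b < R.symbols ∧ b ≠ R.bot

/-- The last state of a run, which is given as the list of its transitions, the last one first. -/
def stateOf : List (PDTransition ℕ ℕ) → ℕ
  | [] => R.init
  | δ :: _ => δ.dst

/-- The topmost symbol that is left of the stack at the end of a run if `c` symbols are removed. -/
def topOf : ℕ → List (PDTransition ℕ ℕ) → ℕ
  | _, [] => R.bot
  | c, ⟨_, _, _, .pop⟩ :: x => topOf (c + 1) x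
  | 0, ⟨_, _, _, .push b⟩ :: _ => b
  | c + 1, ⟨_, _, _, .push _⟩ :: x => topOf c x

/-- The transition `δ` can be applied at the end of the run `x`. -/
def Applicable (δ : PDTransition ℕ ℕ) (x : List (PDTransition ℕ ℕ)) : Prop :=
  δ ∈ R.items ∧ δ.src = R.stateOf x ∧ δ.top = R.topOf 0 x ∧ (δ.op = .pop → δ.top ≠ R.bot)

/-- The list `x` is a run. -/
def IsRun (x : List (PDTransition ℕ ℕ)) : Prop := Prog.AllSuffix R.Applicable x

/-- Remove the last transitions of a run up to and including the one that has pushed the symbol that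
was the `c`-th symbol of the stack, counted from the top. -/
def unwind : ℕ → List (PDTransition ℕ ℕ) → Option (List (PDTransition ℕ ℕ))
  | 0, x => some x
  | _ + 1, [] => none
  | c + 1, ⟨_, _, _, .pop⟩ :: x => unwind (c + 2) x
  | c + 1, ⟨_, _, _, .push _⟩ :: x => unwind c x

/-- The jump relation on runs. -/
def IsJump : List (PDTransition ℕ ℕ) → List (PDTransition ℕ ℕ) → Prop
  | x, ⟨_, _, _, .pop⟩ :: y => unwind 1 y = some x
  | _, _ => False

/-- The variables and transitions in a formula are among the first `d` variables and the transitions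
of the system. -/
def WellFormed : RawFormula → ℕ → Prop
  | .falsum, _ => True
  | .equal i j, d => i < d ∧ j < d
  | .edge δ i j, d => δ ∈ R.items ∧ i < d ∧ j < d
  | .jump i j, d => i < d ∧ j < d
  | .imp φ ψ, d => WellFormed φ d ∧ WellFormed ψ d
  | .all φ, d => WellFormed φ (d + 1)

/-- Satisfaction of a formula by the list `xs` of runs if quantification is restricted to runs with
codes of length at most `g * l`, `g * (g * l)`, and so on. -/
def Sat (g : ℕ) : RawFormula → ℕ → List (List (PDTransition ℕ ℕ)) → Prop
  | .falsum, _, _ => False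
  | .equal i j, _, xs => ∃ x, xs[i]? = some x ∧ ∃ y, xs[j]? = some y ∧ x = y
  | .edge δ i j, _, xs => ∃ x, xs[i]? = some x ∧ ∃ y, xs[j]? = some y ∧ δ :: x = y
  | .jump i j, _, xs => ∃ x, xs[i]? = some x ∧ ∃ y, xs[j]? = some y ∧ IsJump x y
  | .imp φ ψ, l, xs => Sat g φ l xs → Sat g ψ l xs
  | .all φ, l, xs => ∀ x, (Prog.codeRun x).length ≤ g * l → R.IsRun x →
      Sat g φ (g * l) (xs ++ [x])

end RawSystem

/-! ## Tests -/

/-- The stacks of the model checking machine. -/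
inductive Reg : Type where
  | inp | wd | sys | frm | env | fuel | nq | ng | bt | st | t1 | t2 | t3 | t4 | t5 | t6 | dep | z
  deriving DecidableEq

namespace Prog

open Function Decides

variable {n : ℕ} {p : Prog Reg} {e : Reg ≃ Fin (n + 1)}
  {k : List (Prog Reg)} {s : Reg → List Tok} {P P' : Prop} {T T' a a' : ℕ}

@[simp] theorem codeNat_inj {x y : ℕ} : codeNat x = codeNat y ↔ x = y := by
  have := codeNat_append_inj (x := x) (y := y) (r := []) (r' := [])
  simpa using this

@[simp] theorem length_codeNat' (x : ℕ) : (codeNat x).length = x + 1 := length_codeNat x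

/-- The code of a stack operation. -/
def codeOp : StackOp ℕ → List Tok
  | .push b => .push :: codeNat b
  | .pop => [.pop]

theorem codeRaw_append (δ : PDTransition ℕ ℕ) (r : List Tok) : codeRaw δ ++ r =
    codeNat δ.src ++ (codeNat δ.top ++ (codeNat δ.dst ++ (codeOp δ.op ++ r))) := by
  obtain ⟨q, x, q', b | _⟩ := δ <;> simp [codeRaw, codeOp]

section

variable {ι : Type} [DecidableEq ι] {p : Prog ι} {e : ι ≃ Fin (n + 1)} {k : List (Prog ι)}
  {s : ι → List Tok}

theorem Decides.fork_max {q r : Prog ι} (h : Decides p e (q :: k) s P T a)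
    (h' : Decides p e (r :: k) s P' T' a) :
    Decides p e (.fork q r :: k) s (P ∧ P') (max T T' + 2) a :=
  Decides.fork (Decides.le h (le_max_left _ _)) (Decides.le h' (le_max_right _ _))

/-- Skip the code of a transition on stack `i`. -/
theorem Decides.skipTr {i : ι} {δ : PDTransition ℕ ℕ} {r : List Tok} (hs : s i = codeRaw δ ++ r)
    {L : ℕ} (hL : (s i).length ≤ L) (h : Decides p e k (update s i r) P T a) :
    Decides p e (Prog.mvTr i none :: k) s P (T + 20 * L + 40) a :=
  Decides.le (Decides.mvTr_of (none_ne i) hs h) (by omega)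

/-- Skip the code of a formula on stack `i`, with auxiliary stack `c`. -/
theorem Decides.skipForm {i c : ι} (hic : i ≠ c) (hc : s c = []) {φ : RawFormula} {r : List Tok}
    (hs : s i = φ.code ++ r) {L : ℕ} (hL : (s i).length ≤ L)
    (h : Decides p e k (update s i r) P T a) :
    Decides p e (Prog.skipFormula i c :: k) s P (T + (30 * L * L + 70 * L) + 5) a := by
  refine Decides.le (Decides.skipFormula_of hic hc hs h) ?_
  have : (s i).length * (30 * (s i).length + 70) ≤ L * (30 * L + 70) := by gcongr
  have : L * (30 * L + 70) = 30 * L * L + 70 * L := by ring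
  omega

/-- Skip the code of a number on stack `i`. -/
theorem Decides.skipNat {i : ι} {x : ℕ} {r : List Tok} (hs : s i = codeNat x ++ r) {L : ℕ}
    (hL : (s i).length ≤ L) (h : Decides p e k (update s i r) P T a) :
    Decides p e (Prog.mvNat i none :: k) s P (T + 5 * L + 7) a :=
  Decides.le (Decides.mvNat_of (none_ne i) hs h) (by omega)

/-- Read the code of a number from stack `i`, and write it on the empty stack `j`. -/
theorem Decides.readNat {i j : ι} (hij : i ≠ j) {x : ℕ} {r : List Tok}
    (hs : s i = codeNat x ++ r) (hj : s j = []) {L : ℕ} (hL : (s i).length ≤ L)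
    (h : Decides p e k (update (update s i r) j (codeNat x).reverse) P T a) :
    Decides p e (Prog.mvNat i (some j) :: k) s P (T + 5 * L + 7) a :=
  Decides.le (Decides.mvNat_of (by simpa using hij.symm) hs (by simpa [hij.symm, hj] using h))
    (by omega)

/-- Skip the code of a stack operation on stack `i`. -/
def skipOp (i : ι) : Prog ι := br i fun
  | some .push => seq (pop i) (mvNat i none)
  | some .pop => pop i
  | _ => verdict false

theorem Decides.skipOp {i : ι} {o : StackOp ℕ} {r : List Tok} (hs : s i = codeOp o ++ r) {L : ℕ}
    (hL : (s i).length ≤ L) (h : Decides p e k (update s i r) P T a) :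
    Decides p e (Prog.skipOp i :: k) s P (T + 5 * L + 10) a := by
  cases o with
  | push b =>
    have hs' : s i = .push :: (codeNat b ++ r) := hs
    refine br_cons (T := T + 5 * L + 9) _ hs' (seq (Decides.pop (T := T + 5 * L + 7)
      (Decides.skipNat (x := b) (r := r) ?_ ?_ ?_)))
    · simp [hs']
    · simp only [update_self, List.length_tail]
      omega
    · simpa using h
  | pop =>
    have hs' : s i = .pop :: r := hs
    refine Decides.le (br_cons (T := T + 1) _ hs' (Decides.pop ?_)) (by omega)
    simpa [hs'] using h

end

/-- Compare the number on stack `frm` with the number of tokens on stack `dep`. -/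
def varTest : Prog Reg := seq (mvNat .frm (some .t1)) (lt .t1 .dep)

/-- With its end marker, the code of `x` has `x + 1` tokens; this is why `d` is represented by `d +
1` tokens. -/
theorem Decides.varTest {x d : ℕ} {r : List Tok} (hs : s .frm = codeNat x ++ r) (h1 : s .t1 = [])
    (hd : (s .dep).length = d + 1) {L : ℕ} (hL : (s .frm).length ≤ L) :
    Decides p e (Prog.varTest :: k) s (x < d) (10 * L + 11) a := by
  refine Decides.le (seq (Decides.readNat (i := Reg.frm) (j := Reg.t1) (by decide) hs h1 hL
    (Decides.congr ?_ (Decides.lt (i := Reg.t1) (j := Reg.dep) (by decide))))) ?_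
  · simp [hd]
  · have : x + 1 ≤ L := by rw [hs] at hL; simp at hL; omega
    simp
    omega

/-- Apply `varTest` to both numbers on stack `frm`. -/
def varsTest : Prog Reg := seq (fork varTest skip) (seq (mvNat .frm none) varTest)

theorem Decides.varsTest {x y d : ℕ} {r : List Tok} (hs : s .frm = codeNat x ++ (codeNat y ++ r))
    (h1 : s .t1 = []) (hd : (s .dep).length = d + 1) {L : ℕ} (hL : (s .frm).length ≤ L) :
    Decides p e (Prog.varsTest :: k) s (x < d ∧ y < d) (15 * L + 30) a := by
  have hlen : (codeNat y ++ r).length ≤ L := by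
    rw [hs, List.length_append] at hL
    omega
  refine Decides.le (seq (Decides.fork_max (Decides.varTest hs h1 hd hL)
    (Decides.skip (seq (Decides.skipNat hs hL
      (Decides.varTest (x := y) (r := r) (L := L) ?_ ?_ ?_ ?_)))))) (by omega)
  all_goals simp [*]
  simpa using hlen

/-- Test whether the formula on stack `frm` is well-formed; the number of available variables is one
less than the number of tokens on stack `dep`. -/
def formulaTest : Prog Reg := wh .frm (fun _ => true) <| br .frm fun
  | some .falsum => verdict true
  | some .equal => seq (pop .frm) varsTest
  | some .edge =>
    seq (pop .frm) (seq (fork (memTest .sys .frm) skip) (seq (mvTr .frm none) varsTest))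
  | some .jump => seq (pop .frm) varsTest
  | some .imp => seq (pop .frm) (fork skip (skipFormula .frm .t1))
  | some .all => seq (pop .frm) (push .dep .one)
  | _ => verdict false

/-- The loop is left only by verdicts: each path descends to one subformula and reaches at most one
atom, where the search for a transition costs the two alternations. What follows the formula on
stack `frm` is not inspected. -/
theorem Decides.formulaTest {R : RawSystem} {L : ℕ} (φ : RawFormula) {d : ℕ} {r r' : List Tok}
    (hf : s .frm = φ.code ++ r) (hL : (s .frm).length ≤ L) (h1 : s .t1 = [])
    (hd : (s .dep).length = d + 1) (hS : s .sys = codeRun R.items ++ .sep :: r')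
    (hSL : (s .sys).length ≤ L) :
    Decides p e (Prog.formulaTest :: k) s (R.WellFormed φ d) (φ.code.length * (30 * L * L + 200 * L + 100))
      2 := by
  generalize hU : 30 * L * L + 200 * L + 100 = U
  induction φ generalizing s d r with
  | falsum =>
    refine Decides.le (wh_true rfl (br_cons _ hf (accept (T := 0) trivial))) ?_
    simp [RawFormula.code]
    omega
  | equal x y =>
    have hf' : s .frm = .equal :: (codeNat x ++ (codeNat y ++ r)) := by simp [hf, RawFormula.code]
    refine Decides.le (wh_true rfl (br_cons _ hf' (seq (Decides.pop (Decides.varsTest (L := L)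
      (x := x) (y := y) (r := r) ?_ ?_ ?_ ?_))))) (T := 15 * L + 30 + 4) ?_
    any_goals simp [hf', h1, hd]
    · simp [hf'] at hL
      omega
    · simp only [RawFormula.code, List.cons_append, List.length_cons, Nat.succ_mul]
      omega
  | jump x y =>
    have hf' : s .frm = .jump :: (codeNat x ++ (codeNat y ++ r)) := by simp [hf, RawFormula.code]
    refine Decides.le (wh_true rfl (br_cons _ hf' (seq (Decides.pop (Decides.varsTest (L := L)
      (x := x) (y := y) (r := r) ?_ ?_ ?_ ?_))))) (T := 15 * L + 30 + 4) ?_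
    any_goals simp [hf', h1, hd]
    · simp [hf'] at hL
      omega
    · simp only [RawFormula.code, List.cons_append, List.length_cons, Nat.succ_mul]
      omega
  | edge δ x y =>
    have hf' : s .frm = .edge :: (codeRaw δ ++ (codeNat x ++ (codeNat y ++ r))) := by
      simp [hf, RawFormula.code]
    have hlen : (codeRaw δ ++ (codeNat x ++ (codeNat y ++ r))).length + 1 ≤ L := by
      rw [hf'] at hL
      exact hL
    refine Decides.le (wh_true rfl (br_cons _ hf' (seq (Decides.pop (seq (Decides.fork_max
      (P := δ ∈ R.items) (P' := x < d ∧ y < d)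
      (Decides.memTest (i := Reg.sys) (j := Reg.frm) (by decide) (L := L) (x := R.items)
        (r := .sep :: r') (r' := codeNat x ++ (codeNat y ++ r)) ?_ rfl (by simp) ?_ ?_)
      (Decides.skip (seq (Decides.skipTr (δ := δ) (L := L) (r := codeNat x ++ (codeNat y ++ r)) ?_ ?_
        (Decides.varsTest (L := L) (x := x) (y := y) (r := r) ?_ ?_ ?_ ?_)))))))))) ?_
    · simp [hS]
    · simp [hf']
    · simpa using hSL
    · simp [hf']
    · simp at hlen
      simp [hf']
      omega
    · simp
    · simp [h1]
    · simp [hd]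
    · simp at hlen
      simp
      omega
    · simp only [RawFormula.code, List.cons_append, List.length_cons, Nat.add_mul, one_mul]
      have : L * (20 * L + 50) = 20 * L * L + 50 * L := by ring
      have : 20 * L * L ≤ 30 * L * L := by gcongr; omega
      omega
  | imp φ ψ ihφ ihψ =>
    have hf' : s .frm = .imp :: (φ.code ++ (ψ.code ++ r)) := by simp [hf, RawFormula.code]
    have hlen : (φ.code ++ (ψ.code ++ r)).length + 1 ≤ L := by
      rw [hf'] at hL
      exact hL
    have hlen' : (ψ.code ++ r).length ≤ L := by
      rw [List.length_append] at hlen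
      omega
    refine Decides.le (wh_true rfl (br_cons _ hf' (seq (Decides.pop (Decides.fork_max
      (P := R.WellFormed φ d) (P' := R.WellFormed ψ d)
      (Decides.skip (ihφ (r := ψ.code ++ r) ?_ ?_ ?_ ?_ ?_ ?_))
      (Decides.skipForm (φ := φ) (r := ψ.code ++ r) (L := L) (by decide) ?_ ?_ ?_
        (ihψ (r := r) ?_ ?_ ?_ ?_ ?_ ?_))))))) ?_
    any_goals simp [hf', h1, hd, hS]
    · simp at hlen
      omega
    · simpa [hS] using hSL
    · simp at hlen
      omega
    · simpa using hlen'
    · simpa [hS] using hSL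
    · simp only [RawFormula.code, List.cons_append, List.length_cons, List.length_append,
        Nat.add_mul, one_mul]
      omega
  | all φ ih =>
    have hf' : s .frm = .all :: (φ.code ++ r) := by simp [hf, RawFormula.code]
    refine Decides.le (wh_true rfl (br_cons _ hf' (seq (Decides.pop (Decides.push
      (ih (r := r) (d := d + 1) ?_ ?_ ?_ ?_ ?_ ?_)))))) ?_
    any_goals simp [hf', h1, hd, hS]
    · rw [hf'] at hL
      simp at hL
      omega
    · simpa [hS] using hSL
    · simp only [RawFormula.code, List.length_cons, Nat.succ_mul]
      omega

end Prog

/-! ### Tests for pushdown systems and runs. -/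

namespace Prog

open Function Decides

variable {n : ℕ} {p : Prog Reg} {e : Reg ≃ Fin (n + 1)}
  {k : List (Prog Reg)} {s : Reg → List Tok} {P P' : Prop} {T T' a a' : ℕ}

/-- Test whether the transition on stack `sys` is in the specified range. -/
def itemTest : Prog Reg :=
  fork (seq (mvNat .sys (some .t1)) (lt .t1 .nq)) <|
  fork (seq (mvNat .sys none) (seq (mvNat .sys (some .t1)) (lt .t1 .ng))) <|
  fork (seq (mvNat .sys none) (seq (mvNat .sys none) (seq (mvNat .sys (some .t1)) (lt .t1 .nq)))) <|
  seq (mvNat .sys none) (seq (mvNat .sys none) (seq (mvNat .sys none) (br .sys fun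
    | some .push => seq (pop .sys) (fork (seq (mvNat .sys (some .t1)) (lt .t1 .ng))
        (seq (mvNat .sys (some .t1)) (seq flip (eqTest .t1 .bt))))
    | _ => verdict true)))

theorem Decides.itemTest {R : RawSystem} {δ : PDTransition ℕ ℕ} {r : List Tok}
    (hS : s .sys = codeRaw δ ++ r) {L : ℕ} (hL : (s .sys).length ≤ L) (h1 : s .t1 = [])
    (hq : s .nq = (codeNat R.states).reverse) (hg : s .ng = (codeNat R.symbols).reverse)
    (hb : s .bt = (codeNat R.bot).reverse) :
    Decides p e (itemTest :: k) s (δ.src < R.states ∧ δ.top < R.symbols ∧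
      δ.dst < R.states ∧ ∀ b, δ.op = .push b → b < R.symbols ∧ b ≠ R.bot) (40 * L + 60) (a + 1) := by
  rw [codeRaw_append] at hS
  obtain ⟨q, x, q', o⟩ := δ
  dsimp only at hS ⊢
  have hlen := hL
  rw [hS] at hlen
  simp only [List.length_append, length_codeNat] at hlen
  have test : ∀ {K : List (Prog Reg)} {s' : Reg → List Tok} {y m b : ℕ} {j : Reg} {r' : List Tok},
      Reg.t1 ≠ j → Reg.sys ≠ j → s' .sys = codeNat y ++ r' → (s' .sys).length ≤ L → s' .t1 = [] →
      s' j = (codeNat m).reverse →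
      Decides p e (Prog.seq (Prog.mvNat .sys (some .t1)) (Prog.lt .t1 j) :: K) s'
        (y < m) (10 * L + 11) b := by
    intro K s' y m b j r' hj hj' h2 h3 h4 h5
    refine Decides.le (seq (Decides.readNat (i := Reg.sys) (j := Reg.t1) (by decide) h2 h4 h3
      (Decides.congr ?_ (Decides.lt hj)))) ?_
    · simp [hj.symm, hj'.symm, h5]
    · have : y + 1 ≤ L := by rw [h2] at h3; simp at h3; omega
      simp
      omega
  refine Decides.le (Decides.fork_max (test (by decide) (by decide) hS hL h1 hq)
    (Decides.fork_max (seq (Decides.skipNat hS hL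
      (test (y := x) (r' := codeNat q' ++ (codeOp o ++ r)) (by decide) (by decide) ?_ ?_ ?_ ?_)))
    (Decides.fork_max (seq (Decides.skipNat hS hL
      (seq (Decides.skipNat (x := x) (r := codeNat q' ++ (codeOp o ++ r)) (L := L) ?_ ?_
      (test (y := q') (r' := codeOp o ++ r) (by decide) (by decide) ?_ ?_ ?_ ?_)))))
    (seq (Decides.skipNat hS hL
      (seq (Decides.skipNat (x := x) (r := codeNat q' ++ (codeOp o ++ r)) (L := L) ?_ ?_
      (seq (Decides.skipNat (x := q') (r := codeOp o ++ r) (L := L) ?_ ?_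
      (T := 12 * L + 30) ?_))))))))) ?_
  any_goals simp [h1, hq, hg]
  any_goals omega
  cases o with
  | pop =>
    exact br_cons (T := 12 * L + 29) .pop (l := r) (by simp [codeOp]) (accept (by simp))
  | push b =>
    have hP : (∀ b', StackOp.push b = .push b' → b' < R.symbols ∧ b' ≠ R.bot) ↔
        b < R.symbols ∧ ¬ b = R.bot := by
      simp
    simp only [codeOp, List.length_cons, length_codeNat] at hlen
    refine Decides.le (br_cons .push (l := codeNat b ++ r) (by simp [codeOp]) (Decides.congr hP
      (seq (Decides.pop (Decides.fork_max (test (y := b) (r' := r) (m := R.symbols)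
        (by decide) (by decide) ?_ ?_ ?_ ?_)
      (seq (Decides.readNat (i := Reg.sys) (j := Reg.t1) (by decide) (x := b) (r := r) (L := L)
        ?_ ?_ ?_ (seq (Decides.flip (Decides.congr ?_
          (Decides.eqTest (i := Reg.t1) (j := Reg.bt) (by decide)))))))))))) ?_
    any_goals simp [h1, hg, hb, codeOp]
    any_goals omega

theorem allSuffix_iff_forall {α : Type} {R : α → Prop} {x : List α} :
    AllSuffix (fun u _ => R u) x ↔ ∀ u ∈ x, R u := by
  induction x with
  | nil => simp [AllSuffix]
  | cons u x ih => simp [AllSuffix, ih]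

/-- Find the topmost symbol that is left if as many symbols are removed at the end of the run on
stack `env` as there are tokens on stack `t3`, and compare it with stack `t1`. -/
def scanTest : Prog Reg :=
  seq (wh .env (isTok .item) (seq (pop .env) (seq (mvNat .env none) (seq (mvNat .env none)
    (seq (mvNat .env none) (br .env fun
      | some .push => seq (pop .env) (br .t3 fun
        | none => seq (mvNat .env (some .t2)) (eqTest .t1 .t2)
        | some _ => seq (pop .t3) (mvNat .env none))
      | _ => seq (pop .env) (push .t3 .one))))))) (eqTest .t1 .bt)

/-- The run is read backwards. Stack `t3` counts the symbols still to be removed: a pop adds one and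
a push takes one away. The first push met with count zero wrote the symbol in question; if there is
none, it is the bottom symbol. -/
theorem Decides.scanTest {R : RawSystem} {x : List (PDTransition ℕ ℕ)} {r : List Tok} {c t : ℕ}
    (hE : s .env = codeRun x ++ r) (hr : r.head? ≠ some .item) {L : ℕ} (hL : (s .env).length ≤ L)
    (h1 : s .t1 = (codeNat t).reverse) (htL : t + 1 ≤ L) (h2 : s .t2 = []) (h3 : (s .t3).length = c)
    (hb : s .bt = (codeNat R.bot).reverse) :
    Decides p e (scanTest :: k) s (t = R.topOf c x) (L * (20 * L + 60) + 6 * L + 10) a := by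
  suffices h : Decides p e (wh .env (isTok .item) (Prog.seq (Prog.pop .env)
      (Prog.seq (Prog.mvNat .env none) (Prog.seq (Prog.mvNat .env none)
      (Prog.seq (Prog.mvNat .env none) (Prog.br .env fun
        | some .push => Prog.seq (Prog.pop .env) (Prog.br .t3 fun
          | none => Prog.seq (Prog.mvNat .env (some .t2)) (Prog.eqTest .t1 .t2)
          | some _ => Prog.seq (Prog.pop .t3) (Prog.mvNat .env none))
        | _ => Prog.seq (Prog.pop .env) (Prog.push .t3 .one)))))) :: Prog.eqTest .t1 .bt :: k)
      s (t = R.topOf c x) ((s .env).length * (20 * L + 60) + 6 * L + 9) a by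
    refine Decides.le (seq h) ?_
    have := Nat.mul_le_mul_right (20 * L + 60) hL
    omega
  induction x generalizing s c with
  | nil =>
    refine Decides.le (wh_false (by simpa [isTok, hE] using hr) (Decides.congr ?_
      (Decides.eqTest (i := Reg.t1) (j := Reg.bt) (by decide)))) ?_
    · simp [h1, hb, RawSystem.topOf]
    · simp [h1]
      omega
  | cons δ x ih =>
    rw [codeRun_cons, codeRaw_append] at hE
    obtain ⟨q, y, q', o⟩ := δ
    dsimp only at hE
    have hlen := hL
    rw [hE] at hlen
    simp only [List.length_append, length_codeNat, List.length_cons] at hlen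
    have hM : (s .env).length = q + y + q' + 4 + (codeOp o).length + (codeRun x ++ r).length := by
      rw [hE]
      simp
      omega
    cases o with
    | pop =>
      simp only [codeOp, List.length_singleton] at hM hlen
      have htop : R.topOf c (⟨q, y, q', .pop⟩ :: x) = R.topOf (c + 1) x := by
        cases c <;> rfl
      rw [htop]
      refine Decides.le (wh_true (by simp [isTok, hE]) (seq (Decides.pop (seq
        (Decides.skipNat (L := L) (x := q)
          (r := codeNat y ++ (codeNat q' ++ .pop :: (codeRun x ++ r))) ?_ ?_
        (seq (Decides.skipNat (L := L) (x := y) (r := codeNat q' ++ .pop :: (codeRun x ++ r)) ?_ ?_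
        (seq (Decides.skipNat (L := L) (x := q') (r := .pop :: (codeRun x ++ r)) ?_ ?_
        (br_cons .pop (l := codeRun x ++ r) ?_
        (seq (Decides.pop (Decides.push (ih (c := c + 1) ?_ ?_ ?_ ?_ ?_ ?_)))))))))))))) ?_
      any_goals simp [hE, codeOp, h1, h2, h3, hb]
      any_goals omega
      simp only [Nat.add_mul]
      omega
    | push b =>
      simp only [codeOp, List.length_cons, length_codeNat] at hM hlen
      cases c with
      | zero =>
        rw [List.length_eq_zero_iff] at h3
        refine Decides.le (wh_true (by simp [isTok, hE]) <| seq <| Decides.pop <| seq <|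
          Decides.skipNat (L := L) (x := q)
            (r := codeNat y ++ (codeNat q' ++ .push :: (codeNat b ++ (codeRun x ++ r)))) ?_ ?_ <|
          seq <| Decides.skipNat (L := L) (x := y)
            (r := codeNat q' ++ .push :: (codeNat b ++ (codeRun x ++ r))) ?_ ?_ <|
          seq <| Decides.skipNat (L := L) (x := q')
            (r := .push :: (codeNat b ++ (codeRun x ++ r))) ?_ ?_ <|
          br_cons .push (l := codeNat b ++ (codeRun x ++ r)) ?_ <| seq <| Decides.pop <|
          br_of none ?_ <| seq <| Decides.readNat (i := Reg.env) (j := Reg.t2)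
            (by decide) (L := L) (x := b) (r := codeRun x ++ r) ?_ ?_ ?_ <|
          Decides.congr ?_ <| Decides.eqTest (i := Reg.t1) (j := Reg.t2) (by decide)) ?_
        any_goals simp [hE, codeOp, h1, h2, h3, RawSystem.topOf]
        any_goals omega
        refine le_trans ?_ (Nat.add_le_add_right (Nat.add_le_add_right
          (Nat.le_mul_of_pos_left _ (by omega)) _) _)
        omega
      | succ c =>
        obtain ⟨u, cs, hcs⟩ : ∃ u cs, s .t3 = u :: cs := List.exists_cons_of_length_eq_add_one h3
        have hcs' : cs.length = c := by simpa [hcs] using h3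
        refine Decides.le (wh_true (by simp [isTok, hE]) <| seq <| Decides.pop <| seq <|
          Decides.skipNat (L := L) (x := q)
            (r := codeNat y ++ (codeNat q' ++ .push :: (codeNat b ++ (codeRun x ++ r)))) ?_ ?_ <|
          seq <| Decides.skipNat (L := L) (x := y)
            (r := codeNat q' ++ .push :: (codeNat b ++ (codeRun x ++ r))) ?_ ?_ <|
          seq <| Decides.skipNat (L := L) (x := q')
            (r := .push :: (codeNat b ++ (codeRun x ++ r))) ?_ ?_ <|
          br_cons .push (l := codeNat b ++ (codeRun x ++ r)) ?_ <| seq <| Decides.pop <|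
          br_of (some u) ?_ <| seq <| Decides.pop <| Decides.skipNat (L := L) (x := b)
            (r := codeRun x ++ r) ?_ ?_ <| ih (c := c) ?_ ?_ ?_ ?_ ?_ ?_) ?_
        any_goals simp [hE, codeOp, h1, h2, hcs, hb, hcs']
        any_goals omega
        simp only [Nat.add_mul]
        omega

/-- Test whether the transition on stack `env` can be applied at the end of the run below. -/
def stepTest : Prog Reg :=
  fork (memTest .sys .env) <|
  fork (seq (mvNat .env (some .t1)) <| seq (mvNat .env none) <| seq (mvNat .env none) <|
    seq (skipOp .env) <| br .env fun
      | some .item => seq (pop .env) <| seq (mvNat .env none) <| seq (mvNat .env none) <|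
          seq (mvNat .env (some .t2)) (eqTest .t1 .t2)
      | _ => eqTest .t1 .st) <|
  fork (seq (mvNat .env none) <| seq (mvNat .env (some .t1)) <| seq (mvNat .env none) <|
    seq (skipOp .env) scanTest) <|
  seq (mvNat .env none) <| seq (mvNat .env (some .t1)) <| seq (mvNat .env none) <| br .env fun
    | some .pop => seq flip (eqTest .t1 .bt)
    | _ => verdict true

/-- The four conditions in `Applicable` are tested on four branches. Each branch has its own copy of
the stacks and may consume them. -/
theorem Decides.stepTest {R : RawSystem} {δ : PDTransition ℕ ℕ} {x : List (PDTransition ℕ ℕ)}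
    {r r' : List Tok} (hE : s .env = codeRaw δ ++ (codeRun x ++ r)) (hr : r.head? = some .sep)
    {L : ℕ} (hL : (s .env).length ≤ L) (hS : s .sys = codeRun R.items ++ .sep :: r')
    (hSL : (s .sys).length ≤ L) (h1 : s .t1 = []) (h2 : s .t2 = []) (h3 : s .t3 = [])
    (hb : s .bt = (codeNat R.bot).reverse) (hi : s .st = (codeNat R.init).reverse) :
    Decides p e (stepTest :: k) s (R.Applicable δ x) (L * (20 * L + 60) + 60 * L + 200) 2 := by
  have hE' := hE
  rw [codeRaw_append] at hE
  obtain ⟨q, y, q', o⟩ := δ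
  dsimp only at hE
  have hlen := hL
  rw [hE] at hlen
  simp only [List.length_append, length_codeNat] at hlen
  have hmul : L * (20 * L + 60) = L * (20 * L + 50) + 10 * L := by ring
  refine Decides.le (Decides.fork_max
    (Decides.memTest (a := 0) (i := Reg.sys) (j := Reg.env) (by decide) (L := L) (x := R.items)
      (r := .sep :: r') (r' := codeRun x ++ r) hS rfl (by simp) hE' hSL) <|
    Decides.fork_max
    (seq <| Decides.readNat (i := Reg.env) (j := Reg.t1) (by decide) hE h1 hL <|
      seq <| Decides.skipNat (L := L) (x := y) (r := codeNat q' ++ (codeOp o ++ (codeRun x ++ r)))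
        ?_ ?_ <|
      seq <| Decides.skipNat (L := L) (x := q') (r := codeOp o ++ (codeRun x ++ r)) ?_ ?_ <|
      seq <| Decides.skipOp (L := L) (o := o) (r := codeRun x ++ r) ?_ ?_
        (T := 30 * L + 115) ?_) <|
    Decides.fork_max
    (seq <| Decides.skipNat hE hL <| seq <| Decides.readNat (i := Reg.env) (j := Reg.t1)
        (by decide) (L := L) (x := y) (r := codeNat q' ++ (codeOp o ++ (codeRun x ++ r))) ?_ ?_ ?_ <|
      seq <| Decides.skipNat (L := L) (x := q') (r := codeOp o ++ (codeRun x ++ r)) ?_ ?_ <|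
      seq <| Decides.skipOp (L := L) (o := o) (r := codeRun x ++ r) ?_ ?_ <|
      Decides.scanTest (L := L) (R := R) (x := x) (r := r) (c := 0) (t := y) ?_ ?_ ?_ ?_ ?_ ?_ ?_ ?_)
    (seq <| Decides.skipNat hE hL <| seq <| Decides.readNat (i := Reg.env) (j := Reg.t1)
        (by decide) (L := L) (x := y) (r := codeNat q' ++ (codeOp o ++ (codeRun x ++ r))) ?_ ?_ ?_ <|
      seq <| Decides.skipNat (L := L) (x := q') (r := codeOp o ++ (codeRun x ++ r)) ?_ ?_
        (T := 6 * L + 20) ?_)) ?_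
  any_goals simp [h1, h2, h3, hb, hr]
  any_goals omega
  -- The source state is compared with the target of the previous transition or, at the start of the
  -- run, with the initial state.
  case refine_7 =>
    have hqL : q + 1 ≤ L := by omega
    cases x with
    | nil =>
      refine Decides.le (br_of (some .sep) (by simp [hr]) <| Decides.congr ?_ <|
        Decides.eqTest (i := Reg.t1) (j := Reg.st) (by decide)) ?_
      · simp [hi, RawSystem.stateOf]
      · simp
        omega
    | cons δ' x =>
      have hx : (codeRun (δ' :: x)).length = δ'.src + δ'.top + δ'.dst + 4 +
          (codeOp δ'.op).length + (codeRun x).length := by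
        rw [← List.append_nil (codeRun (δ' :: x)), codeRun_cons, codeRaw_append]
        simp
        omega
      rw [codeRun_cons, codeRaw_append]
      refine Decides.le (br_cons .item
        (l := codeNat δ'.src ++ (codeNat δ'.top ++ (codeNat δ'.dst ++ (codeOp δ'.op ++
          (codeRun x ++ r))))) ?_ <| seq <| Decides.pop <|
        seq <| Decides.skipNat (L := L) (x := δ'.src)
          (r := codeNat δ'.top ++ (codeNat δ'.dst ++ (codeOp δ'.op ++ (codeRun x ++ r)))) ?_ ?_ <|
        seq <| Decides.skipNat (L := L) (x := δ'.top)
          (r := codeNat δ'.dst ++ (codeOp δ'.op ++ (codeRun x ++ r))) ?_ ?_ <|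
        seq <| Decides.readNat (i := Reg.env) (j := Reg.t2) (by decide) (L := L) (x := δ'.dst)
          (r := codeOp δ'.op ++ (codeRun x ++ r)) ?_ ?_ ?_ <| Decides.congr ?_ <|
          Decides.eqTest (i := Reg.t1) (j := Reg.t2) (by decide)) ?_
      any_goals simp [h2, RawSystem.stateOf]
      any_goals omega
  -- A pop needs two symbols on the stack; as the bottom symbol is never pushed, it suffices that
  -- the topmost symbol is a different one.
  case refine_28 =>
    cases o with
    | pop =>
      refine Decides.le (br_cons .pop (l := codeRun x ++ r) ?_ <| Decides.congr ?_ <| seq <|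
        Decides.flip (a := 1) <| Decides.eqTest (i := Reg.t1) (j := Reg.bt) (by decide)) ?_
      any_goals simp [codeOp, hb]
      omega
    | push b =>
      exact Decides.le (br_cons .push (l := codeNat b ++ (codeRun x ++ r)) (by simp [codeOp])
        (accept (T := 0) (by simp))) (by omega)

/-- Test whether the list of transitions on stack `env` is a run. -/
def runTest : Prog Reg := forTr .env stepTest

theorem Decides.runTest {R : RawSystem} {x : List (PDTransition ℕ ℕ)} {r r' : List Tok}
    (hE : s .env = codeRun x ++ r) (hr : r.head? = some .sep)
    {L : ℕ} (hL : (s .env).length ≤ L) (hS : s .sys = codeRun R.items ++ .sep :: r')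
    (hSL : (s .sys).length ≤ L) (h1 : s .t1 = []) (h2 : s .t2 = []) (h3 : s .t3 = [])
    (hb : s .bt = (codeNat R.bot).reverse) (hi : s .st = (codeNat R.init).reverse) :
    Decides p e (runTest :: k) s (R.IsRun x) (40 * L * L + 200 * L + 300) 2 := by
  refine Decides.le (Decides.forTr hE (by simp [hr]) hL (T := L * (20 * L + 60) + 60 * L + 200)
    fun K δ y hy => Decides.stepTest (r := r) (r' := r') (by simp) hr (by simpa using hy)
      (by simpa using hS) (by simpa using hSL) (by simpa using h1) (by simpa using h2)
      (by simpa using h3) (by simpa using hb) (by simpa using hi)) ?_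
  have : L * (20 * L + 50) + L * (20 * L + 60) = 40 * L * L + 110 * L := by ring
  omega

/-- Test whether the transitions on stack `sys` are in the specified range. -/
def itemsTest : Prog Reg := forTr .sys itemTest

theorem Decides.itemsTest {R : RawSystem} {r : List Tok}
    (hS : s .sys = codeRun R.items ++ .sep :: r) {L : ℕ} (hL : (s .sys).length ≤ L)
    (h1 : s .t1 = []) (hq : s .nq = (codeNat R.states).reverse)
    (hg : s .ng = (codeNat R.symbols).reverse) (hb : s .bt = (codeNat R.bot).reverse) :
    Decides p e (itemsTest :: k) s (∀ δ ∈ R.items, δ.src < R.states ∧ δ.top < R.symbols ∧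
      δ.dst < R.states ∧ ∀ b, δ.op = .push b → b < R.symbols ∧ b ≠ R.bot)
      (20 * L * L + 90 * L + 70) 1 := by
  refine Decides.le (Decides.congr allSuffix_iff_forall.symm <| Decides.forTr hS (by simp) hL
    (T := 40 * L + 60) fun K δ y hy => Decides.itemTest (a := 0) (r := codeRun y ++ .sep :: r)
      (by simp) (by simpa using hy) (by simpa using h1) (by simpa using hq) (by simpa using hg)
      (by simpa using hb)) ?_
  have : L * (20 * L + 50) = 20 * L * L + 50 * L := by ring
  omega

/-- Test whether the bottom symbol and the initial state are in the specified range. -/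
def headerTest : Prog Reg := fork (lt .bt .ng) (lt .st .nq)

theorem Decides.headerTest {R : RawSystem} (hq : s .nq = (codeNat R.states).reverse)
    (hg : s .ng = (codeNat R.symbols).reverse) (hb : s .bt = (codeNat R.bot).reverse)
    (hi : s .st = (codeNat R.init).reverse) :
    Decides p e (headerTest :: k) s (R.bot < R.symbols ∧ R.init < R.states)
      (5 * R.bot + 5 * R.init + 10) a := by
  refine Decides.le (Decides.congr ?_ <| Decides.fork_max
    (Decides.lt (i := Reg.bt) (j := Reg.ng) (by decide))
    (Decides.lt (i := Reg.st) (j := Reg.nq) (by decide))) ?_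
  · simp [hq, hg, hb, hi]
  · simp [hb, hi]
    omega

end Prog

/-! ### Values of variables and the jump test. -/

namespace Prog

open Function Decides

section

variable {ι : Type} [DecidableEq ι] {n : ℕ} {p : Prog ι} {e : ι ≃ Fin (n + 1)}
  {k : List (Prog ι)} {s : ι → List Tok} {P P' : Prop} {T T' a a' : ℕ}

/-- Test for a token that is not a separator. -/
def notSep : Option Tok → Bool
  | none => false
  | some .sep => false
  | some _ => true

theorem notSep_of_mem_codeRun {x : List (PDTransition ℕ ℕ)} {t : Tok} (h : t ∈ codeRun x) :
    notSep (some t) = true := by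
  simp only [codeRun, List.mem_flatMap, List.mem_cons] at h
  obtain ⟨δ, -, rfl | h⟩ := h
  · rfl
  · obtain ⟨q, y, q', b | _⟩ := δ <;>
    · simp [codeRaw, codeNat] at h
      rcases h with h | h
      all_goals simp_all [notSep]
      try aesop

/-- Move the tokens up to the next separator from stack `i` to stack `o`, if any. -/
def mvBlock (i : ι) (o : Option ι) : Prog ι :=
  wh i notSep <| br i fun
    | some t => seq (emit o t) (pop i)
    | none => skip

theorem Decides.mvBlock {i : ι} {o : Option ι} (hi : o ≠ some i) {l r : List Tok}
    (hs : s i = l ++ r) (hl : ∀ t ∈ l, notSep (some t) = true) (hr : notSep r.head? = false)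
    (h : Decides p e k (emits o l (update s i r)) P T a) :
    Decides p e (mvBlock i o :: k) s P (T + 6 * l.length + 1) a := by
  induction l generalizing s with
  | nil =>
    have hs' : update s i r = s := by rw [← List.nil_append r, ← hs, update_eq_self]
    rw [hs', emits_nil] at h
    exact wh_false (by simpa [hs] using hr) h
  | cons t l ih =>
    have := ih (s := emits o [t] (update s i (l ++ r))) ?_ (fun u hu => hl u (by simp [hu])) ?_
    · refine Decides.le (wh_true (by simpa [hs] using hl t (by simp)) <|
        br_cons t (l := l ++ r) (by simpa using hs) <| seq <| Decides.emit <| Decides.pop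
        (T := T + 6 * l.length + 1) ?_) (by simp; omega)
      rw [update_emits hi, emits_apply_of_ne hi, hs]
      exact this
    · rw [emits_apply_of_ne hi, update_self]
    · rw [update_emits hi, emits_emits, update_idem]
      exact h

end

variable {n : ℕ} {p : Prog Reg} {e : Reg ≃ Fin (n + 1)}
  {k : List (Prog Reg)} {s : Reg → List Tok} {P P' : Prop} {T T' a a' : ℕ}

/-- The code of a list of runs. -/
def codeRuns (xs : List (List (PDTransition ℕ ℕ))) : List Tok :=
  xs.flatMap fun x => .sep :: (codeRun x).reverse

@[simp] theorem codeRuns_nil : codeRuns [] = [] := rfl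

theorem codeRuns_cons (x : List (PDTransition ℕ ℕ)) (xs : List (List (PDTransition ℕ ℕ))) :
    codeRuns (x :: xs) = .sep :: ((codeRun x).reverse ++ codeRuns xs) := by
  simp [codeRuns]

theorem reverse_codeRuns_append (x : List (PDTransition ℕ ℕ))
    (xs : List (List (PDTransition ℕ ℕ))) :
    (codeRuns (xs ++ [x])).reverse = codeRun x ++ .sep :: (codeRuns xs).reverse := by
  simp [codeRuns]

theorem notSep_head_codeRuns (xs : List (List (PDTransition ℕ ℕ))) :
    notSep (codeRuns xs).head? = false := by
  cases xs <;> rfl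

/-- Read the number of a variable from stack `frm`, and copy its value from stack `i` to
stack `j`. -/
def getVar (i j : Reg) : Prog Reg :=
  seq (mvNat .frm (some .t3)) <| seq (pop .t3) <|
  seq (wh .t3 Option.isSome <| seq (pop .t3) (seq (pop i) (mvBlock i none))) <| br i fun
    | none => verdict false
    | some _ => seq (pop i) (mvBlock i (some j))

/-- The number of the variable is counted down on stack `t3` while one block after the other is
skipped. If the number is out of range, the program ends on an empty stack and rejects, in
accordance with `xs[v]?` being `none`. -/
theorem Decides.getVar {i j : Reg} (hif : i ≠ .frm) (hi3 : i ≠ .t3) (hjf : j ≠ .frm)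
    (hj3 : j ≠ .t3) (hij : i ≠ j) {v : ℕ} {r : List Tok} (hf : s .frm = codeNat v ++ r)
    (h3 : s .t3 = []) {xs : List (List (PDTransition ℕ ℕ))} (hi : s i = codeRuns xs)
    (hj : s j = []) {L : ℕ} (hL : (s .frm).length ≤ L) (hL' : (s i).length ≤ L)
    {P : List (PDTransition ℕ ℕ) → Prop}
    (h : ∀ x s', xs[v]? = some x → s' .frm = r → s' j = codeRun x →
      (∀ z, z ≠ i → z ≠ j → z ≠ .frm → s' z = s z) → Decides p e k s' (P x) T a) :
    Decides p e (getVar i j :: k) s (∃ x, xs[v]? = some x ∧ P x) (T + 30 * L + 50) a := by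
  suffices H : ∀ (s : Reg → List Tok) xs v, s .frm = r → s .t3 = List.replicate v .one →
      s i = codeRuns xs → s j = [] →
      (∀ x s', xs[v]? = some x → s' .frm = r → s' j = codeRun x →
        (∀ z, z ≠ i → z ≠ j → z ≠ .frm → z ≠ .t3 → s' z = s z) → s' .t3 = [] →
        Decides p e k s' (P x) T a) →
      Decides p e (wh .t3 Option.isSome (Prog.seq (Prog.pop .t3) (Prog.seq (Prog.pop i)
        (Prog.mvBlock i none))) :: Prog.br i (fun
        | none => Prog.verdict false
        | some _ => Prog.seq (Prog.pop i) (Prog.mvBlock i (some j))) :: k) s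
        (∃ x, xs[v]? = some x ∧ P x) (T + 6 * (codeRuns xs).length + 10 * v + 10) a by
    have hv : v + 1 ≤ L := by
      rw [hf] at hL
      simp at hL
      omega
    refine Decides.le (seq <| Decides.readNat (by decide) hf h3 hL <| seq <| Decides.pop <| seq <|
      H _ xs v ?_ ?_ ?_ ?_ ?_) ?_
    · simp
    · simp [codeNat]
    · simpa [hif, hi3] using hi
    · simpa [hjf, hj3] using hj
    · intro x s' h1 h2 h4 h5 h6
      refine h x s' h1 h2 h4 fun z hzi hzj hzf => ?_
      by_cases hz3 : z = .t3
      · rw [hz3, h6, h3]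
      · simpa [hz3, hzf] using h5 z hzi hzj hzf hz3
    · rw [← hi]
      omega
  clear hf h3 hi hj hL hL' h
  intro s xs v hf h3 hi hj h
  induction v generalizing s xs with
  | zero =>
    refine Decides.le (wh_false (by simp [h3]) ?_) (T := T + 6 * (codeRuns xs).length + 9) (by omega)
    cases xs with
    | nil =>
      exact br_of none (by simp [hi]) (reject (by simp))
    | cons x xs =>
      rw [codeRuns_cons] at hi
      refine Decides.le (br_cons .sep hi <| seq <| Decides.pop <| Decides.congr ?_ <|
        Decides.mvBlock (P := P x) (l := (codeRun x).reverse) (r := codeRuns xs)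
          (by simpa using hij.symm) ?_ ?_ (notSep_head_codeRuns xs) <|
        h x _ (by simp) ?_ ?_ ?_ ?_) ?_
      · simp
      · simp [hi]
      · intro t ht
        exact notSep_of_mem_codeRun (List.mem_reverse.1 ht)
      · simp [hjf.symm, hif.symm, hf]
      · simp [hij.symm, hj]
      · intro z h1 h2 h4 h5
        simp [h1, h2]
      · simp [hj3.symm, hi3.symm, h3]
      · rw [codeRuns_cons]
        simp
        omega
  | succ v ih =>
    have h3' : s .t3 = .one :: List.replicate v .one := by rw [h3, List.replicate_succ]
    cases xs with
    | nil =>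
      refine Decides.le (wh_true (by simp [h3']) <| seq <| Decides.pop <| seq <| Decides.pop <|
        Decides.mvBlock (none_ne i) (l := []) (r := []) ?_ (by simp) rfl <| Decides.congr ?_ <|
        ih _ [] ?_ ?_ ?_ ?_ ?_) ?_
      any_goals simp [hi, h3', hif.symm, hi3, hi3.symm, hf, hj3, hij.symm, hj]
      omega
    | cons x xs =>
      rw [codeRuns_cons] at hi
      refine Decides.le (wh_true (by simp [h3']) <| seq <| Decides.pop <| seq <| Decides.pop <|
        Decides.mvBlock (none_ne i) (l := (codeRun x).reverse) (r := codeRuns xs) ?_ ?_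
          (notSep_head_codeRuns xs) <| Decides.congr ?_ <| ih _ xs ?_ ?_ ?_ ?_ ?_) ?_
      any_goals simp [hi, h3', hif.symm, hi3, hi3.symm, hf, hj3, hij.symm, hj]
      · intro t ht
        exact notSep_of_mem_codeRun ht
      · intro y s' h1 h2 h4 h5 h6
        refine h y s' (by simpa using h1) h2 h4 (fun z hz1 hz2 hz3 hz4 => ?_) h6
        simpa [hz1, hz4] using h5 z hz1 hz2 hz3 hz4
      · rw [codeRuns_cons]
        simp
        omega

/-- Test whether the run on stack `t1` is obtained from that on stack `t2` by removing the last
transitions, up to the one that has pushed a symbol whose position in the stack is the number of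
tokens on stack `t3`. -/
def unwindTest : Prog Reg :=
  seq (wh .t3 Option.isSome <| br .t2 fun
    | some _ => seq (pop .t2) <| seq (mvNat .t2 none) <| seq (mvNat .t2 none) <|
        seq (mvNat .t2 none) <| br .t2 fun
        | some .push => seq (pop .t2) <| seq (mvNat .t2 none) (pop .t3)
        | _ => seq (pop .t2) (push .t3 .one)
    | none => verdict false) (eqTest .t1 .t2)

/-- The run is read backwards as in `scanTest`. When the counter on `t3` reaches zero, the remaining
run is compared with `x`. -/
theorem Decides.unwindTest {x y : List (PDTransition ℕ ℕ)} {c : ℕ} (h1 : s .t1 = codeRun x)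
    (h2 : s .t2 = codeRun y) (h3 : (s .t3).length = c) {L : ℕ} (hL1 : (s .t1).length ≤ L)
    (hL : (s .t2).length ≤ L) :
    Decides p e (unwindTest :: k) s (RawSystem.unwind c y = some x) (L * (20 * L + 60) + 6 * L + 10)
      a := by
  suffices h : Decides p e (wh .t3 Option.isSome (Prog.br .t2 fun
      | some _ => Prog.seq (Prog.pop .t2) <| Prog.seq (Prog.mvNat .t2 none) <|
          Prog.seq (Prog.mvNat .t2 none) <| Prog.seq (Prog.mvNat .t2 none) <| Prog.br .t2 fun
          | some .push => Prog.seq (Prog.pop .t2) <| Prog.seq (Prog.mvNat .t2 none) (Prog.pop .t3)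
          | _ => Prog.seq (Prog.pop .t2) (Prog.push .t3 .one)
      | none => Prog.verdict false) :: Prog.eqTest .t1 .t2 :: k) s (RawSystem.unwind c y = some x)
      ((s .t2).length * (20 * L + 60) + 6 * L + 9) a by
    refine Decides.le (seq h) ?_
    have := Nat.mul_le_mul_right (20 * L + 60) hL
    omega
  induction y generalizing s c with
  | nil =>
    cases c with
    | zero =>
      rw [List.length_eq_zero_iff] at h3
      refine Decides.le (wh_false (by simp [h3]) <| Decides.congr ?_ <|
        Decides.eqTest (i := Reg.t1) (j := Reg.t2) (by decide)) ?_
      · rw [h1, h2, codeRun_inj, RawSystem.unwind, Option.some.injEq]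
        exact eq_comm
      · omega
    | succ c =>
      refine Decides.le (wh_true (T := 1) ?_ <| br_of none (by simp [h2]) <|
        reject (T := 0) (by simp [RawSystem.unwind])) (by omega)
      obtain ⟨u, cs, hcs⟩ : ∃ u cs, s .t3 = u :: cs := List.exists_cons_of_length_eq_add_one h3
      simp [hcs]
  | cons δ y ih =>
    cases c with
    | zero =>
      rw [List.length_eq_zero_iff] at h3
      refine Decides.le (wh_false (by simp [h3]) <| Decides.congr ?_ <|
        Decides.eqTest (i := Reg.t1) (j := Reg.t2) (by decide)) ?_
      · rw [h1, h2, codeRun_inj, RawSystem.unwind, Option.some.injEq]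
        exact eq_comm
      · omega
    | succ c =>
    obtain ⟨u, cs, hcs⟩ : ∃ u cs, s .t3 = u :: cs := List.exists_cons_of_length_eq_add_one h3
    have hcs' : cs.length = c := by simpa [hcs] using h3
    rw [← List.append_nil (codeRun _), codeRun_cons, codeRaw_append, List.append_nil] at h2
    obtain ⟨q, z, q', o⟩ := δ
    dsimp only at h2
    have hlen := hL
    rw [h2] at hlen
    simp only [List.length_append, length_codeNat, List.length_cons] at hlen
    have hM : (s .t2).length = q + z + q' + 4 + (codeOp o).length + (codeRun y).length := by
      rw [h2]
      simp
      omega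
    cases o with
    | pop =>
      simp only [codeOp, List.length_singleton] at hM hlen
      refine Decides.le (wh_true (by simp [hcs]) <| br_cons .item h2 <| seq <| Decides.pop <| seq <|
        Decides.skipNat (L := L) (x := q)
          (r := codeNat z ++ (codeNat q' ++ .pop :: codeRun y)) ?_ ?_ <| seq <|
        Decides.skipNat (L := L) (x := z) (r := codeNat q' ++ .pop :: codeRun y) ?_ ?_ <| seq <|
        Decides.skipNat (L := L) (x := q') (r := .pop :: codeRun y) ?_ ?_ <|
        br_cons .pop (l := codeRun y) ?_ <| seq <| Decides.pop <| Decides.push <|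
        ih (c := c + 2) ?_ ?_ ?_ ?_ ?_) ?_
      any_goals simp [h2, codeOp, h1, hcs, hcs']
      any_goals omega
      · rw [h1] at hL1
        exact hL1
      · simp only [Nat.add_mul]
        omega
    | push b =>
      simp only [codeOp, List.length_cons, length_codeNat] at hM hlen
      refine Decides.le (wh_true (by simp [hcs]) <| br_cons .item h2 <| seq <| Decides.pop <| seq <|
        Decides.skipNat (L := L) (x := q)
          (r := codeNat z ++ (codeNat q' ++ .push :: (codeNat b ++ codeRun y))) ?_ ?_ <| seq <|
        Decides.skipNat (L := L) (x := z)
          (r := codeNat q' ++ .push :: (codeNat b ++ codeRun y)) ?_ ?_ <| seq <|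
        Decides.skipNat (L := L) (x := q') (r := .push :: (codeNat b ++ codeRun y)) ?_ ?_ <|
        br_cons .push (l := codeNat b ++ codeRun y) ?_ <| seq <| Decides.pop <| seq <|
        Decides.skipNat (L := L) (x := b) (r := codeRun y) ?_ ?_ <| Decides.pop <|
        ih (c := c) ?_ ?_ ?_ ?_ ?_) ?_
      any_goals simp [h2, codeOp, h1, hcs, hcs']
      any_goals omega
      · rw [h1] at hL1
        exact hL1
      · simp only [Nat.add_mul]
        omega

/-- Test whether the runs on stacks `t1` and `t2` are in the jump relation. -/
def jumpTest : Prog Reg := br .t2 fun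
  | some _ => seq (pop .t2) <| seq (mvNat .t2 none) <| seq (mvNat .t2 none) <|
      seq (mvNat .t2 none) <| br .t2 fun
      | some .pop => seq (pop .t2) (seq (push .t3 .one) unwindTest)
      | _ => verdict false
  | none => verdict false

theorem Decides.jumpTest {x y : List (PDTransition ℕ ℕ)} (h1 : s .t1 = codeRun x)
    (h2 : s .t2 = codeRun y) (h3 : s .t3 = []) {L : ℕ} (hL1 : (s .t1).length ≤ L)
    (hL : (s .t2).length ≤ L) :
    Decides p e (jumpTest :: k) s (RawSystem.IsJump x y) (L * (20 * L + 60) + 30 * L + 60) a := by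
  cases y with
  | nil =>
    exact Decides.le (br_of none (by simp [h2]) <| reject (T := 0) (by simp [RawSystem.IsJump]))
      (by omega)
  | cons δ y =>
    rw [← List.append_nil (codeRun _), codeRun_cons, codeRaw_append, List.append_nil] at h2
    obtain ⟨q, z, q', o⟩ := δ
    dsimp only at h2
    have hlen := hL
    rw [h2] at hlen
    simp only [List.length_append, length_codeNat, List.length_cons] at hlen
    rw [h1] at hL1
    refine Decides.le (br_cons .item h2 <| seq <| Decides.pop <| seq <|
      Decides.skipNat (L := L) (x := q)
        (r := codeNat z ++ (codeNat q' ++ (codeOp o ++ codeRun y))) ?_ ?_ <| seq <|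
      Decides.skipNat (L := L) (x := z) (r := codeNat q' ++ (codeOp o ++ codeRun y)) ?_ ?_ <| seq <|
      Decides.skipNat (L := L) (x := q') (r := codeOp o ++ codeRun y) ?_ ?_
        (T := L * (20 * L + 60) + 12 * L + 20) ?_) ?_
    any_goals simp [h2]
    any_goals omega
    cases o with
    | pop =>
      refine Decides.le (br_cons .pop (l := codeRun y) ?_ <| seq <| Decides.pop <| seq <|
        Decides.push <| Decides.unwindTest (L := L) (x := x) (y := y) (c := 1) ?_ ?_ ?_ ?_ ?_) ?_
      any_goals simp [codeOp, h1, h3, hL1]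
      any_goals omega
    | push b =>
      exact Decides.le (br_cons .push (l := codeNat b ++ codeRun y) (by simp [codeOp]) <|
        reject (T := 0) (by simp [RawSystem.IsJump])) (by omega)

end Prog

/-! ### Evaluation of formulas. -/

namespace Prog

open Function Decides

variable {n : ℕ} {p : Prog Reg} {e : Reg ≃ Fin (n + 1)}
  {k : List (Prog Reg)} {s : Reg → List Tok} {P P' : Prop} {T T' a a' : ℕ}

theorem length_codeRun_le {x : List (PDTransition ℕ ℕ)} {xs : List (List (PDTransition ℕ ℕ))}
    (h : x ∈ xs) : (codeRun x).length ≤ (codeRuns xs).length := by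
  obtain ⟨l, r, rfl⟩ := List.append_of_mem h
  simp [codeRuns]
  omega

/-- Copy the values of the two variables on stack `frm` to stacks `t1` and `t2`, then execute `q`. -/
def atom (q : Prog Reg) : Prog Reg :=
  seq (pourTwo .env .t4 .t5) <| seq (getVar .t4 .t1) <| seq (getVar .t5 .t2) q

/-- Looking up a variable consumes the stack that is searched, so the environment is first poured
onto two stacks. This also reverses it into the order of the variables. -/
theorem Decides.atom {q : Prog Reg} {i j : ℕ} {r : List Tok}
    (hf : s .frm = codeNat i ++ (codeNat j ++ r)) {xs : List (List (PDTransition ℕ ℕ))}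
    (hE : s .env = (codeRuns xs).reverse) (h1 : s .t1 = []) (h2 : s .t2 = []) (h3 : s .t3 = [])
    (h4 : s .t4 = []) (h5 : s .t5 = []) {L : ℕ} (hL : (s .frm).length ≤ L)
    (hL' : (s .env).length ≤ L) {P : List (PDTransition ℕ ℕ) → List (PDTransition ℕ ℕ) → Prop}
    (h : ∀ x y s', (codeRun x).length ≤ L → (codeRun y).length ≤ L → s' .t1 = codeRun x →
      s' .t2 = codeRun y → s' .t3 = [] → s' .t6 = s .t6 → Decides p e (q :: k) s' (P x y) T a) :
    Decides p e (atom q :: k) s (∃ x, xs[i]? = some x ∧ ∃ y, xs[j]? = some y ∧ P x y)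
      (T + 70 * L + 110) a := by
  have hlen := hL'
  rw [hE, List.length_reverse] at hlen
  have hx : ∀ {v : ℕ} {x}, xs[v]? = some x → (codeRun x).length ≤ L := fun h =>
    (length_codeRun_le (List.mem_of_getElem? h)).trans hlen
  refine Decides.le (seq <| Decides.pourTwo (by decide) (by decide) (by decide) <| seq <|
    Decides.getVar (xs := xs) (v := i) (r := codeNat j ++ r) (L := L) (by decide) (by decide)
      (by decide) (by decide) (by decide) ?_ ?_ ?_ ?_ ?_ ?_
      fun x s₁ hx₁ hf₁ ht₁ hs₁ => seq <|
    Decides.getVar (xs := xs) (v := j) (r := r) (L := L) (by decide) (by decide)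
      (by decide) (by decide) (by decide) hf₁ ?_ ?_ ?_ ?_ ?_
      fun y s₂ hx₂ hf₂ ht₂ hs₂ => h x y s₂ (hx hx₁) (hx hx₂) ?_ ht₂ ?_ ?_) ?_
  · simp [hf]
  · simp [h3]
  · simp [hE, h4]
  · simp [h1]
  · simpa using hL
  · simp [hE, h4, hlen]
  · simp [hs₁, h3]
  · simp [hs₁, hE, h5]
  · simp [hs₁, h2]
  · rw [hf, List.length_append] at hL
    rw [hf₁]
    omega
  · simp [hs₁, hE, h5, hlen]
  · simp [hs₂, ht₁]
  · simp [hs₂, hs₁, h3]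
  · simp [hs₂, hs₁]
  · omega

/-- The stacks contain the arguments of the program `eval`. -/
structure EvalState (R : RawSystem) (m l : ℕ) (xs : List (List (PDTransition ℕ ℕ)))
    (s : Reg → List Tok) : Prop where
  env : s .env = (codeRuns xs).reverse
  fuel : s .fuel = List.replicate l .one
  wd : (s .wd).length = m
  sys : ∃ r, s .sys = codeRun R.items ++ .sep :: r
  bt : s .bt = (codeNat R.bot).reverse
  st : s .st = (codeNat R.init).reverse
  t1 : s .t1 = []
  t2 : s .t2 = []
  t3 : s .t3 = []
  t4 : s .t4 = []
  t5 : s .t5 = []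
  t6 : s .t6 = []

/-- Guess a run with a code of bounded length on stack `env`. -/
def guessRun : Prog Reg :=
  seq (scalePow .wd .t1 .fuel .t2 2) <| seq (push .env .sep) <| seq (guess .fuel .t1 .env) <|
  seq flip <| seq (mvRun .env (some .t1)) <| seq (br .env fun
    | some .sep => skip
    | _ => verdict false) <| seq (pour .t1 .env) (fork runTest flip)

/-- Test whether the formula on stack `frm` is satisfied by the runs on stack `env`, where
quantification is restricted to runs with codes of bounded length. -/
def eval : Prog Reg := wh .frm (fun _ => true) <| br .frm fun
  | some .equal => seq (pop .frm) (atom (eqTest .t1 .t2))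
  | some .edge => seq (pop .frm) <| seq (mvTr .frm (some .t6)) <|
      atom (seq (pour .t6 .t1) (seq (push .t1 .item) (eqTest .t1 .t2)))
  | some .jump => seq (pop .frm) (atom jumpTest)
  | some .imp => seq (pop .frm) (seq flip (fork skip (seq (skipFormula .frm .t3) flip)))
  | some .all => seq (pop .frm) guessRun
  | _ => verdict false

/-- The number of quantifiers of a formula. -/
def RawFormula.quantifiers : RawFormula → ℕ
  | .imp φ ψ => φ.quantifiers + ψ.quantifiers
  | .all φ => φ.quantifiers + 1
  | _ => 0

/-- The number of atoms, connectives and quantifiers of a formula. -/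
def RawFormula.size : RawFormula → ℕ
  | .imp φ ψ => φ.size + ψ.size + 1
  | .all φ => φ.size + 1
  | _ => 1

theorem mem_runToks_of_mem_codeRun {x : List (PDTransition ℕ ℕ)} {t : Tok} (h : t ∈ codeRun x) :
    t ∈ runToks := by
  have h1 := notSep_of_mem_codeRun h
  simp only [codeRun, List.mem_flatMap, List.mem_cons] at h
  obtain ⟨δ, -, rfl | h⟩ := h
  · simp [runToks]
  · obtain ⟨q, y, q', b | _⟩ := δ <;>
    · simp [codeRaw, codeNat] at h
      simp [runToks]
      tauto

theorem append_sep_inj {l l' r r' : List Tok} (hl : Tok.sep ∉ l) (hl' : Tok.sep ∉ l') :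
    l ++ .sep :: r = l' ++ .sep :: r' ↔ l = l' ∧ r = r' := by
  induction l generalizing l' with
  | nil => cases l' with
    | nil => simp
    | cons t l' => simp_all
  | cons t l ih => cases l' with
    | nil => simp_all [eq_comm]
    | cons t' l' =>
      simp only [List.mem_cons, not_or] at hl hl'
      simp [ih hl.2 hl'.2, and_assoc]

theorem evalState_update_frm {R : RawSystem} {m l : ℕ} {xs : List (List (PDTransition ℕ ℕ))}
    {f : List Tok} : EvalState R m l xs (update s .frm f) ↔ EvalState R m l xs s := by
  constructor <;> rintro ⟨h1, h2, h3, h4, h5, h6, h7, h8, h9, h10, h11, h12⟩ <;>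
    constructor <;> simpa using by assumption

/-- After the universal choice of a word `X`, the mode is changed, and it is decided whether `X` is
the code of a run that violates `φ`. One branch tests the run with two alternations and halts; only
the other one continues with `φ`, after changing the mode back. The cost of a quantifier is
therefore constant, whatever the length of the run. -/
theorem Decides.guessRun {R : RawSystem} {m l : ℕ} {xs : List (List (PDTransition ℕ ℕ))}
    (hs : EvalState R m l xs s) {φ : RawFormula} {L : ℕ}
    (hS : (s .sys).length ≤ L) (hm : m ≤ L) (hE : (s .env).length + 2 ^ m * l + 1 ≤ L)
    (h : ∀ x s', EvalState R m (2 ^ m * l) (xs ++ [x]) s' → s' .frm = s .frm → s' .sys = s .sys →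
      (s' .env).length ≤ (s .env).length + (2 ^ m * l + 1) →
      Decides p e k s' (R.Sat (2 ^ m) φ (2 ^ m * l) (xs ++ [x])) T (a + 2)) :
    Decides p e (guessRun :: k) s
      (R.Sat (2 ^ m) (.all φ) l xs) (T + (100 * L * L + 400 * L + 500)) (a + 4) := by
  generalize hl' : 2 ^ m * l = l' at *
  -- `P0 X` states that `X` is a counterexample. Guessed words that are not codes of runs are
  -- harmless.
  set P0 : List Tok → Prop := fun X => ∃ x, X = codeRun x ∧ R.IsRun x ∧
    ¬ R.Sat (2 ^ m) φ l' (xs ++ [x]) with hP0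
  have hP : R.Sat (2 ^ m) (.all φ) l xs ↔
      ∀ X : List Tok, (∀ t ∈ X, t ∈ runToks) → X.length ≤ l' → ¬ P0 X := by
    rw [RawSystem.Sat, hl']
    constructor
    · rintro H X - hX ⟨x, rfl, h1, h2⟩
      exact h2 (H x hX h1)
    · intro H x hx h1
      by_contra h2
      exact H _ (fun t => mem_runToks_of_mem_codeRun) hx ⟨x, rfl, h1, h2⟩
  obtain ⟨r', hsys⟩ := hs.sys
  refine Decides.congr hP <| Decides.le (seq <| Decides.scalePow (l := l) (by decide) (by decide)
    (by decide) (by decide) (by decide) (by decide) hs.t1 hs.t2 (by decide) hs.fuel <| seq <|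
    Decides.push <| seq <| Decides.guess (l := l') (by decide) (by decide) (by decide) ?_ ?_
    (T := T + (70 * L * L + 320 * L + 400)) fun X hX hXl => ?_) ?_
  · simp [hs.t1]
  · simp [hs.wd, hl']
  · have hX' : Tok.sep ∉ X := fun h => by simpa [runToks] using hX _ h
    have hlen : (X ++ .sep :: (s .env)).length ≤ L := by
      simp
      omega
    refine Decides.le (seq <| flip <| seq <| Decides.congr ?_ <|
      Decides.mvRun (P := P0 X) (L := L) (T := T + (50 * L * L + 250 * L + 350)) (by decide) ?_
        fun x r₁ h1 h2 => seq ?_) ?_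
    · refine iff_and_self.2 ?_
      rintro ⟨x, rfl, -⟩
      exact ⟨x, .sep :: s .env, by simp, by simp⟩
    · simpa using hlen
    · replace h1 : X ++ .sep :: (s .env) = codeRun x ++ r₁ := by simpa using h1
      -- Reading items stops at the separator written before the guess if and only if the whole of
      -- `X` is the code of a list of transitions.
      by_cases hr : r₁.head? = some .sep
      · obtain ⟨r₂, rfl⟩ : ∃ r₂, r₁ = .sep :: r₂ := by
          cases r₁ with
          | nil => simp at hr
          | cons t r₂ => exact ⟨r₂, by simpa using hr⟩
        have hx' : Tok.sep ∉ codeRun x := fun h => by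
          simpa [notSep] using notSep_of_mem_codeRun h
        obtain ⟨rfl, rfl⟩ := (append_sep_inj hX' hx').1 h1
        have hPx : P0 (codeRun x) ↔ R.IsRun x ∧ ¬ R.Sat (2 ^ m) φ l' (xs ++ [x]) := by
          rw [hP0]
          simp [codeRun_inj]
        refine Decides.congr hPx ?_
        refine Decides.le (br_of (some .sep) (by simp) <| Decides.skip <| seq <|
          Decides.pour (by decide) <| Decides.fork_max (Decides.mono (a := 2) (a' := a + 3)
            (Decides.runTest (R := R) (x := x) (r := .sep :: s .env) (r' := r') (L := L)
              ?_ ?_ ?_ ?_ ?_ ?_ ?_ ?_ ?_ ?_) Iff.rfl le_rfl (by omega)) <|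
            flip <| h x _ ⟨?_, ?_, ?_, ?_, ?_, ?_, ?_, ?_, ?_, ?_, ?_, ?_⟩ ?_ ?_ ?_) ?_
        any_goals simp [hs.t1, hs.t2, hs.t3, hs.bt, hs.st, hs.t4, hs.t5, hs.t6, hsys, hs.env, hs.wd,
          reverse_codeRuns_append]
        · rw [hs.env] at hlen
          simpa using hlen
        · simpa [hsys] using hS
        · simp [hl']
        · omega
        · simp only [List.length_append] at hlen
          have : 50 * L * L = 40 * L * L + 10 * (L * L) := by ring
          omega
      · have hPx : ¬ P0 X := by
          rintro ⟨x', rfl, -⟩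
          have := (codeRun_append_inj (by simp) h2).1 h1
          rw [← this.2] at hr
          exact hr rfl
        refine Decides.le (br (T := 0) ?_) (by simp only [Nat.add_eq]; omega)
        split
        · rename_i h'
          simp at h'
          exact absurd h' hr
        · exact reject hPx
    · have : (X ++ .sep :: (s .env)).length * (20 * L + 50) ≤ L * (20 * L + 50) :=
        Nat.mul_le_mul_right _ hlen
      have : L * (20 * L + 50) = 20 * L * L + 50 * L := by ring
      have : 70 * L * L = 50 * L * L + 20 * L * L := by ring
      simp only [update_self, ne_eq, reduceCtorEq, not_false_eq_true, update_of_ne]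
      omega
  · have : (s .wd).length * ((9 * 2 + 4) * (2 ^ (s .wd).length * l) + 20) ≤ L * (22 * L + 20) := by
      rw [hs.wd, hl']
      gcongr
      omega
    have : L * (22 * L + 20) = 22 * L * L + 20 * L := by ring
    have : 100 * L * L = 70 * L * L + 22 * L * L + 8 * L * L := by ring
    omega

/-- `B` bounds the fuel after all quantifiers of `φ`, and each quantifier adds at most `B + 1`
tokens to the environment. Hence `L` bounds the stacks that are read throughout. Along a path each
step into a subformula costs at most four alternations, as the two parts of an implication lie on
different branches. -/
theorem Decides.eval {R : RawSystem} {m L B : ℕ} (φ : RawFormula) {l : ℕ}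
    {xs : List (List (PDTransition ℕ ℕ))} {r : List Tok} (hs : EvalState R m l xs s)
    (hf : s .frm = φ.code ++ r) (hL : (s .frm).length ≤ L) (hS : (s .sys).length ≤ L) (hm : m ≤ L)
    (hB : (2 ^ m) ^ φ.quantifiers * l ≤ B)
    (hE : (s .env).length + φ.quantifiers * (B + 1) ≤ L) :
    Decides p e (eval :: k) s (R.Sat (2 ^ m) φ l xs)
      (φ.code.length * (200 * L * L + 1000 * L + 1000)) (4 * φ.size) := by
  generalize hU : 200 * L * L + 1000 * L + 1000 = U
  have hU' : L * (20 * L + 60) = 20 * L * L + 60 * L := by ring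
  have hU'' : 200 * L * L = 20 * L * L + 180 * (L * L) := by ring
  have hEL : (s .env).length ≤ L := by omega
  induction φ generalizing s l xs r with
  | falsum =>
    refine Decides.le (wh_true rfl <| br_cons _ hf <| reject (T := 0) (by simp [RawSystem.Sat])) ?_
    simp [RawFormula.code]
    omega
  | equal i j =>
    have hf' : s .frm = .equal :: (codeNat i ++ (codeNat j ++ r)) := by simp [hf, RawFormula.code]
    rw [hf', List.length_cons] at hL
    refine Decides.le (wh_true rfl <| br_cons _ hf' <| seq <| Decides.pop <|
      Decides.atom (i := i) (j := j) (r := r) (xs := xs) (L := L) (T := 6 * L + 3) ?_ ?_ ?_ ?_ ?_ ?_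
        ?_ ?_ ?_ fun x y s' hx hy h1 h2 h3 h6 => Decides.le (Decides.congr
        (by rw [h1, h2, codeRun_inj]) <|
        Decides.eqTest (i := Reg.t1) (j := Reg.t2) (by decide)) (by rw [h1]; omega)) ?_
    any_goals simp [hf', hs.env, hs.t1, hs.t2, hs.t3, hs.t4, hs.t5]
    · simp at hL
      omega
    · simpa [hs.env] using hEL
    · simp only [RawFormula.code, List.cons_append, List.length_cons, Nat.add_mul, one_mul]
      omega
  | jump i j =>
    have hf' : s .frm = .jump :: (codeNat i ++ (codeNat j ++ r)) := by simp [hf, RawFormula.code]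
    rw [hf', List.length_cons] at hL
    refine Decides.le (wh_true rfl <| br_cons _ hf' <| seq <| Decides.pop <|
      Decides.atom (i := i) (j := j) (r := r) (xs := xs) (L := L)
        (T := L * (20 * L + 60) + 30 * L + 60) ?_ ?_ ?_ ?_ ?_ ?_
        ?_ ?_ ?_ fun x y s' hx hy h1 h2 h3 h6 => Decides.jumpTest h1 h2 h3 (L := L) (by rwa [h1])
        (by rwa [h2])) ?_
    any_goals simp [hf', hs.env, hs.t1, hs.t2, hs.t3, hs.t4, hs.t5]
    · simp at hL
      omega
    · simpa [hs.env] using hEL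
    · simp only [RawFormula.code, List.cons_append, List.length_cons, Nat.add_mul, one_mul]
      omega
  | edge δ i j =>
    have hf' : s .frm = .edge :: (codeRaw δ ++ (codeNat i ++ (codeNat j ++ r))) := by
      simp [hf, RawFormula.code]
    rw [hf', List.length_cons] at hL
    have hlen := hL
    rw [List.length_append] at hlen
    refine Decides.le (wh_true rfl <| br_cons _ hf' <| seq <| Decides.pop <| seq <|
      Decides.mvTr_of (δ := δ) (r := codeNat i ++ (codeNat j ++ r)) (by decide) ?_ <|
      Decides.atom (i := i) (j := j) (r := r) (xs := xs) (L := L) (T := 20 * L + 20) ?_ ?_ ?_ ?_ ?_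
        ?_ ?_ ?_ ?_ fun x y s' hx hy h1 h2 h3 h6 => Decides.le (seq <|
        Decides.pour (by decide) <| seq <| Decides.push <| Decides.congr (P' := δ :: x = y)
        (by
          rw [← codeRun_inj, ← List.append_nil (codeRun (δ :: x)), codeRun_cons, List.append_nil]
          simp [h1, h2, h6, hs.t6]) <|
        Decides.eqTest (i := Reg.t1) (j := Reg.t2) (by decide)) (by
          simp [h1, h6, hs.t6]
          omega)) ?_
    any_goals simp [hf', hs.env, hs.t1, hs.t2, hs.t3, hs.t4, hs.t5]
    · simp at hlen
      omega
    · simpa [hs.env] using hEL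
    · simp only [RawFormula.code, List.cons_append, List.length_cons, Nat.add_mul, one_mul]
      simp at hlen
      omega
  | imp φ ψ ihφ ihψ =>
    have hf' : s .frm = .imp :: (φ.code ++ (ψ.code ++ r)) := by simp [hf, RawFormula.code]
    rw [hf', List.length_cons] at hL
    have hlen : (ψ.code ++ r).length ≤ L := by
      rw [List.length_append] at hL
      omega
    simp only [RawFormula.quantifiers] at hB hE
    have hg : ∀ {i j : ℕ}, i ≤ j → (2 ^ m) ^ j * l ≤ B → (2 ^ m) ^ i * l ≤ B := fun h h' =>
      (Nat.mul_le_mul_right _ (Nat.pow_le_pow_right (by positivity) h)).trans h'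
    simp only [Nat.add_mul] at hE
    -- The implication is decided as `¬(φ ∧ ¬ψ)`. A path enters only one of the two conjuncts, so
    -- the maximum of their alternations counts.
    refine Decides.le (Decides.mono (a := max (4 * φ.size) (4 * ψ.size + 1) + 1)
      (a' := 4 * (RawFormula.imp φ ψ).size) (wh_true rfl <| br_cons _ hf' <| seq <| Decides.pop <|
      seq <| flip <| Decides.fork_max
        (Decides.skip <| Decides.mono (ihφ (r := ψ.code ++ r) (l := l) (xs := xs) ?_ ?_ ?_ ?_
          (hg (by omega) hB) ?_ ?_) Iff.rfl le_rfl ?_)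
        (seq <| Decides.skipForm (φ := φ) (r := ψ.code ++ r) (L := L) (by decide) ?_ ?_ ?_ <|
          Decides.mono (flip <| ihψ (r := r) (l := l) (xs := xs) ?_ ?_ ?_ ?_
            (hg (by omega) hB) ?_ ?_) Iff.rfl le_rfl ?_)) ?_ le_rfl ?_) ?_
    any_goals simp [evalState_update_frm, hs, hf', hs.t3, hS]
    any_goals omega
    · simp at hL
      omega
    · simp at hL
      omega
    · simpa using hlen
    · rfl
    · simp only [RawFormula.size]
      omega
    · simp only [RawFormula.code, List.cons_append, List.length_cons, List.length_append,
        Nat.add_mul, one_mul]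
      have : 30 * L * L = 30 * (L * L) := by ring
      have : 20 * L * L = 20 * (L * L) := by ring
      omega
  | all φ ih =>
    have hf' : s .frm = .all :: (φ.code ++ r) := by simp [hf, RawFormula.code]
    rw [hf', List.length_cons] at hL
    simp only [RawFormula.quantifiers] at hB hE
    rw [pow_succ, mul_assoc] at hB
    rw [Nat.add_mul, one_mul] at hE
    have hl : 2 ^ m * l ≤ B := le_trans (Nat.le_mul_of_pos_left _ (by positivity)) hB
    refine Decides.le (Decides.mono (a := 4 * φ.size + 4) (a' := 4 * (RawFormula.all φ).size)
      (wh_true rfl <| br_cons _ hf' <| seq <| Decides.pop <|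
      Decides.guessRun (m := m) (l := l) (xs := xs) (φ := φ) (L := L) ?_ ?_ hm ?_
        fun x s' h1 h2 h3 h4 => Decides.mono (ih (r := r) h1
          (by simpa [hf'] using h2) (by simp [h2, hf']; simp at hL; omega) (by simpa [h3] using hS) hB
          (by simp at h4; omega) (by simp at h4; omega)) Iff.rfl le_rfl
          (by omega)) Iff.rfl le_rfl ?_) ?_
    any_goals simp [evalState_update_frm, hs, hf', hS]
    any_goals omega
    · simp only [RawFormula.size]
      omega
    · simp only [RawFormula.code, List.length_cons, Nat.add_mul, one_mul]
      have : 200 * L * L = 100 * L * L + 100 * (L * L) := by ring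
      omega

end Prog

/-! ### Parsing and the complete program. -/

namespace Prog

/-- The code of a numbered pushdown system. -/
def _root_.RawSystem.code (R : RawSystem) : List Tok :=
  codeNat R.states ++ (codeNat R.symbols ++ (codeNat R.bot ++ (codeNat R.init ++
    (codeRun R.items ++ [.sep]))))

/-- Unique readability. It makes the size of the formula, and with it the alternation bound, a
function of the input word. -/
theorem code_append_code_inj {R R' : RawSystem} {φ φ' : RawFormula} {r r' : List Tok} :
    R.code ++ (φ.code ++ r) = R'.code ++ (φ'.code ++ r') ↔ (R = R' ∧ φ = φ') ∧ r = r' := by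
  obtain ⟨q, g, b, i, x⟩ := R
  obtain ⟨q', g', b', i', x'⟩ := R'
  simp only [RawSystem.code, List.append_assoc, codeNat_append_inj, RawSystem.mk.injEq,
    List.singleton_append]
  rw [codeRun_append_inj (by simp) (by simp), List.cons_inj_right, RawFormula.code_append_inj]
  tauto

/-- The word `w` codes a pushdown system and a sentence that holds if quantification is restricted
to runs with codes of bounded length. -/
def BoundedModelChecking (w : List Tok) : Prop :=
  ∃ (R : RawSystem) (φ : RawFormula), w = R.code ++ φ.code ∧ R.Ok ∧ R.WellFormed φ 0 ∧
    R.Sat (2 ^ w.length) φ (2 ^ 2 ^ (11 * w.length)) []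

theorem RawFormula.quantifiers_le (φ : RawFormula) : φ.quantifiers ≤ φ.code.length := by
  induction φ with
  | imp φ ψ ih ih' =>
    simp only [quantifiers, code, List.cons_append, List.length_cons, List.length_append]
    omega
  | all φ ih => simpa [quantifiers, code] using ih
  | _ => simp [quantifiers]

open Function Decides

variable {n : ℕ} {p : Prog Reg} {e : Reg ≃ Fin (n + 1)}
  {k : List (Prog Reg)} {s : Reg → List Tok} {P P' : Prop} {T T' a a' : ℕ}

/-- When the property itself implies that the stack starts with a code, the rejection of other
stacks is already correct. -/
theorem Decides.mvNat_const {i : Reg} {o : Option Reg} (hi : o ≠ some i) {L : ℕ}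
    (hL : (s i).length ≤ L) (hP : P → ∃ x r, s i = codeNat x ++ r)
    (h : ∀ x r, s i = codeNat x ++ r → Decides p e k (emits o (codeNat x) (update s i r)) P T a) :
    Decides p e (Prog.mvNat i o :: k) s P (T + 5 * L + 7) a := by
  refine Decides.le (Decides.congr ?_ (Decides.mvNat hi (P := fun _ _ => P) h)) (by omega)
  refine ⟨fun h' => ?_, fun ⟨_, _, _, h'⟩ => h'⟩
  obtain ⟨x, r, hx⟩ := hP h'
  exact ⟨x, r, hx, h'⟩

/-- Compute the bound on the lengths of the codes of runs. -/
def initFuel : Prog Reg :=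
  seq (push .z .one) <| seq (scalePow .wd .t1 .z .t2 2048) <| seq (push .fuel .one) <|
    scalePow .z .t1 .fuel .t2 2

/-- Since `2048 = 2 ^ 11`, the first loop produces `2 ^ (11 * m)` tokens on `z`. The second one
doubles the fuel once for each of them. -/
theorem Decides.initFuel {m : ℕ} (hw : (s .wd).length = m) (h1 : s .t1 = []) (h2 : s .t2 = [])
    (hf : s .fuel = []) (hz : s .z = []) {L : ℕ} (hL : 2 ^ 2 ^ (11 * m) ≤ L)
    (h : ∀ s', s' .fuel = List.replicate (2 ^ 2 ^ (11 * m)) .one →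
      (∀ i, i ≠ .fuel → i ≠ .z → s' i = s i) → Decides p e k s' P T a) :
    Decides p e (initFuel :: k) s P (T + (18500 * L * L + 50 * L + 50)) a := by
  have h11 : 2048 ^ m = 2 ^ (11 * m) := by
    rw [pow_mul]
    norm_num
  have hm : m ≤ 2 ^ (11 * m) :=
    Nat.lt_two_pow_self.le.trans (Nat.pow_le_pow_right (by omega) (by omega))
  have hm' : 2 ^ (11 * m) ≤ L := Nat.lt_two_pow_self.le.trans hL
  refine Decides.le (seq <| Decides.push <| seq <| Decides.scalePow (l := 1) (by decide) (by decide)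
    (by decide) (by decide) (by decide) (by decide) ?_ ?_ (by decide) ?_ <| seq <| Decides.push <|
    Decides.scalePow (l := 1) (by decide) (by decide)
    (by decide) (by decide) (by decide) (by decide) ?_ ?_ (by decide) ?_ <| h _ ?_ ?_) ?_
  any_goals simp [h1, h2, hf, hz, hw]
  · rw [h11]
  · intro i h3 h4
    simp [h3, h4]
  · rw [h11]
    have e1 : m * (18436 * 2 ^ (11 * m) + 20) ≤ L * (18436 * L + 20) := by
      gcongr
      omega
    have e2 : 2 ^ (11 * m) * (22 * 2 ^ 2 ^ (11 * m) + 20) ≤ L * (22 * L + 20) := by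
      gcongr
    have e3 : L * (18436 * L + 20) = 18436 * (L * L) + 20 * L := by ring
    have e4 : L * (22 * L + 20) = 22 * (L * L) + 20 * L := by ring
    have e5 : 18500 * L * L = 18500 * (L * L) := by ring
    omega

/-- Perform the tests on the parsed input. -/
def check : Prog Reg :=
  fork (fork headerTest itemsTest) <|
  fork (seq (push .dep .one) formulaTest) (seq initFuel eval)

theorem Decides.check {R : RawSystem} {φ : RawFormula} {m L : ℕ} (hw : (s .wd).length = m)
    (hS : s .sys = codeRun R.items ++ .sep :: φ.code) (hf : s .frm = φ.code)
    (hq : s .nq = (codeNat R.states).reverse) (hg : s .ng = (codeNat R.symbols).reverse)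
    (hb : s .bt = (codeNat R.bot).reverse) (hi : s .st = (codeNat R.init).reverse)
    (h1 : s .t1 = []) (h2 : s .t2 = []) (h3 : s .t3 = []) (h4 : s .t4 = []) (h5 : s .t5 = [])
    (h6 : s .t6 = []) (hE : s .env = []) (hF : s .fuel = []) (hz : s .z = []) (hd : s .dep = [])
    (hbm : R.bot ≤ m) (him : R.init ≤ m) (hSm : (s .sys).length ≤ m)
    (hL : φ.quantifiers * ((2 ^ m) ^ φ.quantifiers * 2 ^ 2 ^ (11 * m) + 1) ≤ L)
    (hL' : m + 2 ^ 2 ^ (11 * m) ≤ L) :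
    Decides p e (check :: k) s
      (R.Ok ∧ R.WellFormed φ 0 ∧ R.Sat (2 ^ m) φ (2 ^ 2 ^ (11 * m)) [])
      (300 * L * L * L + 20000 * L * L + 2000 * L + 1000) (4 * φ.size + 2) := by
  have hmL : m ≤ L := (Nat.le_add_right _ _).trans hL'
  have hfL : 2 ^ 2 ^ (11 * m) ≤ L := (Nat.le_add_left _ _).trans hL'
  have hfm : φ.code.length ≤ L := by
    rw [hS] at hSm
    simp at hSm
    omega
  have hSL : (codeRun R.items).length + (φ.code.length + 1) ≤ L := by
    rw [hS] at hSm
    simp at hSm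
    omega
  refine Decides.le (Decides.fork_max (Decides.fork_max (Decides.headerTest hq hg hb hi)
    (Decides.mono (Decides.itemsTest hS (L := L) ?_ ?_ hq hg hb) Iff.rfl le_rfl (by omega))) <|
    Decides.fork_max (seq <| Decides.push <| Decides.mono (Decides.formulaTest φ (r := [])
      (d := 0) (L := L) ?_ ?_ ?_ ?_ (r' := φ.code) ?_ ?_) Iff.rfl le_rfl (by omega))
    (seq <| Decides.initFuel (m := m) hw h1 h2 hF hz (L := L) ?_ fun s' hs1 hs2 =>
      Decides.mono (Decides.eval (R := R) (m := m) (L := L) φ (xs := []) (r := []) ⟨?_, hs1, ?_,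
        ⟨φ.code, ?_⟩, ?_, ?_, ?_, ?_, ?_, ?_, ?_, ?_⟩ ?_ ?_ ?_ ?_ le_rfl ?_) Iff.rfl le_rfl
        (by omega))) ?_
  any_goals simp [*]
  have e1 : φ.code.length * (200 * L * L + 1000 * L + 1000) ≤
      L * (200 * L * L + 1000 * L + 1000) := by gcongr
  have e2 : L * (200 * L * L + 1000 * L + 1000) = 200 * (L * L * L) + 1000 * (L * L) + 1000 * L := by
    ring
  have e3 : φ.code.length * (30 * L * L + 200 * L + 100) ≤ L * (30 * L * L + 200 * L + 100) := by
    gcongr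
  have e4 : L * (30 * L * L + 200 * L + 100) = 30 * (L * L * L) + 200 * (L * L) + 100 * L := by
    ring
  have e5 : 300 * L * L * L = 300 * (L * L * L) := by ring
  have e6 : 20000 * L * L = 20000 * (L * L) := by ring
  have e7 : 18500 * L * L = 18500 * (L * L) := by ring
  have e8 : 20 * L * L = 20 * (L * L) := by ring
  omega

/-- Parse the list of transitions and the formula on stack `inp`, then perform the tests. -/
def parse : Prog Reg :=
  seq (dup .inp .t1 .sys) <| seq (mvRun .inp none) <| br .inp fun
  | some .sep => seq (pop .inp) <| seq (dup .inp .t1 .frm) <| seq (skipFormula .inp .t1) <|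
      br .inp fun
      | none => check
      | some _ => verdict false
  | _ => verdict false

theorem Decides.parse {w r : List Tok} {L q g b i : ℕ}
    (hL : w.length * ((2 ^ w.length) ^ w.length * 2 ^ 2 ^ (11 * w.length) + 1) ≤ L)
    (hL' : w.length + 2 ^ 2 ^ (11 * w.length) ≤ L)
    (ha : ∀ (R : RawSystem) (φ : RawFormula), w = R.code ++ φ.code → 4 * φ.size + 2 ≤ a)
    (hw : w = codeNat q ++ (codeNat g ++ (codeNat b ++ (codeNat i ++ r))))
    (h : ∀ j, s j = match j with
      | .inp => r
      | .wd => w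
      | .nq => (codeNat q).reverse
      | .ng => (codeNat g).reverse
      | .bt => (codeNat b).reverse
      | .st => (codeNat i).reverse
      | _ => []) :
    Decides p e (parse :: k) s (BoundedModelChecking w)
      (300 * L * L * L + 25000 * L * L + 2500 * L + 2000) a := by
  have hwL : w.length ≤ L := (Nat.le_add_right _ _).trans hL'
  -- Every positive instance can be parsed, so it is correct to reject when parsing fails.
  have hQ : BoundedModelChecking w → ∃ (x : List (PDTransition ℕ ℕ)) (φ : RawFormula),
      r = codeRun x ++ .sep :: φ.code := by
    rintro ⟨R, φ, h, -⟩
    rw [hw] at h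
    simp only [RawSystem.code, List.append_assoc, codeNat_append_inj] at h
    exact ⟨R.items, φ, by simpa using h.2.2.2.2⟩
  have hr : r.length + (q + 1) + (g + 1) + (b + 1) + (i + 1) = w.length := by
    rw [hw]
    simp
    omega
  have e1 : L * (20 * L + 50) = 20 * (L * L) + 50 * L := by ring
  have e2 : L * (30 * L + 70) = 30 * (L * L) + 70 * L := by ring
  have e3 : 20000 * L * L = 20000 * (L * L) := by ring
  have e4 : 25000 * L * L = 25000 * (L * L) := by ring
  have hrL : r.length * (20 * L + 50) ≤ L * (20 * L + 50) := Nat.mul_le_mul_right _ (by omega)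
  have hrr : r.length * (30 * r.length + 70) ≤ L * (30 * L + 70) := by
    have : r.length ≤ L := by omega
    gcongr
  generalize hT : 300 * L * L * L + 20000 * L * L + 2000 * L + 1000 = T at *
  refine Decides.le (seq <| Decides.dup (i := Reg.inp) (j := Reg.sys) (l := Reg.t1) (by decide)
    (by decide) (by decide) ?_ <| seq <| Decides.congr ?_ <| Decides.mvRun (i := Reg.inp) (o := none)
      (P := BoundedModelChecking w) (L := L) (by decide) ?_ fun x r₁ h1 h2 => br
        (T := T + (L * (30 * L + 70) + 15 * L + 30)) ?_) ?_
  · simp [h]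
  · refine (and_iff_right_of_imp fun h' => ?_).symm
    obtain ⟨x, φ, h'⟩ := hQ h'
    exact ⟨x, .sep :: φ.code, by simp [h, h'], by simp⟩
  · simpa [h] using by omega
  · replace h1 : r = codeRun x ++ r₁ := by simpa [h] using h1
    simp only [update_self, emits_none]
    split
    · rename_i h3
      obtain ⟨r₂, rfl⟩ : ∃ r₂, r₁ = .sep :: r₂ := by
        cases r₁ with
        | nil => simp at h3
        | cons t r₂ => exact ⟨r₂, by simpa using h3⟩
      have hr₂ : r₂.length ≤ L := by
        have := congrArg List.length h1
        simp at this
        omega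
      have hr₂' : r₂.length * (30 * r₂.length + 70) ≤ L * (30 * L + 70) := by gcongr
      refine Decides.le (seq <| Decides.pop <| seq <| Decides.dup (i := Reg.inp) (j := Reg.frm)
        (l := Reg.t1) (by decide) (by decide) (by decide) ?_ <| seq <| Decides.congr ?_ <|
        Decides.skipFormula (i := Reg.inp) (c := Reg.t1) (P := BoundedModelChecking w) (by decide)
        ?_ fun φ r₃ h4 => br (T := T) ?_) ?_
      · simp [h]
      · refine (and_iff_right_of_imp fun h' => ?_).symm
        obtain ⟨x', φ, h'⟩ := hQ h'
        rw [h1, codeRun_append_inj (by simp) (by simp)] at h'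
        exact ⟨φ, [], by simpa using h'.2⟩
      · simp [h]
      · replace h4 : r₂ = φ.code ++ r₃ := by simpa using h4
        simp only [update_self]
        -- The parsed system and formula are the only ones that `w` can code, and they are coded by
        -- `w` precisely if nothing is left over.
        have hiff : ∀ (R' : RawSystem) (φ' : RawFormula), w = R'.code ++ φ'.code ↔
            (⟨q, g, b, i, x⟩ = R' ∧ φ = φ') ∧ r₃ = [] := by
          intro R' φ'
          rw [hw, h1, h4, ← List.append_nil φ'.code, ← code_append_code_inj]
          simp [RawSystem.code]
        split
        · rename_i h5
          rw [List.head?_eq_none_iff] at h5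
          subst h5
          have hφ := ha ⟨q, g, b, i, x⟩ φ ((hiff _ _).2 ⟨⟨rfl, rfl⟩, rfl⟩)
          have hφq := φ.quantifiers_le
          have hlen := congrArg List.length h1
          simp only [h4, List.length_append, List.length_cons, List.append_nil] at hlen
          rw [← hT]
          refine Decides.congr ?_ <| Decides.mono (Decides.check (R := ⟨q, g, b, i, x⟩) (φ := φ)
            (m := w.length) (L := L) ?_ ?_ ?_ ?_ ?_ ?_ ?_ ?_ ?_ ?_ ?_ ?_ ?_ ?_ ?_ ?_ ?_ ?_ ?_ ?_ ?_
              hL') Iff.rfl le_rfl hφ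
          · rw [BoundedModelChecking]
            simp only [hiff]
            constructor
            · rintro ⟨_, _, ⟨⟨rfl, rfl⟩, -⟩, h⟩
              exact h
            · exact fun h => ⟨⟨q, g, b, i, x⟩, φ, ⟨⟨rfl, rfl⟩, trivial⟩, h⟩
          any_goals simp [h, h1, h4]
          any_goals omega
          refine le_trans ?_ hL
          have : φ.quantifiers ≤ w.length := by omega
          gcongr
          exact Nat.one_le_two_pow
        · rename_i h5
          refine reject fun ⟨R', φ', h', _⟩ => ?_
          simp [((hiff _ _).1 h').2] at h5
      · simp [h]
        omega
    · rename_i h3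
      refine reject fun h' => ?_
      obtain ⟨x', φ, h'⟩ := hQ h'
      rw [h1, codeRun_append_inj h2 (by simp)] at h'
      rw [h'.2] at h3
      exact h3 rfl
  · simp [h]
    omega

/-- Model checking on nested pushdown trees, up to bounds on the lengths of runs. -/
def main : Prog Reg :=
  seq (dup .inp .t1 .wd) <| seq (mvNat .inp (some .nq)) <| seq (mvNat .inp (some .ng)) <|
  seq (mvNat .inp (some .bt)) <| seq (mvNat .inp (some .st)) parse

theorem Decides.main {w : List Tok} {L : ℕ}
    (hL : w.length * ((2 ^ w.length) ^ w.length * 2 ^ 2 ^ (11 * w.length) + 1) ≤ L)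
    (hL' : w.length + 2 ^ 2 ^ (11 * w.length) ≤ L)
    (ha : ∀ (R : RawSystem) (φ : RawFormula), w = R.code ++ φ.code → 4 * φ.size + 2 ≤ a) :
    Decides p e [main] (fun i => if i = .inp then w else []) (BoundedModelChecking w)
      (300 * L * L * L + 25000 * L * L + 3000 * L + 3000) a := by
  have hwL : w.length ≤ L := (Nat.le_add_right _ _).trans hL'
  have hQ : BoundedModelChecking w → ∃ q g b i r,
      w = codeNat q ++ (codeNat g ++ (codeNat b ++ (codeNat i ++ r))) := by
    rintro ⟨R, φ, h, -⟩
    simp only [RawSystem.code, List.append_assoc] at h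
    exact ⟨_, _, _, _, _, h⟩
  have hW : ∀ {x y z : List Tok}, x = y ++ z → z.length ≤ x.length := fun h => by
    rw [h, List.length_append]
    omega
  refine Decides.le (seq <| Decides.dup (by decide) (by decide) (by decide) (by simp) <| seq <|
    Decides.mvNat_const (L := L) (by decide) ?_ ?_ fun q r₁ h1 => seq <|
    Decides.mvNat_const (L := L) (by decide) ?_ ?_ fun g r₂ h2 => seq <|
    Decides.mvNat_const (L := L) (by decide) ?_ ?_ fun b r₃ h3 => seq <|
    Decides.mvNat_const (L := L) (by decide) ?_ ?_ fun i r₄ h4 =>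
    Decides.parse (q := q) (g := g) (b := b) (i := i) (r := r₄) hL hL' ha ?_ ?_) ?_
  all_goals simp at *
  any_goals omega
  · intro h
    obtain ⟨q, g, b, i, r, h⟩ := hQ h
    exact ⟨_, _, h⟩
  · exact (hW h1).trans hwL
  · intro h
    obtain ⟨q', g, b, i, r, h⟩ := hQ h
    rw [h1, codeNat_append_inj] at h
    exact ⟨_, _, h.2⟩
  · exact (hW h2).trans ((hW h1).trans hwL)
  · intro h
    obtain ⟨q', g', b, i, r, h⟩ := hQ h
    rw [h1, h2] at h
    simp only [codeNat_append_inj] at h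
    exact ⟨_, _, h.2.2⟩
  · exact (hW h3).trans ((hW h2).trans ((hW h1).trans hwL))
  · intro h
    obtain ⟨q', g', b', i, r, h⟩ := hQ h
    rw [h1, h2, h3] at h
    simp only [codeNat_append_inj] at h
    exact ⟨_, _, h.2.2.2⟩
  · rw [h1, h2, h3, h4]
  · intro j
    cases j <;> simp

end Prog

/-! ### The time bound and the machine. -/

namespace Prog

/-- With `E = 2 ^ (11 * m)`, the stacks stay below `2 ^ (8 * E)`. The running time is cubic in this
bound, and `2 ^ (256 * E)` absorbs the constants. -/
theorem time_le (m : ℕ) :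
    m * ((2 ^ m) ^ m * 2 ^ 2 ^ (11 * m) + 1) ≤ 2 ^ 2 ^ (11 * m + 3) ∧
      m + 2 ^ 2 ^ (11 * m) ≤ 2 ^ 2 ^ (11 * m + 3) ∧
      300 * 2 ^ 2 ^ (11 * m + 3) * 2 ^ 2 ^ (11 * m + 3) * 2 ^ 2 ^ (11 * m + 3) +
        25000 * 2 ^ 2 ^ (11 * m + 3) * 2 ^ 2 ^ (11 * m + 3) + 3000 * 2 ^ 2 ^ (11 * m + 3) + 3000 ≤
        2 ^ 2 ^ (11 * m + 8) := by
  have h1 : m ≤ 2 ^ m := Nat.lt_two_pow_self.le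
  have h2 : 2 ^ m ≤ 2 ^ (11 * m) := Nat.pow_le_pow_right (by omega) (by omega)
  have h3 : m * m ≤ 2 ^ (11 * m) := by
    calc m * m ≤ 2 ^ m * 2 ^ m := by gcongr
      _ = 2 ^ (2 * m) := by ring
      _ ≤ 2 ^ (11 * m) := Nat.pow_le_pow_right (by omega) (by omega)
  have hE : 1 ≤ 2 ^ (11 * m) := Nat.one_le_two_pow
  have e3 : 2 ^ (11 * m + 3) = 8 * 2 ^ (11 * m) := by ring
  have e8 : 2 ^ (11 * m + 8) = 256 * 2 ^ (11 * m) := by ring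
  rw [e3, e8]
  generalize 2 ^ (11 * m) = E at *
  have hmE : m ≤ 2 ^ E := by
    have := (Nat.lt_two_pow_self (n := E)).le
    omega
  refine ⟨?_, ?_, ?_⟩
  · calc m * ((2 ^ m) ^ m * 2 ^ E + 1) ≤ 2 ^ E * (2 ^ E * 2 ^ E + 2 ^ E * 2 ^ E) := by
          rw [← pow_mul]
          gcongr
          · omega
          · exact Nat.one_le_iff_ne_zero.2 (by positivity)
      _ = 2 ^ (3 * E + 1) := by ring
      _ ≤ 2 ^ (8 * E) := Nat.pow_le_pow_right (by omega) (by omega)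
  · calc m + 2 ^ E ≤ 2 ^ E + 2 ^ E := by gcongr
      _ = 2 ^ (E + 1) := by ring
      _ ≤ 2 ^ (8 * E) := Nat.pow_le_pow_right (by omega) (by omega)
  · have hL : 1 ≤ 2 ^ (8 * E) := Nat.one_le_two_pow
    calc 300 * 2 ^ (8 * E) * 2 ^ (8 * E) * 2 ^ (8 * E) + 25000 * 2 ^ (8 * E) * 2 ^ (8 * E) +
          3000 * 2 ^ (8 * E) + 3000 ≤ 2 ^ 15 * (2 ^ (8 * E)) ^ 3 := by
          generalize 2 ^ (8 * E) = L at *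
          have h1 : L * L ≤ L * L * L := Nat.le_mul_of_pos_right _ hL
          have h2 : L ≤ L * L := Nat.le_mul_of_pos_right _ hL
          have e1 : 300 * L * L * L = 300 * (L * L * L) := by ring
          have e2 : 25000 * L * L = 25000 * (L * L) := by ring
          have e3 : L ^ 3 = L * L * L := by ring
          omega
      _ = 2 ^ (24 * E + 15) := by ring
      _ ≤ 2 ^ (256 * E) := Nat.pow_le_pow_right (by omega) (by omega)

/-- A numbering of the stacks. -/
def regEquiv : Reg ≃ Fin 18 where
  toFun i := match i with
    | .inp => 0 | .wd => 1 | .sys => 2 | .frm => 3 | .env => 4 | .fuel => 5 | .nq => 6 | .ng => 7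
    | .bt => 8 | .st => 9 | .t1 => 10 | .t2 => 11 | .t3 => 12 | .t4 => 13 | .t5 => 14 | .t6 => 15
    | .dep => 16 | .z => 17
  invFun := ![.inp, .wd, .sys, .frm, .env, .fuel, .nq, .ng, .bt, .st, .t1, .t2, .t3, .t4, .t5, .t6,
    .dep, .z]
  left_inv i := by cases i <;> rfl
  right_inv i := by fin_cases i <;> rfl

/-- The correctness of the program comes with an alternation bound `a` that may depend on the word.
For a code it is given by the unique formula coded; for acceptance and time on arbitrary words, the
existence of some `a` suffices. -/
theorem exists_atm_boundedModelChecking : ∃ (M : ATM Tok) (p : Polynomial ℕ),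
    (∀ w, M.Accepts w ↔ BoundedModelChecking w) ∧
    (∀ w, M.TimeBound w (2 ^ 2 ^ p.eval w.length)) ∧
    ∀ (R : RawSystem) (φ : RawFormula), M.AlternationBound (R.code ++ φ.code) (4 * φ.size + 2) := by
  have key := fun (w : List Tok) (a : ℕ) ha => correct_of_decides (p := main) (e := regEquiv)
    (i₀ := Reg.inp) rfl (Decides.le (Decides.main (w := w) (a := a) (time_le w.length).1
      (time_le w.length).2.1 ha) (time_le w.length).2.2)
  have hcode : ∀ (R : RawSystem) (φ : RawFormula) (R' : RawSystem) (φ' : RawFormula), R.code ++ φ.code = R'.code ++ φ'.code →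
      4 * φ'.size + 2 ≤ 4 * φ.size + 2 := by
    intro R φ R' φ' h
    rw [← List.append_nil φ.code, ← List.append_nil φ'.code, code_append_code_inj] at h
    rw [h.1.2]
  -- For a word that is no code, the requirement on `a` is empty.
  have ha : ∀ w, ∃ a, ∀ (R : RawSystem) (φ : RawFormula), w = R.code ++ φ.code →
      4 * φ.size + 2 ≤ a := by
    intro w
    by_cases h : ∃ (R : RawSystem) (φ : RawFormula), w = R.code ++ φ.code
    · obtain ⟨R, φ, rfl⟩ := h
      exact ⟨_, hcode R φ⟩
    · exact ⟨0, fun R φ h' => absurd ⟨R, φ, h'⟩ h⟩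
  refine ⟨main.toATM regEquiv, Polynomial.C 11 * Polynomial.X + Polynomial.C 8, fun w => ?_,
    fun w => ?_, fun R φ => (key _ _ (hcode R φ)).2.2⟩
  · obtain ⟨a, h⟩ := ha w
    exact (key w a h).1
  · obtain ⟨a, h⟩ := ha w
    simpa using (key w a h).2.1

end Prog

open Prog

/-! ## Numbered runs -/

/-- The transitions of an excursion, the last one first. -/
def Loop.transitions {D : Type} : Loop D → List D
  | nil => []
  | cons l δ₁ i δ₂ => δ₂ :: (i.transitions ++ δ₁ :: l.transitions)

/-- The transitions of a run, the last one first. -/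
def Trace.transitions {D : Type} : Trace D → List D
  | [] => []
  | (d, l) :: x => l.transitions ++ (d.toList ++ transitions x)

theorem Prog.le_length_codeRun (x : List (PDTransition ℕ ℕ)) : x.length ≤ (codeRun x).length := by
  induction x with
  | nil => simp
  | cons δ x ih =>
    simp only [codeRun, List.flatMap_cons, List.length_append, List.length_cons] at ih ⊢
    omega

variable {n m : ℕ}

/-- A transition, with numbers as states and symbols. -/
def PDTransition.raw (δ : PDTransition (Fin n) (Fin m)) : PDTransition ℕ ℕ :=
  ⟨δ.src, δ.top, δ.dst, match δ.op with
    | .push b => .push b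
    | .pop => .pop⟩

theorem PDTransition.raw_inj {δ δ' : PDTransition (Fin n) (Fin m)} : δ.raw = δ'.raw ↔ δ = δ' := by
  obtain ⟨q, x, q', b | _⟩ := δ <;> obtain ⟨q₁, x₁, q₁', b₁ | _⟩ := δ' <;>
    simp [PDTransition.raw, Fin.ext_iff]

theorem PDTransition.raw_op_pop {δ : PDTransition (Fin n) (Fin m)} :
    δ.raw.op = .pop ↔ δ.op = .pop := by
  obtain ⟨q, x, q', b | _⟩ := δ <;> simp [PDTransition.raw]

/-- A pushdown system, with numbers as states and symbols. -/
def PushdownSystem.raw (N : PushdownSystem (Fin n) (Fin m))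
    (l : List (PDTransition (Fin n) (Fin m))) : RawSystem :=
  ⟨n, m, N.bot, N.init, l.map PDTransition.raw⟩

/-- In an excursion every pop is matched by a push, so the counter returns to its value. It has to
be positive, since with counter zero the unwinding stops at once. -/
theorem RawSystem.unwind_loop {N : PushdownSystem (Fin n) (Fin m)}
    {T : Loop (PDTransition (Fin n) (Fin m))} {q : Fin n} {a : Fin m} (h : N.OkL q a T) (c : ℕ)
    (y : List (PDTransition ℕ ℕ)) :
    unwind (c + 1) (T.transitions.map PDTransition.raw ++ y) = unwind (c + 1) y := by
  induction T generalizing q a c y with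
  | nil => rfl
  | cons l δ₁ i δ₂ ihl ihi =>
    obtain ⟨h1, -, -, -, h5, h6, -, -, -, h10⟩ := h
    obtain ⟨p₁, x₁, p₁', b | _⟩ := δ₁
    · obtain ⟨p₂, x₂, p₂', _ | _⟩ := δ₂
      · cases h10
      · simp only [Loop.transitions, List.map_cons, List.map_append, List.append_assoc,
          List.cons_append, PDTransition.raw, unwind]
        rw [ihi h6]
        simp only [unwind]
        exact ihl h1 _ _
    · exact absurd rfl h5

namespace NPT

variable {N : PushdownSystem (Fin n) (Fin m)}

/-- The transitions of a run, the last one first, with numbers as states and symbols. -/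
noncomputable def raw (ρ : NPT N) : List (PDTransition ℕ ℕ) :=
  ρ.trace.transitions.map PDTransition.raw

theorem raw_root : (root N).raw = [] := by
  rw [raw, (root N).rel_trace.unique .root]
  rfl

theorem Edge.raw {δ : PDTransition (Fin n) (Fin m)} {ρ ρ' : NPT N} (h : Edge δ ρ ρ') :
    ρ'.raw = δ.raw :: ρ.raw := by
  rw [NPT.raw, NPT.raw, ρ'.rel_trace.unique (.step ρ.rel_trace h)]
  obtain ⟨-, -, ⟨-, h⟩ | ⟨-, δ₁, i, d, l, s, h1, h2⟩⟩ := ρ.rel_trace.ext_eq h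
  · rw [h]
    rfl
  · rw [h2, h1]
    simp [Trace.transitions, Loop.transitions]

theorem length_raw (ρ : NPT N) : ρ.raw.length = ρ.length := by
  induction hn : ρ.length generalizing ρ with
  | zero =>
    rcases ρ.eq_root_or_edge with rfl | ⟨δ, ρ', h⟩
    · rw [raw_root]
      rfl
    · have := h.length
      omega
  | succ k ih =>
    rcases ρ.eq_root_or_edge with rfl | ⟨δ, ρ', h⟩
    · simp [root, length] at hn
    · rw [h.raw, List.length_cons, ih ρ' (by have := h.length; omega)]

/-- Induction on runs. -/
theorem edge_induction {P : NPT N → Prop} (h0 : P (root N))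
    (h1 : ∀ δ ρ ρ', Edge δ ρ ρ' → P ρ → P ρ') (ρ : NPT N) : P ρ := by
  induction hn : ρ.length generalizing ρ with
  | zero =>
    rcases ρ.eq_root_or_edge with rfl | ⟨δ, ρ', h⟩
    · exact h0
    · have := h.length
      omega
  | succ k ih =>
    rcases ρ.eq_root_or_edge with rfl | ⟨δ, ρ', h⟩
    · exact h0
    · exact h1 δ ρ' ρ h (ih ρ' (by have := h.length; omega))

theorem raw_inj {ρ ρ' : NPT N} : ρ.raw = ρ'.raw ↔ ρ = ρ' := by
  refine ⟨fun h => ?_, fun h => h ▸ rfl⟩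
  induction ρ using edge_induction generalizing ρ' with
  | h0 =>
    rcases ρ'.eq_root_or_edge with rfl | ⟨δ', ρ₁', h'⟩
    · rfl
    · simp [raw_root, h'.raw] at h
  | h1 δ ρ₁ ρ he ih =>
    rcases ρ'.eq_root_or_edge with rfl | ⟨δ', ρ₁', h'⟩
    · simp [raw_root, he.raw] at h
    · rw [he.raw, h'.raw, List.cons.injEq, PDTransition.raw_inj] at h
      obtain ⟨rfl, h⟩ := h
      obtain rfl := ih h
      exact he.unique h'

theorem edge_iff_raw {δ : PDTransition (Fin n) (Fin m)} {ρ ρ' : NPT N} :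
    Edge δ ρ ρ' ↔ δ.raw :: ρ.raw = ρ'.raw := by
  refine ⟨fun h => h.raw.symm, fun h => ?_⟩
  rcases ρ'.eq_root_or_edge with rfl | ⟨δ', ρ₁', h'⟩
  · simp [raw_root] at h
  · rw [h'.raw, List.cons.injEq, PDTransition.raw_inj, raw_inj] at h
    obtain ⟨rfl, rfl⟩ := h
    exact h'

/-- After the final pop has been removed, unwinding one symbol passes over the excursion of the top
level, removes the push that opened this level and leaves the run before that push, which is the
tail of the trace. -/
theorem jump_iff_raw {ρ ρ' : NPT N} : Jump ρ ρ' ↔ RawSystem.IsJump ρ.raw ρ'.raw := by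
  rw [jump_iff]
  rcases ρ'.eq_root_or_edge with rfl | ⟨δ, ρ₁, h⟩
  · rw [(root N).rel_trace.unique .root, raw_root]
    simp [PushdownSystem.rootTrace, Trace.lastOp, RawSystem.IsJump]
  · obtain ⟨h1, h2⟩ := edge_iff.1 h
    rw [h1, h2, h.raw]
    have hE := ρ₁.rel_trace.ext_eq h
    obtain ⟨p, x, p', b | _⟩ := δ
    · simp [RawSystem.IsJump, PDTransition.raw]
    · obtain ⟨-, -, ⟨⟨b, hb⟩, -⟩ | ⟨-, δ₁, i, d, l, s, h3, -⟩⟩ := hE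
      · cases hb
      · obtain ⟨hok, -⟩ := ρ₁.rel_trace.props
        rw [h3] at hok
        obtain ⟨ho1, ho2, -, -, ho3⟩ := hok
        obtain ⟨ρ₂, hρ₂⟩ := exists_rel_of_ok ho1 (List.cons_ne_nil _ _)
        have hr : ρ₂.raw = (Trace.transitions ((d, l) :: s)).map PDTransition.raw := by
          rw [raw, ρ₂.rel_trace.unique hρ₂]
        have hu : RawSystem.unwind 1 ρ₁.raw = some ρ₂.raw := by
          rw [raw, h3, Trace.transitions, List.map_append, RawSystem.unwind_loop ho2]
          obtain ⟨p₁, x₁, p₁', b | _⟩ := δ₁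
          · simp [hr, PDTransition.raw, RawSystem.unwind]
          · exact absurd rfl ho3
        simp only [RawSystem.IsJump, PDTransition.raw, hu, Option.some.injEq, raw_inj]
        rw [h3, List.tail_cons, ← ρ₂.rel_trace.unique hρ₂, trace_inj]
        simp

/-- State and stack can be computed from the list of transitions alone. The last clause holds
because the bottom symbol is never pushed; it lets the topmost symbol tell whether a pop is
possible. -/
theorem raw_props (l : List (PDTransition (Fin n) (Fin m))) (ρ : NPT N) :
    (N.raw l).stateOf ρ.raw = ρ.final.1 ∧
      (∀ (c : ℕ) (a : Fin m), ρ.final.2[c]? = some a → (N.raw l).topOf c ρ.raw = a) ∧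
      ∃ t, ρ.final.2 = t ++ [N.bot] ∧ N.bot ∉ t := by
  induction ρ using edge_induction with
  | h0 =>
    rw [raw_root]
    refine ⟨rfl, ?_, [], rfl, by simp⟩
    intro c a h
    cases c with
    | zero =>
      obtain rfl : N.bot = a := Option.some.inj h
      rfl
    | succ c => cases h
  | h1 δ ρ ρ' h ih =>
    obtain ⟨-, h1, t, h2, h3⟩ := ih
    obtain ⟨s1, -, -, s4, s5⟩ := h.final
    rw [h.raw]
    refine ⟨by rw [s4]; rfl, ?_⟩
    obtain ⟨p, x, p', b | _⟩ := δ
    · have hs : b :: ρ.final.2 = ρ'.final.2 := Option.some.inj s5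
      rw [← hs]
      refine ⟨fun c a hc => ?_, b :: t, by rw [h2]; rfl, ?_⟩
      · cases c with
        | zero =>
          obtain rfl : b = a := by simpa using hc
          rfl
        | succ c => exact h1 c a (by simpa using hc)
      · rw [List.mem_cons, not_or]
        exact ⟨(N.push_ne_bot _ s1 b rfl).symm, h3⟩
    · obtain ⟨a, ha⟩ : ∃ a, ρ.final.2 = a :: ρ'.final.2 := by
        rcases hf : ρ.final.2 with _ | ⟨a, _ | ⟨b, s⟩⟩
        · simp [hf, StackOp.apply] at s5
        · simp [hf, StackOp.apply] at s5
        · rw [hf] at s5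
          exact ⟨a, by rw [Option.some.inj s5]⟩
      refine ⟨fun c a' hc => ?_, ?_⟩
      · have htop : (N.raw l).topOf c (PDTransition.raw ⟨p, x, p', .pop⟩ :: ρ.raw) =
            (N.raw l).topOf (c + 1) ρ.raw := by
          cases c <;> rfl
        rw [htop]
        exact h1 (c + 1) a' (by rw [ha]; simpa using hc)
      · rw [ha] at h2
        cases t with
        | nil =>
          rw [List.nil_append, List.cons.injEq] at h2
          rw [ha, h2.2] at s5
          simp [StackOp.apply] at s5
        | cons a' t =>
          rw [List.cons_append, List.cons.injEq] at h2
          exact ⟨t, h2.2, fun h => h3 (List.mem_cons_of_mem _ h)⟩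

theorem applicable_iff {l : List (PDTransition (Fin n) (Fin m))} (hl : ∀ δ, δ ∈ l ↔ δ ∈ N.Δ)
    {δ : PDTransition (Fin n) (Fin m)} {ρ : NPT N} :
    (N.raw l).Applicable δ.raw ρ.raw ↔ ∃ ρ', Edge δ ρ ρ' := by
  obtain ⟨h1, h2, t, h3, h4⟩ := ρ.raw_props l
  have hmem : δ.raw ∈ (N.raw l).items ↔ δ ∈ N.Δ := by
    rw [← hl]
    exact List.mem_map_of_injective fun _ _ => PDTransition.raw_inj.1
  obtain ⟨a, s, hs⟩ : ∃ a s, ρ.final.2 = a :: s := by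
    rw [h3]
    cases t <;> simp
  have htop := h2 0 a (by simp [hs])
  rw [RawSystem.Applicable, hmem, h1, htop, PDTransition.raw_op_pop]
  change δ ∈ N.Δ ∧ (δ.src : ℕ) = ρ.final.1 ∧ (δ.top : ℕ) = a ∧ (δ.op = .pop → (δ.top : ℕ) ≠ N.bot) ↔ _
  rw [Fin.val_inj, Fin.val_inj, ne_eq, Fin.val_inj]
  constructor
  · rintro ⟨e1, e2, e3, e4⟩
    obtain ⟨s', hs'⟩ : ∃ s', δ.op.apply ρ.final.2 = some s' := by
      rw [hs]
      cases hop : δ.op with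
      | push b => exact ⟨_, rfl⟩
      | pop =>
        cases s with
        | nil =>
          rw [hs] at h3
          cases t with
          | nil => exact absurd (e3.trans (List.cons.inj h3).1) (e4 hop)
          | cons b t => simp at h3
        | cons b s => exact ⟨_, rfl⟩
    exact exists_edge (c := (δ.dst, s')) ⟨e1, e2.symm, by rw [hs, e3]; rfl, rfl, hs'⟩
  · rintro ⟨ρ', h⟩
    obtain ⟨s1, s2, s3, -, s5⟩ := h.final
    rw [hs] at s3 s5
    have ha : a = δ.top := Option.some.inj s3
    refine ⟨s1, s2.symm, ha.symm, fun hop hb => ?_⟩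
    rw [hop] at s5
    cases t with
    | nil =>
      rw [hs] at h3
      rw [(List.cons.inj h3).2] at s5
      simp [StackOp.apply] at s5
    | cons b t =>
      rw [hs] at h3
      have := (List.cons.inj h3).1
      exact h4 (by rw [← hb, ← ha, this]; exact List.mem_cons_self)

theorem isRun_raw {l : List (PDTransition (Fin n) (Fin m))} (hl : ∀ δ, δ ∈ l ↔ δ ∈ N.Δ)
    (ρ : NPT N) : (N.raw l).IsRun ρ.raw := by
  induction ρ using edge_induction with
  | h0 =>
    rw [raw_root]
    trivial
  | h1 δ ρ ρ' h ih =>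
    rw [h.raw]
    exact ⟨(applicable_iff hl).2 ⟨ρ', h⟩, ih⟩

theorem exists_raw_eq {l : List (PDTransition (Fin n) (Fin m))} (hl : ∀ δ, δ ∈ l ↔ δ ∈ N.Δ)
    {x : List (PDTransition ℕ ℕ)} (h : (N.raw l).IsRun x) : ∃ ρ : NPT N, ρ.raw = x := by
  induction x with
  | nil => exact ⟨root N, raw_root⟩
  | cons δ x ih =>
    obtain ⟨h1, h2⟩ := h
    obtain ⟨ρ, rfl⟩ := ih h2
    obtain ⟨δ', -, rfl⟩ := List.mem_map.1 h1.1
    obtain ⟨ρ', h'⟩ := (applicable_iff hl).1 h1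
    exact ⟨ρ', h'.raw⟩

theorem length_le_length_codeRun (ρ : NPT N) : ρ.length ≤ (codeRun ρ.raw).length := by
  rw [← length_raw]
  exact le_length_codeRun _

/-- Every transition of the run occurs in the list of the system, so its code is no longer than that
of the list. -/
theorem length_codeRun_raw_le {l : List (PDTransition (Fin n) (Fin m))}
    (hl : ∀ δ, δ ∈ l ↔ δ ∈ N.Δ) (ρ : NPT N) :
    (codeRun ρ.raw).length ≤ (codeRun (N.raw l).items).length * ρ.length := by
  rw [← length_raw]
  have h := isRun_raw hl ρ
  generalize ρ.raw = x at *
  generalize N.raw l = R at *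
  induction x with
  | nil => simp
  | cons δ x ih =>
    have h1 : (codeRaw δ).length + 1 ≤ (codeRun R.items).length := by
      obtain ⟨l₁, l₂, hl⟩ := List.append_of_mem h.1.1
      rw [hl]
      simp [codeRun]
      omega
    have := ih h.2
    simp only [codeRun, List.flatMap_cons, List.length_append, List.length_cons] at this h1 ⊢
    rw [Nat.mul_succ]
    omega

end NPT

open FirstOrder

/-! ## Numbered formulas -/

namespace PushdownSystem

variable {n m : ℕ} {N : PushdownSystem (Fin n) (Fin m)} {k : ℕ}

/-- An atom, with numbers as states, symbols and variables. -/
def rawAtom : {a : ℕ} → NPTRel N a → (Fin a → ℕ) → RawFormula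
  | _, .edge δ _, x => .edge δ.raw (x 0) (x 1)
  | _, .jump, x => .jump (x 0) (x 1)

/-- A formula, with numbers as states, symbols and variables. -/
def rawFormula : {k : ℕ} → (nptLang N).BoundedFormula Empty k → RawFormula
  | _, .falsum => .falsum
  | _, .equal s t => .equal (varIndex s) (varIndex t)
  | _, .rel R ts => rawAtom R (fun i => varIndex (ts i))
  | _, .imp φ ψ => .imp (rawFormula φ) (rawFormula ψ)
  | _, .all φ => .all (rawFormula φ)

theorem codeTransition_eq (δ : PDTransition (Fin n) (Fin m)) : codeTransition δ = codeRaw δ.raw := by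
  obtain ⟨q, x, q', b | _⟩ := δ <;> rfl

theorem codeSystem_eq (l : List (PDTransition (Fin n) (Fin m))) :
    codeSystem N l = (N.raw l).code := by
  simp [codeSystem, RawSystem.code, codeRun, raw, List.flatMap_map, codeTransition_eq]

theorem codeFormula_eq (φ : (nptLang N).BoundedFormula Empty k) :
    codeFormula φ = (rawFormula φ).code := by
  induction φ with
  | falsum => rfl
  | equal s t => rfl
  | rel R ts =>
    cases R with
    | edge δ h => simp [codeFormula, codeAtom, rawFormula, rawAtom, RawFormula.code, codeTransition_eq]
    | jump => rfl
  | imp φ ψ ih ih' => simp [codeFormula, rawFormula, RawFormula.code, ih, ih']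
  | all φ ih => simp [codeFormula, rawFormula, RawFormula.code, ih]

theorem size_rawFormula (φ : (nptLang N).BoundedFormula Empty k) :
    (rawFormula φ).size = formulaSize φ := by
  induction φ with
  | falsum => rfl
  | equal s t => rfl
  | rel R ts => cases R <;> rfl
  | imp φ ψ ih ih' => simp [formulaSize, rawFormula, RawFormula.size, ih, ih']
  | all φ ih => simp [formulaSize, rawFormula, RawFormula.size, ih]

theorem exists_var (t : (nptLang N).Term (Empty ⊕ Fin k)) : ∃ i : Fin k, t = .var (.inr i) := by
  cases t with
  | var x => cases x with
    | inl x => exact x.elim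
    | inr i => exact ⟨i, rfl⟩
  | func f _ => exact Empty.elim f

theorem wellFormed_rawFormula {l : List (PDTransition (Fin n) (Fin m))}
    (hl : ∀ δ, δ ∈ l ↔ δ ∈ N.Δ) (φ : (nptLang N).BoundedFormula Empty k) :
    (N.raw l).WellFormed (rawFormula φ) k := by
  have hv : ∀ {k : ℕ} (t : (nptLang N).Term (Empty ⊕ Fin k)), varIndex t < k := by
    intro k t
    obtain ⟨i, rfl⟩ := exists_var t
    exact i.2
  induction φ with
  | falsum => trivial
  | equal s t => exact ⟨hv s, hv t⟩
  | rel R ts =>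
    cases R with
    | edge δ h => exact ⟨List.mem_map_of_mem ((hl δ).2 h), hv _, hv _⟩
    | jump => exact ⟨hv _, hv _⟩
  | imp φ ψ ih ih' => exact ⟨ih, ih'⟩
  | all φ ih => exact ih

/-- The well-formedness test is exact: what passes it is the translation of a formula in the
vocabulary of the system. -/
theorem exists_rawFormula_eq {l : List (PDTransition (Fin n) (Fin m))}
    (hl : ∀ δ, δ ∈ l ↔ δ ∈ N.Δ) {φ : RawFormula} (h : (N.raw l).WellFormed φ k) :
    ∃ ψ : (nptLang N).BoundedFormula Empty k, rawFormula ψ = φ := by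
  induction φ generalizing k with
  | falsum => exact ⟨.falsum, rfl⟩
  | equal i j => exact ⟨.equal (.var (.inr ⟨i, h.1⟩)) (.var (.inr ⟨j, h.2⟩)), rfl⟩
  | edge δ i j =>
    obtain ⟨h1, hi, hj⟩ := h
    obtain ⟨δ', hδ', rfl⟩ : ∃ δ', δ' ∈ l ∧ δ'.raw = δ := List.mem_map.1 h1
    exact ⟨.rel (NPTRel.edge δ' ((hl δ').1 hδ')) ![.var (.inr ⟨i, hi⟩), .var (.inr ⟨j, hj⟩)], rfl⟩
  | jump i j =>
    exact ⟨.rel (NPTRel.jump : NPTRel N 2) ![.var (.inr ⟨i, h.1⟩), .var (.inr ⟨j, h.2⟩)], rfl⟩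
  | imp φ ψ ih ih' =>
    obtain ⟨φ', rfl⟩ := ih h.1
    obtain ⟨ψ', rfl⟩ := ih' h.2
    exact ⟨.imp φ' ψ', rfl⟩
  | all φ ih =>
    obtain ⟨φ', rfl⟩ := ih h
    exact ⟨.all φ', rfl⟩

theorem raw_ok (l : List (PDTransition (Fin n) (Fin m))) (hl : ∀ δ, δ ∈ l ↔ δ ∈ N.Δ) :
    (N.raw l).Ok := by
  refine ⟨⟨N.bot.2, N.init.2⟩, fun δ hδ => ?_⟩
  obtain ⟨δ, hmem, rfl⟩ := List.mem_map.1 hδ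
  refine ⟨δ.src.2, δ.top.2, δ.dst.2, fun b hb => ?_⟩
  have hne := N.push_ne_bot δ ((hl δ).1 hmem)
  obtain ⟨q, x, q', b' | _⟩ := δ
  · obtain rfl : (b' : ℕ) = b := by simpa [PDTransition.raw] using hb
    exact ⟨b'.2, fun h => hne b' rfl (Fin.ext h)⟩
  · simp [PDTransition.raw] at hb

end PushdownSystem

open PushdownSystem

/-- The range conditions allow all numbers to be read as elements of `Fin`. Repeated items do no
harm, since the transitions form a set. -/
theorem RawSystem.Ok.exists_eq {R : RawSystem} (h : R.Ok) :
    ∃ (n m : ℕ) (N : PushdownSystem (Fin n) (Fin m)) (l : List (PDTransition (Fin n) (Fin m))),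
      (∀ δ, δ ∈ l ↔ δ ∈ N.Δ) ∧ R = N.raw l := by
  classical
  obtain ⟨⟨h1, h2⟩, h3⟩ := h
  obtain ⟨l, hl⟩ : ∃ l : List (PDTransition (Fin R.states) (Fin R.symbols)),
      l.map PDTransition.raw = R.items := by
    have : R.items ∈ Set.range (List.map (PDTransition.raw (n := R.states) (m := R.symbols))) := by
      rw [Set.range_list_map]
      intro δ hδ
      obtain ⟨e1, e2, e3, e4⟩ := h3 δ hδ
      obtain ⟨q, x, q', b | _⟩ := δ
      · exact ⟨⟨⟨q, e1⟩, ⟨x, e2⟩, ⟨q', e3⟩, .push ⟨b, (e4 b rfl).1⟩⟩, rfl⟩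
      · exact ⟨⟨⟨q, e1⟩, ⟨x, e2⟩, ⟨q', e3⟩, .pop⟩, rfl⟩
    exact this
  refine ⟨R.states, R.symbols, ⟨⟨R.bot, h1⟩, ⟨R.init, h2⟩, l.toFinset, ?_⟩, l, by simp, ?_⟩
  · intro δ hδ b hb hbot
    have hmem : δ.raw ∈ R.items := by
      rw [← hl]
      exact List.mem_map_of_mem (List.mem_toFinset.1 hδ)
    obtain ⟨q, x, q', b' | _⟩ := δ
    · obtain rfl : b' = b := by simpa using hb
      refine ((h3 _ hmem).2.2.2 b' rfl).2 ?_
      rw [hbot]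
    · cases hb
  · obtain ⟨q, g, b, i, x⟩ := R
    simp only [PushdownSystem.raw, hl]

/-! ## Bounded quantification -/

namespace PushdownSystem

variable {n m : ℕ} {N : PushdownSystem (Fin n) (Fin m)} {k : ℕ}

/-- This holds for every `r` and `j`, so a game may be started with the same tuple in both copies.
-/
theorem gameInv_refl (r j : ℕ) (v : Fin k → NPT N) :
    N.GameInv r j (List.ofFn fun i => (v i, v i)) := by
  have h : ∀ z ∈ (List.ofFn fun i => (v i, v i)).map (fun z => (z.1.trace, z.2.trace)),
      N.Ok z.1 ∧ z.1 = z.2 := by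
    intro z hz
    obtain ⟨y, hy, rfl⟩ := List.mem_map.1 hz
    obtain ⟨i, rfl⟩ := List.mem_ofFn.1 hy
    exact ⟨(v i).rel_trace.props.1, rfl⟩
  refine ⟨fun z hz => ⟨(h z hz).1, (h z hz).2 ▸ (h z hz).1⟩, fun z hz => ?_, fun z hz z' hz' w u _ _ => ?_⟩
  · rw [(h z hz).2]
    exact XS.refl N _ _ _
  · rw [(h z hz).2, (h z' hz').2]

theorem ofFn_snoc {A B : Type} (v : Fin k → A) (v' : Fin k → B) (a : A) (b : B) :
    (List.ofFn fun i => ((Fin.snoc v a : Fin (k + 1) → A) i, (Fin.snoc v' b : Fin (k + 1) → B) i)) =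
      (List.ofFn fun i => (v i, v' i)) ++ [(a, b)] := by
  rw [List.ofFn_succ']
  simp

/-- The usual induction for Ehrenfeucht–Fraïssé games: each quantifier uses one of the `j` remaining
rounds, with Duplicator answering in either copy. -/
theorem realize_iff_of_gameInv (φ : (nptLang N).BoundedFormula Empty k) {e : Empty → NPT N}
    {v v' : Fin k → NPT N} {r j : ℕ} (hj : (rawFormula φ).quantifiers ≤ j) (hr : k + j ≤ r)
    (h : N.GameInv r j (List.ofFn fun i => (v i, v' i))) : φ.Realize e v ↔ φ.Realize e v' := by
  induction φ generalizing j with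
  | falsum => rfl
  | equal s t =>
    obtain ⟨i, rfl⟩ := exists_var s
    obtain ⟨i', rfl⟩ := exists_var t
    exact h.isPartialIso.1 (v i, v' i) (List.mem_ofFn.2 ⟨i, rfl⟩) (v i', v' i')
      (List.mem_ofFn.2 ⟨i', rfl⟩)
  | rel R ts =>
    choose i hi using fun a => exists_var (ts a)
    obtain rfl : ts = fun a => .var (.inr (i a)) := funext hi
    exact h.isPartialIso.2 _ R (fun a => (v (i a), v' (i a))) fun a => List.mem_ofFn.2 ⟨i a, rfl⟩
  | imp φ ψ ih ih' =>
    simp only [rawFormula, RawFormula.quantifiers] at hj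
    exact imp_congr (ih (by omega) hr h) (ih' (by omega) hr h)
  | all φ ih =>
    simp only [rawFormula, RawFormula.quantifiers] at hj
    obtain ⟨j, rfl⟩ : ∃ j', j = j' + 1 := ⟨j - 1, by omega⟩
    rw [Language.BoundedFormula.realize_all, Language.BoundedFormula.realize_all]
    constructor
    · intro H ρ'
      obtain ⟨ρ, hρ⟩ := h.extend_left (by rw [List.length_ofFn]; omega) ρ'
      rw [← ofFn_snoc] at hρ
      exact (ih (by omega) (by omega) hρ).1 (H ρ)
    · intro H ρ
      obtain ⟨ρ', hρ, -⟩ := h.extend (by rw [List.length_ofFn]; omega) ρ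
      rw [← ofFn_snoc] at hρ
      exact (ih (by omega) (by omega) hρ).2 (H ρ')

/-- Restricting a quantifier is harmless, since an arbitrary run can be replaced by Duplicator's
answer in the game on two copies of the same tuple. If the tuple has lengths at most `t` and the
threshold is at most `t`, the answer has length at most `2 * t`. Its code is longer by at most the
length of the list of transitions as a factor, hence the condition on `g`. -/
theorem sat_rawFormula_iff {l : List (PDTransition (Fin n) (Fin m))} (hl : ∀ δ, δ ∈ l ↔ δ ∈ N.Δ)
    (φ : (nptLang N).BoundedFormula Empty k) {e : Empty → NPT N} {v : Fin k → NPT N} {g r t : ℕ}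
    (hg : 2 * (codeRun (N.raw l).items).length ≤ g) (hg' : 1 ≤ g)
    (hr : k + (rawFormula φ).quantifiers ≤ r) (hv : ∀ i, (v i).length ≤ t)
    (ht : N.threshold r r ≤ t) :
    (N.raw l).Sat g (rawFormula φ) t (List.ofFn fun i => (v i).raw) ↔ φ.Realize e v := by
  have hx : ∀ {k : ℕ} (v : Fin k → NPT N) (i : Fin k) (P : List (PDTransition ℕ ℕ) → Prop),
      (∃ x, (List.ofFn fun i => (v i).raw)[(i : ℕ)]? = some x ∧ P x) ↔ P (v i).raw := by
    intro k v i P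
    simp
  induction φ generalizing t with
  | falsum => rfl
  | equal s s' =>
    obtain ⟨i, rfl⟩ := exists_var s
    obtain ⟨i', rfl⟩ := exists_var s'
    simp only [rawFormula, RawSystem.Sat, varIndex, hx, NPT.raw_inj]
    rfl
  | rel R ts =>
    choose i hi using fun a => exists_var (ts a)
    obtain rfl : ts = fun a => .var (.inr (i a)) := funext hi
    cases R with
    | edge δ hδ =>
      simp only [rawFormula, rawAtom, RawSystem.Sat, varIndex, hx]
      exact NPT.edge_iff_raw.symm
    | jump =>
      simp only [rawFormula, rawAtom, RawSystem.Sat, varIndex, hx]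
      exact NPT.jump_iff_raw.symm
  | imp φ ψ ih ih' =>
    simp only [rawFormula, RawFormula.quantifiers] at hr
    exact imp_congr (ih (by omega) hv ht) (ih' (by omega) hv ht)
  | all φ ih =>
    simp only [rawFormula, RawFormula.quantifiers] at hr
    have htg : t ≤ g * t := Nat.le_mul_of_pos_left _ hg'
    have key : ∀ ρ : NPT N, (codeRun ρ.raw).length ≤ g * t →
        ((N.raw l).Sat g (rawFormula φ) (g * t) ((List.ofFn fun i => (v i).raw) ++ [ρ.raw]) ↔
          φ.Realize e (Fin.snoc v ρ)) := by
      intro ρ hρ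
      have hsnoc : ∀ i, ((Fin.snoc v ρ : Fin _ → NPT N) i).length ≤ g * t := by
        refine Fin.lastCases ?_ fun i => ?_
        · simpa using ρ.length_le_length_codeRun.trans hρ
        · simpa using (hv i).trans htg
      have h := ih (v := Fin.snoc v ρ) (by omega) hsnoc (ht.trans htg)
      rw [List.ofFn_succ'] at h
      simpa using h
    rw [Language.BoundedFormula.realize_all]
    constructor
    · intro H ρ
      -- The run `ρ'` is short and satisfies the same formulas as `ρ` over `v`, as far as `φ` is
      -- concerned.
      obtain ⟨ρ', h1, h2⟩ := (gameInv_refl r ((rawFormula φ).quantifiers + 1) v).extend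
        (by rw [List.length_ofFn]; omega) ρ
      rw [← ofFn_snoc] at h1
      have hρ' : (codeRun ρ'.raw).length ≤ g * t := by
        have h3 := h2 t fun z hz => by
          obtain ⟨i, rfl⟩ := List.mem_ofFn.1 hz
          exact hv i
        calc _ ≤ _ := NPT.length_codeRun_raw_le hl ρ'
          _ ≤ (codeRun (N.raw l).items).length * (2 * t) := by
            gcongr
            omega
          _ = 2 * (codeRun (N.raw l).items).length * t := by ring
          _ ≤ g * t := by gcongr
      exact (realize_iff_of_gameInv φ le_rfl (by omega) h1).2
        ((key ρ' hρ').1 (H _ hρ' (NPT.isRun_raw hl ρ')))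
    · intro H x hx hrun
      obtain ⟨ρ, rfl⟩ := NPT.exists_raw_eq hl hrun
      exact (key ρ hx).2 (H ρ)

/-- The exponent is at most `2 ^ (4 * s + 6)` plus a cubic polynomial in `s`. For `2 ≤ s` the first
part is at most `2 ^ (7 * s)`, and the factor `2 ^ (4 * s)` that remains absorbs the polynomial. -/
theorem threshold_le_two_pow {s r : ℕ} (hN : N.size ≤ s) (hr : r ≤ s) (hs : 2 ≤ s) :
    N.threshold r r ≤ 2 ^ 2 ^ (11 * s) := by
  refine (N.threshold_le r).trans ?_
  rw [← pow_add]
  refine Nat.pow_le_pow_right (by norm_num) ?_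
  have h1 : s ≤ 2 ^ s := Nat.lt_two_pow_self.le
  have h2 : N.size ^ 3 ≤ (2 ^ s) ^ 3 := Nat.pow_le_pow_left (hN.trans h1) 3
  have h3 : N.size ^ 2 ≤ (2 ^ s) ^ 3 := (Nat.pow_le_pow_left (hN.trans h1) 2).trans
    (Nat.pow_le_pow_right (by positivity) (by norm_num))
  have h4 : 2 ^ (4 * r + 6) ≤ 2 ^ (4 * s + 6) := Nat.pow_le_pow_right (by norm_num) (by omega)
  have h5 : (2 : ℕ) ^ (4 * s + 6) ≤ 2 ^ (7 * s) :=
    Nat.pow_le_pow_right (by norm_num) (by omega)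
  have h6 : 2 ^ (11 * s) = 2 ^ (7 * s) * (2 ^ s * 2 ^ (3 * s)) := by
    rw [← pow_add, ← pow_add]
    congr 1
    omega
  have h7 : 2 ^ 2 ≤ 2 ^ s := Nat.pow_le_pow_right (by norm_num) hs
  have h8 : 2 ^ 3 ≤ 2 ^ (3 * s) := Nat.pow_le_pow_right (by norm_num) (by omega)
  have h9 : 2 ^ (7 * s) ≤ 2 ^ (7 * s) * 2 ^ (3 * s) := Nat.le_mul_of_pos_right _ (by positivity)
  have h10 : 2 ^ (3 * s) ≤ 2 ^ (7 * s) * 2 ^ (3 * s) := Nat.le_mul_of_pos_left _ (by positivity)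
  have h11 := Nat.mul_le_mul_right (2 ^ (7 * s) * 2 ^ (3 * s)) h7
  rw [← pow_mul, mul_comm s 3] at h2 h3
  rw [h6, mul_left_comm]
  omega

/-- Numbers are coded in unary, so the length of the word bounds the size of the system, the number
of quantifiers and the code of the transitions. It can thus serve as the number of rounds and as the
exponent of the growth factor. -/
theorem sat_iff_realize {w : List Tok} {l : List (PDTransition (Fin n) (Fin m))}
    (hl : ∀ δ, δ ∈ l ↔ δ ∈ N.Δ) (φ : (nptLang N).Sentence)
    (hw : w = codeSystem N l ++ codeFormula φ) :
    (N.raw l).Sat (2 ^ w.length) (rawFormula φ) (2 ^ 2 ^ (11 * w.length)) [] ↔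
      Language.Sentence.Realize (NPT N) φ := by
  classical
  rw [codeSystem_eq, codeFormula_eq] at hw
  have hlen : w.length = n + 1 + (m + 1) + (N.bot + 1) + (N.init + 1) +
      (codeRun (N.raw l).items).length + 1 + (rawFormula φ).code.length := by
    rw [hw]
    simp [RawSystem.code, raw]
    omega
  have hq := (rawFormula φ).quantifiers_le
  have hΔ : N.Δ.card ≤ (codeRun (N.raw l).items).length := by
    calc N.Δ.card ≤ l.toFinset.card := Finset.card_le_card fun δ hδ => by simpa [hl] using hδ
      _ ≤ l.length := l.toFinset_card_le
      _ = (N.raw l).items.length := by simp [raw]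
      _ ≤ _ := le_length_codeRun _
  have hsize : N.size ≤ w.length := by
    simp only [PushdownSystem.size, Fintype.card_fin]
    omega
  have hC : 2 * (codeRun (N.raw l).items).length ≤ 2 ^ w.length := by
    calc _ ≤ 2 * 2 ^ (codeRun (N.raw l).items).length := by
          gcongr
          exact Nat.lt_two_pow_self.le
      _ = 2 ^ ((codeRun (N.raw l).items).length + 1) := by ring
      _ ≤ _ := Nat.pow_le_pow_right (by norm_num) (by omega)
  exact sat_rawFormula_iff hl φ (e := default) (v := default) (r := w.length) hC Nat.one_le_two_pow
    (by omega) (fun i => i.elim0) (threshold_le_two_pow hsize le_rfl (by omega))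

theorem boundedModelChecking_iff (w : List Tok) :
    BoundedModelChecking w ↔ w ∈ ModelCheckingNPT := by
  constructor
  · rintro ⟨R, φ, hw, hR, hφ, h⟩
    obtain ⟨n, m, N, l, hl, rfl⟩ := hR.exists_eq
    obtain ⟨ψ, rfl⟩ := exists_rawFormula_eq hl hφ
    rw [← codeSystem_eq, ← codeFormula_eq] at hw
    exact ⟨n, m, N, ψ, ⟨l, hl, hw⟩, (sat_iff_realize hl ψ hw).1 h⟩
  · rintro ⟨n, m, N, φ, ⟨l, hl, hw⟩, h⟩
    exact ⟨N.raw l, rawFormula φ, by rw [hw, codeSystem_eq, codeFormula_eq], raw_ok l hl,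
      wellFormed_rawFormula hl φ, (sat_iff_realize hl φ hw).2 h⟩

end PushdownSystem

theorem one_le_formulaSize {n m : ℕ} {N : PushdownSystem (Fin n) (Fin m)} {k : ℕ}
    (φ : (nptLang N).BoundedFormula Empty k) : 1 ≤ formulaSize φ := by
  cases φ <;> simp [formulaSize]

theorem mainTheorem3 :
    (∃ (M : ATM Tok) (p : Polynomial ℕ) (c : ℕ),
      (∀ w : List Tok, M.Accepts w ↔ w ∈ ModelCheckingNPT) ∧
      (∀ w : List Tok, M.TimeBound w (2 ^ 2 ^ p.eval w.length)) ∧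
      (∀ (w : List Tok) (n m : ℕ) (N : PushdownSystem (Fin n) (Fin m)) (φ : (nptLang N).Sentence),
        Encodes w N φ → M.AlternationBound w (c * formulaSize φ))) ∧
    (∃ p q : Polynomial ℕ,
      ∀ (Q Γ : Type) [Fintype Q] [Fintype Γ] (N : PushdownSystem Q Γ) (r : ℕ),
        ∃ (f : ℕ → ℕ) (τ : DuplicatorStrategy (NPT N)),
          Monotone f ∧
          f r ≤ r * 2 ^ 2 ^ q.eval r * 2 ^ p.eval N.size ∧
          τ.IsWinning (nptLang N) r ∧
          τ.Preserves r (lengthConstraint N f)) := by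
  obtain ⟨M, p, hM, ht, ha⟩ := exists_atm_boundedModelChecking
  -- A formula has size at least one, so `4 * size + 2` is at most `6 * size`.
  refine ⟨⟨M, p, 6, fun w => (hM w).trans (boundedModelChecking_iff w), ht, ?_⟩,
    PushdownSystem.exists_bounded_strategy⟩
  rintro w n m N φ ⟨l, -, rfl⟩
  have h := ha (N.raw l) (rawFormula φ)
  rw [← codeSystem_eq, ← codeFormula_eq, size_rawFormula] at h
  have h1 := one_le_formulaSize φ
  refine fun l hl => (h l hl).trans ?_
  omega
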